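/- Let $n\ge 1$, $\gamma\in(0,\infty)\setminus\mathbb N$, $[\gamma]=\gamma-\lfloor\gamma\rfloor$, $m=1-2[\gamma]$, $k=\lfloor\gamma\rfloor+1$. On $\mathbb R^{n+1}_+=\{(x,y):x\in\mathbb R^n,\ y>0\}$ put $T=\partial_y^2+my^{-1}\partial_y$ and $\Delta_m=\Delta+my^{-1}\partial_y=\overline\Delta+T$, where $\overline\Delta$ is the Laplacian of $\mathbb R^n$; let $\iota^*W=\lim_{y\to0^+}W(\cdot,y)$. Let $\mathcal C^{2\gamma}=C^\infty_{\rm even}+y^{2[\gamma]}C^\infty_{\rm even}$, where $C^\infty_{\rm even}$ is the space of smooth functions on $\overline{\mathbb R^{n+1}_+}$ whose Taylor series in $y$ at $y=0$ are even. For $0\le j\le\lfloor\gamma\rfloor$ define recursively on $\mathcal C^{2\gamma}$ $$B_{2j}=(-1)^j\iota^*T^j-\sum_{\ell=1}^j\binom j\ell\frac{\Gamma(1+j-[\gamma])\Gamma(1+2j-2\ell-\gamma)}{\Gamma(1+j-\ell-[\gamma])\Gamma(1+2j-\ell-\gamma)}\overline\Delta^\ell B_{2j-2\ell},$$ $$B_{2[\gamma]+2j}=(-1)^{j+1}\iota^*y^m\partial_yT^j-\sum_{\ell=1}^j\binom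 j\ell\frac{\Gamma(1+j+[\gamma])\Gamma(1+2j-2\ell-\lfloor\gamma\rfloor+[\gamma])}{\Gamma(1+j-\ell+[\gamma])\Gamma(1+2j-\ell-\lfloor\gamma\rfloor+[\gamma])}\overline\Delta^\ell B_{2[\gamma]+2j-2\ell},$$ and $$\mathcal E_{2\gamma}(U)=\int_{\mathbb R^{n+1}_+}U\,(-\Delta_m)^kU\,y^m\,dx\,dy+\sum_{j=0}^{\lfloor\gamma/2\rfloor}\oint_{\mathbb R^n}B_{2j}(U)B_{2\gamma-2j}(U)\,dx-\sum_{j=0}^{\lfloor\gamma\rfloor-\lfloor\gamma/2\rfloor-1}\oint_{\mathbb R^n}B_{2[\gamma]+2j}(U)B_{2\lfloor\gamma\rfloor-2j}(U)\,dx .$$ Let $\mathcal W$ be the set of $U\in\mathcal C^{2\gamma}$ whose derivatives of order at most $k$ are in $L^2(y^m\,dx\,dy)$ on each slab $\mathbb R^n\times(0,Y)$, $Y<\infty$, and whose derivatives of order $k$ are in $L^2(\mathbb R^{n+1}_+,y^m\,dx\,dy)$; thus $\mathcal C^{2\gamma}\cap W^{k,2}(\mathbb R^{n+1}_+,y^m)\subset\mathcal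 W$. Let $$\mathcal C_+^{2\gamma}=\{U\in\mathcal W: B_{2j}(U)=0\ (1\le j\le\lfloor\gamma/2\rfloor),\ B_{2[\gamma]+2j}(U)=0\ (0\le j\le\lfloor\gamma\rfloor-\lfloor\gamma/2\rfloor-1)\}.$$ For $f\in H^\gamma(\mathbb R^n)$ let $(-\overline\Delta)^\gamma f$ be the distribution with Fourier transform $|\xi|^{2\gamma}\widehat f(\xi)$ (for the convention in which $-\overline\Delta$ has symbol $|\xi|^2$), and let $\oint f(-\overline\Delta)^\gamma f\,dx$ denote the $H^{\gamma}$–$H^{-\gamma}$ pairing. For $f\in C^\infty(\mathbb R^n)\cap H^\gamma(\mathbb R^n)$ consider the problem for $U\in\mathcal W$ $$(\ast)\quad\begin{cases}\Delta_m^kU=0&\text{in }\mathbb R^{n+1}_+,\\ U=f&\text{on }\mathbb R^n,\\ \Delta_m^jU=\dfrac{\lfloor\gamma\rfloor!}{(\lfloor\gamma\rfloor-j)!}\dfrac{\Gamma(\gamma-j)}{\Gamma(\gamma)}\overline\Delta^jf&\text{on }\mathbb R^n,\ 1\le j\le\lfloor\gamma/2\rfloor,\\ y^m\partial_y\Delta_m^jU=0&\text{on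 }\mathbb R^n,\ 0\le j\le\lfloor\gamma\rfloor-\lfloor\gamma/2\rfloor-1,\end{cases}$$ the boundary conditions being understood as (pointwise) limits $y\to0^+$. Put $K_\gamma=2^{1-2[\gamma]}\lfloor\gamma\rfloor!\,\dfrac{\gamma\Gamma(-\gamma)}{\Gamma([\gamma])}$. (1) Let $U\in\mathcal C_+^{2\gamma}$ be such that all integrals in $\mathcal E_{2\gamma}(U)$ converge absolutely and $B_{2\gamma-2j}(U)\in L^2(\mathbb R^n)$ for $1\le j\le\lfloor\gamma/2\rfloor$ (no condition if $\gamma<2$). Then $f:=U(\cdot,0)\in H^\gamma(\mathbb R^n)$ and $$\mathcal E_{2\gamma}(U)\ \ge\ (-1)^{1+\lfloor\gamma\rfloor}K_\gamma\oint_{\mathbb R^n}f(-\overline\Delta)^\gamma f\,dx,$$ with equality if and only if $U$ solves $(\ast)$. (2) For every $f\in C^\infty(\mathbb R^n)\cap H^\gamma(\mathbb R^n)$ the problem $(\ast)$ has exactly one solution $U\in\mathcal W$; it belongs to $\mathcal C_+^{2\gamma}$, and $(-\overline\Delta)^\gamma f$ is the continuous function given pointwise by $$(-\overline\Delta)^\gamma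 f=K_\gamma^{-1}\lim_{y\to0^+}y^{1-2[\gamma]}\partial_y\Delta_m^{\lfloor\gamma\rfloor}U .$$ -/

import Mathlib

open MeasureTheory Filter Topology Set
open scoped ContDiff FourierTransform

namespace WeightedTrace

noncomputable section

/-- The boundary `ℝⁿ`. -/
abbrev Bdry (n : ℕ) : Type := EuclideanSpace ℝ (Fin n)

/-- The ambient space `ℝⁿ × ℝ` with coordinates `(x, y)`.  Functions on the closed upper half space
are represented by functions on `ℝⁿ × ℝ`; only their values at points with `y ≥ 0` are used. -/
abbrev Amb (n : ℕ) : Type := Bdry n × ℝ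

/-- The open upper half space `{y > 0}`. -/
def upper (n : ℕ) : Set (Amb n) := {p | 0 < p.2}

/-- The weight exponent `m = 1 - 2[γ]`. -/
def wt (γ : ℝ) : ℝ := 1 - 2 * Int.fract γ

variable {n : ℕ}

/-! ### Differential operators -/

/-- The Laplacian of the boundary `ℝⁿ`. -/
def bLap (u : Bdry n → ℝ) : Bdry n → ℝ := Laplacian.laplacian u

/-- `∂_y U`. -/
def dy (U : Amb n → ℝ) : Amb n → ℝ := fun p => deriv (fun t => U (p.1, t)) p.2

/-- `T = ∂_y² + m y⁻¹ ∂_y` (used at `y > 0`). -/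
def opT (m : ℝ) (U : Amb n → ℝ) : Amb n → ℝ := fun p => dy (dy U) p + m / p.2 * dy U p

/-- The weighted Laplacian `Δ_m = Δ + m y⁻¹ ∂_y` (used at `y > 0`), where
`Δ = Δ_x + ∂_y²` is the Laplacian of the half space. -/
def wLap (m : ℝ) (U : Amb n → ℝ) : Amb n → ℝ := fun p =>
  bLap (fun x => U (x, p.2)) p.1 + dy (dy U) p + m / p.2 * dy U p

/-- The restriction `U(·, 0)`. -/
def restr (U : Amb n → ℝ) : Bdry n → ℝ := fun x => U (x, 0)

/-- The boundary value `lim_{y → 0⁺} W(x, y)` of a function defined for `y > 0`. -/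
def bval (W : Amb n → ℝ) : Bdry n → ℝ := fun x => limUnder (𝓝[>] (0 : ℝ)) (fun y => W (x, y))

/-- `y^m ∂_y W`. -/
def wNormal (m : ℝ) (W : Amb n → ℝ) : Amb n → ℝ := fun p => p.2 ^ m * dy W p

/-! ### Function spaces -/

/-- A smooth function on the closed half space all of whose odd `y`-Taylor coefficients at `y = 0`
vanish is the same thing as (the restriction to `y ≥ 0` of) a smooth function on `ℝⁿ × ℝ` that is
even in `y`. -/
def IsEvenSmooth (A : Amb n → ℝ) : Prop :=
  ContDiff ℝ ∞ A ∧ ∀ (x : Bdry n) (y : ℝ), A (x, -y) = A (x, y)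

/-- `𝒞^{2γ} = C^∞_even + y^{2[γ]} C^∞_even` on the closed half space. -/
def InC (γ : ℝ) (U : Amb n → ℝ) : Prop :=
  ∃ A B : Amb n → ℝ, IsEvenSmooth A ∧ IsEvenSmooth B ∧
    ∀ (x : Bdry n) (y : ℝ), 0 ≤ y → U (x, y) = A (x, y) + y ^ (2 * Int.fract γ) * B (x, y)

/-- The weighted Sobolev condition of order `k = ⌊γ⌋ + 1` with weight `y^m`: all derivatives of order
at most `k` are in `L²(y^m dx dy)` on every slab `0 < y < Y`, and those of order `k` are in
`L²(y^m dx dy)` on the whole half space.  Every element of `W^{k,2}(ℝ₊^{n+1}, y^m)` has this property;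
the lower order derivatives of an extension of a function on `ℝⁿ` are in general only
square-integrable on slabs. -/
structure FiniteEnergy (γ : ℝ) (U : Amb n → ℝ) : Prop where
  slab : ∀ Y : ℝ, 0 < Y → ∀ j : ℕ, j ≤ ⌊γ⌋₊ + 1 →
    IntegrableOn (fun p : Amb n => ‖iteratedFDeriv ℝ j U p‖ ^ 2 * p.2 ^ wt γ)
      {p | 0 < p.2 ∧ p.2 < Y}
  top : IntegrableOn (fun p : Amb n => ‖iteratedFDeriv ℝ (⌊γ⌋₊ + 1) U p‖ ^ 2 * p.2 ^ wt γ) (upper n)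

/-! ### Boundary operators -/

/-- `B_{2j}^{2γ}`; in the sum the index is `i = j - ℓ`. -/
def bEven (γ : ℝ) (j : ℕ) (U : Amb n → ℝ) : Bdry n → ℝ := fun x =>
  (-1 : ℝ) ^ j * bval ((opT (wt γ))^[j] U) x
    - ∑ i : Fin j, (j.choose (j - (i : ℕ)) : ℝ) *
        (Real.Gamma (1 + j - Int.fract γ) * Real.Gamma (1 + 2 * (i : ℕ) - γ) /
          (Real.Gamma (1 + (i : ℕ) - Int.fract γ) * Real.Gamma (1 + j + (i : ℕ) - γ))) *
        (bLap^[j - (i : ℕ)] (bEven γ (i : ℕ) U)) x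
termination_by j
decreasing_by exact i.2

/-- `B_{2[γ]+2j}^{2γ}`; in the sum the index is `i = j - ℓ`. -/
def bOdd (γ : ℝ) (j : ℕ) (U : Amb n → ℝ) : Bdry n → ℝ := fun x =>
  (-1 : ℝ) ^ (j + 1) * bval (wNormal (wt γ) ((opT (wt γ))^[j] U)) x
    - ∑ i : Fin j, (j.choose (j - (i : ℕ)) : ℝ) *
        (Real.Gamma (1 + j + Int.fract γ) *
            Real.Gamma (1 + 2 * (i : ℕ) - (⌊γ⌋₊ : ℝ) + Int.fract γ) /
          (Real.Gamma (1 + (i : ℕ) + Int.fract γ) *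
            Real.Gamma (1 + j + (i : ℕ) - (⌊γ⌋₊ : ℝ) + Int.fract γ))) *
        (bLap^[j - (i : ℕ)] (bOdd γ (i : ℕ) U)) x
termination_by j
decreasing_by exact i.2

/-! ### The Dirichlet form and the energy -/

/-- `L_{2k} = (-Δ_m)^k` with `k = ⌊γ⌋ + 1`. -/
def opL (γ : ℝ) (U : Amb n → ℝ) : Amb n → ℝ := fun p =>
  (-1 : ℝ) ^ (⌊γ⌋₊ + 1) * ((wLap (wt γ))^[⌊γ⌋₊ + 1] U) p

/-- The Dirichlet form `𝓠_{2γ}`; note `B_{2γ-2j} = B_{2[γ]+2(⌊γ⌋-j)}`. -/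
def formQ (γ : ℝ) (U V : Amb n → ℝ) : ℝ :=
  (∫ p in upper n, U p * opL γ V p * p.2 ^ wt γ)
    + (∑ j ∈ Finset.range (⌊γ / 2⌋₊ + 1), ∫ x, bEven γ j U x * bOdd γ (⌊γ⌋₊ - j) V x)
    - ∑ j ∈ Finset.range (⌊γ⌋₊ - ⌊γ / 2⌋₊), ∫ x, bOdd γ j U x * bEven γ (⌊γ⌋₊ - j) V x

/-- The energy `𝓔_{2γ}(U) = 𝓠_{2γ}(U, U)`. -/
def energy (γ : ℝ) (U : Amb n → ℝ) : ℝ := formQ γ U U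

/-- All integrals in `𝓔_{2γ}(U)` converge absolutely, and the Neumann-type data `B_{2γ-2j}(U)`,
`1 ≤ j ≤ ⌊γ/2⌋` (there are none if `γ < 2`), are square-integrable. -/
structure EnergyConverges (γ : ℝ) (U : Amb n → ℝ) : Prop where
  interior : IntegrableOn (fun p : Amb n => U p * opL γ U p * p.2 ^ wt γ) (upper n)
  even_odd : ∀ j : ℕ, j ≤ ⌊γ / 2⌋₊ →
    Integrable (fun x : Bdry n => bEven γ j U x * bOdd γ (⌊γ⌋₊ - j) U x)
  odd_even : ∀ j : ℕ, j < ⌊γ⌋₊ - ⌊γ / 2⌋₊ →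
    Integrable (fun x : Bdry n => bOdd γ j U x * bEven γ (⌊γ⌋₊ - j) U x)
  neumann : ∀ j : ℕ, 1 ≤ j → j ≤ ⌊γ / 2⌋₊ → MemLp (bOdd γ (⌊γ⌋₊ - j) U) 2

/-- The class `𝒞₊^{2γ}`: all Dirichlet data except `B_0` vanish. -/
structure InCPlus (γ : ℝ) (U : Amb n → ℝ) : Prop where
  smooth : InC γ U
  sobolev : FiniteEnergy γ U
  even_zero : ∀ j : ℕ, 1 ≤ j → j ≤ ⌊γ / 2⌋₊ → ∀ x, bEven γ j U x = 0
  odd_zero : ∀ j : ℕ, j < ⌊γ⌋₊ - ⌊γ / 2⌋₊ → ∀ x, bOdd γ j U x = 0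

/-! ### The fractional Laplacian on `ℝⁿ` -/

open Classical in
/-- The Fourier transform of a real square-integrable function, normalized as
`∫ e^{-2πi⟨x,ξ⟩} f(x) dx` (and `0` if `f` is not in `L²`). -/
def fourierL2 (f : Bdry n → ℝ) : Bdry n → ℂ :=
  if h : MemLp (fun x => (f x : ℂ)) 2 (volume : Measure (Bdry n)) then
    ((𝓕 (h.toLp (fun x => (f x : ℂ))) : Lp ℂ 2 (volume : Measure (Bdry n))) : Bdry n → ℂ)
  else 0

/-- The symbol `|2πξ|^{2γ}` of `(-Δ̄)^γ`. -/
def symb (γ : ℝ) (ξ : Bdry n) : ℝ := (2 * Real.pi * ‖ξ‖) ^ (2 * γ)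

/-- `f ∈ H^γ(ℝⁿ)`. -/
def MemH (γ : ℝ) (f : Bdry n → ℝ) : Prop :=
  MemLp f 2 ∧ Integrable (fun ξ : Bdry n => (1 + ‖ξ‖ ^ 2) ^ γ * ‖fourierL2 f ξ‖ ^ 2)

/-- `∮ f (-Δ̄)^γ f dx`, the pairing of `(-Δ̄)^γ f ∈ H^{-γ}` with `f ∈ H^γ`. -/
def fracForm (γ : ℝ) (f : Bdry n → ℝ) : ℝ := ∫ ξ, symb γ ξ * ‖fourierL2 f ξ‖ ^ 2

/-- The continuous function `g` is `(-Δ̄)^γ f`, the distribution with Fourier transform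
`|2πξ|^{2γ} f̂(ξ)`, where `f ∈ H^γ`. -/
def IsFracLaplacian (γ : ℝ) (f g : Bdry n → ℝ) : Prop :=
  Continuous g ∧ ∀ φ : Bdry n → ℝ, ContDiff ℝ ∞ φ → HasCompactSupport φ →
    ((∫ x, g x * φ x : ℝ) : ℂ) =
      ∫ ξ, (symb γ ξ : ℂ) * fourierL2 f ξ * 𝓕⁻ (fun x => (φ x : ℂ)) ξ

/-! ### The extension problem -/

/-- `U` solves the extension problem with boundary value `f`, where `m = 1 - 2[γ]` and
`k = ⌊γ⌋ + 1`. -/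
structure IsYangExtension (γ : ℝ) (f : Bdry n → ℝ) (U : Amb n → ℝ) : Prop where
  smooth : InC γ U
  sobolev : FiniteEnergy γ U
  pde : ∀ p ∈ upper n, ((wLap (wt γ))^[⌊γ⌋₊ + 1] U) p = 0
  value : ∀ x, U (x, 0) = f x
  even_data : ∀ j : ℕ, 1 ≤ j → j ≤ ⌊γ / 2⌋₊ → ∀ x,
    Tendsto (fun y : ℝ => ((wLap (wt γ))^[j] U) (x, y)) (𝓝[>] 0)
      (𝓝 ((Nat.factorial ⌊γ⌋₊ : ℝ) / (Nat.factorial (⌊γ⌋₊ - j) : ℝ) *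
        (Real.Gamma (γ - j) / Real.Gamma γ) * (bLap^[j] f) x))
  odd_data : ∀ j : ℕ, j < ⌊γ⌋₊ - ⌊γ / 2⌋₊ → ∀ x,
    Tendsto (fun y : ℝ => wNormal (wt γ) ((wLap (wt γ))^[j] U) (x, y)) (𝓝[>] 0) (𝓝 0)

/-- The constant `2^{1-2[γ]} ⌊γ⌋! γ Γ(-γ) / Γ([γ])`. -/
def yangConst (γ : ℝ) : ℝ :=
  (2 : ℝ) ^ (1 - 2 * Int.fract γ) * (Nat.factorial ⌊γ⌋₊ : ℝ) *
    (γ * Real.Gamma (-γ) / Real.Gamma (Int.fract γ))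

end

end WeightedTrace

open WeightedTrace

namespace WeightedTrace

noncomputable section

variable {n : ℕ}

open Real
open ENNReal (ofReal)
open EuclideanSpace (single)
open Function (iterate_succ_apply' iterate_succ_apply)
local notation "C∞" => ContDiff ℝ ∞
local notation "𝒟" => iteratedFDeriv ℝ
local notation "Ξ" => Bdry n
local notation "Υ" => Amb n
local notation "Ψ" => Amb n → ℝ
local notation "ℍ" => upper n
local notation "pos!" => by positivity
open Complex (norm_real norm_I re_ofReal_mul continuous_ofReal re_mul_ofReal ofReal_re add_re conj_ofReal ofRealCLM abs_re_le_norm continuous_re)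
open Finset (sum_congr mul_sum prod_range_succ prod_range_succ' prod_congr smul_sum sum_comm' sum_eq_zero sum_range_succ sum_neg_distrib sum_le_sum sum_nonneg sum_mul sum_eq_single_of_mem sum_add_distrib)
open Nat (lt_succ_iff cast_sub cast_succ)
open ContinuousLinearMap (le_opNorm opNorm_comp_le norm_fst_le norm_snd_le opNorm_le_bound toSpanSingleton coe_fst' coe_snd')
open ENNReal (toReal_ofReal ofReal_le_ofReal ofReal_ne_top mul_lt_top ofReal_lt_top ofReal_mul ofReal_add ofReal_pow)
open Int (fract fract_lt_one)
local notation "ℛ" => Finset.range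

section

variable {E G : Type*}

/-! ### Smooth dependence of integrals on parameters -/

lemma contDiffOn_integral_of_dominated {α : Type*} [NormedAddCommGroup E] [NormedSpace ℝ E]
    [NormedAddCommGroup G] [NormedSpace ℝ G] [CompleteSpace G] [MeasurableSpace α]
    {μ : Measure α} {Ω : Set E} (hΩ : IsOpen Ω) {F : E → α → G}
    (hF : ∀ᵐ a ∂μ, ContDiffOn ℝ ∞ (fun p => F p a) Ω)
    (hm : ∀ j : ℕ, ∀ p ∈ Ω, AEStronglyMeasurable (fun a => 𝒟 j (fun p => F p a) p) μ)
    (hb : ∀ j : ℕ, ∀ p₀ ∈ Ω, ∃ s ∈ 𝓝 p₀, ∃ bound : α → ℝ, Integrable bound μ ∧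
      ∀ᵐ a ∂μ, ∀ p ∈ s, ‖𝒟 j (fun p => F p a) p‖ ≤ bound a) :
    ContDiffOn ℝ ∞ (fun p => ∫ a, F p a ∂μ) Ω ∧ ∀ j : ℕ, ∀ p ∈ Ω,
      Integrable (fun a => 𝒟 j (fun p => F p a) p) μ ∧
      𝒟 j (fun p => ∫ a, F p a ∂μ) p = ∫ a, 𝒟 j (fun p => F p a) p ∂μ := by
  have hint : ∀ j, ∀ p ∈ Ω, Integrable (fun a => 𝒟 j (fun p => F p a) p) μ := by
    intro j p hp
    obtain ⟨s, hs, b, hbi, hb'⟩ := hb j p hp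
    exact hbi.mono' (hm j p hp) (hb'.mono fun a ha => ha p (mem_of_mem_nhds hs))
  have hder : ∀ j, ∀ p ∈ Ω, HasFDerivAt (fun p => ∫ a, 𝒟 j (fun p => F p a) p ∂μ)
      (∫ a, 𝒟 (j + 1) (fun p => F p a) p ∂μ).curryLeft p := by
    intro j p hp; obtain ⟨s, hs, b, hbi, hb'⟩ := hb (j + 1) p hp; have hs' := inter_mem hs (hΩ.mem_nhds hp)
    have h1 : (∫ a, 𝒟 (j + 1) (fun p => F p a) p ∂μ).curryLeft
        = ∫ a, fderiv ℝ (𝒟 j (fun p => F p a)) p ∂μ := by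
      exact (ContinuousLinearEquiv.integral_comp_comm (𝕜 := ℝ) (E := E [×(j + 1)]→L[ℝ] G)
        (F := E →L[ℝ] (E [×j]→L[ℝ] G))
        (continuousMultilinearCurryLeftEquiv ℝ (fun _ : Fin (j + 1) => E) G).toContinuousLinearEquiv
          (fun a => 𝒟 (j + 1) (fun p => F p a) p)).symm
    rw [h1]; refine hasFDerivAt_integral_of_dominated_of_fderiv_le
      (F' := fun x a => fderiv ℝ (𝒟 j (fun p => F p a)) x) hs' ?_ (hint j p hp) ?_ ?_
      hbi ?_
    · filter_upwards [hΩ.mem_nhds hp] with x hx using hm j x hx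
    · exact (continuousMultilinearCurryLeftEquiv ℝ (fun _ => E)
        G).continuous.comp_aestronglyMeasurable (hm (j + 1) p hp)
    · filter_upwards [hb'] with a ha x hx; rw [norm_fderiv_iteratedFDeriv]; exact ha x hx.1
    · filter_upwards [hF] with a ha x hx; have h2 := ha.contDiffAt (hΩ.mem_nhds hx.2)
      exact (((h2.iteratedFDeriv_right (i := j) (m := 1) (by norm_cast; exact le_top))).differentiableAt (by norm_num)).hasFDerivAt
  have hT : HasFTaylorSeriesUpToOn ∞ (fun p => ∫ a, F p a ∂μ)
      (fun p j => ∫ a, 𝒟 j (fun p => F p a) p ∂μ) Ω := by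
    refine ⟨?_, ?_, ?_⟩
    · intro p hp
      exact ((continuousMultilinearCurryFin0 ℝ E G).toContinuousLinearEquiv.integral_comp_comm (fun a => 𝒟 0 (fun p => F p a) p)).symm
    · intro j _ p hp; exact (hder j p hp).hasFDerivWithinAt
    · intro j _ p hp; exact (hder j p hp).continuousAt.continuousWithinAt
  refine ⟨hT.contDiffOn, fun j p hp => ⟨hint j p hp, ?_⟩⟩
  rw [← iteratedFDerivWithin_of_isOpen j hΩ hp]
  exact (hT.eq_iteratedFDerivWithin_of_uniqueDiffOn (by exact_mod_cast le_top) hΩ.uniqueDiffOn hp).symm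

lemma continuous_iteratedFDeriv_left {K : Type*} [NormedAddCommGroup E] [NormedSpace ℝ E]
    [NormedAddCommGroup K] [NormedSpace ℝ K] [NormedAddCommGroup G] [NormedSpace ℝ G]
    {F : E × K → G} (hF : C∞ F) (j : ℕ) :
    Continuous fun q : E × K => 𝒟 j (fun p => F (p, q.2)) q.1 := by
  have h0 : ∀ q, 𝒟 j (fun p => F (p, q.2)) q.1 = (𝒟 j F q).compContinuousLinearMap (fun _ => ContinuousLinearMap.inl ℝ E K) := by
    intro q
    have : (fun p => F (p, q.2)) = (fun z => F (z + (0, q.2))) ∘ (ContinuousLinearMap.inl ℝ E K) := by ext p; simp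
    rw [this, ContinuousLinearMap.iteratedFDeriv_comp_right _ (by fun_prop) _
      (by exact_mod_cast le_top), iteratedFDeriv_comp_add_right]
    simp
  simp_rw [h0]
  exact (ContinuousMultilinearMap.compContinuousLinearMapL (fun _ => ContinuousLinearMap.inl ℝ E K)).continuous.comp
    (hF.continuous_iteratedFDeriv (by exact_mod_cast le_top))

lemma contDiff_intervalIntegral_param [NormedAddCommGroup E] [NormedSpace ℝ E]
    [FiniteDimensional ℝ E] [NormedAddCommGroup G] [NormedSpace ℝ G] [CompleteSpace G]
    {F : E × ℝ → G} (hF : C∞ F) :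
    C∞ (fun p => ∫ t in (0 : ℝ)..1, F (p, t)) := by
  simp_rw [intervalIntegral.integral_of_le (zero_le_one' ℝ)]
  rw [← contDiffOn_univ]
  refine (contDiffOn_integral_of_dominated isOpen_univ
    (ae_of_all _ fun a => ?_) (fun j p _ => ?_) (fun j p₀ _ => ?_)).1
  · exact ContDiff.contDiffOn (by fun_prop)
  · exact ((continuous_iteratedFDeriv_left hF j).comp (by fun_prop : Continuous fun a => (p, a))).aestronglyMeasurable
  · obtain ⟨C, hC⟩ := ((isCompact_closedBall p₀ 1).prod (isCompact_Icc)).exists_bound_of_continuousOn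
      (continuous_iteratedFDeriv_left hF j).continuousOn
    refine ⟨Metric.closedBall p₀ 1, Metric.closedBall_mem_nhds _ one_pos, fun _ => C, ?_, ?_⟩
    · exact integrable_const _
    · filter_upwards [ae_restrict_mem measurableSet_Ioc] with a ha p hp
      exact hC (p, a) ⟨hp, Ioc_subset_Icc_self ha⟩

end

section

variable {U V A B : Amb n → ℝ} {p : Amb n} {m e : ℝ}

/-! ### Calculus on the half space -/

/-- The unit vector in the direction of the `i`-th boundary coordinate. -/
def eX (i : Fin n) : Υ := (single i 1, 0)

/-- The unit vector in the direction of `y`. -/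
def eY : Υ := (0, 1)

/-- Directional derivative. -/
def Dv (v : Υ) (U : Ψ) : Ψ := fun p => fderiv ℝ U p v

/-- The boundary Laplacian on the slices `y = const`. -/
def LX (U : Ψ) : Ψ := fun p => bLap (fun x => U (x, p.2)) p.1

/-- Smoothness in the open half space. -/
def SmU (U : Ψ) : Prop := ContDiffOn ℝ ∞ U ℍ

lemma isOpen_upper : IsOpen ℍ := isOpen_lt continuous_const continuous_snd

lemma measurableSet_upper : MeasurableSet ℍ := isOpen_upper.measurableSet

lemma SmU.contDiffAt (h : SmU U) (hp : p ∈ ℍ) :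
    ContDiffAt ℝ ∞ U p := ContDiffOn.contDiffAt h (isOpen_upper.mem_nhds hp)

lemma SmU.differentiableAt (h : SmU U) (hp : p ∈ ℍ) :
    DifferentiableAt ℝ U p := (h.contDiffAt hp).differentiableAt (by simp)

lemma SmU.congr (h : SmU U) (hUV : EqOn V U ℍ) : SmU V := ContDiffOn.congr h hUV

lemma contDiffAt_Dv (h : ContDiffAt ℝ ∞ U p) (v : Υ) : ContDiffAt ℝ ∞ (Dv v U) p :=
  (h.fderiv_right (by simp)).clm_apply contDiffAt_const

lemma csm_Dv (h : C∞ U) (v : Υ) : C∞ (Dv v U) :=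
  contDiff_iff_contDiffAt.2 fun _ => contDiffAt_Dv h.contDiffAt v

protected lemma SmU.Dv (h : SmU U) (v : Υ) : SmU (Dv v U) :=
  fun _ hp => (contDiffAt_Dv (h.contDiffAt hp) v).contDiffWithinAt

lemma Dv_congr (h : EqOn U V ℍ) (v : Υ) :
    EqOn (Dv v U) (Dv v V) ℍ := fun p hp => by
  have : U =ᶠ[𝓝 p] V := by filter_upwards [isOpen_upper.mem_nhds hp] with q hq using h hq
  simp [Dv, this.fderiv_eq]

lemma dy_congr (h : EqOn U V ℍ) : EqOn (dy U) (dy V) ℍ := fun p hp => by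
    have : (fun t => U (p.1, t)) =ᶠ[𝓝 p.2] fun t => V (p.1, t) := by
      filter_upwards [lt_mem_nhds hp] with t ht using h ht
    exact this.deriv_eq

lemma LX_congr (h : EqOn U V ℍ) : EqOn (LX U) (LX V) ℍ := fun p hp => by
    have : (fun x => U (x, p.2)) = fun x => V (x, p.2) := funext fun x => h hp; simp [LX, this]

lemma opT_congr (h : EqOn U V ℍ) :
    EqOn (opT m U) (opT m V) ℍ := fun p hp => by
  simp [opT, dy_congr (dy_congr h) hp, dy_congr h hp]

lemma wLap_eq (m : ℝ) (U : Ψ) : wLap m U = fun p => LX U p + opT m U p := by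
  ext p; simp [wLap, LX, opT, add_assoc]

lemma wLap_congr (h : EqOn U V ℍ) :
    EqOn (wLap m U) (wLap m V) ℍ := fun p hp => by
  simp [wLap_eq, opT_congr h hp, LX_congr h hp]

lemma wLap_iterate_congr (h : EqOn U V ℍ) (j : ℕ) :
    EqOn ((wLap m)^[j] U) ((wLap m)^[j] V) ℍ := by
  induction j generalizing U V with
  | zero => exact h
  | succ j ih => exact ih (wLap_congr h)

lemma dy_eq_Dv_of_differentiableAt (h : DifferentiableAt ℝ U p) :
    dy U p = Dv eY U p := by
  exact (HasFDerivAt.comp_hasDerivAt (x := p.2) (f := fun t : ℝ => ((p.1, t) : Υ))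
    (l := U) (l' := fderiv ℝ U p) h.hasFDerivAt ((hasDerivAt_const p.2 p.1).prodMk (hasDerivAt_id p.2))).deriv

lemma dy_eq_Dv (h : SmU U) : EqOn (dy U) (Dv eY U) ℍ :=
  fun _ hp => dy_eq_Dv_of_differentiableAt (h.differentiableAt hp)

lemma csm_dy_eq (h : C∞ U) : dy U = Dv eY U :=
  funext fun p => dy_eq_Dv_of_differentiableAt (h.differentiable (by simp) p)

lemma csm_dy (h : C∞ U) : C∞ (dy U) := by rw [csm_dy_eq h]; exact csm_Dv h _

protected lemma SmU.dy (h : SmU U) : SmU (dy U) := (h.Dv _).congr (dy_eq_Dv h)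

lemma Dv_comm (h : ContDiffAt ℝ ∞ U p) (v w : Υ) :
    Dv v (Dv w U) p = Dv w (Dv v U) p := by
  have key : ∀ v w, Dv v (Dv w U) p = fderiv ℝ (fderiv ℝ U) p v w := by
    intro v w
    have := fderiv_clm_apply ((h.fderiv_right (m := 1) (by norm_cast)).differentiableAt (by simp)) (differentiableAt_const (c := w))
    change fderiv ℝ (fun y => (fderiv ℝ U y) w) p v = _; rw [this]; simp
  rw [key, key, (h.isSymmSndFDerivAt (by simp; norm_cast)) v w]

lemma slice_eq_Dv (h : DifferentiableAt ℝ U p) (v : Ξ) :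
    fderiv ℝ (fun x => U (x, p.2)) p.1 v = Dv (v, 0) U p := by
  have := HasFDerivAt.comp (x := p.1) (f := fun x : Ξ => ((x, p.2) : Υ)) (g := U)
    (g' := fderiv ℝ U p) h.hasFDerivAt (hasFDerivAt_prodMk_left _ _)
  have e : (fun x => U (x, p.2)) = U ∘ (fun x : Ξ => ((x, p.2) : Υ)) := rfl
  rw [e, this.fderiv]; simp [Dv]

lemma bLap_eq_sum {u : Ξ → ℝ} {x : Ξ} (h : ContDiffAt ℝ 2 u x) :
    bLap u x = ∑ i, fderiv ℝ (fun z => fderiv ℝ u z (single i 1)) x (single i 1) := by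
  rw [bLap, InnerProductSpace.laplacian_eq_iteratedFDeriv_orthonormalBasis u (EuclideanSpace.basisFun (Fin n) ℝ)]
  refine sum_congr rfl fun i _ => ?_
  rw [fderiv_clm_apply ((h.fderiv_right (m := 1) (by norm_cast)).differentiableAt (by simp)) (differentiableAt_const _), iteratedFDeriv_two_apply]
  simp

lemma LX_eq_sum_at (h : ∀ᶠ q in 𝓝 p, ContDiffAt ℝ ∞ U q) :
    LX U p = ∑ i, Dv (eX i) (Dv (eX i) U) p := by
  have hp := h.self_of_nhds
  have hs : ContDiffAt ℝ ∞ (fun x => U (x, p.2)) p.1 :=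
    ContDiffAt.comp p.1 (g := U) (f := fun x : Ξ => ((x, p.2) : Υ)) hp (by fun_prop)
  rw [LX, bLap_eq_sum (hs.of_le (by norm_cast))]
  refine sum_congr rfl fun i _ => ?_
  have hev : (fun z => fderiv ℝ (fun x => U (x, p.2)) z (single i 1)) =ᶠ[𝓝 p.1]
      fun z => Dv (eX i) U (z, p.2) := by
    filter_upwards [((show Continuous (fun x => (x, p.2)) by fun_prop).tendsto p.1).eventually h] with z hz
    exact slice_eq_Dv (hz.differentiableAt (by simp)) _
  rw [hev.fderiv_eq]
  exact slice_eq_Dv ((contDiffAt_Dv hp _).differentiableAt (by simp)) _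

lemma SmU.LX_eq (h : SmU U) :
    EqOn (LX U) (fun p => ∑ i, Dv (eX i) (Dv (eX i) U) p) ℍ :=
  fun p hp => LX_eq_sum_at (by filter_upwards [isOpen_upper.mem_nhds hp] with q hq using h.contDiffAt hq)

lemma csm_LX_eq (h : C∞ U) :
    LX U = fun p => ∑ i, Dv (eX i) (Dv (eX i) U) p :=
  funext fun _ => LX_eq_sum_at (Eventually.of_forall fun _ => h.contDiffAt)

lemma csm_LX (h : C∞ U) : C∞ (LX U) := by
  rw [csm_LX_eq h]
  exact ContDiff.sum fun i _ => csm_Dv (csm_Dv h _) _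

protected lemma SmU.LX (h : SmU U) : SmU (LX U) := by
  refine SmU.congr ?_ h.LX_eq
  exact ContDiffOn.sum fun i _ => (h.Dv _).Dv _

protected lemma SmU.opT (h : SmU U) (m : ℝ) : SmU (opT m U) := by
  refine ContDiffOn.add h.dy.dy (ContDiffOn.mul ?_ h.dy)
  exact ContDiffOn.div contDiffOn_const contDiffOn_snd fun p hp => (ne_of_gt hp)

protected lemma SmU.wLap (h : SmU U) (m : ℝ) : SmU (wLap m U) := by
  rw [wLap_eq]; exact ContDiffOn.add h.LX (h.opT m)

lemma SmU.wLap_iterate (h : SmU U) (m : ℝ) (j : ℕ) : SmU ((wLap m)^[j] U) := by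
  induction j generalizing U with
  | zero => exact h
  | succ j ih => exact ih (h.wLap m)

/-! ### Even smooth functions -/

lemma IsEvenSmooth.add (hA : IsEvenSmooth A) (hB : IsEvenSmooth B) :
    IsEvenSmooth (fun p => A p + B p) :=
  ⟨hA.1.add hB.1, fun x y => by simp [hA.2, hB.2]⟩

lemma IsEvenSmooth.mul (hA : IsEvenSmooth A) (hB : IsEvenSmooth B) :
    IsEvenSmooth (fun p => A p * B p) :=
  ⟨hA.1.mul hB.1, fun x y => by simp [hA.2, hB.2]⟩

lemma isEvenSmooth_const (c : ℝ) : IsEvenSmooth (fun _ : Υ => c) := ⟨contDiff_const, fun _ _ => rfl⟩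

lemma isEvenSmooth_sq : IsEvenSmooth (fun p : Υ => p.2 ^ 2) := ⟨contDiff_snd.pow 2, fun _ _ => by simp⟩

lemma IsEvenSmooth.sum {ι : Type*} {s : Finset ι} {A : ι → Ψ}
    (h : ∀ i ∈ s, IsEvenSmooth (A i)) : IsEvenSmooth (fun p => ∑ i ∈ s, A i p) :=
  ⟨ContDiff.sum fun i hi => (h i hi).1, fun x y => sum_congr rfl fun i hi => (h i hi).2 x y⟩

lemma IsEvenSmooth.Dv_eX (h : IsEvenSmooth A) (v : Ξ) : IsEvenSmooth (Dv (v, 0) A) := by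
  refine ⟨csm_Dv h.1 _, fun x y => ?_⟩
  rw [← slice_eq_Dv (h.1.differentiable (by simp) _), ← slice_eq_Dv (h.1.differentiable (by simp) _)]
  simp [h.2]

lemma IsEvenSmooth.dX (h : IsEvenSmooth A) (i : Fin n) : IsEvenSmooth (Dv (eX i) A) := h.Dv_eX _

protected lemma IsEvenSmooth.LX (h : IsEvenSmooth A) : IsEvenSmooth (LX A) := by
  rw [csm_LX_eq h.1]
  exact IsEvenSmooth.sum fun i _ => (h.dX i).dX i

lemma IsEvenSmooth.dy_neg (h : IsEvenSmooth A) (x : Ξ) (y : ℝ) :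
    dy A (x, -y) = - dy A (x, y) := by
  have := funext fun t => (h.2 x t).symm
  simp only [dy]
  conv_rhs => rw [this]
  rw [deriv_comp_neg (f := fun t => A (x, t))]
  simp

lemma dy_dy_neg (h : IsEvenSmooth A) (x : Ξ) (y : ℝ) :
    dy (dy A) (x, -y) = dy (dy A) (x, y) := by
  have : (fun t => dy A (x, t)) = fun t => - dy A (x, -t) := funext fun t => by rw [h.dy_neg]; simp
  simp only [dy] at this ⊢
  conv_rhs => rw [this]
  rw [deriv.fun_neg, deriv_comp_neg]
  simp

lemma IsEvenSmooth.dy_dy (h : IsEvenSmooth A) : IsEvenSmooth (dy (dy A)) :=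
  ⟨csm_dy (csm_dy h.1), dy_dy_neg h⟩

lemma IsEvenSmooth.dy_zero (h : IsEvenSmooth A) (x : Ξ) : dy A (x, 0) = 0 := by
  have := h.dy_neg x 0
  simp at this; linarith

/-- `y⁻¹ ∂_y E` for an even smooth function, extended smoothly to `y = 0`. -/
def hd (E : Ψ) : Ψ := fun p => ∫ t in (0 : ℝ)..1, dy (dy E) (p.1, t * p.2)

/-- `(E - E|_{y=0}) / y²` for an even smooth function, extended smoothly to `y = 0`. -/
def dq (E : Ψ) : Ψ := fun p => ∫ t in (0 : ℝ)..1, t * hd E (p.1, t * p.2)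

lemma hasDerivAt_slice (h : C∞ A) (x : Ξ) (y : ℝ) :
    HasDerivAt (fun t => A (x, t)) (dy A (x, y)) y := by
  have : Differentiable ℝ (fun t : ℝ => A (x, t)) := ContDiff.differentiable (n := ∞) (by fun_prop) (by simp)
  exact (this y).hasDerivAt

lemma mul_integral_dy (h : C∞ A) (x : Ξ) (y : ℝ) :
    y * ∫ t in (0 : ℝ)..1, dy A (x, t * y) = A (x, y) - A (x, 0) := by
  rw [← intervalIntegral.integral_const_mul]
  have hc := (csm_dy h).continuous
  rw [intervalIntegral.integral_eq_sub_of_hasDerivAt (f := fun t => A (x, t * y))]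
  · simp
  · intro t _
    simpa [mul_comm, Function.comp_def] using (hasDerivAt_slice h x (t * y)).comp t ((hasDerivAt_id t).mul_const y)
  · exact (Continuous.intervalIntegrable (by fun_prop) _ _)

protected lemma IsEvenSmooth.hd (h : IsEvenSmooth A) : IsEvenSmooth (hd A) := by
  have h2 := h.dy_dy
  refine ⟨?_, fun x y => ?_⟩
  · have := h2.1; exact contDiff_intervalIntegral_param
      (F := fun q : Υ × ℝ => dy (dy A) (q.1.1, q.2 * q.1.2))
      (by fun_prop)
  · simp only [hd, mul_neg, h2.2]

protected lemma IsEvenSmooth.dq (h : IsEvenSmooth A) : IsEvenSmooth (dq A) := by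
  have h2 := h.hd
  refine ⟨?_, fun x y => ?_⟩
  · have := h2.1; exact contDiff_intervalIntegral_param
      (F := fun q : Υ × ℝ => q.2 * hd A (q.1.1, q.2 * q.1.2))
      (by fun_prop)
  · simp only [dq, mul_neg, h2.2]

lemma IsEvenSmooth.dy_eq_mul_hd (h : IsEvenSmooth A) (p : Υ) :
    dy A p = p.2 * hd A p := by
  have := mul_integral_dy (csm_dy h.1) p.1 p.2
  rw [h.dy_zero] at this
  simp [hd, this]

lemma IsEvenSmooth.eq_add_sq_mul_dq (h : IsEvenSmooth A) (p : Υ) :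
    A p = A (p.1, 0) + p.2 ^ 2 * dq A p := by
  have := mul_integral_dy h.1 p.1 p.2
  simp only [h.dy_eq_mul_hd] at this
  rw [show ∫ t in (0 : ℝ)..1, t * p.2 * hd A (p.1, t * p.2) = p.2 * dq A p by rw [dq, ← intervalIntegral.integral_const_mul]; congr 1; ext t; ring] at this
  linear_combination -this

/-- `∂_y² + c y⁻¹ ∂_y` on even smooth functions. -/
def Tc (c : ℝ) (E : Ψ) : Ψ := fun p => dy (dy E) p + c * hd E p

protected lemma IsEvenSmooth.Tc (h : IsEvenSmooth A) (c : ℝ) : IsEvenSmooth (Tc c A) :=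
  h.dy_dy.add ((isEvenSmooth_const c).mul h.hd)

lemma eqOn_of_eqOn_ne_zero {f g : Ψ} (hf : Continuous f) (hg : Continuous g)
    (h : ∀ x y, y ≠ 0 → f (x, y) = g (x, y)) : f = g := by
  ext ⟨x, y⟩
  have := Continuous.ext_on (dense_compl_singleton 0) (by fun_prop) (by fun_prop) fun t ht => h x t ht
  exact congrFun this y

/-! ### Expansions `A + y^e B` -/

/-- `U = A + y^e B` in the open half space. -/
def RepOn (e : ℝ) (A B U : Ψ) : Prop := ∀ p ∈ ℍ, U p = A p + p.2 ^ e * B p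

lemma RepOn.congr (h : RepOn e A B U) (hV : EqOn V U ℍ) :
    RepOn e A B V := fun p hp => by rw [hV hp, h p hp]

lemma contDiffOn_rpow_snd (e : ℝ) : ContDiffOn ℝ ∞ (fun p : Υ => p.2 ^ e) ℍ :=
  contDiffOn_snd.rpow_const_of_ne fun _ hp => ne_of_gt hp

lemma RepOn.smU (hA : C∞ A) (hB : C∞ B)
    (h : RepOn e A B U) : SmU U :=
  SmU.congr (hA.contDiffOn.add ((contDiffOn_rpow_snd e).mul hB.contDiffOn)) h

protected lemma RepOn.dy (hA : C∞ A) (hB : C∞ B) (h : RepOn e A B U) :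
    RepOn (e - 1) (dy A) (fun p => e * B p + p.2 * dy B p) (dy U) := by
  rintro ⟨x, y⟩ hp
  rw [dy_congr (V := fun p => A p + p.2 ^ e * B p) h hp]
  have hy : (0 : ℝ) < y := hp
  have := (hasDerivAt_slice hA x y).add
    ((hasDerivAt_rpow_const (p := e) (Or.inl hy.ne')).mul (hasDerivAt_slice hB x y))
  have h2 := this.deriv
  simp only [Pi.add_def, Pi.mul_def] at h2
  have e1 : dy (fun p : Υ => A p + p.2 ^ e * B p) (x, y) =
    deriv (fun t => A (x, t) + t ^ e * B (x, t)) y := rfl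
  rw [e1, h2]
  have : y ^ e = y ^ (e - 1) * y := by rw [← rpow_add_one hy.ne']; ring_nf
  simp only [this]; ring

protected lemma RepOn.opT (m : ℝ) (hA : IsEvenSmooth A) (hB : IsEvenSmooth B)
    (h : RepOn e A B U) :
    RepOn (e - 2) (Tc m A) (fun p => e * (e - 1 + m) * B p +
      p.2 ^ 2 * ((2 * e + m) * hd B p + dy (dy B) p))
      (opT m U) := by
  have h1 := h.dy hA.1 hB.1
  have hsm : C∞ (fun p : Υ => e * B p + p.2 * dy B p) := by
    have := hB.1; have := csm_dy hB.1; fun_prop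
  rintro ⟨x, y⟩ hp
  have hy : (0 : ℝ) < y := hp
  have e3 : dy (fun p => e * B p + p.2 * dy B p) (x, y) =
      e * dy B (x, y) + (dy B (x, y) +
        y * dy (dy B) (x, y)) := by
    have := ((hasDerivAt_slice hB.1 x y).const_mul e).add ((hasDerivAt_id y).mul (hasDerivAt_slice (csm_dy hB.1) x y))
    have := this.deriv; simp only [Pi.add_def] at this; rw [one_mul] at this; exact this
  simp only [opT, (h1.dy (csm_dy hA.1) hsm) _ hp, h1 _ hp, e3, hB.dy_eq_mul_hd (x, y), hA.dy_eq_mul_hd (x, y),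
    Tc]
  rw [show y ^ (e - 1 - 1) = y ^ (e - 2) by ring_nf, show y ^ (e - 1) = y ^ (e - 2) * y by rw [← rpow_add_one hy.ne']; ring_nf]
  field_simp
  ring

protected lemma RepOn.LX (hA : C∞ A) (hB : C∞ B)
    (h : RepOn e A B U) : RepOn e (LX A) (LX B) (LX U) := by
  rintro ⟨x, y⟩ hp
  have e1 : (fun z => U (z, y)) = (fun z => A (z, y)) + y ^ e • fun z => B (z, y) := funext fun z => h (z, y) hp
  have hA' : ContDiff ℝ 2 fun z => A (z, y) := (hA.of_le (by norm_cast)).comp (by fun_prop)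
  have hB' : ContDiff ℝ 2 fun z => B (z, y) := (hB.of_le (by norm_cast)).comp (by fun_prop)
  have hB'' : ContDiffAt ℝ 2 (y ^ e • fun z => B (z, y)) x := (contDiffAt_const).smul hB'.contDiffAt
  simp only [LX, bLap, e1]
  rw [ContDiffAt.laplacian_add hA'.contDiffAt hB'', InnerProductSpace.laplacian_smul _ hB'.contDiffAt, smul_eq_mul]

lemma RepOn.Dv_eX (hA : C∞ A) (hB : C∞ B)
    (h : RepOn e A B U) (i : Fin n) : RepOn e (Dv (eX i) A) (Dv (eX i) B) (Dv (eX i) U) := by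
  rintro ⟨x, y⟩ hp
  have hd {f : Ψ} (hf : C∞ f) (p : Υ) : DifferentiableAt ℝ f p := hf.differentiable (by simp) p
  have hd' {f : Ψ} (hf : C∞ f) : DifferentiableAt ℝ (fun z => f (z, y)) x :=
    (hf.comp (f := fun z : Ξ => ((z, y) : Υ)) (by fun_prop)).differentiable (by simp) x
  have e1 : (fun z => U (z, y)) = (fun z => A (z, y)) + y ^ e • fun z => B (z, y) := funext fun z => h (z, y) hp
  rw [eX, ← slice_eq_Dv (p := (x, y)) ((h.smU hA hB).differentiableAt hp),
    ← slice_eq_Dv (p := (x, y)) (hd hA _), ← slice_eq_Dv (p := (x, y)) (hd hB _)]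
  simp only [e1]
  rw [fderiv_add (hd' hA) ((hd' hB).const_smul _), fderiv_const_smul (hd' hB)]
  simp

end

section

variable {U V A : Amb n → ℝ} {p : Amb n} {s e c : ℝ} {q j : ℕ}

local notation "ϖ" => 1 - 2 * s

/-! ### Linear operators on even smooth functions and on boundary functions -/

lemma Dv_add (hU : DifferentiableAt ℝ U p) (hV : DifferentiableAt ℝ V p) (v : Υ) :
    Dv v (fun q => U q + V q) p = Dv v U p + Dv v V p := by
  simp only [Dv]; rw [fderiv_fun_add hU hV]; simp

lemma Dv_const_mul (c : ℝ) (hU : DifferentiableAt ℝ U p)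
    (v : Υ) : Dv v (fun q => c * U q) p = c * Dv v U p := by
  simp only [Dv]; rw [fderiv_const_mul hU]; simp

lemma csm_Dv_add (hU : C∞ U) (hV : C∞ V)
    (v : Υ) : Dv v (fun q => U q + V q) = fun q => Dv v U q + Dv v V q :=
  funext fun _ => Dv_add (hU.differentiable (by simp) _) (hV.differentiable (by simp) _) v

lemma csm_Dv_const_mul (c : ℝ) (hU : C∞ U)
    (v : Υ) : Dv v (fun q => c * U q) = fun q => c * Dv v U q :=
  funext fun _ => Dv_const_mul c (hU.differentiable (by simp) _) v

variable (n) in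
/-- The space of even smooth functions. -/
def ES : Submodule ℝ (Amb n → ℝ) where
  carrier := {A | IsEvenSmooth A}
  add_mem' := fun hA hB => hA.add hB
  zero_mem' := isEvenSmooth_const 0
  smul_mem' := fun c _ hA => (isEvenSmooth_const c).mul hA

variable (n) in
/-- The space of smooth functions on the boundary. -/
def SB : Submodule ℝ (Bdry n → ℝ) where
  carrier := {A | C∞ A}
  add_mem' := fun {A B} (hA : C∞ A) (hB : C∞ B) => hA.add hB
  zero_mem' := (contDiff_const : C∞ fun _ : Bdry n => (0 : ℝ))
  smul_mem' := fun c A (hA : C∞ A) => (contDiff_const.mul hA : C∞ fun x => c * A x)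

lemma SB.contDiff (u : SB n) : C∞ (u : Ξ → ℝ) := u.2

lemma csm_LX_add {B : Ψ} (hA : C∞ A) (hB : C∞ B) :
    LX (fun p => A p + B p) = fun p => LX A p + LX B p := by
  rw [csm_LX_eq hA, csm_LX_eq hB, csm_LX_eq (hA.add hB)]
  ext p
  simp only [csm_Dv_add hA hB, csm_Dv_add (csm_Dv hA _) (csm_Dv hB _)]
  rw [sum_add_distrib]

lemma csm_LX_const_mul (c : ℝ) (hA : C∞ A) :
    LX (fun p => c * A p) = fun p => c * LX A p := by
  rw [csm_LX_eq hA, csm_LX_eq (contDiff_const.mul hA)]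
  ext p
  simp only [csm_Dv_const_mul c hA, csm_Dv_const_mul c (csm_Dv hA _)]
  rw [mul_sum]

lemma csm_dy_add {B : Ψ} (hA : C∞ A) (hB : C∞ B) :
    dy (fun p => A p + B p) = fun p => dy A p + dy B p := by
  rw [csm_dy_eq hA, csm_dy_eq hB, csm_dy_eq (hA.add hB), csm_Dv_add hA hB]

lemma csm_dy_const_mul (c : ℝ) (hA : C∞ A) :
    dy (fun p => c * A p) = fun p => c * dy A p := by
  rw [csm_dy_eq hA, csm_dy_eq (contDiff_const.mul hA), csm_Dv_const_mul c hA]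

lemma continuous_slice_mul (hA : Continuous A) (x : Ξ) (y : ℝ) :
    Continuous fun t : ℝ => A (x, t * y) := by fun_prop

lemma Tc_add (c : ℝ) {B : Ψ} (hA : IsEvenSmooth A) (hB : IsEvenSmooth B) :
    Tc c (fun p => A p + B p) = fun p => Tc c A p + Tc c B p := by
  ext p
  have : hd (fun p => A p + B p) p = hd A p + hd B p := by
    simp only [hd]
    rw [csm_dy_add hA.1 hB.1, csm_dy_add (csm_dy hA.1) (csm_dy hB.1), intervalIntegral.integral_add ((continuous_slice_mul hA.dy_dy.1.continuous p.1 p.2).intervalIntegrable _ _)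
        ((continuous_slice_mul hB.dy_dy.1.continuous p.1 p.2).intervalIntegrable _ _)]
  simp only [Tc, this]
  rw [csm_dy_add hA.1 hB.1, csm_dy_add (csm_dy hA.1) (csm_dy hB.1)]
  ring

lemma Tc_const_mul (c a : ℝ) (hA : IsEvenSmooth A) :
    Tc c (fun p => a * A p) = fun p => a * Tc c A p := by
  ext p
  simp only [Tc, hd]
  rw [csm_dy_const_mul a hA.1, csm_dy_const_mul a (csm_dy hA.1), intervalIntegral.integral_const_mul]
  ring

/-- The boundary Laplacian on even smooth functions. -/
def LXe : Module.End ℝ (ES n) where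
  toFun A := ⟨LX A, A.2.LX⟩
  map_add' A B := Subtype.ext (csm_LX_add A.2.1 B.2.1)
  map_smul' c A := Subtype.ext (csm_LX_const_mul c A.2.1)

/-- The operator `∂_y² + c y⁻¹ ∂_y` on even smooth functions. -/
def Te (c : ℝ) : Module.End ℝ (ES n) where
  toFun A := ⟨Tc c A, A.2.Tc c⟩
  map_add' A B := Subtype.ext (Tc_add c A.2 B.2)
  map_smul' a A := Subtype.ext (Tc_const_mul c a A.2)

lemma LX_dy_comm (hA : C∞ A) : LX (dy A) = dy (LX A) := by
  rw [csm_dy_eq (csm_LX hA), csm_LX_eq (csm_dy hA), csm_LX_eq hA, csm_dy_eq hA]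
  ext p
  have h1 : ∀ i, Dv (eX i) (Dv eY A) = Dv eY (Dv (eX i) A) := fun i => funext fun q => Dv_comm hA.contDiffAt _ _
  have h2 : ∀ i, Dv (eX i) (Dv eY (Dv (eX i) A)) p = Dv eY (Dv (eX i) (Dv (eX i) A)) p := fun i =>
    Dv_comm (csm_Dv hA _).contDiffAt _ _
  simp only [h1, h2]
  have h3 : fderiv ℝ (fun p => ∑ i, Dv (eX i) (Dv (eX i) A) p) p =
      ∑ i, fderiv ℝ (Dv (eX i) (Dv (eX i) A)) p := fderiv_fun_sum fun i _ => ?_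
  · change _ = fderiv ℝ (fun p => ∑ i, Dv (eX i) (Dv (eX i) A) p) p eY; rw [h3]; simp [Dv]
  · exact (csm_Dv (csm_Dv hA (eX i)) (eX i)).differentiable (by simp) p

lemma LX_Tc_comm (c : ℝ) (hA : IsEvenSmooth A) : LX (Tc c A) = Tc c (LX A) := by
  refine eqOn_of_eqOn_ne_zero (hA.Tc c).LX.1.continuous (hA.LX.Tc c).1.continuous fun x y hy => ?_
  have h2 : LX (hd A) (x, y) = hd (LX A) (x, y) := by
    have e1 := hA.LX.dy_eq_mul_hd (x, y); rw [← LX_dy_comm hA.1] at e1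
    have e2 : (fun z => dy A (z, y)) = y • fun z => hd A (z, y) := funext fun z => hA.dy_eq_mul_hd (z, y)
    have h3 : LX (dy A) (x, y) = y * LX (hd A) (x, y) := by
      simp only [LX, bLap, e2]
      have hB' : ContDiff ℝ 2 fun z => hd A (z, y) := (hA.hd.1.of_le (by norm_cast)).comp (by fun_prop)
      rw [InnerProductSpace.laplacian_smul _ hB'.contDiffAt, smul_eq_mul]
    rw [h3] at e1; exact mul_left_cancel₀ hy e1
  rw [show LX (Tc c A) = fun p => LX (dy (dy A)) p + c * LX (hd A) p by have := csm_LX_add hA.dy_dy.1 (contDiff_const (c := c) |>.mul hA.hd.1); rw [csm_LX_const_mul c hA.hd.1] at this; exact this]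
  simp only [Tc, h2, LX_dy_comm (csm_dy hA.1), LX_dy_comm hA.1]

lemma commute_LXe_Te (c : ℝ) : Commute (LXe : Module.End ℝ (ES n)) (Te c) :=
  LinearMap.ext fun A => Subtype.ext (LX_Tc_comm c A.2)

lemma contDiff_bLap {u : Ξ → ℝ} (h : C∞ u) : C∞ (bLap u) := by
  have : bLap u = fun x => ∑ i, fderiv ℝ (fun z => fderiv ℝ u z (single i 1)) x
      (single i 1) :=
    funext fun x => bLap_eq_sum (h.of_le (by norm_cast)).contDiffAt
  rw [this]
  have hd : ∀ {w : Ξ → ℝ} (v : Ξ), C∞ w → C∞ (fun z => fderiv ℝ w z v) := fun v hw =>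
    (hw.fderiv_right (m := ∞) (by simp)).clm_apply contDiff_const
  exact ContDiff.sum fun i _ => hd _ (hd _ h)

/-- The Laplacian on smooth boundary functions. -/
def Lb : Module.End ℝ (SB n) where
  toFun u := ⟨bLap u, contDiff_bLap u.2⟩
  map_add' u v := Subtype.ext (funext fun x => ContDiffAt.laplacian_add
    ((SB.contDiff u).of_le (by norm_cast)).contDiffAt ((SB.contDiff v).of_le (by norm_cast)).contDiffAt)
  map_smul' c u := Subtype.ext (funext fun x => InnerProductSpace.laplacian_smul c
    ((SB.contDiff u).of_le (by norm_cast)).contDiffAt)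

lemma coe_Lb_pow (u : SB n) (j : ℕ) : (((Lb ^ j) u : SB n) : Ξ → ℝ) = bLap^[j] u := by
  induction j generalizing u with
  | zero => rfl
  | succ j ih => rw [pow_succ, Module.End.mul_apply, ih]; rfl

/-- The restriction of an even smooth function to the boundary. -/
def tr : ES n →ₗ[ℝ] SB n where
  toFun A := ⟨fun x => A.1 (x, 0), A.2.1.comp (f := fun x : Ξ => ((x, 0) : Υ))
    (by fun_prop)⟩
  map_add' _ _ := rfl
  map_smul' _ _ := rfl

lemma tr_LXe (A : ES n) : tr (LXe A) = Lb (tr A) := rfl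

lemma tr_LXe_pow (A : ES n) (j : ℕ) : tr ((LXe ^ j) A) = (Lb ^ j) (tr A) := by
  induction j generalizing A with
  | zero => rfl
  | succ j ih => rw [pow_succ, Module.End.mul_apply, ih, tr_LXe, pow_succ, Module.End.mul_apply]

/-- The operator `Δ + c y⁻¹ ∂_y` on even smooth functions. -/
def Le (c : ℝ) : Module.End ℝ (ES n) := LXe + Te c

lemma tr_Le_pow (c : ℝ) (A : ES n) (j : ℕ) : tr ((Le c ^ j) A) = ∑ i ∈ ℛ (j + 1), (j.choose i : ℝ) • (Lb ^ (j - i)) (tr ((Te c ^ i) A)) := by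
  rw [Le, add_comm, ((commute_LXe_Te c).symm).add_pow, LinearMap.sum_apply, map_sum]
  refine sum_congr rfl fun i _ => ?_
  rw [← nsmul_eq_mul', LinearMap.smul_apply, map_nsmul, ← Nat.cast_smul_eq_nsmul ℝ,
    ((commute_LXe_Te c).symm.pow_pow i (j - i)).eq, Module.End.mul_apply, tr_LXe_pow]

/-! ### Functions with an expansion and their traces -/

protected lemma RepOn.wLap {A B : ES n} (h : RepOn (2 * s) A B U) :
    RepOn (2 * s) (Le ϖ A : ES n) (Le (1 + 2 * s) B : ES n) (wLap ϖ U) := by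
  intro p hp
  simp only [wLap_eq, (h.LX A.2.1 B.2.1) p hp, (h.opT ϖ A.2 B.2) p hp]
  rw [show p.2 ^ (2 * s) = p.2 ^ (2 * s - 2) * p.2 ^ 2 by rw [← rpow_natCast, ← rpow_add hp]; norm_num]
  change _ = (LX A p + Tc _ A p) + _ * (LX B p + Tc _ B p)
  simp only [Tc]
  ring

lemma RepOn.opT' {A B : ES n} (h : RepOn (2 * s) A B U) :
    RepOn (2 * s) (Te ϖ A : ES n) (Te (1 + 2 * s) B : ES n) (opT ϖ U) := by
  intro p hp
  rw [(h.opT ϖ A.2 B.2) p hp]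
  rw [show p.2 ^ (2 * s) = p.2 ^ (2 * s - 2) * p.2 ^ 2 by rw [← rpow_natCast, ← rpow_add hp]; norm_num]
  change _ = Tc _ A p + _ * Tc _ B p
  simp only [Tc]
  ring

lemma RepOn.wLap_iterate {A B : ES n} (h : RepOn (2 * s) A B U)
    (j : ℕ) : RepOn (2 * s) ((Le ϖ ^ j) A : ES n)
      ((Le (1 + 2 * s) ^ j) B : ES n) ((wLap ϖ)^[j] U) := by
  induction j generalizing A B U with
  | zero => exact h
  | succ j ih => simpa only [pow_succ, Module.End.mul_apply, iterate_succ_apply] using ih h.wLap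

lemma RepOn.opT_iterate {A B : ES n} (h : RepOn (2 * s) A B U)
    (j : ℕ) : RepOn (2 * s) ((Te ϖ ^ j) A : ES n)
      ((Te (1 + 2 * s) ^ j) B : ES n) ((opT ϖ)^[j] U) := by
  induction j generalizing A B U with
  | zero => exact h
  | succ j ih => simpa only [pow_succ, Module.End.mul_apply, iterate_succ_apply] using ih h.opT'

lemma continuous_max_rpow (he : 0 ≤ e) : Continuous fun p : Υ => (max p.2 0) ^ e :=
  (continuous_snd.max continuous_const).rpow_const fun _ => Or.inr he

lemma RepOn.exists_continuous (he : 0 < e) {B : Ψ} (hA : Continuous A)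
    (hB : Continuous B) (h : RepOn e A B U) :
    ∃ G : Ψ, Continuous G ∧ EqOn U G ℍ ∧ ∀ x, G (x, 0) = A (x, 0) := by
  refine ⟨fun p => A p + (max p.2 0) ^ e * B p,
    hA.add ((continuous_max_rpow he.le).mul hB), fun p hp => ?_, fun x => ?_⟩
  · simp only [h p hp, max_eq_left (le_of_lt (show (0 : ℝ) < p.2 from hp))]
  · simp [zero_rpow he.ne']

lemma RepOn.exists_continuous_wNormal (hs1 : s < 1) {A B : ES n} (h : RepOn (2 * s) A B U) :
    ∃ G : Ψ, Continuous G ∧ EqOn (wNormal ϖ U) G ℍ ∧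
      ∀ x, G (x, 0) = 2 * s * (tr B).1 x := by
  have c2 := B.2.hd.1.continuous
  have c3 := B.2.1.continuous
  refine ⟨fun p => (max p.2 0) ^ (2 - 2 * s) * hd A p + (2 * s * (B : Ψ) p + p.2 ^ 2 * hd B p),
    ((continuous_max_rpow (by linarith)).mul A.2.hd.1.continuous).add (by fun_prop), fun p hp => ?_, fun x => ?_⟩
  · have hy : (0 : ℝ) < p.2 := hp
    simp only [wNormal, (h.dy A.2.1 B.2.1) p hp, max_eq_left hy.le, A.2.dy_eq_mul_hd p, B.2.dy_eq_mul_hd p]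
    have e2 : p.2 ^ ϖ * p.2 ^ (2 * s - 1) = 1 := by rw [← rpow_add hy]; norm_num
    rw [show p.2 ^ (2 - 2 * s) = p.2 ^ ϖ * p.2 by rw [← rpow_add_one hy.ne']; ring_nf]
    linear_combination (2 * s * (B : Ψ) p + p.2 * (p.2 * hd B p)) * e2
  · have : (2 - 2 * s) ≠ 0 := by linarith
    simp [zero_rpow this, tr]

lemma tendsto_slice_of_eqOn {G : Ψ} (hG : Continuous G) (h : EqOn U G ℍ)
    (x : Ξ) : Tendsto (fun y => U (x, y)) (𝓝[>] 0) (𝓝 (G (x, 0))) := by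
  refine (((by fun_prop : Continuous fun y => G (x, y)).tendsto 0).mono_left nhdsWithin_le_nhds).congr' ?_
  filter_upwards [self_mem_nhdsWithin] with y hy using (h (show (x, y) ∈ ℍ from hy)).symm

lemma RepOn.tendsto (he : 0 < e) {B : Ψ} (hA : Continuous A)
    (hB : Continuous B) (h : RepOn e A B U) (x : Ξ) :
    Tendsto (fun y => U (x, y)) (𝓝[>] 0) (𝓝 (A (x, 0))) := by
  obtain ⟨G, hG, hUG, h0⟩ := h.exists_continuous he hA hB
  rw [← h0]; exact tendsto_slice_of_eqOn hG hUG x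

lemma RepOn.tendsto_wNormal (hs1 : s < 1) {A B : ES n}
    (h : RepOn (2 * s) A B U) (x : Ξ) :
    Tendsto (fun y => wNormal ϖ U (x, y)) (𝓝[>] 0) (𝓝 (2 * s * (tr B).1 x)) := by
  obtain ⟨G, hG, hUG, h0⟩ := h.exists_continuous_wNormal hs1
  rw [← h0]; exact tendsto_slice_of_eqOn hG hUG x

/-! ### Functions whose odd data vanish to some order -/

/-- Functions of the form `A + y^{2s+2q} B` with even smooth `A` and `B`. -/
def Cl (s : ℝ) (q : ℕ) (U : Ψ) : Prop :=
  ∃ A B : Ψ, IsEvenSmooth A ∧ IsEvenSmooth B ∧ RepOn (2 * s + 2 * q) A B U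

lemma Cl.smU (h : Cl s q U) : SmU U := by
  obtain ⟨A, B, hA, hB, h⟩ := h
  exact h.smU hA.1 hB.1

lemma Cl.congr (h : Cl s q U) (hV : EqOn V U ℍ) : Cl s q V := by
  obtain ⟨A, B, hA, hB, h⟩ := h
  exact ⟨A, B, hA, hB, h.congr hV⟩

lemma Cl.of_succ (h : Cl s (q + 1) U) : Cl s q U := by
  obtain ⟨A, B, hA, hB, h⟩ := h
  refine ⟨A, fun p => p.2 ^ 2 * B p, hA, isEvenSmooth_sq.mul hB, fun p hp => ?_⟩
  have : p.2 ^ (2 * s + 2 * (q + 1 : ℕ)) = p.2 ^ (2 * s + 2 * q) * p.2 ^ 2 := by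
    rw [← rpow_natCast, ← rpow_add hp]; push_cast; ring_nf
  rw [h p hp, this]; ring

lemma Cl.of_le {r : ℕ} (h : Cl s q U) (hr : r ≤ q) : Cl s r U := by
  induction q, hr using Nat.le_induction with
  | base => exact h
  | succ q _ ih => exact ih h.of_succ

lemma Cl.exists_rep (h : Cl s q U) : ∃ A B : ES n, RepOn (2 * s) A B U := by
  obtain ⟨A, B, hA, hB, h⟩ := h.of_le (Nat.zero_le q)
  exact ⟨⟨A, hA⟩, ⟨B, hB⟩, by simpa using h⟩

protected lemma Cl.opT (h : Cl s (q + 1) U) : Cl s q (opT ϖ U) := by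
  obtain ⟨A, B, hA, hB, h⟩ := h
  have h1 := h.opT ϖ hA hB
  rw [show 2 * s + 2 * (q + 1 : ℕ) - 2 = 2 * s + 2 * q by push_cast; ring] at h1
  exact ⟨_, _, hA.Tc _, ((isEvenSmooth_const _).mul hB).add
    (isEvenSmooth_sq.mul (((isEvenSmooth_const _).mul hB.hd).add hB.dy_dy)), h1⟩

protected lemma Cl.LX (h : Cl s q U) : Cl s q (LX U) := by
  obtain ⟨A, B, hA, hB, h⟩ := h
  exact ⟨_, _, hA.LX, hB.LX, h.LX hA.1 hB.1⟩

lemma Cl.Dv_eX (h : Cl s q U) (i : Fin n) : Cl s q (Dv (eX i) U) := by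
  obtain ⟨A, B, hA, hB, h⟩ := h
  exact ⟨_, _, hA.dX i, hB.dX i, h.Dv_eX hA.1 hB.1 i⟩

lemma Cl.add (hU : Cl s q U) (hV : Cl s q V) : Cl s q (fun p => U p + V p) := by
  obtain ⟨A, B, hA, hB, h⟩ := hU
  obtain ⟨A', B', hA', hB', h'⟩ := hV
  exact ⟨_, _, hA.add hA', hB.add hB', fun p hp => by simp only [h p hp, h' p hp]; ring⟩

lemma Cl.even_mul {χ : Ψ} (hχ : IsEvenSmooth χ) (hU : Cl s q U) :
    Cl s q (fun p => χ p * U p) := by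
  obtain ⟨A, B, hA, hB, h⟩ := hU
  exact ⟨_, _, hχ.mul hA, hχ.mul hB, fun p hp => by simp only [h p hp]; ring⟩

lemma Cl.sub (hU : Cl s q U) (hV : Cl s q V) : Cl s q (fun p => U p - V p) :=
  (hU.add (hV.even_mul (isEvenSmooth_const (-1)))).congr fun p _ => by ring

protected lemma Cl.wLap (h : Cl s (q + 1) U) : Cl s q (wLap ϖ U) := by
  rw [wLap_eq]; exact h.of_succ.LX.add h.opT

lemma RepOn.cl {A B : ES n} (h : RepOn (2 * s) A B U) : Cl s 0 U :=
  ⟨A, B, A.2, B.2, by simpa using h⟩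

lemma Cl.wLap_iterate (h : Cl s (q + j) U) :
    Cl s q ((wLap ϖ)^[j] U) := by
  induction j generalizing U with
  | zero => exact h
  | succ j ih => exact ih (Cl.wLap h)

lemma Cl.wLap_iterate_zero (h : Cl s 0 U) (j : ℕ) :
    Cl s 0 ((wLap ϖ)^[j] U) := by
  obtain ⟨A, B, h⟩ := h.exists_rep
  exact (h.wLap_iterate j).cl

lemma Cl.opT_iterate (h : Cl s (q + j) U) :
    Cl s q ((opT ϖ)^[j] U) := by
  induction j generalizing U with
  | zero => exact h
  | succ j ih => exact ih (Cl.opT h)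

lemma Cl.tendsto_wNormal (hs1 : s < 1) (h : Cl s 1 U)
    (x : Ξ) : Tendsto (fun y => wNormal ϖ U (x, y)) (𝓝[>] 0) (𝓝 0) := by
  obtain ⟨A, B, hA, hB, h⟩ := h
  have h2 : RepOn (2 * s) (⟨A, hA⟩ : ES n) (⟨_, isEvenSmooth_sq.mul hB⟩ : ES n) U := fun p hp => by
    have hy := hp; have : p.2 ^ (2 * s + 2 * ((1 : ℕ) : ℝ)) = p.2 ^ (2 * s) * p.2 ^ 2 := by
      rw [← rpow_natCast, ← rpow_add hy]; push_cast; ring_nf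
    rw [h p hp, this]; ring
  simpa [tr] using h2.tendsto_wNormal hs1 x

lemma Te_coe_eqOn (c : ℝ) (B : ES n) : EqOn (Te c B : ES n) (opT c (B : Ψ)) ℍ := fun p hp => by
    have hy : (0 : ℝ) < p.2 := hp; change Tc c B p = _; simp only [Tc, opT, B.2.dy_eq_mul_hd p]; field_simp

lemma opT_iterate_congr {m : ℝ} (h : EqOn U V ℍ) (j : ℕ) :
    EqOn ((opT m)^[j] U) ((opT m)^[j] V) ℍ := by
  induction j generalizing U V with
  | zero => exact h
  | succ j ih => exact ih (opT_congr h)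

lemma Te_pow_eqOn (c : ℝ) (B : ES n) (j : ℕ) :
    EqOn ((Te c ^ j) B : ES n) ((opT c)^[j] (B : Ψ)) ℍ := by
  induction j generalizing B with
  | zero => exact fun _ _ => rfl
  | succ j ih =>
    rw [pow_succ]; exact (ih _).trans (opT_iterate_congr (Te_coe_eqOn c B) j)

lemma Tc_zero (c : ℝ) : Tc c (fun _ : Υ => (0 : ℝ)) = fun _ => 0 := by ext p; simp [Tc, hd, dy]

lemma RepOn.opT_iterate_even (hc : 0 < c) (hj : j ≤ q) {E : Ψ}
    (hE : IsEvenSmooth E) (h : RepOn (2 * q : ℝ) (fun _ => 0) E U) :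
    ∃ E' : Ψ, IsEvenSmooth E' ∧ RepOn (2 * ((q - j : ℕ) : ℝ)) (fun _ => 0) E' ((opT c)^[j] U) ∧
      ∃ κ : ℝ, κ ≠ 0 ∧ ∀ x, E' (x, 0) = κ * E (x, 0) := by
  induction j with
  | zero => exact ⟨E, hE, h, 1, one_ne_zero, fun x => (one_mul _).symm⟩
  | succ j ih =>
    obtain ⟨E', hE', h', κ, hκ, hx⟩ := ih (by omega); have h2 := h'.opT c (isEvenSmooth_const 0) hE'; rw [Tc_zero] at h2; have e1 : (2 * (q - j : ℕ)) - 2 = 2 * ((q - (j + 1) : ℕ) : ℝ) := by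
      rw [cast_sub (by omega), cast_sub (by omega)]; push_cast; ring
    rw [e1, ← iterate_succ_apply' (opT c) j U] at h2
    have hpos : 1 ≤ (q - j) := by exact_mod_cast (by omega : 1 ≤ q - j)
    refine ⟨_, ?_, h2, (2 * (q - j : ℕ)) * ((2 * (q - j : ℕ)) - 1 + c) * κ, ?_, fun x => ?_⟩
    · exact ((isEvenSmooth_const _).mul hE').add
        (isEvenSmooth_sq.mul (((isEvenSmooth_const _).mul hE'.hd).add hE'.dy_dy))
    · have : 0 < (2 * (q - j : ℕ)) * ((2 * (q - j : ℕ)) - 1 + c) := by apply mul_pos <;> linarith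
      exact mul_ne_zero this.ne' hκ
    · simp [hx]; ring

lemma tr_Te_pow_of_eq (hc : 0 < c) {B E : ES n}
    (h : ∀ p, (B : Ψ) p = p.2 ^ (2 * q) * (E : Ψ) p) :
    (∀ j < q, tr ((Te c ^ j) B) = 0) ∧ ∃ κ : ℝ, κ ≠ 0 ∧ tr ((Te c ^ q) B) = κ • tr E := by
  have hrep : RepOn (2 * q : ℝ) (fun _ => 0) (E : Ψ) (B : Ψ) := fun p hp => by
    rw [h p, ← rpow_natCast]; push_cast; ring
  have hlim := fun j x => tendsto_slice_of_eqOn ((Te c ^ j) B).2.1.continuous (Te_pow_eqOn c B j).symm x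
  constructor
  · intro j hj; obtain ⟨E', hE', h', -⟩ := hrep.opT_iterate_even hc hj.le E.2
    have hpos : 0 < (2 * ((q - j : ℕ) : ℝ)) := by
      have : (1 : ℝ) ≤ ((q - j : ℕ) : ℝ) := by exact_mod_cast (by omega : 1 ≤ q - j)
      linarith
    ext x; exact tendsto_nhds_unique (hlim j x) (h'.tendsto hpos continuous_const hE'.1.continuous x)
  · obtain ⟨E', hE', h', κ, hκ, hx⟩ := hrep.opT_iterate_even hc le_rfl E.2; refine ⟨κ, hκ, ?_⟩; ext x; refine tendsto_nhds_unique (hlim q x) ?_; have := tendsto_slice_of_eqOn hE'.1.continuous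
      (U := (opT c)^[q] (B : Ψ)) (fun p hp => by rw [h' p hp]; simp) x
    rw [hx] at this; exact this

lemma exists_eq_pow_mul (hc : 0 < c) {B : ES n} (h : ∀ j < q, tr ((Te c ^ j) B) = 0) :
    ∃ E : ES n, ∀ p, (B : Ψ) p = p.2 ^ (2 * q) * (E : Ψ) p := by
  induction q with
  | zero => exact ⟨B, fun p => by simp⟩
  | succ q ih =>
    obtain ⟨E, hE⟩ := ih fun j hj => h j (by omega); obtain ⟨-, κ, hκ, hk⟩ := tr_Te_pow_of_eq hc hE; rw [h q (by omega)] at hk; have h0 : tr E = 0 := by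
      have := hk.symm; exact (smul_eq_zero.1 this).resolve_left hκ
    refine ⟨⟨_, E.2.dq⟩, fun p => ?_⟩
    have h1 : (E : Ψ) (p.1, 0) = 0 := congrFun (congrArg Subtype.val h0) p.1
    rw [hE p, E.2.eq_add_sq_mul_dq p, h1]; ring

lemma cl_iff (hs0 : 0 < s) (hs1 : s < 1) {A B : ES n}
    (h : RepOn (2 * s) A B U) : Cl s q U ↔ ∀ j < q, tr ((Te (1 + 2 * s) ^ j) B) = 0 := by
  constructor
  · intro hq j hj; ext x; have h1 := (h.opT_iterate j).tendsto_wNormal hs1 x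
    have h3 := tendsto_nhds_unique h1 ((Cl.opT_iterate (hq.of_le (by omega : 1 + j ≤ q))).tendsto_wNormal hs1 x); have : (2 * s) ≠ 0 := pos!
    exact (mul_eq_zero.1 h3).resolve_left this
  · intro hj; obtain ⟨E, hE⟩ := exists_eq_pow_mul (by linarith : 0 < 1 + 2 * s) hj
    refine ⟨A, E, A.2, E.2, fun p hp => ?_⟩; have hy := hp; have : p.2 ^ (2 * s + 2 * q) = p.2 ^ (2 * s) * p.2 ^ (2 * q) := by
      rw [← rpow_natCast, ← rpow_add hy]; push_cast; ring_nf
    rw [h p hp, hE p, this]; ring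

end

section

variable {x : ℝ}

/-! ### Pochhammer identities -/

/-- The rising factorial `x (x+1) ⋯ (x+k-1)`. -/
def ph (x : ℝ) (k : ℕ) : ℝ := ∏ r ∈ ℛ k, (x + r)

@[simp] theorem ph_zero (x : ℝ) : ph x 0 = 1 := by simp [ph]

lemma ph_succ (x : ℝ) (k : ℕ) : ph x (k + 1) = ph x k * (x + k) := prod_range_succ _ _

lemma ph_succ' (x : ℝ) (k : ℕ) : ph x (k + 1) = x * ph (x + 1) k := by
  rw [ph, prod_range_succ', ph, mul_comm]
  congr 1
  · simp
  · exact prod_congr rfl fun r _ => by push_cast; ring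

lemma ph_ne_zero (hx : ∀ r : ℕ, x + r ≠ 0) (k : ℕ) : ph x k ≠ 0 := Finset.prod_ne_zero_iff.2 fun r _ => hx r

lemma Gamma_add_nat (hx : ∀ r : ℕ, x + r ≠ 0) (k : ℕ) : Gamma (x + k) = ph x k * Gamma x := by
  induction k with
  | zero => simp
  | succ k ih =>
    rw [ph_succ, cast_succ, ← add_assoc, Gamma_add_one (hx k), ih]; ring

lemma Gamma_ne_zero_of (hx : ∀ r : ℕ, x + r ≠ 0) : Gamma x ≠ 0 :=
  Gamma_ne_zero fun r h => hx r (by rw [h]; ring)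

lemma sum_choose_ph (a b : ℝ) (hb : ∀ r : ℕ, b + r ≠ 0) (k : ℕ) :
    ∑ l ∈ ℛ (k + 1), (k.choose l : ℝ) * ((-1) ^ l * (ph a l / ph b l)) = ph (b - a) k / ph b k := by
  induction k generalizing a b with
  | zero => simp
  | succ k ih =>
    have hb1 : ∀ r : ℕ, b + 1 + r ≠ 0 := fun r => by
      have := hb (r + 1); push_cast at this; intro h; apply this; linarith
    have h := Finset.sum_choose_succ_mul (fun i _ => (-1) ^ i * (ph a i / ph b i)) k; beta_reduce at h; rw [h, ih a b hb]
    have h2 : ∑ i ∈ ℛ (k + 1), k.choose i * ((-1) ^ (i + 1) * (ph a (i + 1) / ph b (i + 1)))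
        = - (a / b) * (ph (b - a) k / ph (b + 1) k) := by
      have := ih (a + 1) (b + 1) hb1; rw [show b + 1 - (a + 1) = b - a by ring] at this; rw [← this, mul_sum]; refine sum_congr rfl fun i _ => ?_; rw [ph_succ', ph_succ', pow_succ]; have h0 : b ≠ 0 := by simpa using hb 0
      have h1 := ph_ne_zero hb1 i; field_simp
    rw [h2, ph_succ (b - a)]; have h0 : b ≠ 0 := by simpa using hb 0
    have h1 := ph_ne_zero hb1 k; have h3 := ph_ne_zero hb k; have h4 := hb k; have h5 : b * ph (b + 1) k = ph b k * (b + k) := by rw [← ph_succ', ph_succ]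
    rw [ph_succ b, show ph (b + 1) k = ph b k * (b + k) / b by field_simp; linarith]; field_simp; ring

/-- The coefficient in the definition of the boundary operators. -/
def cf (α N : ℝ) (j i : ℕ) : ℝ := ph (1 + i + α) (j - i) / ph (1 + 2 * i - N + α) (j - i)

/-- The coefficient relating iterated weighted Laplacians to the boundary operators. -/
def cw (α N : ℝ) (r p : ℕ) : ℝ := (-1) ^ p * (r.choose p : ℝ) *
  (ph (p - N) (r - p) / ph (1 + 2 * p - N + α) (r - p))

lemma sum_binomial_boundary {M : Type*} [AddCommGroup M] [Module ℝ M] (L : Module.End ℝ M)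
    (α N : ℝ) (hα : ∀ z : ℤ, 1 - N + α + z ≠ 0) (b τ : ℕ → M) (r : ℕ)
    (h : ∀ j ≤ r, (-1 : ℝ) ^ j • τ j =
      ∑ i ∈ ℛ (j + 1), ((j.choose i : ℝ) * cf α N j i) • (L ^ (j - i)) (b i)) :
    ∑ j ∈ ℛ (r + 1), (r.choose j : ℝ) • (L ^ (r - j)) (τ j) =
      ∑ p ∈ ℛ (r + 1), cw α N r p • (L ^ (r - p)) (b p) := by
  have hτ : ∀ j ≤ r, τ j = ∑ i ∈ ℛ (j + 1),
      ((-1) ^ j * (j.choose i * cf α N j i)) • (L ^ (j - i)) (b i) := by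
    intro j hj; have := congrArg (fun v => (-1 : ℝ) ^ j • v) (h j hj)
    simp only [smul_smul, smul_sum] at this; rw [← this, ← mul_pow]; simp
  calc _ = ∑ j ∈ ℛ (r + 1), ∑ i ∈ ℛ (j + 1),
        (r.choose j * ((-1) ^ j * (j.choose i * cf α N j i))) • (L ^ (r - i)) (b i) := by
        refine sum_congr rfl fun j hj => ?_; have hj' : j ≤ r := by simpa using hj
        rw [hτ j hj', map_sum, smul_sum]; refine sum_congr rfl fun i hi => ?_; have hi' : i ≤ j := by simpa using hi
        rw [map_smul, smul_smul, ← Module.End.mul_apply, ← pow_add]; congr 3; omega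
    _ = ∑ i ∈ ℛ (r + 1), ∑ j ∈ Finset.Ico i (r + 1),
        (r.choose j * ((-1) ^ j * (j.choose i * cf α N j i))) • (L ^ (r - i)) (b i) := by
        refine sum_comm' fun j i => ?_; simp; omega
    _ = _ := by
        refine sum_congr rfl fun p hp => ?_; have hp' : p ≤ r := by simpa using hp
        rw [← Finset.sum_smul]; congr 1
        have hv := sum_choose_ph (1 + p + α) (1 + 2 * p - N + α) (fun s hs => hα (2 * p + s) (by
          push_cast; linarith)) (r - p)
        rw [show 1 + 2 * p - N + α - (1 + p + α) = p - N by ring] at hv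
        rw [cw, ← hv, mul_sum, Finset.sum_Ico_eq_sum_range, show r + 1 - p = r - p + 1 by omega]
        refine sum_congr rfl fun l hl => ?_; have hl' : l ≤ r - p := by simpa using hl
        have hch : (r.choose (p + l)) * ((p + l).choose p) = r.choose p * ((r - p).choose l : ℝ) := by
          have := Nat.choose_mul (n := r) (k := p + l) (s := p) (by omega)
          rw [show p + l - p = l by omega] at this; exact_mod_cast this
        rw [cf, show p + l - p = l by omega, pow_add]
        linear_combination ((-1) ^ p * (-1) ^ l * (ph (1 + p + α) l / ph (1 + 2 * p - N + α) l)) * hch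

lemma ph_neg_nat (N i : ℕ) (hi : i ≤ N) :
    ph (-(N : ℝ)) i * ((N - i).factorial : ℝ) = (-1) ^ i * (N.factorial : ℝ) := by
  induction i with
  | zero => simp
  | succ i ih =>
    have h1 := ih (by omega); have h2 : ((N - i).factorial) = (N - i) * ((N - (i + 1)).factorial : ℝ) := by
      rw [show N - i = (N - (i + 1)) + 1 by omega, Nat.factorial_succ]; push_cast [cast_sub hi]; ring
    rw [h2] at h1; rw [ph_succ]; linear_combination -h1

lemma ph_reflect (x : ℝ) (i : ℕ) : ph (1 - x) i = (-1) ^ i * ph (x - i) i := by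
  induction i generalizing x with
  | zero => simp
  | succ i ih =>
    rw [ph_succ, ih, ph_succ', pow_succ]
    have : x - (i + 1 : ℕ) + 1 = x - i := by push_cast; ring
    rw [this]; push_cast; ring

lemma cw_zero_eq (N j : ℕ) (hj : j ≤ N) (γ s : ℝ) (hγ : γ = N + s) (hs0 : 0 < s) (hs1 : s < 1) :
    cw (-s) N j 0 = (N.factorial : ℝ) / ((N - j).factorial : ℝ) * (Gamma (γ - j) / Gamma γ) := by
  have hjN : (j : ℝ) ≤ N := by exact_mod_cast hj
  have hne : ∀ r : ℕ, γ - j + r ≠ 0 := fun r => by have : (0 : ℝ) ≤ r := Nat.cast_nonneg r; linarith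
  have h4 := ph_ne_zero hne j
  have h5 := Gamma_ne_zero_of hne
  rw [cw, show (1 + 2 * (0 : ℕ) - N + -s) = 1 - γ by rw [hγ]; push_cast; ring, show Gamma γ = ph (γ - j) j * Gamma (γ - j) by rw [← Gamma_add_nat hne j]; ring_nf]
  simp
  rw [ph_reflect γ j]
  have h6 : ((-1)) ^ j * (-1) ^ j = 1 := by rw [← mul_pow]; simp
  have h7 : ((-1)) ^ j ≠ 0 := pos!
  field_simp
  linear_combination (ph_neg_nat N j hj)

lemma sum_cw_mul_eq_zero (N l : ℕ) (hl1 : 1 ≤ l) (hl : l ≤ N) (s : ℝ) (hs0 : 0 < s) (hs1 : s < 1) :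
    ∑ i ∈ ℛ (l + 1), cw (-s) N i 0 * cw s N (N - i) (N - l) = 0 := by
  set γ : ℝ := N + s with hγ
  have hirr : ∀ z : ℤ, γ + z ≠ 0 := by
    intro z hz
    have h1 : (-1 : ℝ) < ((N + z : ℤ) : ℝ) := by push_cast; linarith
    have h2 : ((N + z : ℤ) : ℝ) < 0 := by push_cast; linarith
    have h1' : (-1) < N + z := by exact_mod_cast h1
    have h2' : (N + z : ℤ) < 0 := by exact_mod_cast h2
    omega
  have hb : ∀ r : ℕ, 1 - γ + r ≠ 0 := fun r h => hirr (-1 - r) (by push_cast; linarith)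
  have hc : ∀ r : ℕ, 1 + γ - 2 * l + r ≠ 0 := fun r h => hirr (1 - 2 * l + r) (by push_cast; linarith)
  have hv := sum_choose_ph (l - γ) (1 - γ) hb l
  rw [show ph (1 - γ - (l - γ)) l = 0 by refine Finset.prod_eq_zero (i := l - 1) (by simp; omega) ?_; rw [cast_sub hl1]; push_cast; ring, zero_div] at hv
  have hterm : ∀ i ∈ ℛ (l + 1), cw (-s) N i 0 * cw s N (N - i) (N - l) =
      ((-1) ^ (N - l) * (-1) ^ l * (N.factorial / (N - l).factorial) / ph (1 + γ - 2 * l) l) *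
      (l.choose i * ((-1) ^ i * (ph (l - γ) i / ph (1 - γ) i))) := by
    intro i hi
    have hi' : i ≤ l := by simpa [lt_succ_iff] using hi
    have e1 : (1 + 2 * (0 : ℕ) - N + -s) = 1 - γ := by rw [hγ]; push_cast; ring
    have e2 : 1 + 2 * (N - l : ℕ) - N + s = 1 + γ - 2 * l := by rw [cast_sub hl]; rw [hγ]; ring
    have e3 : N - i - (N - l) = l - i := by omega
    have e4 : (N - l : ℕ) - N = -(l : ℝ) := by rw [cast_sub hl]; ring
    have e5 : (0 : ℕ) - N = -(N : ℝ) := by simp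
    have hsplit : ph (1 + γ - 2 * l) l = ph (1 + γ - 2 * l) (l - i) * ((-1) ^ i * ph (l - γ) i) := by
      have h1 : ph (1 + γ - 2 * l) l = ph (1 + γ - 2 * l) (l - i) * ph (1 + γ - 2 * l + (l - i : ℕ)) i := by
        conv_lhs => rw [show l = (l - i) + i by omega]
        rw [ph, Finset.prod_range_add, ph, ph]
        congr 1
        · rw [show l - i + i = l by omega]
        · refine prod_congr rfl fun r _ => ?_; rw [show l - i + i = l by omega]; push_cast; ring
      have h2 := ph_reflect (1 + γ - l) i; have h3 : 1 - (1 + γ - l) = l - γ := by ring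
      rw [h3, show 1 + γ - l - i = 1 + γ - 2 * l + (l - i : ℕ) by rw [cast_sub hi']; ring] at h2; rw [h1, h2, ← mul_assoc ((-1) ^ i), ← mul_pow]; simp
    have hch : ((N - i).choose (N - l) : ℝ) * ((N - l).factorial * (l - i).factorial) = (N - i).factorial := by
      have := Nat.choose_mul_factorial_mul_factorial (n := N - i) (k := N - l) (by omega); rw [e3] at this; rw [← mul_assoc]; exact_mod_cast this
    have hch2 : (l.choose i : ℝ) * (i.factorial * (l - i).factorial) = l.factorial := by
      rw [← mul_assoc]; exact_mod_cast Nat.choose_mul_factorial_mul_factorial (n := l) (k := i) hi'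
    have hp1 := ph_neg_nat N i (by omega); have hp2 := ph_neg_nat l (l - i) (by omega); rw [show l - (l - i) = i by omega] at hp2
    have hf1 : ((N - i).factorial : ℝ) ≠ 0 := by exact_mod_cast Nat.factorial_ne_zero _
    have hf2 : ((N - l).factorial : ℝ) ≠ 0 := by exact_mod_cast Nat.factorial_ne_zero _
    have hf3 : ((l - i).factorial : ℝ) ≠ 0 := by exact_mod_cast Nat.factorial_ne_zero _
    have hf4 : (i.factorial : ℝ) ≠ 0 := by exact_mod_cast Nat.factorial_ne_zero _
    have q2 : ph (-(l : ℝ)) (l - i) = (-1) ^ (l - i) * l.factorial / i.factorial := by field_simp; exact hp2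
    have q3 : ((N - i).choose (N - l) : ℝ) = (N - i).factorial / ((N - l).factorial * (l - i).factorial) := by
      field_simp; linarith
    have q4 : (l.choose i : ℝ) = l.factorial / (i.factorial * (l - i).factorial) := by field_simp; linarith
    have hc1 := ph_ne_zero hc (l - i); have hc2 := ph_ne_zero hc l; have hb1 := ph_ne_zero hb i; have hl0 : ph (l - γ) i ≠ 0 := by intro h0; rw [hsplit, h0] at hc2; simp at hc2
    rw [cw, cw, e1, e2, e3, e4, e5, Nat.sub_zero, show ph (-(N : ℝ)) i = (-1) ^ i * N.factorial / (N - i).factorial by field_simp; exact hp1, q2, q3, q4, hsplit]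
    have hsg : ((-1 : ℝ)) ^ l = (-1) ^ i * (-1) ^ (l - i) := by rw [← pow_add]; congr 1; omega
    have hone : ((-1 : ℝ)) ^ i * (-1) ^ i = 1 := by rw [← mul_pow]; simp
    have hne1 : ((-1 : ℝ)) ^ i ≠ 0 := pos!
    simp only [pow_zero, Nat.choose_zero_right, Nat.cast_one, one_mul, Nat.sub_zero]; rw [hsg]; field_simp
  rw [sum_congr rfl hterm, ← mul_sum, hv, mul_zero]

end

section

variable {M : Type*} {b σ : ℕ → M} {γ s : ℝ} {A B : ES n} {U : Amb n → ℝ}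

lemma ES_contDiff (A : ES n) : C∞ (A : Ψ) := A.2.1

lemma ES_continuous (A : ES n) : Continuous (A : Ψ) := A.2.1.continuous

/-! ### The boundary operators on functions with an expansion -/

lemma triangular_zero_iff [AddCommGroup M] [Module ℝ M]
    (K : ℕ → ℕ → Module.End ℝ M) (hK : ∀ r, ∃ c : ℝ, c ≠ 0 ∧ K r r = c • (1 : Module.End ℝ M))
    (h : ∀ r, σ r = ∑ p ∈ ℛ (r + 1), K r p (b p)) (q : ℕ) :
    (∀ j < q, b j = 0) ↔ ∀ j < q, σ j = 0 := by
  constructor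
  · intro hb j hj; rw [h]; refine sum_eq_zero fun p hp => ?_; rw [hb p (by simp at hp; omega), map_zero]
  · intro hσ j; induction j using Nat.strong_induction_on with
    | _ j ih =>
      intro hj; have h1 := hσ j hj; rw [h, sum_range_succ, sum_eq_zero, zero_add] at h1
      · obtain ⟨c, hc, hc'⟩ := hK j; rw [hc', LinearMap.smul_apply, Module.End.one_apply] at h1; exact (smul_eq_zero.1 h1).resolve_left hc
      · intro p hp; rw [ih p (by simpa using hp) (by simp at hp; omega), map_zero]

lemma triangular_iff [AddCommGroup M] [Module ℝ M]
    (K : ℕ → ℕ → Module.End ℝ M) (hK : ∀ r, ∃ c : ℝ, c ≠ 0 ∧ K r r = c • (1 : Module.End ℝ M))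
    (h : ∀ r, σ r = ∑ p ∈ ℛ (r + 1), K r p (b p)) (q : ℕ) :
    (∀ j, 1 ≤ j → j ≤ q → b j = 0) ↔ ∀ j, 1 ≤ j → j ≤ q → σ j = K j 0 (b 0) := by
  have key := triangular_zero_iff (b := fun j => if j = 0 then 0 else b j)
    (σ := fun r => σ r - K r 0 (b 0)) K hK (fun r => by
      rw [h, Finset.sum_range_succ', Finset.sum_range_succ']; simp) (q + 1)
  constructor
  · intro hb j h1 h2; refine sub_eq_zero.1 (key.1 (fun i hi => ?_) j (by omega)); by_cases hi0 : i = 0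
    · simp [hi0]
    · simpa [hi0] using hb i (by omega) (by omega)
  · intro hσ j h1 h2; have := key.2 (fun i hi => ?_) j (by omega)
    · simpa [show j ≠ 0 by omega] using this
    · by_cases hi0 : i = 0
      · subst hi0; obtain ⟨c, -, hc'⟩ := hK 0; rw [h]; simp
      · exact sub_eq_zero.2 (hσ i (by omega) (by omega))

lemma Gamma_ratio_eq (α : ℝ) (N : ℕ) (hα : ∀ z : ℤ, α + z ≠ 0) {i j : ℕ} (hij : i ≤ j) :
    Gamma (1 + j + α) * Gamma (1 + 2 * i - N + α) /
      (Gamma (1 + i + α) * Gamma (1 + j + i - N + α)) = cf α N j i := by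
  have h1 : ∀ r : ℕ, (1 + i + α) + r ≠ 0 := fun r h => hα (1 + i + r) (by push_cast; linarith)
  have h2 : ∀ r : ℕ, (1 + 2 * i - N + α) + r ≠ 0 := fun r h => hα (1 + 2 * i - N + r) (by push_cast; linarith)
  have e1 := Gamma_add_nat h1 (j - i)
  have e2 := Gamma_add_nat h2 (j - i)
  rw [cast_sub hij] at e1 e2
  rw [show 1 + i + α + (j - i) = 1 + j + α by ring] at e1
  rw [show 1 + 2 * i - N + α + (j - i) = 1 + j + i - N + α by ring] at e2
  have g1 := Gamma_ne_zero_of h1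
  have g2 := Gamma_ne_zero_of h2
  have g3 := ph_ne_zero h2 (j - i)
  rw [e1, e2, cf]
  generalize Gamma (1 + i + α) = a at *
  generalize Gamma (1 + 2 * i - N + α) = b at *
  generalize ph (1 + 2 * i - N + α) (j - i) = c at *
  field_simp

lemma exists_boundary_recursion (α : ℝ) (N : ℕ) (hα : ∀ z : ℤ, α + z ≠ 0) (D : ℕ → Ξ → ℝ) (τ : ℕ → SB n)
    (hD : ∀ j x, D j x = (-1) ^ j * (τ j).1 x - ∑ i : Fin j, (j.choose (j - (i : ℕ)) : ℝ) *
      (Gamma (1 + j + α) * Gamma (1 + 2 * (i : ℕ) - N + α) /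
        (Gamma (1 + (i : ℕ) + α) * Gamma (1 + j + (i : ℕ) - N + α))) *
      (bLap^[j - (i : ℕ)] (D i)) x) :
    ∃ b : ℕ → SB n, (∀ j, (b j).1 = D j) ∧ ∀ j, (-1 : ℝ) ^ j • τ j =
      ∑ i ∈ ℛ (j + 1), ((j.choose i : ℝ) * cf α N j i) • (Lb ^ (j - i)) (b i) := by
  have hsm : ∀ j, D j ∈ SB n := by
    intro j; induction j using Nat.strong_induction_on with
    | _ j ih =>
      have : D j = (((-1 : ℝ) ^ j • τ j - ∑ i : Fin j, ((j.choose (j - (i : ℕ)) : ℝ) *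
        (Gamma (1 + j + α) * Gamma (1 + 2 * (i : ℕ) - N + α) /
          (Gamma (1 + (i : ℕ) + α) * Gamma (1 + j + (i : ℕ) - N + α)))) •
          (Lb ^ (j - (i : ℕ))) (⟨D i, ih i i.2⟩ : SB n) : SB n) : Ξ → ℝ) := by
        ext x; rw [hD]; simp [coe_Lb_pow, Finset.sum_apply]
      rw [this]; exact Subtype.coe_prop _
  refine ⟨fun j => ⟨D j, hsm j⟩, fun j => rfl, fun j => ?_⟩
  rw [sum_range_succ]
  ext x
  have h1 := hD j x
  have h2 : ((∑ i ∈ ℛ j, ((j.choose i : ℝ) * cf α N j i) • (Lb ^ (j - i))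
      ⟨D i, hsm i⟩ : SB n) : Ξ → ℝ) x = ∑ i : Fin j, (j.choose (j - i)) *
      (Gamma (1 + j + α) * Gamma (1 + 2 * i - N + α) /
        (Gamma (1 + i + α) * Gamma (1 + j + i - N + α))) *
      (bLap^[j - (i : ℕ)] (D i)) x := by
    rw [Finset.sum_range, Submodule.coe_sum, Finset.sum_apply]; refine sum_congr rfl fun i _ => ?_
    rw [Gamma_ratio_eq α N hα i.2.le, Nat.choose_symm i.2.le, Submodule.coe_smul, Pi.smul_apply,
      coe_Lb_pow, smul_eq_mul]
  rw [← h2] at h1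
  simp [show cf α N j j = 1 by simp [cf]] at h1 ⊢
  linarith

lemma cw_self (α N : ℝ) (r : ℕ) : cw α N r r = (-1) ^ r := by simp [cw]

lemma fract_pos_of (hγ : 0 < γ) (hγN : ∀ N : ℕ, γ ≠ N) : 0 < fract γ := by
  refine lt_of_le_of_ne (Int.fract_nonneg γ) fun h => hγN ⌊γ⌋₊ ?_
  have h1 := Int.floor_add_fract γ
  rw [← h, add_zero] at h1
  rw [← h1, ← natCast_floor_eq_intCast_floor hγ.le, Nat.floor_natCast]

lemma eq_floor_add_fract (hγ : 0 < γ) : γ = (⌊γ⌋₊ : ℝ) + fract γ := by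
  rw [natCast_floor_eq_intCast_floor hγ.le, Int.floor_add_fract]

lemma add_int_ne_zero (h0 : 0 < s) (h1 : s < 1) (z : ℤ) : s + z ≠ 0 := by
  intro h
  have h2 : ((-1 : ℤ) : ℝ) < z := by push_cast; linarith
  have h3 : z < (0 : ℝ) := by push_cast; linarith
  have h2' : (-1) < z := by exact_mod_cast h2
  have h3' : z < 0 := by exact_mod_cast h3
  omega

lemma neg_add_int_ne_zero (h0 : 0 < s) (h1 : s < 1) (z : ℤ) : -s + z ≠ 0 := by
  intro h
  exact add_int_ne_zero h0 h1 (-z) (by push_cast; linarith)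

lemma wt_eq (γ : ℝ) : wt γ = 1 - 2 * fract γ := rfl

lemma bval_eq {W : Ψ} {x : Ξ} {l : ℝ}
    (h : Tendsto (fun y => W (x, y)) (𝓝[>] 0) (𝓝 l)) : bval W x = l := h.limUnder_eq

lemma exists_bEven (hγ : 0 < γ) (hγN : ∀ N : ℕ, γ ≠ N)
    (h : RepOn (2 * fract γ) A B U) :
    ∃ b : ℕ → SB n, (∀ j, (b j).1 = bEven γ j U) ∧ ∀ j, (-1 : ℝ) ^ j • tr ((Te (1 - 2 * fract γ) ^ j) A) =
      ∑ i ∈ ℛ (j + 1), ((j.choose i : ℝ) * cf (-fract γ) ⌊γ⌋₊ j i) • (Lb ^ (j - i)) (b i) := by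
  have hs0 := fract_pos_of hγ hγN
  have hs1 := fract_lt_one γ
  refine exists_boundary_recursion (-fract γ) ⌊γ⌋₊ (neg_add_int_ne_zero hs0 hs1)
    (fun j => bEven γ j U) (fun j => tr ((Te (1 - 2 * fract γ) ^ j) A)) fun j x => ?_
  rw [bEven, wt_eq, bval_eq ((h.opT_iterate j).tendsto (by linarith) (ES_continuous _) (ES_continuous _) x)]
  congr 1
  refine sum_congr rfl fun i _ => ?_
  have e : γ = (⌊γ⌋₊ : ℝ) + fract γ := eq_floor_add_fract hγ
  rw [show 1 + 2 * (i : ℝ) - γ = 1 + 2 * i - ⌊γ⌋₊ + -fract γ by linarith, show 1 + j + i - γ = 1 + j + i - ⌊γ⌋₊ + -fract γ by linarith, ← sub_eq_add_neg (1 + (j : ℝ)), ← sub_eq_add_neg (1 + (i : ℝ))]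

lemma exists_bOdd (hγ : 0 < γ) (hγN : ∀ N : ℕ, γ ≠ N)
    (h : RepOn (2 * fract γ) A B U) :
    ∃ b : ℕ → SB n, (∀ j, (b j).1 = bOdd γ j U) ∧ ∀ j,
      (-1 : ℝ) ^ j • (-(2 * fract γ)) • tr ((Te (1 + 2 * fract γ) ^ j) B) =
      ∑ i ∈ ℛ (j + 1), ((j.choose i : ℝ) * cf (fract γ) ⌊γ⌋₊ j i) • (Lb ^ (j - i)) (b i) := by
  have hs1 := fract_lt_one γ
  refine exists_boundary_recursion (fract γ) ⌊γ⌋₊ (add_int_ne_zero (fract_pos_of hγ hγN) hs1) (fun j => bOdd γ j U)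
    (fun j => (-(2 * fract γ)) • tr ((Te (1 + 2 * fract γ) ^ j) B)) fun j x => ?_
  beta_reduce
  rw [bOdd, wt_eq, bval_eq ((h.opT_iterate j).tendsto_wNormal hs1 x)]
  congr 1
  rw [pow_succ]
  simp

lemma bEven_zero_eq (hγ : 0 < γ) (hγN : ∀ N : ℕ, γ ≠ N)
    (h : RepOn (2 * fract γ) A B U) : bEven γ 0 U = (tr A).1 := by
  obtain ⟨b, hb, hr⟩ := exists_bEven hγ hγN h
  have h0 := hr 0
  rw [← hb 0]
  simp [cf] at h0
  rw [← h0]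

lemma even_data_iff (hγ : 0 < γ) (hγN : ∀ N : ℕ, γ ≠ N)
    (h : RepOn (2 * fract γ) A B U) (J : ℕ) :
    (∀ j, 1 ≤ j → j ≤ J → ∀ x, bEven γ j U x = 0) ↔ ∀ j, 1 ≤ j → j ≤ J →
      tr ((Le (1 - 2 * fract γ) ^ j) A) = cw (-fract γ) ⌊γ⌋₊ j 0 • (Lb ^ j) (tr A) := by
  obtain ⟨b, hb, hr⟩ := exists_bEven hγ hγN h
  have key := triangular_iff (fun r p => cw (-fract γ) ⌊γ⌋₊ r p • (Lb : Module.End ℝ (SB n)) ^ (r - p))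
    (fun r => ⟨(-1) ^ r, pos!, by simp [cw_self]⟩) (fun r => sum_binomial_boundary Lb (-fract γ) ⌊γ⌋₊ (fun z hz => neg_add_int_ne_zero (fract_pos_of hγ hγN) (fract_lt_one γ) (1 - ⌊γ⌋₊ + z) (by push_cast; linarith)) b _ r (fun j _ => hr j)) J
  rw [Subtype.ext ((hb 0).trans (bEven_zero_eq hγ hγN h))] at key
  simp only [← tr_Le_pow] at key
  refine Iff.trans ?_ key
  refine forall_congr' fun j => forall_congr' fun _ => forall_congr' fun _ => ?_
  rw [← hb j]
  exact ⟨fun h => Subtype.ext (funext h), fun h x => by rw [h]; rfl⟩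

lemma odd_trace_iff (hs0 : 0 < s) (hs1 : s < 1) {q : ℕ}     (h : RepOn (2 * s) A B U) : Cl s q U ↔ ∀ j < q, tr ((Le (1 + 2 * s) ^ j) B) = 0 := by
  rw [cl_iff hs0 hs1 h]
  exact triangular_zero_iff (fun r p => (r.choose p : ℝ) • (Lb : Module.End ℝ (SB n)) ^ (r - p))
    (fun r => ⟨1, one_ne_zero, by simp⟩) (fun r => tr_Le_pow _ B r) q

lemma odd_data_iff (hγ : 0 < γ) (hγN : ∀ N : ℕ, γ ≠ N)
    (h : RepOn (2 * fract γ) A B U) (q : ℕ) :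
    (∀ j < q, ∀ x, bOdd γ j U x = 0) ↔ Cl (fract γ) q U := by
  have hs0 := fract_pos_of hγ hγN
  rw [cl_iff hs0 (fract_lt_one γ) h]
  obtain ⟨b, hb, hr⟩ := exists_bOdd hγ hγN h
  have key := triangular_zero_iff (b := b)
    (fun r p => ((r.choose p : ℝ) * cf (fract γ) ⌊γ⌋₊ r p) • (Lb : Module.End ℝ (SB n)) ^ (r - p))
    (fun r => ⟨1, one_ne_zero, by simp [cf]⟩) hr q
  have e1 : (∀ j < q, ∀ x, bOdd γ j U x = 0) ↔ ∀ j < q, b j = 0 := forall_congr' fun j => forall_congr' fun _ => by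
      rw [← hb j]; exact ⟨fun h => Subtype.ext (funext h), fun h x => by rw [h]; rfl⟩
  rw [e1, key]
  refine forall_congr' fun j => forall_congr' fun _ => ?_
  rw [smul_smul, smul_eq_zero]
  have : (-1 : ℝ) ^ j * -(2 * fract γ) ≠ 0 := mul_ne_zero pos! (neg_ne_zero.2 pos!)
  simp [hs0.ne']

lemma exists_bOdd_trace (hγ : 0 < γ) (hγN : ∀ N : ℕ, γ ≠ N)
    (h : RepOn (2 * fract γ) A B U) :
    ∃ b : ℕ → SB n, (∀ j, (b j).1 = bOdd γ j U) ∧ ∀ r, (2 * fract γ) • tr ((Le (1 + 2 * fract γ) ^ r) B) =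
        - ∑ p ∈ ℛ (r + 1), cw (fract γ) ⌊γ⌋₊ r p • (Lb ^ (r - p)) (b p) := by
  obtain ⟨b, hb, hr⟩ := exists_bOdd hγ hγN h
  refine ⟨b, hb, fun r => ?_⟩
  rw [← sum_binomial_boundary Lb (fract γ) ⌊γ⌋₊
    (fun z hz => add_int_ne_zero (fract_pos_of hγ hγN) (fract_lt_one γ) (1 - ⌊γ⌋₊ + z) (by push_cast; linarith)) b _ r
    (fun j _ => hr j), tr_Le_pow, smul_sum, ← sum_neg_distrib]
  refine sum_congr rfl fun j _ => ?_
  rw [map_smul]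
  module

end

section

variable {f g G U P V : Amb n → ℝ} {m R e s : ℝ} {O : Set (Amb n)} {A B A' B' : ES n} {q : ℕ}

local notation "ϖ" => 1 - 2 * s

/-! ### The weighted measure -/

/-- The measure `y^m dy` on the half line. -/
def nu (m : ℝ) : Measure ℝ := (volume.restrict (Ioi 0)).withDensity fun y => ofReal (y ^ m)

/-- The measure `y^m dx dy` on the half space. -/
def mu (m : ℝ) : Measure Υ := (volume : Measure Ξ).prod (nu m)

instance (m : ℝ) : SigmaFinite (nu m) := by unfold nu; infer_instance

lemma measurable_rpow_snd (m : ℝ) : Measurable fun p : Υ => p.2 ^ m := by fun_prop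

lemma volume_restrict_upper : (volume : Measure Υ).restrict ℍ =
    (volume : Measure Ξ).prod (volume.restrict (Ioi 0)) := by
  rw [show ℍ = univ ×ˢ Ioi 0 by ext; simp [upper], Measure.volume_eq_prod,
    ← Measure.prod_restrict, Measure.restrict_univ]

lemma mu_eq (m : ℝ) : (mu m : Measure Υ) = ((volume : Measure Υ).restrict ℍ).withDensity fun p => ofReal (p.2 ^ m) := by
  rw [volume_restrict_upper, mu, nu, prod_withDensity_right (by fun_prop)]

lemma lintegral_mu (m : ℝ) {f : Υ → ENNReal} (hf : Measurable f) :
    ∫⁻ p, f p ∂mu m = ∫⁻ p in ℍ, ofReal (p.2 ^ m) * f p := by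
  rw [mu_eq, lintegral_withDensity_eq_lintegral_mul _ (by fun_prop) hf]; rfl

lemma ae_mu (m : ℝ) : ∀ᵐ p : Υ ∂mu m, p ∈ ℍ := by
  rw [mu_eq]
  exact (withDensity_absolutelyContinuous _ _).ae_le (ae_restrict_mem measurableSet_upper)

lemma ae_nu (m : ℝ) : ∀ᵐ y ∂nu m, 0 < y :=
  (withDensity_absolutelyContinuous _ _).ae_le (ae_restrict_mem measurableSet_Ioi)

lemma integrable_mu_iff :
    Integrable f (mu m) ↔ IntegrableOn (fun p => f p * p.2 ^ m) ℍ := by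
  rw [mu_eq, integrable_withDensity_iff_integrable_smul' (by fun_prop) (by simp), IntegrableOn]
  refine integrable_congr ?_
  filter_upwards [ae_restrict_mem measurableSet_upper] with p hp
  rw [toReal_ofReal (rpow_nonneg (le_of_lt hp) _), smul_eq_mul, mul_comm]

lemma integral_mu (m : ℝ) (f : Ψ) : ∫ p, f p ∂mu m = ∫ p in ℍ, f p * p.2 ^ m := by
  rw [mu_eq, integral_withDensity_eq_integral_toReal_smul (by fun_prop) (by simp)]
  refine setIntegral_congr_fun measurableSet_upper fun p hp => ?_
  rw [toReal_ofReal (rpow_nonneg (le_of_lt hp) _), smul_eq_mul, mul_comm]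

lemma integrable_nu_iff {f : ℝ → ℝ} :
    Integrable f (nu m) ↔ IntegrableOn (fun y => f y * y ^ m) (Ioi 0) := by
  rw [nu, integrable_withDensity_iff_integrable_smul' (by fun_prop) (by simp), IntegrableOn]
  refine integrable_congr ?_
  filter_upwards [ae_restrict_mem measurableSet_Ioi] with p hp
  rw [toReal_ofReal (rpow_nonneg (le_of_lt hp) _), smul_eq_mul, mul_comm]

lemma integral_nu (m : ℝ) (f : ℝ → ℝ) : ∫ y, f y ∂nu m = ∫ y in Ioi 0, f y * y ^ m := by
  rw [nu, integral_withDensity_eq_integral_toReal_smul (by fun_prop) (by simp)]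
  refine setIntegral_congr_fun measurableSet_Ioi fun p hp => ?_
  rw [toReal_ofReal (rpow_nonneg (le_of_lt hp) _), smul_eq_mul, mul_comm]

lemma aestronglyMeasurable_mu (hf : ContinuousOn f ℍ) :
    AEStronglyMeasurable f (mu m) := by
  rw [mu_eq]
  exact (hf.aestronglyMeasurable measurableSet_upper).mono_ac (withDensity_absolutelyContinuous _ _)

/-! ### Functions of compact support with a weak singularity at the boundary -/

/-- Functions on the half space with bounded support. -/
def CS (h : Ψ) : Prop := ∃ R : ℝ, ∀ p ∈ ℍ, R < ‖p‖ → h p = 0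

/-- Functions of the form `E + y^{2s-1} F` with continuous `E` and `F`. -/
def Wk (s : ℝ) (h : Ψ) : Prop :=
  ∃ E F : Ψ, Continuous E ∧ Continuous F ∧ ∀ p ∈ ℍ, h p = E p + p.2 ^ (2 * s - 1) * F p

lemma CS.mul_right (hf : CS f) (g : Ψ) : CS fun p => f p * g p := by
  obtain ⟨R, h⟩ := hf
  exact ⟨R, fun p hp hR => by simp [h p hp hR]⟩

lemma CS.mul_left (hf : CS f) (g : Ψ) : CS fun p => g p * f p := by
  obtain ⟨R, h⟩ := hf
  exact ⟨R, fun p hp hR => by simp [h p hp hR]⟩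

lemma CS.add (hf : CS f) (hg : CS g) : CS fun p => f p + g p := by
  obtain ⟨R, h⟩ := hf
  obtain ⟨R', h'⟩ := hg
  exact ⟨max R R', fun p hp hR => by
    simp [h p hp (lt_of_le_of_lt (le_max_left _ _) hR), h' p hp (lt_of_le_of_lt (le_max_right _ _) hR)]⟩

lemma isOpen_upper_inter (R : ℝ) : IsOpen {p : Υ | p ∈ ℍ ∧ R < ‖p‖} :=
  isOpen_upper.inter (isOpen_lt continuous_const continuous_norm)

lemma CS.congr (hf : CS f) (h : EqOn g f ℍ) : CS g := by
  obtain ⟨R, hR⟩ := hf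
  exact ⟨R, fun p hp h1 => by rw [h hp, hR p hp h1]⟩

lemma eventually_zero_of_eqOn (hO : IsOpen O) (h : EqOn f 0 O)
    {p : Υ} (hp : p ∈ O) : f =ᶠ[𝓝 p] fun _ => 0 :=
  Filter.eventuallyEq_of_mem (hO.mem_nhds hp) h

lemma eqOn_zero_Dv (hO : IsOpen O) (h : EqOn f 0 O) (v : Υ) :
    EqOn (Dv v f) 0 O := fun p hp => by
  rw [Dv, (eventually_zero_of_eqOn hO h hp).fderiv_eq]
  simp

lemma eqOn_zero_dy (hO : IsOpen O) (h : EqOn f 0 O) :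
    EqOn (dy f) 0 O := fun p hp => by
  have h2 : (fun t => f (p.1, t)) =ᶠ[𝓝 p.2] fun _ => 0 :=
    ((by fun_prop : Continuous fun t : ℝ => (p.1, t)).tendsto p.2).eventually (eventually_zero_of_eqOn hO h hp)
  rw [dy, h2.deriv_eq]
  simp

lemma eqOn_zero_LX (hO : IsOpen O) (h : EqOn f 0 O) :
    EqOn (LX f) 0 O := fun p hp => by
  have h2 := ((by fun_prop : Continuous fun x => (x, p.2)).tendsto p.1).eventually (eventually_zero_of_eqOn hO h hp)
  rw [LX, bLap, (InnerProductSpace.laplacian_congr_nhds h2).eq_of_nhds]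
  simp

lemma eqOn_zero_wLap_iterate (hO : IsOpen O) (h : EqOn f 0 O)
    (m : ℝ) (j : ℕ) : EqOn ((wLap m)^[j] f) 0 O := by
  induction j generalizing f with
  | zero => exact h
  | succ j ih =>
    refine ih fun p hp => ?_; have h1 := eqOn_zero_LX hO h hp; have h2 := eqOn_zero_dy hO (eqOn_zero_dy hO h) hp; have h3 := eqOn_zero_dy hO h hp; simp only [wLap_eq, opT, h1, h2, h3]; simp

protected lemma CS.Dv (hf : CS f) (v : Υ) : CS (Dv v f) := by
  obtain ⟨R, h⟩ := hf
  exact ⟨R, fun p hp hR => eqOn_zero_Dv (isOpen_upper_inter R) (fun q hq => h q hq.1 hq.2) v ⟨hp, hR⟩⟩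

protected lemma CS.dy (hf : CS f) : CS (dy f) := by
  obtain ⟨R, h⟩ := hf
  exact ⟨R, fun p hp hR => eqOn_zero_dy (isOpen_upper_inter R) (fun q hq => h q hq.1 hq.2) ⟨hp, hR⟩⟩

protected lemma CS.LX (hf : CS f) : CS (LX f) := by
  obtain ⟨R, h⟩ := hf
  exact ⟨R, fun p hp hR => eqOn_zero_LX (isOpen_upper_inter R) (fun q hq => h q hq.1 hq.2) ⟨hp, hR⟩⟩

protected lemma CS.opT (hf : CS f) (m : ℝ) : CS (opT m f) := hf.dy.dy.add (hf.dy.mul_left fun p => m / p.2)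

protected lemma CS.wLap (hf : CS f) (m : ℝ) : CS (wLap m f) := by rw [wLap_eq]; exact hf.LX.add (hf.opT m)

lemma CS.wLap_iterate (hf : CS f) (m : ℝ) (j : ℕ) : CS ((wLap m)^[j] f) := by
  induction j generalizing f with
  | zero => exact hf
  | succ j ih => exact ih (hf.wLap m)

lemma integrableOn_mul_rpow (hG : Continuous G) (he : -1 < e)
    (h : ∀ p, R < ‖p‖ → G p = 0) :
    IntegrableOn (fun p => G p * p.2 ^ e) ℍ := by
  obtain ⟨C, hC⟩ := (isCompact_closedBall 0 R).exists_bound_of_continuousOn hG.continuousOn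
  have h1 : Integrable (fun p => (Metric.closedBall 0 R).indicator (fun _ => C) p.1 *
      (Ioc 0 R).indicator (fun y => y ^ e) p.2) ((volume : Measure Ξ).prod volume) := by
    refine Integrable.mul_prod ?_ ?_
    · exact (integrable_indicator_iff measurableSet_closedBall).2 (integrableOn_const
        (isCompact_closedBall _ _).measure_lt_top.ne)
    · rw [integrable_indicator_iff measurableSet_Ioc]; rcases le_or_gt R 0 with hR | hR
      · simp [Ioc_eq_empty (not_lt.2 hR)]
      · exact (intervalIntegral.intervalIntegrable_rpow' he).1
  rw [← Measure.volume_eq_prod] at h1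
  refine h1.integrableOn.mono' (hG.aestronglyMeasurable.mul (measurable_rpow_snd e).aestronglyMeasurable) ?_
  filter_upwards [ae_restrict_mem measurableSet_upper] with p hp
  have hy := hp
  by_cases hR : R < ‖p‖
  · rw [h p hR]; simp; refine mul_nonneg (indicator_nonneg (fun x hx => ?_) _) (indicator_nonneg (fun y hy => ?_) _)
    · exact (norm_nonneg _).trans (hC (x, 0) (by simpa using hx))
    · exact rpow_nonneg hy.1.le _
  · rw [not_lt] at hR; have h3 := max_le_iff.1 (Prod.norm_def p ▸ hR); have h2 := (le_abs_self _).trans h3.2; rw [indicator_of_mem (by simpa using h3.1),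
      indicator_of_mem (show p.2 ∈ Ioc 0 R from ⟨hy, h2⟩), norm_mul,
      norm_of_nonneg (rpow_nonneg hy.le e)]
    exact mul_le_mul_of_nonneg_right (hC p (by simpa using hR)) (rpow_nonneg hy.le e)

lemma integrableOn_slice_mul_rpow (hG : Continuous G) (he : -1 < e)
    (h : ∀ p, R < ‖p‖ → G p = 0) (x : Ξ) :
    IntegrableOn (fun y => G (x, y) * y ^ e) (Ioi 0) := by
  have h1 : IntegrableOn (fun y => G (x, y) * y ^ e) (Ioc 0 (max R 0)) := by
    have := ((intervalIntegral.intervalIntegrable_rpow' (a := 0) (b := max R 0) he)).continuousOn_mul (by fun_prop : Continuous fun y => G (x, y)).continuousOn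
    exact (intervalIntegrable_iff_integrableOn_Ioc_of_le (le_max_right _ _)).1 this
  exact h1.of_forall_sdiff_eq_zero measurableSet_Ioi (fun y hy => by rw [h (x, y) ((show R < y by by_contra hlt; exact hy.2 ⟨hy.1, (not_lt.1 hlt).trans (le_max_left _ _)⟩).trans_le ((le_abs_self _).trans (le_max_right _ _))), zero_mul])

lemma exists_cutoff (R : ℝ) : ∃ θ : Ψ, Continuous θ ∧ (∀ p, ‖p‖ ≤ R → θ p = 1) ∧
    ∀ p, R + 1 < ‖p‖ → θ p = 0 := by
  refine ⟨fun p => max 0 (min 1 (R + 1 - ‖p‖)), by fun_prop, fun p hp => ?_, fun p hp => ?_⟩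
  · simp only; rw [min_eq_left (by linarith), max_eq_right zero_le_one]
  · simp only; rw [min_eq_right (by linarith), max_eq_left (by linarith)]

lemma Wk.mul_rep (hf : Wk s f) (hg : Wk s g)
    (hc : CS fun p => f p * g p) : ∃ (R : ℝ) (G₀ G₁ G₂ : Ψ), (Continuous G₀ ∧ Continuous G₁ ∧ Continuous G₂) ∧
      (∀ p, R < ‖p‖ → G₀ p = 0 ∧ G₁ p = 0 ∧ G₂ p = 0) ∧
      ∀ p ∈ ℍ, f p * g p * p.2 ^ ϖ = G₀ p * p.2 ^ ϖ +
        G₁ p * p.2 ^ (0 : ℝ) + G₂ p * p.2 ^ (2 * s - 1) := by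
  obtain ⟨E, F, hE, hF, h⟩ := hf
  obtain ⟨E', F', hE', hF', h'⟩ := hg
  obtain ⟨R, hR⟩ := hc
  obtain ⟨θ, hθ, h1, h0⟩ := exists_cutoff R
  refine ⟨R + 1, fun p => θ p * (E p * E' p), fun p => θ p * (E p * F' p + F p * E' p),
    fun p => θ p * (F p * F' p), ⟨by fun_prop, by fun_prop, by fun_prop⟩, fun p hp => by simp [h0 p hp],
    fun p hp => ?_⟩
  have hy := hp
  have e1 : f p * g p = θ p * (f p * g p) := by
    by_cases hp' : ‖p‖ ≤ R
    · rw [h1 p hp', one_mul]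
    · rw [show f p * g p = 0 from hR p hp (not_le.1 hp'), mul_zero]
  have e2 : p.2 ^ ϖ * p.2 ^ (2 * s - 1) = 1 := by rw [← rpow_add hy]; norm_num
  rw [e1, h p hp, h' p hp, rpow_zero]
  linear_combination (θ p * (E p * F' p + F p * E' p) + p.2 ^ (2 * s - 1) * (θ p * (F p * F' p))) * e2

lemma Wk.integrable_mul (hs0 : 0 < s) (hs1 : s < 1) (hf : Wk s f)
    (hg : Wk s g) (hc : CS fun p => f p * g p) :
    Integrable (fun p => f p * g p) (mu ϖ) := by
  obtain ⟨R, G₀, G₁, G₂, ⟨c0, c1, c2⟩, hz, h⟩ := hf.mul_rep hg hc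
  rw [integrable_mu_iff]
  refine (((integrableOn_mul_rpow c0 (by linarith) fun p hp => (hz p hp).1).add
    (integrableOn_mul_rpow c1 (by linarith) fun p hp => (hz p hp).2.1)).add
    (integrableOn_mul_rpow c2 (by linarith) fun p hp => (hz p hp).2.2)).congr_fun
    (fun p hp => (h p hp).symm) measurableSet_upper

lemma Wk.integrable_slice_mul (hs0 : 0 < s) (hs1 : s < 1) (hf : Wk s f)
    (hg : Wk s g) (hc : CS fun p => f p * g p) (x : Ξ) :
    Integrable (fun y => f (x, y) * g (x, y)) (nu ϖ) := by
  obtain ⟨R, G₀, G₁, G₂, ⟨c0, c1, c2⟩, hz, h⟩ := hf.mul_rep hg hc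
  rw [integrable_nu_iff]
  refine (((integrableOn_slice_mul_rpow c0 (by linarith) (fun p hp => (hz p hp).1) x).add
    (integrableOn_slice_mul_rpow c1 (by linarith) (fun p hp => (hz p hp).2.1) x)).add
    (integrableOn_slice_mul_rpow c2 (by linarith) (fun p hp => (hz p hp).2.2) x)).congr_fun
    (fun y hy => (h (x, y) hy).symm) measurableSet_Ioi

lemma RepOn.wk (j : ℕ) (he : e = 2 * s - 1 + j) {A B : Ψ} (hA : Continuous A)
    (hB : Continuous B) (h : RepOn e A B U) : Wk s U := by
  refine ⟨A, fun p => p.2 ^ j * B p, hA, by fun_prop, fun p hp => ?_⟩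
  rw [h p hp, he, rpow_add (show 0 < p.2 from hp), rpow_natCast, mul_assoc]

lemma RepOn.dy_iterate (j : ℕ) {A B : Ψ} (hA : C∞ A)
    (hB : C∞ B) (h : RepOn e A B U) : ∃ A' B' : Ψ, C∞ A' ∧
      C∞ B' ∧ RepOn (e - j) A' B' (dy^[j] U) := by
  induction j generalizing e A B U with
  | zero => exact ⟨A, B, hA, hB, by simpa using h⟩
  | succ j ih =>
    obtain ⟨A', B', h1, h2, h3⟩ := ih (csm_dy hA) (by have := csm_dy hB; fun_prop) (h.dy hA hB)
    exact ⟨A', B', h1, h2, by push_cast; rwa [← sub_sub, sub_right_comm]⟩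

lemma Cl.wk_dy_iterate {j : ℕ} (hj : j ≤ 2 * q + 1) (h : Cl s q U) : Wk s (dy^[j] U) := by
  obtain ⟨A, B, hA, hB, h⟩ := h
  obtain ⟨A', B', h1, h2, h3⟩ := h.dy_iterate j hA.1 hB.1
  refine h3.wk (2 * q + 1 - j) ?_ h1.continuous h2.continuous
  rw [cast_sub hj]; push_cast; ring

lemma Cl.wk (h : Cl s q U) : Wk s U := h.wk_dy_iterate (j := 0) (by omega)

lemma Cl.wk_dy (h : Cl s q U) : Wk s (dy U) := h.wk_dy_iterate (j := 1) (by omega)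

/-! ### Integration by parts -/

lemma integral_mul_Dv_eX (hs0 : 0 < s) (hs1 : s < 1) (i : Fin n)
    (hf : SmU f) (hg : SmU g) (wf : Wk s f) (wg : Wk s g) (wf' : Wk s (Dv (eX i) f))
    (wg' : Wk s (Dv (eX i) g)) (hc : CS f ∨ CS g) :
    ∫ p, f p * Dv (eX i) g p ∂mu ϖ = - ∫ p, Dv (eX i) f p * g p ∂mu ϖ := by
  have c1 : CS fun p => f p * Dv (eX i) g p := hc.elim (fun h => h.mul_right _) fun h => (h.Dv _).mul_left _
  have c2 : CS fun p => Dv (eX i) f p * g p := hc.elim (fun h => (h.Dv _).mul_right _) fun h => h.mul_left _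
  have i1 := wf.integrable_mul hs0 hs1 wg' c1
  have i2 := wf'.integrable_mul hs0 hs1 wg c2
  have key {h : Ψ} (hh : SmU h) (hcs : CS h) {y : ℝ} (hy : 0 < y) : Integrable fun x => h (x, y) := by
    obtain ⟨R, hR⟩ := hcs; refine Continuous.integrable_of_hasCompactSupport ?_ ?_
    · exact hh.continuousOn.comp_continuous (f := fun x : Ξ => (x, y)) (by fun_prop) fun x => hy
    · exact HasCompactSupport.intro (isCompact_closedBall (0 : Ξ) R) fun x hx => hR (x, y) hy (lt_of_lt_of_le (by simpa using hx) (le_max_left _ _))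
  rw [mu] at i1 i2 ⊢
  rw [integral_prod_symm _ i1, integral_prod_symm _ i2, ← integral_neg]
  refine integral_congr_ae ?_
  filter_upwards [ae_nu ϖ] with y hy
  have d {h : Ψ} (hh : SmU h) (x : Ξ) : DifferentiableAt ℝ (fun x => h (x, y)) x :=
    DifferentiableAt.comp (g := h) (f := fun x : Ξ => (x, y)) x (hh.differentiableAt hy) (by fun_prop)
  have e {h : Ψ} (hh : SmU h) (x : Ξ) :
      fderiv ℝ (fun x => h (x, y)) x (single i 1) = Dv (eX i) h (x, y) :=
    slice_eq_Dv (p := (x, y)) (hh.differentiableAt hy) _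
  have := integral_mul_fderiv_eq_neg_fderiv_mul_of_integrable (μ := (volume : Measure Ξ))
    (f := fun x => f (x, y)) (v := single i 1)
    (by simpa only [e hf] using key ((hf.Dv _).mul hg) c2 hy)
    (by simpa only [e hg] using key (hf.mul (hg.Dv _)) c1 hy)
    (key (hf.mul hg) (hc.elim (fun h => h.mul_right _) fun h => h.mul_left _) hy) (fun x _ => d hf x) fun x _ => d hg x
  simpa only [e hf, e hg] using this

lemma SmU.hasDerivAt_slice (h : SmU U) (x : Ξ) {y : ℝ} (hy : 0 < y) :
    HasDerivAt (fun t => U (x, t)) (dy U (x, y)) y :=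
  (DifferentiableAt.comp y (h.differentiableAt (show (x, y) ∈ ℍ from hy)) (by fun_prop)).hasDerivAt

lemma integral_nu_of_hasDerivAt {L : ℝ} {F f : ℝ → ℝ} (lim0 : Tendsto F (𝓝[>] 0) (𝓝 L))
    (lim1 : Tendsto F atTop (𝓝 0)) (der : ∀ y ∈ Ioi (0 : ℝ), HasDerivAt F (f y * y ^ m) y)
    (int : Integrable f (nu m)) : ∫ y, f y ∂nu m = -L := by
  rw [integrable_nu_iff] at int
  rw [integral_nu]
  have key := integral_Ioi_of_hasDerivAt_of_tendsto
   
    (continuousWithinAt_update_same.2 (lim0.mono_left (nhdsWithin_mono _ fun y hy =>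
      lt_of_le_of_ne hy.1 (Ne.symm hy.2))))
    (fun y hy => (der y hy).congr_of_eventuallyEq (Filter.eventuallyEq_of_mem (Ioi_mem_nhds hy)
      fun z hz => Function.update_of_ne (ne_of_gt hz) _ _))
    int (lim1.congr' ?_)
  · rw [Function.update_self, zero_sub] at key; exact key
  · filter_upwards [eventually_gt_atTop 0] with y hy; rw [Function.update_of_ne (ne_of_gt hy)]

lemma CS.eventually_slice (hf : CS f) (x : Ξ) : ∀ᶠ y in atTop, f (x, y) = 0 := by
  obtain ⟨R, hR⟩ := hf
  filter_upwards [eventually_gt_atTop (max R 0)] with y hy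
  exact hR (x, y) ((le_max_right _ _).trans_lt hy)
    (((le_max_left _ _).trans_lt hy).trans_le ((le_abs_self _).trans (le_max_right _ _)))

lemma integral_slice_mul_opT (hs0 : 0 < s) (hs1 : s < 1)     (hP : RepOn (2 * s) A B P) (hV : RepOn (2 * s) A' B' V) (hc : CS P ∨ CS V) (x : Ξ) :
    ∫ y, (dy P (x, y) * dy V (x, y) + P (x, y) * opT ϖ V (x, y)) ∂nu ϖ =
      - ((tr A).1 x * (2 * s * (tr B').1 x)) := by
  have der : ∀ y ∈ Ioi (0 : ℝ), HasDerivAt (fun y => P (x, y) * wNormal ϖ V (x, y))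
      ((dy P (x, y) * dy V (x, y) + P (x, y) * opT ϖ V (x, y)) * y ^ ϖ) y := by
    intro y hy; have hy' : (0 : ℝ) < y := hy
    have := (hP.cl.smU.hasDerivAt_slice x hy).mul ((hasDerivAt_rpow_const (p := 1 - 2 * s)
      (Or.inl hy'.ne')).mul (hV.cl.smU.dy.hasDerivAt_slice x hy))
    refine this.congr_deriv ?_
    simp only [opT, show y ^ ϖ = y ^ (1 - 2 * s - 1) * y by rw [← rpow_add_one hy'.ne']; ring_nf, Pi.mul_apply]; field_simp; ring
  exact integral_nu_of_hasDerivAt ((hP.tendsto (by linarith) (ES_continuous A) (ES_continuous B) x).mul (hV.tendsto_wNormal hs1 x)) (by refine tendsto_const_nhds.congr' ?_; filter_upwards [(hc.elim (fun h => h.mul_right _) fun h => h.dy.mul_left _).eventually_slice x] with y this; simp only [wNormal]; linear_combination -(y ^ ϖ) * this) der ((hP.cl.wk_dy.integrable_slice_mul hs0 hs1 hV.cl.wk_dy (hc.elim (fun h => h.dy.mul_right _) fun h => h.dy.mul_left _) x).add (hP.cl.wk.integrable_slice_mul hs0 hs1 ((RepOn.cl hV.opT').wk) (hc.elim (fun h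 => h.mul_right _) fun h => (h.opT _).mul_left _) x))

/-- The components of the gradient. -/
def gr : Option (Fin n) → Ψ → Ψ
  | none => dy
  | some i => Dv (eX i)

lemma Cl.wk_gr (h : Cl s q U) (o : Option (Fin n)) : Wk s (gr o U) := by
  cases o with
  | none => exact h.wk_dy
  | some i => exact (h.Dv_eX i).wk

lemma CS.gr (h : CS U) (o : Option (Fin n)) : CS (gr o U) := by
  cases o with
  | none => exact h.dy
  | some i => exact h.Dv _

lemma SmU.gr (h : SmU U) (o : Option (Fin n)) : SmU (gr o U) := by
  cases o with
  | none => exact h.dy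
  | some i => exact h.Dv _

lemma integral_mul_wLap (hs0 : 0 < s) (hs1 : s < 1)     (hP : RepOn (2 * s) A B P) (hV : RepOn (2 * s) A' B' V) (hc : CS P ∨ CS V) :
    ∫ p, P p * wLap ϖ V p ∂mu ϖ = - ∑ o, ∫ p, gr o P p * gr o V p ∂mu ϖ - ∫ x, (tr A).1 x * (2 * s * (tr B').1 x) := by
  have clP := hP.cl
  have clV := hV.cl
  have cgr (o : Option (Fin n)) : CS fun p => gr o P p * gr o V p :=
    hc.elim (fun h => (h.gr o).mul_right _) fun h => (h.gr o).mul_left _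
  have cP {W : Ψ} (hW : CS V → CS W) : CS fun p => P p * W p :=
    hc.elim (fun h => h.mul_right _) fun h => (hW h).mul_left _
  have igr o := (clP.wk_gr o).integrable_mul hs0 hs1 (clV.wk_gr o) (cgr o)
  have iT := clP.wk.integrable_mul hs0 hs1 (RepOn.cl hV.opT').wk (cP fun h => h.opT _)
  have iX i := clP.wk.integrable_mul hs0 hs1 ((clV.Dv_eX i).Dv_eX i).wk (cP fun h => (h.Dv _).Dv _)
  have e1 : ∫ p, (dy P p * dy V p + P p * opT ϖ V p) ∂mu ϖ =
      - ∫ x, (tr A).1 x * (2 * s * (tr B').1 x) := by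
    have : Integrable (fun p => dy P p * dy V p + P p * opT ϖ V p) (mu ϖ) := (igr none).add iT
    rw [mu] at this ⊢; rw [integral_prod _ this, ← integral_neg]
    exact integral_congr_ae (ae_of_all _ fun x => integral_slice_mul_opT hs0 hs1 hP hV hc x)
  have e3 := integral_add (igr none) iT
  simp only [gr] at e3
  rw [e3] at e1
  rw [show ∫ p, P p * wLap ϖ V p ∂mu ϖ = ∫ p, (∑ i, P p * Dv (eX i) (Dv (eX i) V) p + P p * opT ϖ V p) ∂mu ϖ by refine integral_congr_ae ?_; filter_upwards [ae_mu ϖ] with p hp; simp only [wLap_eq]; rw [clV.smU.LX_eq hp, mul_add, mul_sum], integral_add (integrable_finsetSum _ fun i _ => iX i) iT,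
    integral_finsetSum _ fun i _ => iX i, Fintype.sum_option]
  have e2 i := integral_mul_Dv_eX hs0 hs1 i clP.smU (clV.smU.Dv _) clP.wk (clV.Dv_eX i).wk (clP.Dv_eX i).wk
      ((clV.Dv_eX i).Dv_eX i).wk (hc.imp_right fun h => h.Dv _)
  simp only [e2, sum_neg_distrib, gr]
  linarith

lemma integral_mul_wLap_comm (hs0 : 0 < s) (hs1 : s < 1)
    (hP : RepOn (2 * s) A B P) (hV : RepOn (2 * s) A' B' V) (hc : CS P ∨ CS V)
    (h1 : Cl s 1 P) :
    ∫ p, P p * wLap ϖ V p ∂mu ϖ = ∫ p, wLap ϖ P p * V p ∂mu ϖ - ∫ x, (tr A).1 x * (2 * s * (tr B').1 x) := by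
  have e := integral_mul_wLap hs0 hs1 hV hP hc.symm
  rw [integral_mul_wLap hs0 hs1 hP hV hc]
  simp_rw [show tr B = 0 by simpa using (odd_trace_iff hs0 hs1 hP).1 h1 0 one_pos, mul_comm (V _), mul_comm (gr _ V _)] at e
  simp only [ZeroMemClass.coe_zero, Pi.zero_apply, mul_zero, integral_zero, sub_zero] at e
  rw [e]

lemma integral_mul_wLap_iterate (hs0 : 0 < s) (hs1 : s < 1) {i k : ℕ} (hi : i ≤ q)
    (hk : i ≤ k) (hP : RepOn (2 * s) A B P)
    (hV : RepOn (2 * s) A' B' V) (hc : CS P ∨ CS V) (h1 : Cl s q P) :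
    ∫ p, P p * (wLap ϖ)^[k] V p ∂mu ϖ =
      ∫ p, (wLap ϖ)^[i] P p * (wLap ϖ)^[k - i] V p ∂mu ϖ -
        ∑ r ∈ ℛ i, ∫ x, (tr ((Le ϖ ^ r) A)).1 x *
          (2 * s * (tr ((Le (1 + 2 * s) ^ (k - 1 - r)) B')).1 x) := by
  induction i with
  | zero => simp
  | succ i ih =>
    rw [ih (by omega) (by omega), sum_range_succ]; have e : k - i = (k - 1 - i) + 1 := by omega
    have h2 : Cl s (q - i) ((wLap ϖ)^[i] P) := Cl.wLap_iterate (by rwa [Nat.sub_add_cancel (by omega)])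
    have := integral_mul_wLap_comm hs0 hs1 (hP.wLap_iterate i) (hV.wLap_iterate (k - 1 - i))
      (hc.imp (fun h => h.wLap_iterate _ _) fun h => h.wLap_iterate _ _) (h2.of_le (by omega))
    rw [e, iterate_succ_apply' (wLap ϖ) (k - 1 - i), this,
      iterate_succ_apply' (wLap ϖ) i, show k - (i + 1) = k - 1 - i by omega]
    ring

/-- The components of the differential operator of order `k` whose square is `(-Δ_m)^k`. -/
def kop (m : ℝ) (k : ℕ) (o : Option (Fin n)) (U : Ψ) : Ψ :=
  if Even k then (if o = none then (wLap m)^[k / 2] U else 0) else gr o ((wLap m)^[k / 2] U)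

/-- The Dirichlet form of `(-Δ_m)^k` without boundary terms. -/
def aF (m : ℝ) (k : ℕ) (P V : Ψ) : ℝ := ∑ o, ∫ p, kop m k o P p * kop m k o V p ∂mu m

lemma Cl.wk_kop (h : Cl s 0 U) (k : ℕ) (o : Option (Fin n)) :
    Wk s (kop ϖ k o U) := by
  have h1 := h.wLap_iterate_zero (k / 2)
  unfold kop
  split_ifs
  · exact h1.wk
  · exact ⟨0, 0, continuous_const, continuous_const, by simp⟩
  · exact h1.wk_gr o

protected lemma CS.kop (h : CS U) (m : ℝ) (k : ℕ) (o : Option (Fin n)) : CS (kop m k o U) := by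
  unfold kop
  split_ifs
  · exact h.wLap_iterate _ _
  · exact ⟨0, by simp⟩
  · exact (h.wLap_iterate _ _).gr o

protected lemma SmU.kop (h : SmU U) (m : ℝ) (k : ℕ) (o : Option (Fin n)) : SmU (kop m k o U) := by
  unfold kop
  split_ifs
  · exact h.wLap_iterate _ _
  · exact contDiffOn_const
  · exact (h.wLap_iterate _ _).gr o

lemma integral_mul_wLap_pow (hs0 : 0 < s) (hs1 : s < 1) (k : ℕ)
    (hP : RepOn (2 * s) A B P)
    (hV : RepOn (2 * s) A' B' V) (hc : CS P ∨ CS V) (h1 : Cl s (k / 2) P) :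
    ∫ p, P p * (wLap ϖ)^[k] V p ∂mu ϖ = (-1) ^ k * aF ϖ k P V -
        ∑ r ∈ ℛ (k - k / 2), ∫ x, (tr ((Le ϖ ^ r) A)).1 x *
          (2 * s * (tr ((Le (1 + 2 * s) ^ (k - 1 - r)) B')).1 x) := by
  rw [integral_mul_wLap_iterate hs0 hs1 le_rfl (by omega) hP hV hc h1]
  rcases Nat.even_or_odd k with hk | hk
  · have e : k - k / 2 = k / 2 := by obtain ⟨l, rfl⟩ := hk; omega
    rw [e, hk.neg_one_pow, one_mul]; simp [aF, kop, hk]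
  · have e : k - k / 2 = k / 2 + 1 := by obtain ⟨l, rfl⟩ := hk; omega
    have := integral_mul_wLap hs0 hs1 (hP.wLap_iterate (k / 2)) (hV.wLap_iterate (k / 2))
      (hc.imp (fun h => h.wLap_iterate _ _) fun h => h.wLap_iterate _ _)
    rw [e, iterate_succ_apply', this, hk.neg_one_pow, sum_range_succ]
    simp only [aF, kop, Nat.not_even_iff_odd.2 hk, if_false, show k - 1 - k / 2 = k / 2 by omega]; ring

end

section

variable {U V P : Amb n → ℝ} {s M : ℝ} {q l : ℕ} {p : Amb n}

local notation "ϖ" => 1 - 2 * s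

/-! ### Commutation rules -/

lemma Dv_wLap_comm (h : SmU U) (m : ℝ) (w : Ξ) :
    EqOn (Dv (w, 0) (wLap m U)) (wLap m (Dv (w, 0) U)) ℍ := by
  intro p hp
  have d {f : Ψ} (hf : SmU f) : DifferentiableAt ℝ f p := hf.differentiableAt hp
  have d1 : DifferentiableAt ℝ (fun q : Υ => m / q.2) p := by fun_prop (disch := exact hp.ne')
  have e2 : Dv (w, 0) (wLap m U) p = ∑ i, Dv (w, 0) (Dv (eX i) (Dv (eX i) U)) p +
      (Dv (w, 0) (Dv eY (Dv eY U)) p + m / p.2 * Dv (w, 0) (Dv eY U) p) := by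
    have h1 : ∀ i ∈ Finset.univ, DifferentiableAt ℝ (Dv (eX i) (Dv (eX i) U)) p := fun i _ => d ((h.Dv _).Dv _)
    have h2 := d ((h.Dv eY).Dv eY); have h3 := d (h.Dv eY)
    change fderiv ℝ (wLap m U) p (w, 0) = ∑ i, fderiv ℝ (Dv (eX i) (Dv (eX i) U)) p (w, 0) +
      (fderiv ℝ (Dv eY (Dv eY U)) p (w, 0) + m / p.2 * fderiv ℝ (Dv eY U) p (w, 0))
    rw [show wLap m U =ᶠ[𝓝 p] fun q => ∑ i, Dv (eX i) (Dv (eX i) U) q + (Dv eY (Dv eY U) q + m / q.2 * Dv eY U q) by filter_upwards [isOpen_upper.mem_nhds hp] with q hq; simp only [wLap_eq, opT]; rw [h.LX_eq hq, dy_congr (dy_eq_Dv h) hq, dy_eq_Dv (h.Dv _) hq, dy_eq_Dv h hq].fderiv_eq, fderiv_fun_add (DifferentiableAt.fun_sum h1) (h2.fun_add (d1.fun_mul h3)),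
      fderiv_fun_sum h1, fderiv_fun_add h2 (d1.fun_mul h3), fderiv_fun_mul d1 h3]
    simp [show fderiv ℝ (fun q : Υ => m / q.2) p (w, 0) = 0 by have := slice_eq_Dv d1 w; simp at this; exact this.symm]
  have c {f : Ψ} (hf : SmU f) (v : Υ) : EqOn (Dv (w, 0) (Dv v f)) (Dv v (Dv (w, 0) f))
      ℍ := fun q hq => Dv_comm (hf.contDiffAt hq) _ _
  have c2 {f : Ψ} (hf : SmU f) v : EqOn (Dv (w, 0) (Dv v (Dv v f)))
      (Dv v (Dv v (Dv (w, 0) f))) ℍ := (c (hf.Dv v) v).trans (Dv_congr (c hf v) v)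
  rw [e2]
  simp only [wLap_eq, opT]
  rw [(h.Dv _).LX_eq hp, dy_congr (dy_eq_Dv (h.Dv _)) hp, dy_eq_Dv ((h.Dv _).Dv _) hp,
    dy_eq_Dv (h.Dv _) hp, c2 h eY hp, c h eY hp]
  congr 1
  exact sum_congr rfl fun i _ => c2 h (eX i) hp

lemma dy_iterate_congr (h : EqOn U V ℍ) (j : ℕ) :
    EqOn (dy^[j] U) (dy^[j] V) ℍ := by
  induction j generalizing U V with
  | zero => exact h
  | succ j ih => exact ih (dy_congr h)

lemma SmU.dy_iterate (h : SmU U) (j : ℕ) : SmU (dy^[j] U) := by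
  induction j generalizing U with
  | zero => exact h
  | succ j ih => exact ih h.dy

lemma CS.dy_iterate (h : CS U) (j : ℕ) : CS (dy^[j] U) := by
  induction j generalizing U with
  | zero => exact h
  | succ j ih => exact ih h.dy

lemma dy_iterate_add (hU : SmU U) (hV : SmU V) (j : ℕ) :
    EqOn (dy^[j] fun p => U p + V p) (fun p => dy^[j] U p + dy^[j] V p) ℍ := by
  induction j generalizing U V with
  | zero => exact fun p _ => rfl
  | succ j ih =>
    refine (dy_iterate_congr (fun p hp => ?_) j).trans (ih hU.dy hV.dy)
    exact ((hU.hasDerivAt_slice p.1 hp).add (hV.hasDerivAt_slice p.1 hp)).deriv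

lemma dy_iterate_const_mul (hU : SmU U) (c : ℝ) (j : ℕ) :
    EqOn (dy^[j] fun p => c * U p) (fun p => c * dy^[j] U p) ℍ := by
  induction j generalizing U with
  | zero => exact fun p _ => rfl
  | succ j ih =>
    refine (dy_iterate_congr (fun p hp => ?_) j).trans (ih hU.dy)
    exact ((hU.hasDerivAt_slice p.1 hp).const_mul c).deriv

lemma dy_iterate_sum {ι : Type*} (t : Finset ι) {U : ι → Ψ} (hU : ∀ i, SmU (U i))
    (j : ℕ) : EqOn (dy^[j] fun p => ∑ i ∈ t, U i p) (fun p => ∑ i ∈ t, dy^[j] (U i) p) ℍ := by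
  induction j generalizing U with
  | zero => exact fun p _ => rfl
  | succ j ih =>
    refine (dy_iterate_congr (fun p hp => ?_) j).trans (ih fun i => (hU i).dy)
    exact (HasDerivAt.fun_sum fun i _ => (hU i).hasDerivAt_slice p.1 hp).deriv

lemma dy_iterate_snd_mul {z : Ψ} (hz : SmU z) (j : ℕ) :
    EqOn (dy^[j + 1] fun p => p.2 * z p) (fun p => p.2 * dy^[j + 1] z p + (j + 1) * dy^[j] z p) ℍ := by
  induction j with
  | zero =>
    intro p hp; have := ((hasDerivAt_id p.2).mul (hz.hasDerivAt_slice p.1 hp)).deriv; simp only [Pi.mul_def, id] at this; change deriv (fun t => t * z (p.1, t)) p.2 = _; rw [this]; simp; ring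
  | succ j ih =>
    intro p hp; rw [iterate_succ_apply', dy_congr ih hp]; have h1 := (hz.dy_iterate j).hasDerivAt_slice p.1 hp
    have := (((hasDerivAt_id p.2).mul ((hz.dy_iterate (j + 1)).hasDerivAt_slice p.1 hp)).add (h1.const_mul ((j : ℝ) + 1))).deriv
    simp only [Pi.mul_def, Pi.add_def, id] at this
    change deriv (fun t => t * dy^[j + 1] z (p.1, t) + (j + 1) * dy^[j] z (p.1, t)) p.2 = _; rw [this]; simp only [iterate_succ_apply']; push_cast; ring

/-! ### A Hardy inequality -/

/-- `U_y / y`. -/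
def zd (U : Ψ) : Ψ := fun p => dy U p / p.2

protected lemma Cl.zd (h : Cl s (q + 1) U) : Cl s q (zd U) := by
  obtain ⟨A, B, hA, hB, h⟩ := h
  refine ⟨hd A, fun p => (2 * s + 2 * (q + 1 : ℕ)) * B p + p.2 ^ 2 * hd B p, hA.hd,
    ((isEvenSmooth_const _).mul hB).add (isEvenSmooth_sq.mul hB.hd), fun p hp => ?_⟩
  have hy : (0 : ℝ) < p.2 := hp
  have e : p.2 ^ (2 * s + 2 * ((q + 1 : ℕ) : ℝ) - 1) = p.2 ^ (2 * s + 2 * (q : ℝ)) * p.2 := by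
    rw [← rpow_add_one hy.ne']; push_cast; ring_nf
  have h1 := h.dy hA.1 hB.1 p hp
  simp only [e, hA.dy_eq_mul_hd, hB.dy_eq_mul_hd] at h1
  simp only [zd, h1]
  field_simp

protected lemma CS.zd (h : CS U) : CS (zd U) := by
  have := h.dy.mul_right fun p => p.2⁻¹
  simp only [← div_eq_mul_inv] at this
  exact this

lemma Wk.tendsto_sq (hs0 : 0 < s) (hs1 : s < 1) {h : Ψ} (hh : Wk s h) (x : Ξ) :
    Tendsto (fun y => y ^ (2 - 2 * s) * h (x, y) ^ 2) (𝓝[>] 0) (𝓝 0) := by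
  obtain ⟨E, F, hE, hF, h1⟩ := hh
  have c1 : Continuous fun y : ℝ => y ^ (1 - s) := continuous_rpow_const (by linarith)
  have c2 : Continuous fun y : ℝ => y ^ s := continuous_rpow_const hs0.le
  have := (show Continuous fun y : ℝ => (y ^ (1 - s) * E (x, y) + y ^ s * F (x, y)) ^ 2 by fun_prop).tendsto 0
  simp only [zero_rpow (by linarith : 1 - s ≠ 0), zero_rpow hs0.ne'] at this
  have h2 : Tendsto _ (𝓝[>] (0 : ℝ)) _ := this.mono_left nhdsWithin_le_nhds
  norm_num at h2
  refine h2.congr' ?_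
  filter_upwards [self_mem_nhdsWithin] with y hy
  have hy' : (0 : ℝ) < y := hy
  rw [h1 (x, y) hy]
  simp only [show y ^ (2 - 2 * s) = y ^ (1 - s) * y ^ (1 - s) by rw [← rpow_add hy']; ring_nf, show y ^ s = y ^ (1 - s) * y ^ (2 * s - 1) by rw [← rpow_add hy']; ring_nf]; ring

lemma hardy_dy (hs0 : 0 < s) (hs1 : s < 1) {j : ℕ} (hj : j ≤ 2 * l + 1)
    {v : Ψ} (hv : Cl s (l + 1) v) (hc : CS v) :
    (j + s) ^ 2 * ∫ p, dy^[j] (zd v) p ^ 2 ∂mu ϖ ≤ ∫ p, dy^[j + 2] v p ^ 2 ∂mu ϖ := by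
  have hz := hv.zd
  have hg : EqOn (dy^[j + 2] v) (fun p => p.2 * dy^[j + 1] (zd v) p + (j + 1) * dy^[j] (zd v) p) ℍ := by
    rw [iterate_succ_apply]; exact (dy_iterate_congr (fun p hp => by change dy v p = p.2 * (dy v p / p.2); rw [mul_div_cancel₀ _ (ne_of_gt (show (0 : ℝ) < p.2 from hp))]) _).trans (dy_iterate_snd_mul hz.smU j)
  have wh : Wk s (dy^[j] (zd v)) := hz.wk_dy_iterate hj
  have wg : Wk s (dy^[j + 2] v) := hv.wk_dy_iterate (by omega)
  have ch := hc.zd.dy_iterate j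
  set h := dy^[j] (zd v) with hh
  set g := dy^[j + 2] v
  have igh := wg.integrable_mul hs0 hs1 wh (ch.mul_left _)
  have ihh := wh.integrable_mul hs0 hs1 wh (ch.mul_left _)
  have igg := wg.integrable_mul hs0 hs1 wg ((hc.dy_iterate (j + 2)).mul_left _)
  have key : ∫ p, (g p * h p - (j + s) * (h p * h p)) ∂mu ϖ = 0 := by
    have i0 : Integrable (fun p => g p * h p - (j + s) * (h p * h p)) (mu ϖ) := igh.sub (ihh.const_mul _)
    rw [mu] at i0 ⊢; rw [integral_prod _ i0]; refine integral_eq_zero_of_ae (ae_of_all _ fun x => ?_)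
    have := integral_nu_of_hasDerivAt (m := 1 - 2 * s)
      (f := fun y => g (x, y) * h (x, y) - (j + s) * (h (x, y) * h (x, y))) (by have := (wh.tendsto_sq hs0 hs1 x).const_mul (1 / 2); rwa [mul_zero] at this) (by refine tendsto_const_nhds.congr' ?_; filter_upwards [ch.eventually_slice x] with y hy; rw [hy]; ring) ?_
      ((wg.integrable_slice_mul hs0 hs1 wh (ch.mul_left _) x).sub
        ((wh.integrable_slice_mul hs0 hs1 wh (ch.mul_left _) x).const_mul _))
    · simpa using this
    · intro y hy; have hy' : (0 : ℝ) < y := hy; have h1 := (hz.smU.dy_iterate j).hasDerivAt_slice x hy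
      rw [show dy (dy^[j] (zd v)) (x, y) = dy^[j + 1] (zd v) (x, y) by rw [iterate_succ_apply'], ← hh] at h1; refine (((hasDerivAt_rpow_const (p := 2 - 2 * s) (Or.inl hy'.ne')).mul
        (h1.pow 2)).const_mul (1 / 2)).congr_deriv ?_
      have e4 := hg (show (x, y) ∈ ℍ from hy); simp only at e4; simp only [e4, show y ^ (2 - 2 * s) = y ^ ϖ * y by rw [← rpow_add_one hy'.ne']; ring_nf, show y ^ (2 - 2 * s - 1) = y ^ ϖ by ring_nf, Pi.pow_apply]; push_cast; ring
  rw [integral_sub igh (ihh.const_mul _), integral_const_mul] at key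
  have pos : 0 ≤ ∫ p, (g p - (j + s) * h p) ^ 2 ∂mu ϖ := integral_nonneg fun p => sq_nonneg _
  have e5 : ∀ p, (g p - (j + s) * h p) ^ 2 = g p * g p - 2 * (j + s) * (g p * h p) +
    (j + s) ^ 2 * (h p * h p) := fun p => by ring
  simp_rw [e5] at pos
  have i3 : Integrable (fun p => g p * g p - 2 * (j + s) * (g p * h p)) (mu ϖ) := igg.sub (igh.const_mul _)
  rw [integral_add i3 (ihh.const_mul _), integral_sub igg (igh.const_mul _),
    integral_const_mul, integral_const_mul] at pos
  simp_rw [sq (h _), sq (g _)]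
  have : ∫ p, g p * h p ∂mu ϖ = (j + s) * ∫ p, h p * h p ∂mu ϖ := by linarith
  rw [this] at pos
  linarith

/-! ### Bounding the Dirichlet form by the derivatives of top order -/

/-- Iterated derivatives in the boundary directions. -/
def dxs (α : List (Fin n)) (U : Ψ) : Ψ := α.foldr (fun i f => Dv (eX i) f) U

lemma SmU.dxs (h : SmU U) (α : List (Fin n)) : SmU (dxs α U) := by
  induction α with
  | nil => exact h
  | cons i α ih => exact SmU.Dv ih _

lemma CS.dxs (h : CS U) (α : List (Fin n)) : CS (dxs α U) := by
  induction α with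
  | nil => exact h
  | cons i α ih => exact CS.Dv ih _

lemma Cl.dxs (h : Cl s q U) (α : List (Fin n)) : Cl s q (dxs α U) := by
  induction α with
  | nil => exact h
  | cons i α ih => exact Cl.Dv_eX ih _

lemma dxs_wLap_comm (h : SmU U) (m : ℝ) (α : List (Fin n)) :
    EqOn (dxs α (wLap m U)) (wLap m (dxs α U)) ℍ := by
  induction α with
  | nil => exact fun p _ => rfl
  | cons i α ih => exact (Dv_congr ih _).trans (Dv_wLap_comm (h.dxs α) m _)

/-- All pure derivatives of order `k` have squared weighted norm at most `M`. -/
def HB (m : ℝ) (P : Ψ) (k : ℕ) (M : ℝ) : Prop :=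
  ∀ (α : List (Fin n)) (j : ℕ), α.length + j = k → ∫ p, dy^[j] (dxs α P) p ^ 2 ∂mu m ≤ M

lemma HB.apply_wLap (hs0 : 0 < s) (hs1 : s < 1) {k : ℕ} (hk : k ≤ 2 * l + 1)
    (hP : Cl s (l + 1) P) (hc : CS P) (h : HB ϖ P (k + 2) M) :
    HB ϖ (wLap ϖ P) k (3 * (n ^ 2 + 1 + ϖ ^ 2 / s ^ 2) * M) := by
  intro α j hα
  have hM : 0 ≤ M := (integral_nonneg fun p => sq_nonneg _).trans (h α (j + 2) (by omega))
  have hv := hP.dxs α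
  have cv := hc.dxs α
  set v := dxs α P with hvdef
  have e : EqOn (dy^[j] (dxs α (wLap ϖ P))) (fun p =>
      ∑ i, dy^[j] (Dv (eX i) (Dv (eX i) v)) p + dy^[j + 2] v p + ϖ * dy^[j] (zd v) p)
      ℍ := by
    refine (dy_iterate_congr (dxs_wLap_comm hP.smU _ α) j).trans ?_
    have s1 : SmU fun p => ∑ i, Dv (eX i) (Dv (eX i) v) p := ContDiffOn.sum fun i _ => (hv.smU.Dv _).Dv _
    have s2 : SmU (dy (dy v)) := hv.smU.dy.dy
    have s3 : SmU fun p => ϖ * zd v p := contDiffOn_const.mul hv.zd.smU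
    have e1 : EqOn (wLap ϖ v) (fun p => (∑ i, Dv (eX i) (Dv (eX i) v) p + dy (dy v) p) +
        ϖ * zd v p) ℍ := fun p hp => by
      simp only [wLap_eq, opT, zd]; rw [hv.smU.LX_eq hp]; ring
    refine (dy_iterate_congr e1 j).trans ((dy_iterate_add (s1.add s2) s3 j).trans fun p hp => ?_); simp only; rw [dy_iterate_add s1 s2 j hp, dy_iterate_const_mul hv.zd.smU _ j hp]; simp only; rw [dy_iterate_sum _ (fun i => (hv.smU.Dv (eX i)).Dv (eX i)) j hp]; rfl
  have hj : j ≤ 2 * l + 1 := by omega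
  have sq {f : Ψ} (hf : Wk s f) (hcf : CS f) : Integrable (fun p => f p ^ 2) (mu ϖ) := by
    simp_rw [pow_two]; exact hf.integrable_mul hs0 hs1 hf (hcf.mul_left _)
  have i1 i := sq (((hv.Dv_eX i).Dv_eX i).wk_dy_iterate (j := j) (by omega)) (((cv.Dv (eX i)).Dv (eX i)).dy_iterate j)
  have i2 := sq (hv.wk_dy_iterate (j := j + 2) (by omega)) (cv.dy_iterate (j + 2))
  have i3 := sq (hv.zd.wk_dy_iterate hj) (cv.zd.dy_iterate j)
  calc ∫ p, dy^[j] (dxs α (wLap ϖ P)) p ^ 2 ∂mu ϖ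
      ≤ ∫ p, 3 * (n * ∑ i, dy^[j] (Dv (eX i) (Dv (eX i) v)) p ^ 2 +
      dy^[j + 2] v p ^ 2 + ϖ ^ 2 * dy^[j] (zd v) p ^ 2) ∂mu ϖ := by
        refine integral_mono_of_nonneg (ae_of_all _ fun p => sq_nonneg _) (((((integrable_finsetSum _ fun i _ => i1 i).const_mul _).add i2).add (i3.const_mul _)).const_mul 3) ?_
        filter_upwards [ae_mu ϖ] with p hp; rw [e hp]; have := sq_sum_le_card_mul_sum_sq (s := (Finset.univ : Finset (Fin n)))
          (f := fun i => dy^[j] (Dv (eX i) (Dv (eX i) v)) p)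
        simp only [Finset.card_univ, Fintype.card_fin] at this; set a := ∑ i, dy^[j] (Dv (eX i) (Dv (eX i) v)) p; set b := dy^[j + 2] v p; set c := dy^[j] (zd v) p
        nlinarith [sq_nonneg (a - b), sq_nonneg (a - ϖ * c), sq_nonneg (b - ϖ * c)]
    _ = 3 * (n * ∑ i, ∫ p, dy^[j] (Dv (eX i) (Dv (eX i) v)) p ^ 2 ∂mu ϖ +
      ∫ p, dy^[j + 2] v p ^ 2 ∂mu ϖ +
      ϖ ^ 2 * ∫ p, dy^[j] (zd v) p ^ 2 ∂mu ϖ) := by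
        have i4 : Integrable (fun p => n * ∑ i, dy^[j] (Dv (eX i) (Dv (eX i) v)) p ^ 2 +
            dy^[j + 2] v p ^ 2) (mu ϖ) :=
          ((integrable_finsetSum _ fun i _ => i1 i).const_mul _).add i2
        rw [integral_const_mul, integral_add i4 (i3.const_mul _), integral_add ((integrable_finsetSum _ fun i _ => i1 i).const_mul _) i2,
          integral_const_mul, integral_const_mul, integral_finsetSum _ fun i _ => i1 i]
    _ ≤ 3 * (n * ∑ i : Fin n, M + M + ϖ ^ 2 * (M / s ^ 2)) := by
        have h3 : ∫ p, dy^[j] (zd v) p ^ 2 ∂mu ϖ ≤ M / s ^ 2 := by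
          rw [le_div_iff₀ pos!, mul_comm]
          refine le_trans (mul_le_mul_of_nonneg_right ?_ (integral_nonneg fun p => sq_nonneg _))
            ((hardy_dy hs0 hs1 hj hv cv).trans (h α (j + 2) (by omega)))
          gcongr; linarith
        gcongr with i
        · exact h (i :: i :: α) j (by simp; omega)
        · exact h α (j + 2) (by omega)
    _ = _ := by simp; ring

lemma HB.apply_wLap_iterate (hs0 : 0 < s) (hs1 : s < 1) {r : ℕ} (hr : r ≤ 1) (i : ℕ)
    (hP : Cl s (l + i) P) (hc : CS P)
    (h : HB ϖ P (r + 2 * l + 2 * i) M) :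
    HB ϖ ((wLap ϖ)^[i] P) (r + 2 * l) ((3 * (n ^ 2 + 1 + ϖ ^ 2 / s ^ 2)) ^ i * M) := by
  induction i generalizing P M with
  | zero => simpa using h
  | succ i ih =>
    have := ih (Cl.wLap hP) (hc.wLap _) (HB.apply_wLap hs0 hs1 (l := l + i) (by omega) hP hc h); rwa [← mul_assoc, ← pow_succ] at this

lemma norm_iteratedFDeriv_Dv_le (h : SmU U) (v : Υ) (hv : ‖v‖ ≤ 1) (i : ℕ)
    (hp : p ∈ ℍ) :
    ‖𝒟 i (Dv v U) p‖ ≤ ‖𝒟 (i + 1) U p‖ := by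
  have := norm_iteratedFDeriv_clm_apply_const (c := v) ((h.contDiffAt hp).fderiv_right (m := i) (by norm_cast; exact le_top)) le_rfl
  rw [norm_iteratedFDeriv_fderiv] at this
  exact this.trans (mul_le_of_le_one_left (norm_nonneg _) hv)

lemma norm_eX_le (i : Fin n) : ‖eX i‖ ≤ 1 := by simp [eX]

lemma norm_eY_le : ‖(eY : Υ)‖ ≤ 1 := by simp [eY]

lemma iteratedFDeriv_congr_upper (h : EqOn U V ℍ) (i : ℕ)
    (hp : p ∈ ℍ) : 𝒟 i U p = 𝒟 i V p :=
  ((Filter.eventuallyEq_of_mem (isOpen_upper.mem_nhds hp) h).iteratedFDeriv ℝ i).eq_of_nhds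

lemma norm_iteratedFDeriv_dy_iterate_le (h : SmU U) (i j : ℕ) (hp : p ∈ ℍ) :
    ‖𝒟 i (dy^[j] U) p‖ ≤ ‖𝒟 (i + j) U p‖ := by
  induction j generalizing i with
  | zero => exact le_rfl
  | succ j ih =>
    rw [iterate_succ_apply', iteratedFDeriv_congr_upper (dy_eq_Dv (h.dy_iterate j)) i hp]
    refine (norm_iteratedFDeriv_Dv_le (h.dy_iterate j) _ norm_eY_le i hp).trans ((ih (i + 1)).trans ?_)
    rw [show i + 1 + j = i + (j + 1) by ring]

lemma norm_iteratedFDeriv_dxs_le (h : SmU U) (i : ℕ) (α : List (Fin n))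
    (hp : p ∈ ℍ) :
    ‖𝒟 i (dxs α U) p‖ ≤ ‖𝒟 (i + α.length) U p‖ := by
  induction α generalizing i with
  | nil => exact le_rfl
  | cons a α ih =>
    refine (norm_iteratedFDeriv_Dv_le (h.dxs α) _ (norm_eX_le a) i hp).trans ((ih (i + 1)).trans ?_)
    rw [List.length_cons, show i + 1 + α.length = i + (α.length + 1) by ring]

lemma abs_dy_iterate_dxs_le (h : SmU U) (j : ℕ) (α : List (Fin n)) (hp : p ∈ ℍ) :
    |dy^[j] (dxs α U) p| ≤ ‖𝒟 (α.length + j) U p‖ := by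
  have h1 := norm_iteratedFDeriv_dy_iterate_le (h.dxs α) 0 j hp
  have h2 := norm_iteratedFDeriv_dxs_le h (0 + j) α hp
  rw [norm_iteratedFDeriv_zero, norm_eq_abs] at h1
  rw [show 0 + j + α.length = α.length + j by ring] at h2
  exact h1.trans h2

lemma exists_aF_le (hs0 : 0 < s) (hs1 : s < 1) (k : ℕ) : ∃ C : ℝ, 0 ≤ C ∧
    ∀ P : Ψ, Cl s (k / 2) P → CS P → Integrable (fun p => ‖𝒟 k P p‖ ^ 2) (mu ϖ) →
      aF ϖ k P P ≤ C * ∫ p, ‖𝒟 k P p‖ ^ 2 ∂mu ϖ := by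
  refine ⟨(n + 1) * (3 * (n ^ 2 + 1 + ϖ ^ 2 / s ^ 2)) ^ (k / 2), pos!, fun P hP hc hi => ?_⟩
  set M := ∫ p, ‖𝒟 k P p‖ ^ 2 ∂mu ϖ
  set K := (3 * (n ^ 2 + 1 + ϖ ^ 2 / s ^ 2)) ^ (k / 2)
  have hb : HB ϖ P k M := fun α j hα => by
    refine integral_mono_of_nonneg (ae_of_all _ fun p => sq_nonneg _) hi ?_
    filter_upwards [ae_mu ϖ] with p hp; rw [← hα]
    exact sq_le_sq' (by linarith [neg_abs_le (dy^[j] (dxs α P) p), abs_dy_iterate_dxs_le hP.smU j α hp])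
      ((le_abs_self _).trans (abs_dy_iterate_dxs_le hP.smU j α hp))
  rw [show k = k % 2 + 2 * 0 + 2 * (k / 2) by omega] at hb
  have h1 := HB.apply_wLap_iterate hs0 hs1 (by omega) (k / 2) (by simpa using hP) hc hb
  have key : ∀ o, ∫ p, kop ϖ k o P p * kop ϖ k o P p ∂mu ϖ ≤ K * M := by
    intro o; simp_rw [← sq]; have hKM : 0 ≤ K * M := mul_nonneg pos! (integral_nonneg fun p => sq_nonneg _); unfold kop; split_ifs with h2 h3
    · have := h1 [] 0 (by rw [Nat.even_iff.1 h2]; rfl); exact this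
    · simpa using hKM
    · have h4 := Nat.odd_iff.1 (Nat.not_even_iff_odd.1 h2); cases o with
      | none => exact h1 [] 1 (by rw [h4]; rfl)
      | some i => exact h1 [i] 0 (by rw [h4]; rfl)
  calc aF ϖ k P P ≤ ∑ o, K * M := sum_le_sum fun o _ => key o
    _ = _ := by simp; ring

end

section

variable {U Q : Amb n → ℝ} {s : ℝ}

local notation "ϖ" => 1 - 2 * s

/-! ### Coercivity of the Dirichlet form -/

lemma opT_Dv_comm (h : SmU U) (m : ℝ) (w : Ξ) :
    EqOn (Dv (w, 0) (opT m U)) (opT m (Dv (w, 0) U)) ℍ := by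
  intro p hp
  have d1 : DifferentiableAt ℝ (fun q : Υ => m / q.2) p := by fun_prop (disch := exact hp.ne')
  have h3 := (h.Dv eY).differentiableAt hp
  have c {f : Ψ} (hf : SmU f) (v : Υ) : EqOn (Dv (w, 0) (Dv v f)) (Dv v (Dv (w, 0) f))
      ℍ := fun q hq => Dv_comm (hf.contDiffAt hq) _ _
  simp only [opT]
  rw [dy_congr (dy_eq_Dv (h.Dv _)) hp, dy_eq_Dv ((h.Dv _).Dv _) hp, dy_eq_Dv (h.Dv _) hp, ← ((c (h.Dv eY) eY).trans (Dv_congr (c h eY) eY)) hp, ← c h eY hp]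
  change fderiv ℝ (opT m U) p (w, 0) = fderiv ℝ (Dv eY (Dv eY U)) p (w, 0) + m / p.2 * fderiv ℝ (Dv eY U) p (w, 0)
  rw [show opT m U =ᶠ[𝓝 p] fun q => Dv eY (Dv eY U) q + m / q.2 * Dv eY U q by filter_upwards [isOpen_upper.mem_nhds hp] with q hq; simp only [opT]; rw [dy_congr (dy_eq_Dv h) hq, dy_eq_Dv (h.Dv _) hq, dy_eq_Dv h hq].fderiv_eq, fderiv_fun_add (((h.Dv eY).Dv eY).differentiableAt hp) (d1.fun_mul h3), fderiv_fun_mul d1 h3]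
  simp [show fderiv ℝ (fun q => m / q.2) p (w, 0) = 0 by have := slice_eq_Dv d1 w; simp at this; exact this.symm]

lemma Wk.integrable_sq (hs0 : 0 < s) (hs1 : s < 1) {f : Ψ} (hf : Wk s f)
    (hc : CS f) : Integrable (fun p => f p ^ 2) (mu ϖ) := by
  simp_rw [pow_two]; exact hf.integrable_mul hs0 hs1 hf (hc.mul_left _)

lemma integral_mul_opT_self (hs0 : 0 < s) (hs1 : s < 1) {R : Ψ} (hR : Cl s 1 R)
    (hc : CS R) : ∫ p, R p * opT ϖ R p ∂mu ϖ = - ∫ p, dy R p ^ 2 ∂mu ϖ := by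
  obtain ⟨A, B, h⟩ := hR.exists_rep
  have i1 := hR.wk_dy.integrable_mul hs0 hs1 hR.wk_dy (hc.dy.mul_left _)
  have i2 := hR.wk.integrable_mul hs0 hs1 (Cl.opT hR).wk (hc.mul_right _)
  have e1 : ∫ p, (dy R p * dy R p + R p * opT ϖ R p) ∂mu ϖ = 0 := by
    have : Integrable (fun p => dy R p * dy R p + R p * opT ϖ R p) (mu ϖ) := i1.add i2
    rw [mu] at this ⊢; rw [integral_prod _ this]; refine integral_eq_zero_of_ae (ae_of_all _ fun x => ?_)
    refine (integral_slice_mul_opT hs0 hs1 h h (Or.inl hc) x).trans ?_; simp [show tr B = 0 by simpa using (odd_trace_iff hs0 hs1 h).1 hR 0 one_pos]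
  rw [integral_add i1 i2] at e1
  simp_rw [sq]
  linarith

lemma integral_LX_sq_le (hs0 : 0 < s) (hs1 : s < 1) (hQ : Cl s 1 Q)
    (hc : CS Q) : ∫ p, LX Q p ^ 2 ∂mu ϖ ≤ ∫ p, wLap ϖ Q p ^ 2 ∂mu ϖ := by
  have hT : Cl s 0 (opT ϖ Q) := Cl.opT hQ
  have cT := hc.opT ϖ
  have i1 := hQ.LX.wk.integrable_sq hs0 hs1 hc.LX
  have i2 := hQ.LX.wk.integrable_mul hs0 hs1 hT.wk (cT.mul_left _)
  have key i : 0 ≤ ∫ p, opT ϖ Q p * Dv (eX i) (Dv (eX i) Q) p ∂mu ϖ := by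
    rw [integral_mul_Dv_eX hs0 hs1 i hT.smU (hQ.smU.Dv _) hT.wk (hQ.Dv_eX i).wk (hT.Dv_eX i).wk
      ((hQ.Dv_eX i).Dv_eX i).wk (Or.inl cT)]
    rw [show ∫ p, Dv (eX i) (opT ϖ Q) p * Dv (eX i) Q p ∂mu ϖ = ∫ p, Dv (eX i) Q p * opT ϖ (Dv (eX i) Q) p ∂mu ϖ by refine integral_congr_ae ?_; filter_upwards [ae_mu ϖ] with p hp; rw [mul_comm, eX, opT_Dv_comm hQ.smU _ _ hp], integral_mul_opT_self hs0 hs1 (hQ.Dv_eX i) (hc.Dv _), neg_neg]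
    exact integral_nonneg fun p => sq_nonneg _
  have pos : 0 ≤ ∫ p, LX Q p * opT ϖ Q p ∂mu ϖ := by
    rw [show ∫ p, LX Q p * opT ϖ Q p ∂mu ϖ = ∫ p, ∑ i, opT ϖ Q p * Dv (eX i) (Dv (eX i) Q) p ∂mu ϖ by refine integral_congr_ae ?_; filter_upwards [ae_mu ϖ] with p hp; rw [hQ.smU.LX_eq hp, mul_comm, mul_sum], integral_finsetSum _ fun i _ => hT.wk.integrable_mul hs0 hs1 ((hQ.Dv_eX i).Dv_eX i).wk (cT.mul_right _)]
    exact sum_nonneg fun i _ => key i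
  have e2 : ∀ p, wLap ϖ Q p ^ 2 = LX Q p ^ 2 + 2 * (LX Q p * opT ϖ Q p) +
      opT ϖ Q p ^ 2 := fun p => by rw [wLap_eq]; ring
  simp_rw [e2]
  have i4 : Integrable (fun p => LX Q p ^ 2 + 2 * (LX Q p * opT ϖ Q p)) (mu ϖ) :=
    i1.add (i2.const_mul 2)
  rw [integral_add i4 (hT.wk.integrable_sq hs0 hs1 cT), integral_add i1 (i2.const_mul 2), integral_const_mul]
  have : 0 ≤ ∫ p, opT ϖ Q p ^ 2 ∂mu ϖ := integral_nonneg fun p => sq_nonneg _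
  linarith

lemma LX_wLap_iterate_comm (h : Cl s 0 U) (j : ℕ) :
    EqOn (LX ((wLap ϖ)^[j] U)) ((wLap ϖ)^[j] (LX U)) ℍ := by
  obtain ⟨A, B, h⟩ := h.exists_rep
  have h2 : RepOn (2 * s) (LXe A : ES n) (LXe B : ES n) (LX U) := h.LX (ES_contDiff _) (ES_contDiff _)
  have h3 := h2.wLap_iterate j
  have c (c : ℝ) : Commute (LXe : Module.End ℝ (ES n)) (Le c ^ j) :=
    ((Commute.refl _).add_right (commute_LXe_Te c)).pow_right j
  intro p hp
  rw [((h.wLap_iterate j).LX (ES_contDiff _) (ES_contDiff _)) p hp, h3 p hp]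
  have e c' E : LX (((Le c' ^ j) E : ES n) : Ψ) = ((Le c' ^ j) (LXe E) : ES n) := by
    have := congrArg (fun T => (T E : Ψ)) (c c').eq; exact this
  rw [e, e]

lemma LX_iterate_congr {V : Ψ} (h : EqOn U V ℍ) (j : ℕ) :
    EqOn (LX^[j] U) (LX^[j] V) ℍ := by
  induction j generalizing U V with
  | zero => exact h
  | succ j ih => exact ih (LX_congr h)

lemma Cl.LX_iterate {q : ℕ} (h : Cl s q U) (j : ℕ) : Cl s q (LX^[j] U) := by
  induction j generalizing U with
  | zero => exact h
  | succ j ih => exact ih h.LX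

lemma integral_LX_iterate_sq_le (hs0 : 0 < s) (hs1 : s < 1) (l : ℕ)
    (hQ : Cl s l Q) (hc : CS Q) :
    ∫ p, LX^[l] Q p ^ 2 ∂mu ϖ ≤ ∫ p, (wLap ϖ)^[l] Q p ^ 2 ∂mu ϖ := by
  induction l generalizing Q with
  | zero => exact le_rfl
  | succ l ih =>
    calc ∫ p, LX^[l + 1] Q p ^ 2 ∂mu ϖ
        ≤ ∫ p, (wLap ϖ)^[l] (LX Q) p ^ 2 ∂mu ϖ := ih hQ.of_succ.LX hc.LX
      _ = ∫ p, LX ((wLap ϖ)^[l] Q) p ^ 2 ∂mu ϖ := by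
        refine integral_congr_ae ?_; filter_upwards [ae_mu ϖ] with p hp; rw [LX_wLap_iterate_comm (hQ.of_le (by omega)) l hp]
      _ ≤ ∫ p, wLap ϖ ((wLap ϖ)^[l] Q) p ^ 2 ∂mu ϖ :=
        integral_LX_sq_le hs0 hs1 (Cl.wLap_iterate (by rwa [add_comm])) (hc.wLap_iterate _ _)
      _ = _ := by simp_rw [iterate_succ_apply']

/-- The purely tangential analogue of `kop`. -/
def xop (k : ℕ) (o : Option (Fin n)) (U : Ψ) : Ψ :=
  if Even k then (if o = none then LX^[k / 2] U else 0)
  else match o with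
    | none => 0
    | some i => LX^[k / 2] (Dv (eX i) U)

lemma Dv_wLap_iterate_comm (h : SmU U) (m : ℝ) (w : Ξ) (j : ℕ) :
    EqOn (Dv (w, 0) ((wLap m)^[j] U)) ((wLap m)^[j] (Dv (w, 0) U)) ℍ := by
  induction j generalizing U with
  | zero => exact fun p _ => rfl
  | succ j ih => exact (ih (h.wLap m)).trans (wLap_iterate_congr (Dv_wLap_comm h m w) j)

lemma integral_xop_sq_le (hs0 : 0 < s) (hs1 : s < 1) (k : ℕ)
    (hQ : Cl s (k / 2) Q) (hc : CS Q) (o : Option (Fin n)) :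
    ∫ p, xop k o Q p ^ 2 ∂mu ϖ ≤ ∫ p, kop ϖ k o Q p ^ 2 ∂mu ϖ := by
  unfold xop kop
  split_ifs with h1 h2
  · exact integral_LX_iterate_sq_le hs0 hs1 _ hQ hc
  · exact le_rfl
  · cases o with
    | none => simpa using integral_nonneg fun p => sq_nonneg _
    | some i =>
      refine (integral_LX_iterate_sq_le hs0 hs1 _ (hQ.Dv_eX i) (hc.Dv _)).trans (le_of_eq ?_)
      refine integral_congr_ae ?_; filter_upwards [ae_mu ϖ] with p hp; rw [gr, eX, Dv_wLap_iterate_comm hQ.smU _ _ _ hp]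

end

section

variable {f g U : Amb n → ℝ} {O : Set (Amb n)}

/-! ### Linearity and locality -/

lemma Dv_comb (hf : SmU f) (hg : SmU g) (c : ℝ) (v : Υ) :
    EqOn (Dv v fun p => c * f p + g p) (fun p => c * Dv v f p + Dv v g p) ℍ := fun p hp => by
  have h1 := hf.differentiableAt hp
  simp only [Dv]
  rw [fderiv_fun_add (h1.const_mul c) (hg.differentiableAt hp), fderiv_const_mul h1]
  simp

lemma dy_comb (hf : SmU f) (hg : SmU g) (c : ℝ) :
    EqOn (dy fun p => c * f p + g p) (fun p => c * dy f p + dy g p) ℍ := fun p hp =>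
  (((hf.hasDerivAt_slice p.1 hp).const_mul c).add (hg.hasDerivAt_slice p.1 hp)).deriv

lemma SmU.comb (hf : SmU f) (hg : SmU g) (c : ℝ) :
    SmU fun p => c * f p + g p := (contDiffOn_const.mul hf).add hg

lemma LX_comb (hf : SmU f) (hg : SmU g) (c : ℝ) :
    EqOn (LX fun p => c * f p + g p) (fun p => c * LX f p + LX g p) ℍ := fun p hp => by
  simp only
  rw [(hf.comb hg c).LX_eq hp, hf.LX_eq hp, hg.LX_eq hp, mul_sum, ← sum_add_distrib]
  refine sum_congr rfl fun i _ => ?_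
  rw [Dv_congr (Dv_comb hf hg c _) _ hp, Dv_comb (hf.Dv _) (hg.Dv _) c _ hp]

lemma wLap_comb (hf : SmU f) (hg : SmU g) (m c : ℝ) :
    EqOn (wLap m fun p => c * f p + g p) (fun p => c * wLap m f p + wLap m g p) ℍ :=
  fun p hp => by
    simp only [wLap_eq, opT]
    rw [LX_comb hf hg c hp, dy_congr (dy_comb hf hg c) hp, dy_comb hf hg c hp, dy_comb hf.dy hg.dy c hp]; ring

lemma wLap_iterate_comb (hf : SmU f) (hg : SmU g) (m c : ℝ) (j : ℕ) :
    EqOn ((wLap m)^[j] fun p => c * f p + g p) (fun p => c * (wLap m)^[j] f p + (wLap m)^[j] g p) ℍ := by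
  induction j generalizing f g with
  | zero => exact fun p _ => rfl
  | succ j ih => exact (wLap_iterate_congr (wLap_comb hf hg m c) j).trans (ih (hf.wLap m) (hg.wLap m))

lemma gr_congr (h : EqOn f g ℍ) (o : Option (Fin n)) :
    EqOn (gr o f) (gr o g) ℍ := by
  cases o with
  | none => exact dy_congr h
  | some i => exact Dv_congr h _

lemma kop_congr (h : EqOn f g ℍ) (m : ℝ) (k : ℕ) (o : Option (Fin n)) :
    EqOn (kop m k o f) (kop m k o g) ℍ := by
  unfold kop
  split_ifs
  · exact wLap_iterate_congr h _
  · exact fun p _ => rfl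
  · exact gr_congr (wLap_iterate_congr h _) o

lemma kop_comb (hf : SmU f) (hg : SmU g) (m c : ℝ) (k : ℕ) (o : Option (Fin n)) :
    EqOn (kop m k o fun p => c * f p + g p) (fun p => c * kop m k o f p + kop m k o g p) ℍ := by
  unfold kop
  split_ifs
  · exact wLap_iterate_comb hf hg m c _
  · exact fun p _ => by simp
  · refine (gr_congr (wLap_iterate_comb hf hg m c _) o).trans ?_; cases o with
    | none => exact dy_comb (hf.wLap_iterate _ _) (hg.wLap_iterate _ _) c
    | some i => exact Dv_comb (hf.wLap_iterate _ _) (hg.wLap_iterate _ _) c _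

lemma kop_sub (hf : SmU f) (hg : SmU g) (m : ℝ) (k : ℕ) (o : Option (Fin n)) :
    EqOn (kop m k o fun p => f p - g p) (fun p => kop m k o f p - kop m k o g p) ℍ :=
  fun p hp => by
    rw [kop_congr (g := fun p => -1 * g p + f p) (fun q _ => by ring) m k o hp, kop_comb hg hf m (-1) k o hp]; ring

lemma eqOn_zero_kop (hO : IsOpen O) (h : EqOn f 0 O)
    (m : ℝ) (k : ℕ) (o : Option (Fin n)) : EqOn (kop m k o f) 0 O := by
  unfold kop
  split_ifs
  · exact eqOn_zero_wLap_iterate hO h m _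
  · exact fun p _ => rfl
  · cases o with
    | none => exact eqOn_zero_dy hO (eqOn_zero_wLap_iterate hO h m _)
    | some i => exact eqOn_zero_Dv hO (eqOn_zero_wLap_iterate hO h m _) _

lemma LX_iterate_comb (hf : SmU f) (hg : SmU g) (c : ℝ) (j : ℕ) :
    EqOn (LX^[j] fun p => c * f p + g p) (fun p => c * LX^[j] f p + LX^[j] g p) ℍ := by
  induction j generalizing f g with
  | zero => exact fun p _ => rfl
  | succ j ih => exact (LX_iterate_congr (LX_comb hf hg c) j).trans (ih hf.LX hg.LX)

lemma eqOn_zero_LX_iterate (hO : IsOpen O) (h : EqOn f 0 O)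
    (j : ℕ) : EqOn (LX^[j] f) 0 O := by
  induction j generalizing f with
  | zero => exact h
  | succ j ih => exact ih (eqOn_zero_LX hO h)

lemma xop_comb (hf : SmU f) (hg : SmU g) (c : ℝ) (k : ℕ) (o : Option (Fin n)) :
    EqOn (xop k o fun p => c * f p + g p) (fun p => c * xop k o f p + xop k o g p) ℍ := by
  unfold xop
  split_ifs
  · exact LX_iterate_comb hf hg c _
  · exact fun p _ => by simp
  · cases o with
    | none => exact fun p _ => by simp
    | some i =>
      exact EqOn.trans (LX_iterate_congr (Dv_comb hf hg c (eX i)) (k / 2)) (LX_iterate_comb (hf.Dv _) (hg.Dv _) c _)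

lemma eqOn_zero_xop (hO : IsOpen O) (h : EqOn f 0 O)
    (k : ℕ) (o : Option (Fin n)) : EqOn (xop k o f) 0 O := by
  unfold xop
  split_ifs
  · exact eqOn_zero_LX_iterate hO h _
  · exact fun p _ => rfl
  · cases o with
    | none => exact fun p _ => rfl
    | some i => exact eqOn_zero_LX_iterate hO (eqOn_zero_Dv hO h _) _

lemma SmU.LX_iterate (h : SmU U) (j : ℕ) : SmU (LX^[j] U) := by
  induction j generalizing U with
  | zero => exact h
  | succ j ih => exact ih h.LX

protected lemma SmU.xop (h : SmU U) (k : ℕ) (o : Option (Fin n)) : SmU (xop k o U) := by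
  unfold xop
  split_ifs
  · exact h.LX_iterate _
  · exact contDiffOn_const
  · cases o with
    | none => exact contDiffOn_const
    | some i => exact (h.Dv _).LX_iterate _

/-! ### A Liouville theorem -/

lemma eq_zero_of_bLap_eq_zero (hn : 1 ≤ n) {u : Ξ → ℝ} (hu : C∞ u)
    (h0 : ∀ x, bLap u x = 0) (i0 : MemLp u 2)
    (i1 : ∀ i, MemLp (fun x => fderiv ℝ u x (single i 1)) 2)
    (i2 : ∀ i, MemLp (fun x => fderiv ℝ (fun z => fderiv ℝ u z (single i 1)) x
      (single i 1)) 2) : u = 0 := by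
  have hd (i : Fin n) : C∞ fun x => fderiv ℝ u x (single i 1) :=
    (hu.fderiv_right (m := ∞) (by simp)).clm_apply contDiff_const
  have ibp (i : Fin n) := integral_mul_fderiv_eq_neg_fderiv_mul_of_integrable
   
   
    ((i1 i).integrable_mul (i1 i)) (i0.integrable_mul (i2 i)) (i0.integrable_mul (i1 i))
    (fun x _ => hu.differentiable (by simp) x) fun x _ => (hd i).differentiable (by simp) x
  have sum0 : ∑ i, ∫ x, fderiv ℝ u x (single i 1) * fderiv ℝ u x (single i 1) = 0 := by
    have : ∑ i, ∫ x, u x * fderiv ℝ (fun z => fderiv ℝ u z (single i 1)) x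
        (single i 1) = 0 := by
      have i3 i : Integrable fun x => u x * fderiv ℝ (fun z => fderiv ℝ u z
          (single i 1)) x (single i 1) := i0.integrable_mul (i2 i)
      rw [← integral_finsetSum _ fun i _ => i3 i]; refine integral_eq_zero_of_ae (ae_of_all _ fun x => ?_); simp only [← mul_sum]; rw [← bLap_eq_sum ((hu.of_le (by norm_cast)).contDiffAt), h0]; simp
    rw [← neg_eq_zero, ← sum_neg_distrib, ← this]; exact sum_congr rfl fun i _ => (ibp i).symm
  have z i x : fderiv ℝ u x (single i 1) = 0 := by
    have c := (hd i).continuous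
    exact mul_self_eq_zero.1 (congrFun ((Continuous.ae_eq_iff_eq volume (c.mul c) continuous_const).1 ((integral_eq_zero_iff_of_nonneg (fun x => mul_self_nonneg _) ((i1 i).integrable_mul (i1 i))).1 ((Finset.sum_eq_zero_iff_of_nonneg fun i _ => integral_nonneg fun x => mul_self_nonneg _).1 sum0 i (Finset.mem_univ _)))) x)
  have fz x : fderiv ℝ u x = 0 := by
    refine ContinuousLinearMap.coe_injective ((EuclideanSpace.basisFun (Fin n) ℝ).toBasis.ext fun i => ?_)
    simpa using z i x
  have cst x := is_const_of_fderiv_eq_zero (hu.differentiable (by simp)) fz x 0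
  have e := funext cst
  have : Nonempty (Fin n) := ⟨⟨0, hn⟩⟩
  rw [e, memLp_const_iff (by simp) (by simp)] at i0
  rcases i0 with h | h
  · rw [e, h]; rfl
  · simp at h

/-- Almost every horizontal slice of the tangential derivatives up to order `k` is square
integrable. -/
def SliceL2 (k : ℕ) (U : Ψ) : Prop :=
  ∀ α : List (Fin n), α.length ≤ k → ∀ᵐ y ∂(volume.restrict (Ioi (0 : ℝ))),
    MemLp (fun x => dxs α U (x, y)) 2 (volume : Measure Ξ)

lemma dxs_congr {V : Ψ} (h : EqOn U V ℍ) (α : List (Fin n)) :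
    EqOn (dxs α U) (dxs α V) ℍ := by
  induction α with
  | nil => exact h
  | cons i α ih => exact Dv_congr ih _

lemma dxs_append (α β : List (Fin n)) (U : Ψ) : dxs (α ++ β) U = dxs α (dxs β U) := by simp [dxs]

lemma dxs_sum {ι : Type*} (t : Finset ι) {U : ι → Ψ} (hU : ∀ i, SmU (U i)) (α : List (Fin n)) :
    EqOn (dxs α fun p => ∑ i ∈ t, U i p) (fun p => ∑ i ∈ t, dxs α (U i) p) ℍ := by
  induction α with
  | nil => exact fun p _ => rfl
  | cons a α ih =>
    refine (Dv_congr ih _).trans fun p hp => ?_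
    change fderiv ℝ (fun p => ∑ i ∈ t, dxs α (U i) p) p (eX a) = _; rw [fderiv_fun_sum (fun i _ => ((hU i).dxs α).differentiableAt hp)]; simp [dxs, Dv]

protected lemma SliceL2.LX {k : ℕ} (hU : SmU U) (h : SliceL2 (k + 2) U) : SliceL2 k (LX U) := by
  intro α hα
  have h1 : ∀ᵐ y ∂(volume.restrict (Ioi (0 : ℝ))), ∀ i : Fin n,
      MemLp (fun x => dxs (α ++ [i, i]) U (x, y)) 2 (volume : Measure Ξ) :=
    ae_all_iff.2 fun i => h _ (by simp; omega)
  filter_upwards [h1, ae_restrict_mem measurableSet_Ioi] with y hy hy0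
  have e : (fun x => dxs α (LX U) (x, y)) = fun x => ∑ i, dxs (α ++ [i, i]) U (x, y) := by
    funext x; have hp := hy0; rw [dxs_congr hU.LX_eq α hp, dxs_sum _ (fun i => (hU.Dv _).Dv _) α hp]; simp only [dxs_append]; rfl
  rw [e]
  exact memLp_finsetSum _ fun i _ => hy i

lemma eqOn_zero_of_ae (hf : SmU f)
    (h : ∀ᵐ y ∂(volume.restrict (Ioi (0 : ℝ))), ∀ x : Ξ, f (x, y) = 0) : EqOn f 0 ℍ := by
  rintro ⟨x, y⟩ hp
  exact Measure.eqOn_open_of_ae_eq (by filter_upwards [h] with y hy using hy x) isOpen_Ioi (fun y hy =>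
    (hf.hasDerivAt_slice x hy).continuousAt.continuousWithinAt) continuousOn_const hp

lemma eqOn_zero_of_LX_iterate (hn : 1 ≤ n) (l : ℕ) (hU : SmU U)
    (h : SliceL2 (2 * l) U) (h0 : EqOn (LX^[l] U) 0 ℍ) : EqOn U 0 ℍ := by
  induction l generalizing U with
  | zero => exact h0
  | succ l ih =>
    have h1 := ih hU.LX (SliceL2.LX hU h) h0; refine eqOn_zero_of_ae hU ?_; have e1 : ∀ᵐ y ∂(volume.restrict (Ioi (0 : ℝ))), ∀ i : Fin n,
        MemLp (fun x => dxs [i] U (x, y)) 2 (volume : Measure Ξ) :=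
      ae_all_iff.2 fun i => h _ (by simp; omega)
    have e2 : ∀ᵐ y ∂(volume.restrict (Ioi (0 : ℝ))), ∀ i : Fin n,
        MemLp (fun x => dxs [i, i] U (x, y)) 2 (volume : Measure Ξ) :=
      ae_all_iff.2 fun i => h _ (by simp)
    filter_upwards [h [] (by simp), e1, e2, ae_restrict_mem measurableSet_Ioi] with y g0 g1 g2 hy
    have c {f : Ψ} (hf : SmU f) : C∞ fun x => f (x, y) :=
      contDiffOn_univ.1 (hf.comp (f := fun x : Ξ => (x, y)) (by fun_prop) fun x _ => hy)
    have d {f : Ψ} (hf : SmU f) (i : Fin n) : (fun x =>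
        fderiv ℝ (fun x => f (x, y)) x (single i 1)) = fun x => Dv (eX i) f (x, y) :=
      funext fun x => slice_eq_Dv (p := (x, y)) (hf.differentiableAt hy) _
    refine fun x => congrFun (eq_zero_of_bLap_eq_zero hn (c hU) (fun x => h1 (x := (x, y)) hy) g0
      (fun i => ?_) fun i => ?_) x
    · rw [d hU]; exact g1 i
    · rw [d hU, d (hU.Dv _)]; exact g2 i

lemma eqOn_zero_of_xop (hn : 1 ≤ n) (k : ℕ) (hU : SmU U)
    (h : SliceL2 k U) (h0 : ∀ o, EqOn (xop k o U) 0 ℍ) : EqOn U 0 ℍ := by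
  by_cases hk : Even k
  · have h1 := h0 none; simp only [xop, hk] at h1; refine eqOn_zero_of_LX_iterate hn (k / 2) hU (fun α hα => h α (by omega)) h1
  · have h1 i : EqOn (Dv (eX i) U) 0 ℍ := by
      have h2 := h0 (some i); simp only [xop, hk] at h2; refine eqOn_zero_of_LX_iterate hn (k / 2) (hU.Dv _) (fun α hα => ?_) h2
      have hk' := Nat.not_even_iff_odd.1 hk; have := h (α ++ [i]) (by obtain ⟨r, rfl⟩ := hk'; simp; omega); rwa [dxs_append] at this
    have hk' := Nat.not_even_iff_odd.1 hk; refine eqOn_zero_of_ae hU ?_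
    filter_upwards [h [] (by simp), ae_restrict_mem measurableSet_Ioi] with y g0 hy
    have d {f : Ψ} (hf : SmU f) (i : Fin n) : (fun x =>
        fderiv ℝ (fun x => f (x, y)) x (single i 1)) = fun x => Dv (eX i) f (x, y) :=
      funext fun x => slice_eq_Dv (p := (x, y)) (hf.differentiableAt hy) _
    have z i : (fun x =>
        fderiv ℝ (fun x => U (x, y)) x (single i 1)) = 0 := by
      rw [d hU]; exact funext fun x => h1 i hy
    have c : C∞ fun x => U (x, y) :=
      contDiffOn_univ.1 (hU.comp (f := fun x : Ξ => (x, y)) (by fun_prop) fun x _ => hy)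
    have z2 (i : Fin n) : (fun x => fderiv ℝ (fun z => fderiv ℝ (fun x => U (x, y)) z
      (single i 1)) x (single i 1)) = 0 := by
      rw [z i]; ext x; simp
    refine fun x => congrFun (eq_zero_of_bLap_eq_zero hn c (fun x => ?_) g0 (fun i => ?_) fun i => ?_) x
    · rw [bLap_eq_sum ((c.of_le (by norm_cast)).contDiffAt)]
      exact sum_eq_zero fun i _ => congrFun (z2 i) x
    · rw [z i]; exact MemLp.zero
    · rw [z2 i]; exact MemLp.zero

end

section

variable {y₀ s m : ℝ} {U F V : Amb n → ℝ} {k N : ℕ} {p : Amb n}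

local notation "ϖ" => 1 - 2 * s

/-! ### Decay of the lower order derivatives -/

/-- Derivatives of order `k` are in weighted `L²`, lower order derivatives on slabs. -/
structure FE (m : ℝ) (k : ℕ) (U : Ψ) : Prop where
  smooth : SmU U
  slab : ∀ Y : ℝ, 0 < Y → ∀ j ≤ k,
    IntegrableOn (fun p => ‖𝒟 j U p‖ ^ 2) {p | p.2 < Y} (mu m)
  top : Integrable (fun p => ‖𝒟 k U p‖ ^ 2) (mu m)

lemma hardy_tail {κ : ℝ} (hκ : 0 < κ) (hy₀ : 0 < y₀) {ψ u : ℝ → ℝ} (hψ : Continuous ψ)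
    (hu0 : ∀ y, 0 ≤ u y) (hu : ∀ y, y₀ ≤ y → u y ≤ u y₀ + ∫ t in y₀..y, ψ t) :
    ∫⁻ y in Ioi y₀, ofReal (y ^ (-κ - 1) * u y ^ 2) ≤ ofReal (2 / κ * (y₀ ^ (-κ) * u y₀ ^ 2)) +
        ofReal (4 / κ ^ 2) * ∫⁻ y in Ioi y₀, ofReal (y ^ (1 - κ) * ψ y ^ 2) := by
  set G : ℝ → ℝ := fun y => u y₀ + ∫ t in y₀..y, ψ t
  have hG : ∀ y, HasDerivAt G (ψ y) y := fun y => (hψ.integral_hasStrictDerivAt y₀ y).hasDerivAt.const_add _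
  have cG : Continuous G := continuous_iff_continuousAt.2 fun y => (hG y).continuousAt
  have pow_cont (e Y : ℝ) (hY : y₀ ≤ Y) : ContinuousOn (fun y : ℝ => y ^ e) (uIcc y₀ Y) := by
    rw [uIcc_of_le hY]
    exact fun y hy => (continuousAt_rpow_const _ _ (Or.inl (hy₀.trans_le hy.1).ne')).continuousWithinAt
  have c (e : ℝ) {F : ℝ → ℝ} (hF : Continuous F) {Y : ℝ} (hY : y₀ ≤ Y) :
      IntervalIntegrable (fun y => y ^ e * F y ^ 2) volume y₀ Y :=
    ((pow_cont e Y hY).mul (hF.pow 2).continuousOn).intervalIntegrable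
  have key (Y : ℝ) (hY : y₀ ≤ Y) : ∫ y in y₀..Y, y ^ (-κ - 1) * G y ^ 2 ≤
      2 / κ * (y₀ ^ (-κ) * u y₀ ^ 2) + 4 / κ ^ 2 * ∫ y in y₀..Y, y ^ (1 - κ) * ψ y ^ 2 := by
    have der {y : ℝ} (hy : y₀ ≤ y) := ((hasDerivAt_rpow_const (p := -κ) (Or.inl (hy₀.trans_le hy).ne')).mul
      ((hG y).pow 2)).const_mul (2 / κ)
    have mono := intervalIntegral.sub_le_integral_of_hasDeriv_right_of_le hY
      (φ := fun y => 4 / κ ^ 2 * (y ^ (1 - κ) * ψ y ^ 2) - y ^ (-κ - 1) * G y ^ 2)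
      (fun y hy => (der hy.1).continuousAt.continuousWithinAt) (fun y hy => (der hy.1.le).hasDerivWithinAt)
      ((intervalIntegrable_iff_integrableOn_Icc_of_le hY).1 (((c _ hψ hY).const_mul _).sub (c _ cG hY))) fun y hy => by
        have hy' : 0 < y := hy₀.trans hy.1
        have e1 : y ^ (-κ) = y ^ (-κ - 1) * y := by rw [← rpow_add_one hy'.ne']; ring_nf
        have e2 : y ^ (1 - κ) = y ^ (-κ - 1) * y * y := by
          rw [← rpow_add_one hy'.ne', ← rpow_add_one hy'.ne']; ring_nf
        have := mul_nonneg (rpow_nonneg hy'.le (-κ - 1)) (sq_nonneg (G y - 2 / κ * y * ψ y))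
        have hk : 2 / κ * κ = 2 := by field_simp
        simp only [Pi.pow_apply, e1, e2]; push_cast; linear_combination this - y ^ (-κ - 1) * G y ^ 2 * hk
    rw [intervalIntegral.integral_sub ((c _ hψ hY).const_mul _) (c _ cG hY), intervalIntegral.integral_const_mul] at mono
    simp only [Pi.mul_apply, Pi.pow_apply, show G y₀ = u y₀ by simp [G]] at mono
    have := mul_nonneg (div_nonneg two_pos.le hκ.le) (mul_nonneg (rpow_nonneg (hy₀.le.trans hY) (-κ)) (sq_nonneg (G Y)))
    linarith
  conv_lhs => rw [show Ioi y₀ = ⋃ N : ℕ, Ioc y₀ (y₀ + N) by ext y; simp only [mem_Ioi, mem_iUnion, mem_Ioc]; refine ⟨fun h => ?_, fun ⟨_, h⟩ => h.1⟩; obtain ⟨N, hN⟩ := exists_nat_ge (y - y₀); exact ⟨N, h, by linarith⟩]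
  rw [setLIntegral_iUnion_of_directed _ ((monotone_nat_of_le_succ fun N => Ioc_subset_Ioc_right (by push_cast; linarith)).directed_le)]
  refine iSup_le fun N => ?_
  have hN : y₀ ≤ y₀ + N := by simp
  have int (F : ℝ → ℝ) (hF : Continuous F) (e : ℝ) : ∫⁻ y in Ioc y₀ (y₀ + N), ofReal (y ^ e * F y ^ 2) =
        ofReal (∫ y in y₀..(y₀ + N), y ^ e * F y ^ 2) := by
    rw [intervalIntegral.integral_of_le hN, ofReal_integral_eq_lintegral_ofReal]
    · exact (intervalIntegrable_iff_integrableOn_Ioc_of_le hN).1 (c e hF hN)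
    · filter_upwards [ae_restrict_mem measurableSet_Ioc] with y hy
      exact mul_nonneg (rpow_nonneg (hy₀.trans hy.1).le _) (sq_nonneg _)
  have h1 : 0 ≤ ∫ y in y₀..(y₀ + N), y ^ (1 - κ) * ψ y ^ 2 := intervalIntegral.integral_nonneg hN fun y hy => mul_nonneg (rpow_nonneg (hy₀.le.trans hy.1) _) (sq_nonneg _)
  calc ∫⁻ y in Ioc y₀ (y₀ + N), ofReal (y ^ (-κ - 1) * u y ^ 2)
      ≤ ∫⁻ y in Ioc y₀ (y₀ + N), ofReal (y ^ (-κ - 1) * G y ^ 2) := by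
        refine setLIntegral_mono' measurableSet_Ioc fun y hy => ofReal_le_ofReal ?_
        have := rpow_nonneg (hy₀.trans hy.1).le (-κ - 1); have h2 := hu y hy.1.le; have h3 := hu0 y; gcongr
    _ ≤ ofReal (2 / κ * (y₀ ^ (-κ) * u y₀ ^ 2) + 4 / κ ^ 2 * ∫ y in y₀..(y₀ + N), y ^ (1 - κ) * ψ y ^ 2) := by
        rw [int G cG]; exact ofReal_le_ofReal (key _ hN)
    _ = ofReal (2 / κ * (y₀ ^ (-κ) * u y₀ ^ 2)) + ofReal (4 / κ ^ 2) *
        ∫⁻ y in Ioc y₀ (y₀ + N), ofReal (y ^ (1 - κ) * ψ y ^ 2) := by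
        have := rpow_nonneg hy₀.le (-κ); rw [ofReal_add pos! pos!, int ψ hψ,
          ofReal_mul (p := 4 / κ ^ 2) pos!]
    _ ≤ _ := by gcongr; exact Ioc_subset_Ioi_self

lemma SmU.continuousOn_iteratedFDeriv (h : SmU U) (i : ℕ) :
    ContinuousOn (𝒟 i U) ℍ := fun _ hp => ContinuousAt.continuousWithinAt
  ((h.contDiffAt hp).iteratedFDeriv_right (m := 0) (by simp; exact_mod_cast le_top) |>.continuousAt)

lemma norm_iteratedFDeriv_le_add_integral (h : SmU U) (j : ℕ) (x : Ξ)
    {y : ℝ} (hy₀ : 0 < y₀) (hy : y₀ ≤ y) :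
    ‖𝒟 j U (x, y)‖ ≤ ‖𝒟 j U (x, y₀)‖ +
      ∫ t in y₀..y, ‖𝒟 (j + 1) U (x, t)‖ := by
  have sub : ∀ t ∈ uIcc y₀ y, (x, t) ∈ ℍ := fun t ht => by rw [uIcc_of_le hy] at ht; exact hy₀.trans_le ht.1
  have h' : ContDiffOn ℝ 1 (𝒟 j U) ℍ := fun p hp =>
    ((h.contDiffAt hp).iteratedFDeriv_right (by norm_cast; exact le_top)).contDiffWithinAt
  have c : ContinuousOn (fun t => (x, t)) (uIcc y₀ y) := by fun_prop
  have ftc := intervalIntegral.integral_eq_sub_of_hasDerivAt (f := fun t => 𝒟 j U (x, t))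
    (fun t ht => ((h'.contDiffAt (isOpen_upper.mem_nhds (sub t ht))).differentiableAt
      (by simp)).hasFDerivAt.comp_hasDerivAt t ((hasDerivAt_const t x).prodMk (hasDerivAt_id t)))
    (((h'.continuousOn_fderiv_of_isOpen isOpen_upper le_rfl).comp c sub).clm_apply continuousOn_const).intervalIntegrable
  rw [← sub_add_cancel (𝒟 j U (x, y)) (𝒟 j U (x, y₀)), ← ftc, add_comm]
  refine (norm_add_le _ _).trans (add_le_add le_rfl (intervalIntegral.norm_integral_le_of_norm_le hy
    (ae_of_all _ fun t _ => ?_) ((h.continuousOn_iteratedFDeriv (j + 1)).comp c sub).norm.intervalIntegrable))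
  rw [← norm_fderiv_iteratedFDeriv]
  exact (le_opNorm _ _).trans (mul_le_of_le_one_right (norm_nonneg _) norm_eY_le)

lemma measurable_indicator_upper (hF : ContinuousOn F ℍ) :
    Measurable ((ℍ).indicator F) := by
  classical
  rw [← Set.piecewise_eq_indicator]
  exact hF.measurable_piecewise continuousOn_const measurableSet_upper

lemma lintegral_mu_strip (m : ℝ) (hF : ContinuousOn F ℍ) {S : Set ℝ}
    (hS : MeasurableSet S) (hS0 : S ⊆ Ioi 0) :
    (Measurable fun x : Ξ => ∫⁻ y in S, ofReal (y ^ m * F (x, y))) ∧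
    ∫⁻ p in {p : Υ | p.2 ∈ S}, ofReal (F p) ∂mu m =
      ∫⁻ x : Ξ, ∫⁻ y in S, ofReal (y ^ m * F (x, y)) := by
  have hS' : MeasurableSet {p : Υ | p.2 ∈ S} := measurable_snd hS
  set H : Υ → ENNReal := {p : Υ | p.2 ∈ S}.indicator
    fun p => ofReal (p.2 ^ m) * ofReal ((ℍ).indicator F p)
  have hH : Measurable H := Measurable.indicator (by
    have := measurable_indicator_upper hF; have := measurable_rpow_snd (n := n) m; fun_prop) hS'
  have e x : ∫⁻ y in S, ofReal (y ^ m * F (x, y)) = ∫⁻ y, H (x, y) := by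
    rw [← lintegral_indicator hS]; refine lintegral_congr fun y => ?_; by_cases hy : y ∈ S
    · have hy0 : (0 : ℝ) < y := hS0 hy; have : (x, y) ∈ ℍ := hy0; simp [H, hy, this, ofReal_mul (rpow_nonneg hy0.le m)]
    · simp [H, hy]
  refine ⟨?_, ?_⟩
  · simp_rw [e]; exact hH.lintegral_prod_right'
  · simp_rw [e]; rw [← lintegral_prod _ hH.aemeasurable, ← Measure.volume_eq_prod, ← lintegral_indicator hS']
    have e2 : ∫⁻ p, {p : Υ | p.2 ∈ S}.indicator (fun p => ofReal (F p)) p ∂mu m =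
        ∫⁻ p, {p : Υ | p.2 ∈ S}.indicator (fun p => ofReal ((ℍ).indicator F p)) p ∂mu m := by
      refine lintegral_congr fun p => ?_; by_cases hp : p.2 ∈ S
      · have : p ∈ ℍ := hS0 hp; simp [hp, this]
      · simp [hp]
    rw [e2, lintegral_mu m (Measurable.indicator (by
      have := measurable_indicator_upper hF; fun_prop) hS'), ← lintegral_indicator measurableSet_upper]
    refine lintegral_congr fun p => ?_; by_cases hp : p.2 ∈ S
    · have : p ∈ ℍ := hS0 hp; simp [hp, this, H]
    · simp [hp, H]

lemma FE.integrableOn_tail (hs0 : 0 < s)     (h : FE ϖ k U) (i : ℕ) (hi : i ≤ k) :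
    ∫⁻ p in {p : Υ | p.2 ∈ Ioi 1}, ofReal
      (p.2 ^ (-(2 * i : ℝ)) * ‖𝒟 (k - i) U p‖ ^ 2) ∂mu ϖ < ⊤ := by
  have cpow (e : ℝ) : ContinuousOn (fun p : Υ => p.2 ^ e) ℍ := (contDiffOn_rpow_snd e).continuousOn
  have cn j : ContinuousOn (fun p => ‖𝒟 j U p‖ ^ 2) ℍ :=
    (h.smooth.continuousOn_iteratedFDeriv j).norm.pow 2
  have sub {a : ℝ} (ha : 0 ≤ a) : Ioi a ⊆ Ioi (0 : ℝ) := Ioi_subset_Ioi ha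
  induction i with
  | zero =>
    refine lt_of_le_of_lt (lintegral_mono' Measure.restrict_le_self le_rfl) ?_
    simpa using h.top.lintegral_lt_top
  | succ i ih =>
    have ih := ih (by omega); set j := k - (i + 1) with hj; rw [show k - i = j + 1 by omega] at ih; set κ : ℝ := 2 * s + 2 * i with hκ; have hκ0 : 0 < κ := pos!
    have slab (F : Ψ) (hF : ∀ p ∈ {p : Υ | p.2 ∈ Ioc 1 2}, F p ≤ ‖𝒟 j U p‖ ^ 2) :
        ∫⁻ p in {p : Υ | p.2 ∈ Ioc 1 2}, ofReal (F p) ∂mu ϖ < ⊤ := by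
      refine lt_of_le_of_lt ?_ ((h.slab 3 (by norm_num) j (by omega)).lintegral_lt_top)
      refine (setLIntegral_mono' (measurable_snd measurableSet_Ioc) fun p hp =>
        ofReal_le_ofReal (hF p hp)).trans (lintegral_mono_set fun p hp => ?_)
      have : p.2 ≤ 2 := hp.2; show p.2 < 3; linarith
    rw [show {p : Υ | p.2 ∈ Ioi 1} = {p : Υ | p.2 ∈ Ioc 1 2} ∪ {p : Υ | p.2 ∈ Ioi 2} by ext p; change p.2 ∈ Ioi 1 ↔ p.2 ∈ Ioc 1 2 ∪ Ioi 2; rw [Ioc_union_Ioi_eq_Ioi (by norm_num)]]; refine (lintegral_union_le _ _ _).trans_lt (ENNReal.add_lt_top.2 ⟨slab _ fun p hp => ?_, ?_⟩)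
    · have : p.2 ^ (-(2 * ((i + 1 : ℕ) : ℝ))) ≤ 1 :=
        rpow_le_one_of_one_le_of_nonpos hp.1.le (by push_cast; linarith)
      exact mul_le_of_le_one_left (sq_nonneg _) this
    have cF : ContinuousOn (fun p : Υ => p.2 ^ (-(2 * ((i + 1 : ℕ) : ℝ))) *
      ‖𝒟 j U p‖ ^ 2) ℍ := (cpow _).mul (cn j)
    have cF' : ContinuousOn (fun p : Υ => p.2 ^ (-(2 * (i : ℝ))) *
      ‖𝒟 (j + 1) U p‖ ^ 2) ℍ := (cpow _).mul (cn (j + 1))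
    obtain ⟨-, e1⟩ := lintegral_mu_strip ϖ cF measurableSet_Ioi (sub (by norm_num : (0 : ℝ) ≤ 2))
    obtain ⟨m2, e2⟩ := lintegral_mu_strip ϖ cF' measurableSet_Ioi (sub zero_le_one)
    obtain ⟨m0, e0⟩ := lintegral_mu_strip ϖ (cn j) (measurableSet_Ioc (a := 1) (b := 2))
      (Ioc_subset_Ioi_self.trans (sub zero_le_one))
    rw [e1]; rw [e2] at ih; have main (x : Ξ) : ∫⁻ y in Ioi 2, ofReal (y ^ ϖ *
          (y ^ (-(2 * ((i + 1 : ℕ) : ℝ))) * ‖𝒟 j U (x, y)‖ ^ 2)) ≤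
        ofReal (2 / κ) * (∫⁻ y in Ioc 1 2, ofReal (y ^ ϖ *
          ‖𝒟 j U (x, y)‖ ^ 2)) + ofReal (4 / κ ^ 2) *
          ∫⁻ y in Ioi 1, ofReal (y ^ ϖ * (y ^ (-(2 * (i : ℝ))) *
            ‖𝒟 (j + 1) U (x, y)‖ ^ 2)) := by
      set L := ∫⁻ y in Ioi 2, ofReal (y ^ ϖ *
          (y ^ (-(2 * ((i + 1 : ℕ) : ℝ))) * ‖𝒟 j U (x, y)‖ ^ 2))
      set T := ∫⁻ y in Ioi 1, ofReal (y ^ ϖ * (y ^ (-(2 * (i : ℝ))) *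
            ‖𝒟 (j + 1) U (x, y)‖ ^ 2))
      have pt : ∀ y₀ ∈ Ioc (1 : ℝ) 2, L ≤ ofReal (2 / κ) * ofReal (y₀ ^ ϖ *
          ‖𝒟 j U (x, y₀)‖ ^ 2) + ofReal (4 / κ ^ 2) * T := by
        intro y₀ hy₀; have hp : 0 < y₀ := by linarith [hy₀.1]
        have cψ : Continuous fun t : ℝ => ‖𝒟 (j + 1) U (x, max t y₀)‖ := by
          have := (h.smooth.continuousOn_iteratedFDeriv (j + 1)).comp_continuous
            (f := fun t : ℝ => ((x, max t y₀) : Υ)) (by fun_prop)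
            (fun t => lt_of_lt_of_le hp (le_max_right _ _))
          exact this.norm
        calc L = ∫⁻ y in Ioi 2, ofReal (y ^ (-κ - 1) * ‖𝒟 j U (x, y)‖ ^ 2) := by
              refine setLIntegral_congr_fun measurableSet_Ioi fun y hy => ?_
              have hy' : (0 : ℝ) < y := lt_trans (by norm_num) hy; rw [← mul_assoc, ← rpow_add hy']; congr 3; rw [hκ]; push_cast; ring
          _ ≤ ∫⁻ y in Ioi y₀, ofReal (y ^ (-κ - 1) * ‖𝒟 j U (x, y)‖ ^ 2) :=
              lintegral_mono_set (Ioi_subset_Ioi hy₀.2)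
          _ ≤ _ := hardy_tail (u := fun y => ‖𝒟 j U (x, y)‖) hκ0 hp cψ (fun y => norm_nonneg _) fun y hy => by refine (norm_iteratedFDeriv_le_add_integral h.smooth j x hp hy).trans (le_of_eq ?_); congr 1; refine intervalIntegral.integral_congr fun t ht => ?_; rw [uIcc_of_le hy] at ht; simp only [max_eq_left ht.1]
          _ ≤ _ := by
              refine add_le_add ?_ ?_
              · rw [← ofReal_mul pos!]; refine ofReal_le_ofReal ?_
                have : y₀ ^ (-κ) ≤ y₀ ^ ϖ := rpow_le_rpow_of_exponent_le hy₀.1.le (by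
                    have := (Nat.cast_nonneg i : (0 : ℝ) ≤ i); linarith)
                gcongr
              · gcongr; refine (le_of_eq (setLIntegral_congr_fun measurableSet_Ioi fun y hy => ?_)).trans
                  (lintegral_mono_set (Ioi_subset_Ioi hy₀.1.le))
                simp only [max_eq_left (le_of_lt (show y₀ < y from hy))]
                rw [← mul_assoc, ← rpow_add (hp.trans hy)]; congr 3; rw [hκ]; ring
      rw [← show ∫⁻ _ in Ioc (1 : ℝ) 2, L = L by rw [lintegral_const]; norm_num]
      refine (setLIntegral_mono' measurableSet_Ioc pt).trans ?_
      rw [lintegral_add_right _ measurable_const, lintegral_const_mul' _ _ ofReal_ne_top]; norm_num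
    refine (lintegral_mono main).trans_lt ?_
    rw [lintegral_add_left (m0.const_mul _), lintegral_const_mul _ m0, lintegral_const_mul _ m2]
    refine ENNReal.add_lt_top.2 ⟨mul_lt_top ofReal_lt_top ?_,
      mul_lt_top ofReal_lt_top ih⟩
    rw [← e0]; exact slab _ fun p _ => le_rfl

lemma FE.integrable_weighted (hs0 : 0 < s)     (h : FE ϖ k U) (i : ℕ) (hi : i ≤ k) :
    Integrable (fun p => (min 1 p.2⁻¹) ^ (2 * i) * ‖𝒟 (k - i) U p‖ ^ 2) (mu ϖ) := by
  have meas : AEStronglyMeasurable (fun p : Υ => (min 1 p.2⁻¹) ^ (2 * i) * ‖𝒟 (k - i) U p‖ ^ 2)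
      (mu ϖ) := by
    refine aestronglyMeasurable_mu (ContinuousOn.mul ?_ ((h.smooth.continuousOn_iteratedFDeriv _).norm.pow 2))
    have : ContinuousOn (fun p : Υ => p.2⁻¹) ℍ :=
      continuousOn_snd.inv₀ fun p hp => (ne_of_gt (show (0 : ℝ) < p.2 from hp))
    exact (ContinuousOn.inf continuousOn_const this).pow _
  have hb : ∀ p ∈ ℍ, 0 ≤ min 1 p.2⁻¹ ∧ min 1 p.2⁻¹ ≤ 1 ∧ min 1 p.2⁻¹ ≤ p.2⁻¹ := fun p hp =>
    ⟨le_min zero_le_one (inv_nonneg.2 (le_of_lt hp)), min_le_left _ _, min_le_right _ _⟩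
  rw [← integrableOn_univ, show (univ : Set Υ) = {p | p.2 < 2} ∪ {p | p.2 ∈ Ioi 1} by
    ext p; simp only [mem_univ, true_iff]; rcases lt_or_ge p.2 2 with h | h
    · exact Or.inl h
    · exact Or.inr (show (1 : ℝ) < p.2 by linarith)]
  refine IntegrableOn.union ?_ ?_
  · refine (h.slab 2 (by norm_num) (k - i) (by omega)).mono' meas.restrict ?_
    filter_upwards [ae_restrict_of_ae (ae_mu (n := n) ϖ)] with p hp; obtain ⟨h1, h2, h3⟩ := hb p hp; rw [norm_of_nonneg pos!]; exact mul_le_of_le_one_left (sq_nonneg _) (pow_le_one₀ h1 h2)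
  · refine ⟨meas.restrict, ?_⟩; rw [hasFiniteIntegral_iff_norm]; refine lt_of_le_of_lt ?_ (h.integrableOn_tail hs0 i hi)
    refine setLIntegral_mono' (measurable_snd measurableSet_Ioi) fun p hp => ofReal_le_ofReal ?_
    have hp1 : (1 : ℝ) < p.2 := hp; obtain ⟨h1, h2, h3⟩ := hb p (lt_trans zero_lt_one hp1)
    rw [norm_of_nonneg pos!, rpow_neg (by linarith), show p.2 ^ (2 * (i : ℝ)) = p.2 ^ (2 * i) by rw [← rpow_natCast]; push_cast; rfl, ← inv_pow]; gcongr

lemma FE.comb (hU : FE m k U) (hV : FE m k V) (c : ℝ) :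
    FE m k fun p => c * U p + V p := by
  have sm := hU.smooth.comb hV.smooth c
  have bd (j : ℕ) : ∀ᵐ p ∂mu m, ‖‖𝒟 j (fun p => c * U p + V p) p‖ ^ 2‖ ≤
      2 * c ^ 2 * ‖𝒟 j U p‖ ^ 2 + 2 * ‖𝒟 j V p‖ ^ 2 := by
    filter_upwards [ae_mu m] with p hp
    have hU' : ContDiffAt ℝ j U p := (hU.smooth.contDiffAt hp).of_le (by exact_mod_cast le_top)
    have hV' : ContDiffAt ℝ j V p := (hV.smooth.contDiffAt hp).of_le (by exact_mod_cast le_top)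
    have e : 𝒟 j (fun p => c * U p + V p) p = c • 𝒟 j U p + 𝒟 j V p := by
      have e0 : (fun p => c * U p + V p) = (fun p => c • U p) + V := rfl
      rw [e0, iteratedFDeriv_add_apply (hU'.const_smul c) hV', iteratedFDeriv_const_smul_apply' hU']
    rw [norm_of_nonneg (sq_nonneg _), e]
    have h1 := norm_add_le (c • 𝒟 j U p) (𝒟 j V p)
    rw [norm_smul, norm_eq_abs] at h1; have h2 := sq_abs c; have h3 := sq_nonneg (|c| * ‖𝒟 j U p‖ - ‖𝒟 j V p‖)
    have h4 := pow_le_pow_left₀ (norm_nonneg _) h1 2; nlinarith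
  have meas (j : ℕ) : AEStronglyMeasurable (fun p => ‖𝒟 j (fun p => c * U p + V p) p‖ ^ 2) (mu m) :=
    aestronglyMeasurable_mu ((sm.continuousOn_iteratedFDeriv j).norm.pow 2)
  exact ⟨sm, fun Y hY j hj => (((hU.slab Y hY j hj).const_mul _).add
    ((hV.slab Y hY j hj).const_mul 2)).mono' (meas j).restrict (ae_restrict_of_ae (bd j)),
    ((hU.top.const_mul _).add (hV.top.const_mul 2)).mono' (meas k) (bd k)⟩

lemma FE.sub (hU : FE m k U) (hV : FE m k V) : FE m k fun p => U p - V p := by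
  convert hV.comb hU (-1) using 2; ring

/-! ### Cutoff functions -/

/-- A smooth cutoff function which is even in `y`, and independent of `y` near `y = 0`. -/
def bump : Ψ := fun p =>
  (⟨1, 2, zero_lt_one, one_lt_two⟩ : ContDiffBump (0 : Ξ)) p.1 *
    (⟨1, 2, zero_lt_one, one_lt_two⟩ : ContDiffBump (0 : ℝ)) p.2

/-- The rescaled cutoff function. -/
def chi (N : ℕ) : Ψ := fun p => bump (((N : ℝ) + 1)⁻¹ • p)

lemma contDiff_bump : C∞ (bump : Ψ) :=
  ((ContDiffBump.contDiff _).comp contDiff_fst).mul ((ContDiffBump.contDiff _).comp contDiff_snd)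

lemma bump_eq_one (hp : ‖p‖ ≤ 1) : bump p = 1 := by
  have h := max_le_iff.1 (Prod.norm_def p ▸ hp)
  rw [bump, ContDiffBump.one_of_mem_closedBall _ (by simpa using h.1),
    ContDiffBump.one_of_mem_closedBall _ (by simpa using h.2), one_mul]

lemma bump_eq_zero (hp : 2 ≤ ‖p‖) : bump p = 0 := by
  rw [Prod.norm_def, le_max_iff] at hp
  rw [bump]
  rcases hp with h | h
  · rw [ContDiffBump.zero_of_le_dist _ (by simpa using h), zero_mul]
  · rw [ContDiffBump.zero_of_le_dist (x := p.2) _ (by simpa using h), mul_zero]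

lemma hasCompactSupport_bump : HasCompactSupport (bump : Ψ) :=
  HasCompactSupport.intro (isCompact_closedBall 0 2) fun p hp => bump_eq_zero (by simp at hp; exact hp.le)

lemma contDiff_chi (N : ℕ) : C∞ (chi N : Ψ) := contDiff_bump.comp (contDiff_const_smul _)

lemma isEvenSmooth_chi (N : ℕ) : IsEvenSmooth (chi N : Ψ) := by
  refine ⟨contDiff_chi N, fun x y => ?_⟩
  simp only [chi, bump, Prod.smul_mk, smul_neg]
  rw [ContDiffBump.neg]

lemma chi_eq_one (hp : ‖p‖ ≤ N + 1) : chi N p = 1 := by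
  refine bump_eq_one ?_
  rw [norm_smul, norm_of_nonneg pos!, inv_mul_le_iff₀ pos!]
  simpa using hp

lemma chi_eq_zero (hp : 2 * (N + 1) ≤ ‖p‖) : chi N p = 0 := by
  refine bump_eq_zero ?_
  rw [norm_smul, norm_of_nonneg pos!, le_inv_mul_iff₀ pos!]
  linarith

lemma cs_chi (N : ℕ) : CS (chi N : Ψ) := ⟨2 * (N + 1), fun _ _ hp => chi_eq_zero hp.le⟩

lemma exists_norm_iteratedFDeriv_chi_le (i : ℕ) : ∃ C : ℝ, 0 ≤ C ∧ ∀ (N : ℕ) (p : Υ),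
    ‖𝒟 i (chi N) p‖ ≤ C * ((N : ℝ) + 1)⁻¹ ^ i := by
  obtain ⟨C, hC⟩ := (contDiff_bump.continuous_iteratedFDeriv (by exact_mod_cast le_top)).bounded_above_of_compact_support (hasCompactSupport_bump.iteratedFDeriv i)
  refine ⟨C, (norm_nonneg _).trans (hC 0), fun N p => ?_⟩
  have : chi N = fun z : Υ => bump (((N : ℝ) + 1)⁻¹ • z) := rfl
  rw [this, iteratedFDeriv_comp_const_smul _ (contDiff_bump.of_le (by exact_mod_cast le_top)),
    norm_smul, mul_comm, norm_pow, norm_of_nonneg pos!]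
  gcongr
  exact hC _

lemma exists_norm_iteratedFDeriv_one_sub_chi_le (i : ℕ) : ∃ C : ℝ, 0 ≤ C ∧ ∀ (N : ℕ),
    ∀ p ∈ ℍ, ‖𝒟 i (fun q => 1 - chi N q) p‖ ≤ C * (min 1 p.2⁻¹) ^ i ∧
      (‖p‖ < N + 1 → 𝒟 i (fun q => 1 - chi N q) p = 0) := by
  obtain ⟨C, hC0, hC⟩ := exists_norm_iteratedFDeriv_chi_le (n := n) i
  refine ⟨1 + C * 2 ^ i, pos!, fun N p hp => ?_⟩
  have hy : (0 : ℝ) < p.2 := hp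
  have hN : (0 : ℝ) < N + 1 := pos!
  have hm : 0 ≤ min 1 p.2⁻¹ := le_min zero_le_one (inv_nonneg.2 hy.le)
  have z : ‖p‖ < N + 1 → 𝒟 i (fun q : Υ => 1 - chi N q) p = 0 := fun h => by
    have : (fun q : Υ => 1 - chi N q) =ᶠ[𝓝 p] fun _ => 0 := by
      filter_upwards [(isOpen_lt continuous_norm continuous_const).mem_nhds h] with q hq
      rw [chi_eq_one (le_of_lt hq), sub_self]
    rw [(this.iteratedFDeriv ℝ i).eq_of_nhds]; simp
  refine ⟨?_, z⟩
  rcases lt_or_ge ‖p‖ (N + 1) with h1 | h1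
  · rw [z h1, norm_zero]; positivity
  have e : 𝒟 i (fun q : Υ => 1 - chi N q) p =
      𝒟 i (fun _ : Υ => (1 : ℝ)) p - 𝒟 i (chi N) p :=
    iteratedFDeriv_sub_apply contDiffAt_const ((contDiff_chi N).contDiffAt.of_le (by exact_mod_cast le_top))
  rcases Nat.eq_zero_or_pos i with rfl | hi
  · rw [e]; refine (norm_sub_le _ _).trans ?_; have := hC N p; simp at this ⊢; simpa using this
  · rw [e, iteratedFDeriv_const_of_ne hi.ne']; simp; rcases lt_or_ge (2 * (N + 1) : ℝ) ‖p‖ with h2 | h2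
    · have : chi N =ᶠ[𝓝 p] fun _ => 0 := by
        filter_upwards [(isOpen_lt continuous_const continuous_norm).mem_nhds h2] with q hq
        exact chi_eq_zero (le_of_lt hq)
      rw [(this.iteratedFDeriv ℝ i).eq_of_nhds]; simp; positivity
    · have hyp := ((le_abs_self _).trans (norm_snd_le p)).trans h2
      have h3 : ((N : ℝ) + 1)⁻¹ ≤ 2 * min 1 p.2⁻¹ := by
        rcases min_choice 1 p.2⁻¹ with h | h
        · rw [h]; have : ((N : ℝ) + 1)⁻¹ ≤ 1 := inv_le_one_of_one_le₀ (by simp); linarith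
        · rw [h, ← div_eq_mul_inv, inv_le_comm₀ hN pos!, inv_div]; linarith
      calc ‖𝒟 i (chi N) p‖ ≤ C * ((N : ℝ) + 1)⁻¹ ^ i := hC N p
        _ ≤ C * (2 * min 1 p.2⁻¹) ^ i := by gcongr
        _ = C * 2 ^ i * min 1 p.2⁻¹ ^ i := by ring
        _ ≤ _ := by have := pow_nonneg hm i; nlinarith

end

section

variable {m s L : ℝ} {k q : ℕ} {f g V Z : Amb n → ℝ}

local notation "ϖ" => 1 - 2 * s

/-! ### Functions of finite Dirichlet energy -/

/-- Smooth functions with finite Dirichlet form. -/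
def KL2 (m : ℝ) (k : ℕ) (Z : Ψ) : Prop := SmU Z ∧ ∀ o, MemLp (kop m k o Z) 2 (mu m)

lemma KL2.comb (hf : KL2 m k f) (hg : KL2 m k g) (c : ℝ) :
    KL2 m k fun p => c * f p + g p := by
  refine ⟨hf.1.comb hg.1 c, fun o => (((hf.2 o).const_mul c).add (hg.2 o)).ae_eq ?_⟩
  filter_upwards [ae_mu m] with p hp using (kop_comb hf.1 hg.1 m c k o hp).symm

lemma aF_comm (m : ℝ) (k : ℕ) (P V : Ψ) : aF m k P V = aF m k V P := by simp only [aF, mul_comm]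

lemma aF_comb_left (hf : KL2 m k f) (hg : KL2 m k g) (hV : KL2 m k V) (c : ℝ) :
    aF m k (fun p => c * f p + g p) V = c * aF m k f V + aF m k g V := by
  simp only [aF, mul_sum, ← sum_add_distrib]
  refine sum_congr rfl fun o _ => ?_
  have i1 : Integrable (fun p => kop m k o f p * kop m k o V p) (mu m) := (hf.2 o).integrable_mul (hV.2 o)
  have i2 : Integrable (fun p => kop m k o g p * kop m k o V p) (mu m) := (hg.2 o).integrable_mul (hV.2 o)
  rw [← integral_const_mul, ← integral_add (i1.const_mul c) i2]
  refine integral_congr_ae ?_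
  filter_upwards [ae_mu m] with p hp
  rw [kop_comb hf.1 hg.1 m c k o hp]
  ring

lemma aF_congr (h : EqOn f g ℍ) : aF m k f V = aF m k g V := by
  refine sum_congr rfl fun o _ => integral_congr_ae ?_
  filter_upwards [ae_mu m] with p hp
  rw [kop_congr h m k o hp]

lemma aF_self_nonneg (m : ℝ) (k : ℕ) (f : Ψ) : 0 ≤ aF m k f f :=
  sum_nonneg fun _ _ => integral_nonneg fun _ => mul_self_nonneg _

lemma aF_comb_self (hf : KL2 m k f) (hg : KL2 m k g) (c : ℝ) :
    aF m k (fun p => c * f p + g p) (fun p => c * f p + g p) =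
      c ^ 2 * aF m k f f + 2 * c * aF m k f g + aF m k g g := by
  rw [aF_comb_left hf hg (hf.comb hg c), aF_comm m k f, aF_comm m k g, aF_comb_left hf hg hf,
    aF_comb_left hf hg hg, aF_comm m k g f]
  ring

lemma aF_sq_le (hf : KL2 m k f) (hg : KL2 m k g) :
    aF m k f g ^ 2 ≤ aF m k f f * aF m k g g := by
  have h : ∀ t : ℝ, 0 ≤ aF m k f f * (t * t) + 2 * aF m k f g * t + aF m k g g := fun t => by
    have := aF_self_nonneg m k fun p => t * f p + g p; rw [aF_comb_self hf hg] at this; linarith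
  have := discrim_le_zero h
  rw [discrim] at this
  linarith

lemma SmU.one_sub_chi_mul (h : SmU Z) (N : ℕ) : SmU fun p => (1 - chi N p) * Z p :=
  (contDiffOn_const.sub (contDiff_chi N).contDiffOn).mul h

lemma SmU.chi_mul (h : SmU Z) (N : ℕ) : SmU fun p => chi N p * Z p :=
  (contDiff_chi N).contDiffOn.mul h

lemma norm_iteratedFDeriv_mul_le_upper (hf : SmU f) (hg : SmU g) (k : ℕ)
    {p : Υ} (hp : p ∈ ℍ) : ‖𝒟 k (fun q => f q * g q) p‖ ≤
      ∑ i ∈ ℛ (k + 1), (k.choose i : ℝ) * ‖𝒟 i f p‖ * ‖𝒟 (k - i) g p‖ := by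
  have := norm_iteratedFDerivWithin_mul_le (N := ∞) hf hg isOpen_upper.uniqueDiffOn hp
    (n := k) (by exact_mod_cast le_top)
  simpa only [iteratedFDerivWithin_of_isOpen _ isOpen_upper hp] using this

lemma exists_dominating (hs0 : 0 < s) (h : FE ϖ k Z) :
    ∃ G : Ψ, Integrable G (mu ϖ) ∧ ∀ (N : ℕ), ∀ p ∈ ℍ,
      ‖𝒟 k (fun q => (1 - chi N q) * Z q) p‖ ^ 2 ≤ G p ∧
      (‖p‖ < N + 1 → ‖𝒟 k (fun q => (1 - chi N q) * Z q) p‖ ^ 2 = 0) := by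
  choose C hC0 hC using exists_norm_iteratedFDeriv_one_sub_chi_le (n := n)
  refine ⟨fun p => (k + 1) * ∑ i ∈ ℛ (k + 1), (k.choose i * C i) ^ 2 *
    ((min 1 p.2⁻¹) ^ (2 * i) * ‖𝒟 (k - i) Z p‖ ^ 2),
    (integrable_finsetSum _ fun i hi => (h.integrable_weighted hs0 i (by
      simp at hi; omega)).const_mul _).const_mul _, fun N p hp => ?_⟩
  have sm : SmU fun q : Υ => 1 - chi N q := contDiffOn_const.sub (contDiff_chi N).contDiffOn
  have hle := norm_iteratedFDeriv_mul_le_upper sm h.smooth k hp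
  refine ⟨?_, fun hN => ?_⟩
  · calc ‖𝒟 k (fun q => (1 - chi N q) * Z q) p‖ ^ 2
        ≤ (∑ i ∈ ℛ (k + 1), k.choose i * (C i * (min 1 p.2⁻¹) ^ i) *
          ‖𝒟 (k - i) Z p‖) ^ 2 := by
          gcongr; refine hle.trans (sum_le_sum fun i _ => ?_); gcongr; exact (hC i N p hp).1
      _ ≤ (k + 1) * ∑ i ∈ ℛ (k + 1), (k.choose i * (C i * (min 1 p.2⁻¹) ^ i) *
          ‖𝒟 (k - i) Z p‖) ^ 2 := by
          have := sq_sum_le_card_mul_sum_sq (s := ℛ (k + 1)) (f := fun i =>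
            (k.choose i : ℝ) * (C i * (min 1 p.2⁻¹) ^ i) * ‖𝒟 (k - i) Z p‖)
          simpa using this
      _ = _ := by congr 1; exact sum_congr rfl fun i _ => by ring
  · have : ‖𝒟 k (fun q => (1 - chi N q) * Z q) p‖ ≤ 0 := by
      refine hle.trans (Finset.sum_nonpos fun i _ => ?_); rw [(hC i N p hp).2 hN]; simp
    rw [le_antisymm this (norm_nonneg _)]; simp

lemma tendsto_integral_one_sub_chi (hs0 : 0 < s) (h : FE ϖ k Z) :
    (∀ N, Integrable (fun p => ‖𝒟 k (fun q => (1 - chi N q) * Z q) p‖ ^ 2) (mu ϖ)) ∧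
    Tendsto (fun N => ∫ p, ‖𝒟 k (fun q => (1 - chi N q) * Z q) p‖ ^ 2 ∂mu ϖ)
      atTop (𝓝 0) := by
  obtain ⟨G, hG, hb⟩ := exists_dominating hs0 h
  have meas (N : ℕ) : AEStronglyMeasurable
      (fun p => ‖𝒟 k (fun q => (1 - chi N q) * Z q) p‖ ^ 2) (mu ϖ) :=
    aestronglyMeasurable_mu (((h.smooth.one_sub_chi_mul N).continuousOn_iteratedFDeriv k).norm.pow 2)
  have bd N : ∀ᵐ p ∂mu ϖ, ‖‖𝒟 k (fun q => (1 - chi N q) * Z q) p‖ ^ 2‖ ≤ G p := by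
    filter_upwards [ae_mu ϖ] with p hp; rw [norm_of_nonneg (sq_nonneg _)]; exact (hb N p hp).1
  refine ⟨fun N => hG.mono' (meas N) (bd N), ?_⟩
  rw [show (0 : ℝ) = ∫ p : Υ, 0 ∂mu ϖ by simp]
  refine tendsto_integral_of_dominated_convergence G meas hG bd ?_
  filter_upwards [ae_mu ϖ] with p hp
  refine tendsto_const_nhds.congr' ?_
  obtain ⟨N₀, hN₀⟩ := exists_nat_gt ‖p‖
  filter_upwards [eventually_ge_atTop N₀] with N hN
  refine ((hb N p hp).2 ?_).symm
  have : (N₀ : ℝ) ≤ N := by exact_mod_cast hN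
  linarith

lemma Cl.chi_mul (h : Cl s q Z) (N : ℕ) :
    Cl s q fun p => chi N p * Z p := h.even_mul (isEvenSmooth_chi N)

lemma Cl.one_sub_chi_mul (h : Cl s q Z) (N : ℕ) :
    Cl s q fun p => (1 - chi N p) * Z p :=
  (h.sub (h.chi_mul N)).congr fun p _ => by ring

lemma Cl.kl2_of_cs (hs0 : 0 < s) (hs1 : s < 1) {P : Ψ} (h : Cl s q P)
    (hc : CS P) : KL2 ϖ k P := by
  refine ⟨h.smU, fun o => ?_⟩
  rw [memLp_two_iff_integrable_sq (aestronglyMeasurable_mu (h.smU.kop _ k o).continuousOn)]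
  exact ((h.of_le (Nat.zero_le _)).wk_kop k o).integrable_sq hs0 hs1 (hc.kop _ k o)

lemma lintegral_sq_le_of_eventually {F : ℕ → Ψ}
    (hF : ∀ N, ContinuousOn (F N) ℍ) (hi : ∀ N, Integrable (fun p => F N p ^ 2) (mu m))
    (hE : ∀ p ∈ ℍ, ∀ᶠ N in atTop, F N p = f p) {b : ℕ → ℝ}
    (hb : ∀ᶠ N in atTop, ∫ p, F N p ^ 2 ∂mu m ≤ b N) (hL : Tendsto b atTop (𝓝 L)) :
    ∫⁻ p, ofReal (f p ^ 2) ∂mu m ≤ ofReal L := by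
  calc ∫⁻ p, ofReal (f p ^ 2) ∂mu m
      = ∫⁻ p, liminf (fun N => ofReal (F N p ^ 2)) atTop ∂mu m := by
        refine lintegral_congr_ae ?_; filter_upwards [ae_mu m] with p hp; refine (Tendsto.liminf_eq (tendsto_const_nhds.congr' ?_)).symm; filter_upwards [hE p hp] with N hN; rw [hN]
    _ ≤ liminf (fun N => ∫⁻ p, ofReal (F N p ^ 2) ∂mu m) atTop :=
        lintegral_liminf_le' fun N => (aestronglyMeasurable_mu (hF N)).aemeasurable.pow_const 2
          |>.ennreal_ofReal
    _ = liminf (fun N => ofReal (∫ p, F N p ^ 2 ∂mu m)) atTop := by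
        congr 1; ext N; rw [ofReal_integral_eq_lintegral_ofReal (hi N) (ae_of_all _ fun p => sq_nonneg _)]
    _ ≤ liminf (fun N => ofReal (b N)) atTop :=
        liminf_le_liminf (hb.mono fun N h => ofReal_le_ofReal h)
    _ = ofReal L := ((ENNReal.continuous_ofReal.tendsto L).comp hL).liminf_eq

lemma eventually_chi_eq (hZ : SmU Z) (p : Υ) (hp : p ∈ ℍ) :
    ∀ᶠ N : ℕ in atTop, p ∈ {q : Υ | q ∈ ℍ ∧ ‖q‖ < N + 1} ∧
      EqOn (fun q => (1 - chi N q) * Z q) 0 {q : Υ | q ∈ ℍ ∧ ‖q‖ < N + 1} := by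
  obtain ⟨N₀, hN₀⟩ := exists_nat_gt ‖p‖
  filter_upwards [eventually_ge_atTop N₀] with N hN
  have : (N₀ : ℝ) ≤ N := by exact_mod_cast hN
  refine ⟨⟨hp, by linarith⟩, fun q hq => ?_⟩
  simp only [chi_eq_one (le_of_lt hq.2), sub_self, zero_mul, Pi.zero_apply]

lemma isOpen_upper_inter_lt (R : ℝ) : IsOpen {q : Υ | q ∈ ℍ ∧ ‖q‖ < R} :=
  isOpen_upper.inter (isOpen_lt continuous_norm continuous_const)

lemma exists_integral_kop_le (hs0 : 0 < s) (hs1 : s < 1) (k : ℕ) : ∃ C : ℝ, 0 ≤ C ∧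
    ∀ Z : Ψ, Cl s (k / 2) Z → FE ϖ k Z → ∀ (N : ℕ) (o : Option (Fin n)),
      ∫⁻ p, ofReal (kop ϖ k o (fun q => (1 - chi N q) * Z q) p ^ 2) ∂mu ϖ ≤
        ofReal (C * ∫ p, ‖𝒟 k (fun q => (1 - chi N q) * Z q) p‖ ^ 2 ∂mu ϖ) := by
  obtain ⟨C, hC0, hC⟩ := exists_aF_le (n := n) hs0 hs1 k
  refine ⟨2 * C, pos!, fun Z hZ hE N o => ?_⟩
  obtain ⟨hi, ht⟩ := tendsto_integral_one_sub_chi hs0 hE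
  set ε := fun N => ∫ p, ‖𝒟 k (fun q => (1 - chi N q) * Z q) p‖ ^ 2 ∂mu ϖ
  set R := fun (N : ℕ) q => (1 - chi N q) * Z q
  have sR N := hZ.smU.one_sub_chi_mul N
  have clP M := (hZ.one_sub_chi_mul N).sub (hZ.one_sub_chi_mul M)
  have csP M : CS fun q => R N q - R M q :=
    (((cs_chi M).mul_right Z).add ((cs_chi N).mul_right fun q => - Z q)).congr fun q _ => by simp; ring
  have klP M : KL2 ϖ k fun q => R N q - R M q := (clP M).kl2_of_cs hs0 hs1 (csP M)
  have hP M : ∫ p, kop ϖ k o (fun q => R N q - R M q) p ^ 2 ∂mu ϖ ≤ 2 * C * (ε N + ε M) := by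
    have bd : ∀ᵐ p ∂mu ϖ, ‖𝒟 k (fun q => R N q - R M q) p‖ ^ 2 ≤
        2 * ‖𝒟 k (R N) p‖ ^ 2 + 2 * ‖𝒟 k (R M) p‖ ^ 2 := by
      filter_upwards [ae_mu ϖ] with p hp; have e : 𝒟 k (fun q => R N q - R M q) p =
          𝒟 k (R N) p - 𝒟 k (R M) p :=
        iteratedFDeriv_sub_apply (((sR N).contDiffAt hp).of_le (by exact_mod_cast le_top))
          (((sR M).contDiffAt hp).of_le (by exact_mod_cast le_top))
      rw [e]; have h1 := norm_sub_le (𝒟 k (R N) p) (𝒟 k (R M) p)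
      have h4 := pow_le_pow_left₀ (norm_nonneg _) h1 2
      nlinarith [sq_nonneg (‖𝒟 k (R N) p‖ - ‖𝒟 k (R M) p‖)]
    have int2 : Integrable (fun p => 2 * ‖𝒟 k (R N) p‖ ^ 2 +
        2 * ‖𝒟 k (R M) p‖ ^ 2) (mu ϖ) :=
      ((hi N).const_mul 2).add ((hi M).const_mul 2)
    have int1 : Integrable (fun p => ‖𝒟 k (fun q => R N q - R M q) p‖ ^ 2)
        (mu ϖ) := int2.mono'
      (aestronglyMeasurable_mu (((clP M).smU.continuousOn_iteratedFDeriv k).norm.pow 2))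
      (bd.mono fun p hp => by rwa [norm_of_nonneg (sq_nonneg _)])
    have h2 : ∫ p, ‖𝒟 k (fun q => R N q - R M q) p‖ ^ 2 ∂mu ϖ ≤ 2 * ε N + 2 * ε M := by
      refine (integral_mono_ae int1 int2 bd).trans (le_of_eq ?_)
      rw [integral_add ((hi N).const_mul 2) ((hi M).const_mul 2), integral_const_mul, integral_const_mul]
    calc ∫ p, kop ϖ k o (fun q => R N q - R M q) p ^ 2 ∂mu ϖ
        ≤ aF ϖ k (fun q => R N q - R M q) (fun q => R N q - R M q) := by
          simp_rw [sq]
          exact Finset.single_le_sum (f := fun o => ∫ p, kop ϖ k o (fun q => R N q - R M q) p *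
            kop ϖ k o (fun q => R N q - R M q) p ∂mu ϖ)
            (fun o _ => integral_nonneg fun p => mul_self_nonneg _) (Finset.mem_univ o)
      _ ≤ C * (2 * ε N + 2 * ε M) := (hC _ (clP M) (csP M) int1).trans (by gcongr)
      _ = _ := by ring
  refine lintegral_sq_le_of_eventually (fun M => ((clP M).smU.kop _ k o).continuousOn)
    (fun M => (memLp_two_iff_integrable_sq ((klP M).2 o).1).1 ((klP M).2 o)) (fun p hp => ?_)
    (Eventually.of_forall hP) (by simpa using (ht.const_add (ε N)).const_mul (2 * C))
  filter_upwards [eventually_chi_eq hZ.smU p hp] with M hM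
  rw [kop_sub (sR N) (sR M) _ k o hp]
  simp only
  rw [eqOn_zero_kop (isOpen_upper_inter_lt _) hM.2 _ k o hM.1]
  simp

lemma memLp_two_of_lintegral (hf : ContinuousOn f ℍ)
    (h : ∫⁻ p, ofReal (f p ^ 2) ∂mu m ≤ ofReal L) (hL : 0 ≤ L) :
    MemLp f 2 (mu m) ∧ ∫ p, f p ^ 2 ∂mu m ≤ L := by
  have meas := aestronglyMeasurable_mu (m := m) hf
  have hi : Integrable (fun p => f p ^ 2) (mu m) := by
    refine ⟨meas.pow 2, ?_⟩; rw [hasFiniteIntegral_iff_ofReal (ae_of_all _ fun p => sq_nonneg _)]; exact h.trans_lt ofReal_lt_top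
  refine ⟨(memLp_two_iff_integrable_sq meas).2 hi, ?_⟩
  rwa [← ofReal_integral_eq_lintegral_ofReal hi (ae_of_all _ fun p => sq_nonneg _),
    ENNReal.ofReal_le_ofReal_iff hL] at h

lemma kl2_and_tendsto (hs0 : 0 < s) (hs1 : s < 1)     (hZ : Cl s (k / 2) Z) (hE : FE ϖ k Z) :
    (∀ N, KL2 ϖ k fun q => (1 - chi N q) * Z q) ∧ KL2 ϖ k Z ∧
    Tendsto (fun N => aF ϖ k (fun q => (1 - chi N q) * Z q) fun q => (1 - chi N q) * Z q) atTop (𝓝 0) := by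
  obtain ⟨C, hC0, hC⟩ := exists_integral_kop_le (n := n) hs0 hs1 k
  obtain ⟨hi, ht⟩ := tendsto_integral_one_sub_chi hs0 hE
  have h1 N o := memLp_two_of_lintegral ((hZ.smU.one_sub_chi_mul N).kop ϖ k o).continuousOn (hC Z hZ hE N o)
    (mul_nonneg hC0 (integral_nonneg fun p => sq_nonneg _))
  have k1 N : KL2 ϖ k fun q => (1 - chi N q) * Z q := ⟨hZ.smU.one_sub_chi_mul N, fun o => (h1 N o).1⟩
  refine ⟨k1, ?_, ?_⟩
  · convert (k1 0).comb ((hZ.chi_mul 0).kl2_of_cs hs0 hs1 ((cs_chi 0).mul_right Z)) 1 using 2; ring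
  · refine squeeze_zero (g := fun N => ∑ _o : Option (Fin n),
      C * ∫ p, ‖𝒟 k (fun q => (1 - chi N q) * Z q) p‖ ^ 2 ∂mu ϖ)
      (fun N => aF_self_nonneg _ _ _) (fun N => sum_le_sum fun o _ => ?_) ?_
    · have := (h1 N o).2; simp_rw [sq] at this ⊢; exact this
    · have := (ht.const_mul C).const_mul ((Fintype.card (Option (Fin n)) : ℕ) : ℝ); simpa using this

lemma tendsto_aF_chi_left (hs0 : 0 < s) (hs1 : s < 1)     (hZ : Cl s (k / 2) Z) (hE : FE ϖ k Z) (hV : KL2 ϖ k V) :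
    Tendsto (fun N => aF ϖ k (fun q => chi N q * Z q) V) atTop (𝓝 (aF ϖ k Z V)) := by
  obtain ⟨k1, k2, ht⟩ := kl2_and_tendsto hs0 hs1 hZ hE
  have h2 := (show Tendsto (fun N => aF ϖ k (fun q => (1 - chi N q) * Z q) V) atTop (𝓝 0) by rw [tendsto_zero_iff_abs_tendsto_zero]; exact squeeze_zero (fun N => abs_nonneg _) (fun N => abs_le_sqrt (aF_sq_le (k1 N) hV)) (by have := (ht.mul_const (aF ϖ k V V)).sqrt; simpa using this)).const_sub (aF ϖ k Z V)
  rw [sub_zero] at h2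
  refine h2.congr fun N => ?_
  have := aF_comb_left (k1 N) k2 hV (-1)
  rw [show (fun q => chi N q * Z q) = fun p => -1 * ((1 - chi N p) * Z p) + Z p by ext p; ring, this]
  ring

lemma tendsto_aF_chi_self (hs0 : 0 < s) (hs1 : s < 1)     (hZ : Cl s (k / 2) Z) (hE : FE ϖ k Z) :
    Tendsto (fun N => aF ϖ k (fun q => chi N q * Z q) fun q => chi N q * Z q) atTop
      (𝓝 (aF ϖ k Z Z)) := by
  obtain ⟨k1, k2, ht⟩ := kl2_and_tendsto hs0 hs1 hZ hE
  have h2 := (((tendsto_aF_chi_left hs0 hs1 hZ hE k2).const_mul 2).add ht).sub_const (aF ϖ k Z Z)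
  rw [show 2 * aF ϖ k Z Z + 0 - aF ϖ k Z Z = aF ϖ k Z Z by ring] at h2
  refine h2.congr fun N => ?_
  have e1 := aF_comb_self ((hZ.chi_mul N).kl2_of_cs hs0 hs1 ((cs_chi N).mul_right Z)) k2 (-1)
  rw [show (fun p => -1 * (chi N p * Z p) + Z p) = fun q => (1 - chi N q) * Z q by ext p; ring] at e1
  rw [e1]; ring

/-! ### Vanishing of functions of zero energy -/

lemma FE.sliceL2 (h : FE m k Z) : SliceL2 k Z := by
  intro α hα
  have h1 : ∀ᵐ y ∂nu m, ∀ Y : ℕ, Integrable fun x : Ξ =>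
      {p : Υ | p.2 < (Y : ℝ) + 1}.indicator (fun p => dxs α Z p ^ 2) (x, y) := by
    refine ae_all_iff.2 fun Y => ?_
    have h2 : IntegrableOn (fun p => dxs α Z p ^ 2) {p : Υ | p.2 < (Y : ℝ) + 1} (mu m) := by
      refine (h.slab (Y + 1) pos! α.length hα).mono'
        (aestronglyMeasurable_mu ((h.smooth.dxs α).continuousOn.pow 2)).restrict ?_
      filter_upwards [ae_restrict_of_ae (ae_mu m)] with p hp; rw [norm_of_nonneg (sq_nonneg _), ← sq_abs]
      exact pow_le_pow_left₀ (abs_nonneg _) (abs_dy_iterate_dxs_le h.smooth 0 α hp) 2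
    rw [← integrable_indicator_iff (isOpen_lt continuous_snd continuous_const).measurableSet] at h2
    exact h2.prod_left_ae
  filter_upwards [(show (volume.restrict (Ioi 0)) ≪ nu m by refine withDensity_absolutelyContinuous' (by fun_prop) ?_; filter_upwards [ae_restrict_mem measurableSet_Ioi] with y hy; simpa using rpow_pos_of_pos hy m).ae_le h1, ae_restrict_mem measurableSet_Ioi] with y hy hy0
  obtain ⟨Y, hY⟩ := exists_nat_gt y
  have c : Continuous fun x : Ξ => dxs α Z (x, y) := ((h.smooth.dxs α).continuousOn).comp_continuous (by fun_prop) fun x => hy0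
  rw [memLp_two_iff_integrable_sq c.aestronglyMeasurable]
  refine (hy Y).congr (ae_of_all _ fun x => ?_)
  have : y < Y + 1 := by linarith
  simp [this]

lemma eqOn_zero_of_aF_eq_zero (hn : 1 ≤ n) (hs0 : 0 < s) (hs1 : s < 1)
    (hZ : Cl s (k / 2) Z) (hE : FE ϖ k Z)
    (h0 : aF ϖ k Z Z = 0) : EqOn Z 0 ℍ := by
  refine eqOn_zero_of_xop hn k hE.smooth hE.sliceL2 fun o => ?_
  have lim := tendsto_aF_chi_self hs0 hs1 hZ hE
  rw [h0] at lim
  have h0Z : Cl s 0 Z := hZ.of_le (Nat.zero_le _)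
  have wx {P : Ψ} (hP : Cl s 0 P) (hc : CS P) : Wk s (xop k o P) ∧ CS (xop k o P) := by
    have cLX {P : Ψ} (hc : CS P) (j : ℕ) : CS (LX^[j] P) := by
      induction j generalizing P with
      | zero => exact hc
      | succ j ih => exact ih hc.LX
    have w0 : Wk s (0 : Ψ) ∧ CS (0 : Ψ) :=
      ⟨⟨0, 0, continuous_const, continuous_const, by simp⟩, 0, by simp⟩
    unfold xop; split_ifs
    · exact ⟨(hP.LX_iterate _).wk, cLX hc _⟩
    · exact w0
    · cases o with
      | none => exact w0
      | some i => exact ⟨((hP.Dv_eX i).LX_iterate _).wk, cLX (hc.Dv _) _⟩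
  have key := lintegral_sq_le_of_eventually (m := 1 - 2 * s) (f := xop k o Z)
   
    (fun N => ((hE.smooth.chi_mul N).xop k o).continuousOn)
    (fun N => by obtain ⟨h1, h2⟩ := wx (h0Z.chi_mul N) ((cs_chi N).mul_right Z); exact h1.integrable_sq hs0 hs1 h2)
    (fun p hp => ?_) (Eventually.of_forall fun N => ?_) lim
  · obtain ⟨h1, h2⟩ := memLp_two_of_lintegral (hE.smooth.xop k o).continuousOn key le_rfl
    have h3 := le_antisymm h2 (integral_nonneg fun p => sq_nonneg _)
    rw [integral_eq_zero_iff_of_nonneg (fun p => sq_nonneg _) ((memLp_two_iff_integrable_sq h1.1).1 h1), mu_eq] at h3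
    have hac : (volume.restrict ℍ) ≪ (volume.restrict ℍ).withDensity fun p => ofReal (p.2 ^ ϖ) := by
      refine withDensity_absolutelyContinuous' (by fun_prop) ?_
      filter_upwards [ae_restrict_mem measurableSet_upper] with p hp
      simpa using rpow_pos_of_pos hp ϖ
    refine Measure.eqOn_open_of_ae_eq (μ := (volume : Measure Υ)) ?_ isOpen_upper
      (hE.smooth.xop k o).continuousOn continuousOn_const
    filter_upwards [hac.ae_le h3] with p hp using by simpa using hp
  · filter_upwards [eventually_chi_eq hE.smooth p hp] with N hN
    rw [show (fun q => chi N q * Z q) = fun p => -1 * ((1 - chi N p) * Z p) + Z p by ext p; ring, xop_comb (hE.smooth.one_sub_chi_mul N) hE.smooth (-1) k o hp]; simp only; rw [eqOn_zero_xop (isOpen_upper_inter_lt _) hN.2 k o hN.1]; simp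
  · refine (integral_xop_sq_le hs0 hs1 k (hZ.chi_mul N) ((cs_chi N).mul_right Z) o).trans ?_; simp_rw [sq]
    exact Finset.single_le_sum (f := fun o => ∫ p, kop ϖ k o (fun q => chi N q * Z q) p *
      kop ϖ k o (fun q => chi N q * Z q) p ∂mu ϖ)
      (fun o _ => integral_nonneg fun p => mul_self_nonneg _) (Finset.mem_univ o)

end

section

variable {μ l r γ c : ℝ}

/-! ### The profile functions -/

/-- The integrand of the profile functions. -/
def psiKer (μ l r : ℝ) : ℝ := exp (-r - l / r) * r ^ (μ - 1)

/-- The profile `ψ_μ(λ) = ∫₀^∞ e^{-r-λ/r} r^{μ-1} dr`, a multiple of a modified Bessel function. -/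
def psi (μ l : ℝ) : ℝ := ∫ r in Ioi 0, psiKer μ l r

lemma psiKer_nonneg (hr : 0 < r) : 0 ≤ psiKer μ l r := by unfold psiKer; positivity

lemma measurable_psiKer (μ l : ℝ) : Measurable (psiKer μ l) := by unfold psiKer; fun_prop

lemma exp_neg_div_le (hl : 0 < l) (hr : 0 < r) (p : ℕ) :
    exp (-(l / r)) ≤ p.factorial / l ^ p * r ^ p := by
  have h := pow_div_factorial_le_exp (l / r) pos! p
  rw [exp_neg, div_mul_eq_mul_div, inv_eq_one_div, div_le_div_iff₀ (exp_pos _) pos!]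
  rw [div_pow, div_div, div_le_iff₀ pos!] at h
  linarith

lemma psiKer_le (hl : 0 < l) (hr : 0 < r) (p : ℕ) :
    psiKer μ l r ≤ p.factorial / l ^ p * (exp (-r) * r ^ (μ + p - 1)) := by
  have h := exp_neg_div_le hl hr p
  rw [psiKer, show exp (-r - l / r) = exp (-r) * exp (-(l / r)) by rw [← exp_add]; ring_nf, show r ^ (μ + p - 1) = r ^ (μ - 1) * r ^ p by rw [← rpow_natCast, ← rpow_add hr]; ring_nf]
  calc exp (-r) * exp (-(l / r)) * r ^ (μ - 1)
      ≤ exp (-r) * (p.factorial / l ^ p * r ^ p) * r ^ (μ - 1) := by gcongr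
    _ = _ := by ring

lemma integrableOn_psiKer_of_pos (hl : 0 < l) (μ : ℝ) : IntegrableOn (psiKer μ l) (Ioi 0) := by
  obtain ⟨p, hp⟩ := exists_nat_gt (-μ)
  refine ((GammaIntegral_convergent (s := μ + p) (by linarith)).const_mul
    (p.factorial / l ^ p)).mono' (measurable_psiKer μ l).aestronglyMeasurable ?_
  filter_upwards [ae_restrict_mem measurableSet_Ioi] with r hr
  rw [norm_of_nonneg (psiKer_nonneg hr)]
  exact psiKer_le hl hr p

lemma psiKer_le_gamma (hl : 0 ≤ l) (hr : 0 < r) : psiKer μ l r ≤ exp (-r) * r ^ (μ - 1) := by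
  unfold psiKer
  have : 0 ≤ l / r := pos!
  gcongr
  linarith

lemma integrableOn_psiKer (hμ : 0 < μ) (hl : 0 ≤ l) : IntegrableOn (psiKer μ l) (Ioi 0) := by
  refine (GammaIntegral_convergent hμ).mono' (measurable_psiKer μ l).aestronglyMeasurable ?_
  filter_upwards [ae_restrict_mem measurableSet_Ioi] with r hr
  rw [norm_of_nonneg (psiKer_nonneg hr)]
  exact psiKer_le_gamma hl hr

lemma psi_nonneg (μ l : ℝ) : 0 ≤ psi μ l := setIntegral_nonneg measurableSet_Ioi fun _ hr => psiKer_nonneg hr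

lemma psi_zero (μ : ℝ) (hμ : 0 < μ) : psi μ 0 = Gamma μ := by
  rw [Gamma_eq_integral hμ, psi]
  simp [psiKer]

lemma hasDerivAt_psi (hl : 0 < l) (μ : ℝ) : HasDerivAt (psi μ) (-psi (μ - 1) l) l := by
  have key := hasDerivAt_integral_of_dominated_loc_of_deriv_le (μ := volume.restrict (Ioi (0 : ℝ)))
    (F := psiKer μ) (F' := fun l r => -psiKer (μ - 1) l r) (x₀ := l)
    (bound := psiKer (μ - 1) (l / 2)) (s := Ioi (l / 2)) (Ioi_mem_nhds (by linarith))
    (Eventually.of_forall fun l => (measurable_psiKer μ l).aestronglyMeasurable)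
    (integrableOn_psiKer_of_pos hl μ) (measurable_psiKer (μ - 1) l).neg.aestronglyMeasurable ?_
    (integrableOn_psiKer_of_pos (by linarith) _) ?_
  · have := key.2; rw [integral_neg] at this; exact this
  · filter_upwards [ae_restrict_mem measurableSet_Ioi] with r hr x hx
    have hr' : (0 : ℝ) < r := hr; have hx' : l / 2 < x := hx; rw [norm_neg, norm_of_nonneg (psiKer_nonneg hr)]; unfold psiKer; gcongr
  · filter_upwards [ae_restrict_mem measurableSet_Ioi] with r hr x hx
    refine ((show HasDerivAt (fun x => -r - x / r) (-(1 / r)) x by simpa using ((hasDerivAt_id x).div_const r).const_sub (-r)).exp.mul_const (r ^ (μ - 1))).congr_deriv ?_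
    rw [psiKer, rpow_sub_one hr.ne' (μ - 1)]; ring

lemma psi_neg (hl : 0 < l) (μ : ℝ) : psi (-μ) l = l ^ (-μ) * psi μ l := by
  have e2 := integral_comp_mul_left_Ioi (fun x => (|(-1)| * x ^ ((-1 : ℝ) - 1)) •
    psiKer (-μ) l (x ^ (-1 : ℝ))) 0 (inv_pos.2 hl)
  rw [mul_zero, integral_comp_rpow_Ioi (psiKer (-μ) l) (show (-1 : ℝ) ≠ 0 by norm_num), inv_inv] at e2
  rw [show psi (-μ) l = l⁻¹ * (l • psi (-μ) l) by rw [smul_eq_mul]; field_simp, show l • psi (-μ) l = _ from e2.symm, psi, ← integral_const_mul, ← integral_const_mul]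
  refine setIntegral_congr_fun measurableSet_Ioi fun r hr => ?_
  have hr' : (0 : ℝ) < r := hr
  have hd : 0 < l⁻¹ * r := pos!
  simp only [psiKer, smul_eq_mul]
  rw [show (l⁻¹ * r) ^ (-1 : ℝ) = l / r by rw [rpow_neg_one]; field_simp, show (l⁻¹ * r) ^ ((-1 : ℝ) - 1) = l ^ 2 * r ^ (-2 : ℝ) by rw [mul_rpow pos! hr'.le, inv_rpow hl.le, ← rpow_neg hl.le]; norm_num, show (l / r) ^ (-μ - 1) = l ^ (-μ) * l⁻¹ * r ^ (μ + 1) by rw [div_rpow hl.le hr'.le, rpow_sub_one hl.ne', div_eq_mul_inv, ← rpow_neg hr'.le]; ring_nf, ← show r ^ (-2 : ℝ) * r ^ (μ + 1) = r ^ (μ - 1) by rw [← rpow_add hr']; ring_nf, show -(l / r) - l / (l / r) = -r - l / r by field_simp; ring]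
  simp
  field_simp

lemma psi_rec (hl : 0 < l) (μ : ℝ) : l * psi (μ - 2) l + (μ - 1) * psi (μ - 1) l = psi μ l := by
  have I μ := integrableOn_psiKer_of_pos hl μ
  have hd : ∀ r ∈ Ioi 0, HasDerivAt (psiKer μ l)
      (l * psiKer (μ - 2) l r + (μ - 1) * psiKer (μ - 1) l r - psiKer μ l r) r := by
    intro r hr; have hr' := hr
    refine ((show HasDerivAt (fun r => -r - l / r) (-1 + l / r ^ 2) r by refine ((hasDerivAt_id r).neg.sub ((hasDerivAt_inv hr'.ne').const_mul l)).congr_deriv ?_; ring).exp.mul (hasDerivAt_rpow_const (Or.inl hr'.ne'))).congr_deriv ?_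
    simp only [psiKer, show r ^ (μ - 2 - 1) = r ^ (μ - 1) / r ^ 2 by rw [← rpow_natCast, ← rpow_sub hr']; congr 1; push_cast; ring]; ring
  have t0 : Tendsto (psiKer μ l) (𝓝[>] 0) (𝓝 0) := by
    obtain ⟨p, hp⟩ := exists_nat_gt (1 - μ); have hq : 0 < μ + p - 1 := by linarith
    have h2 : Tendsto (fun r : ℝ => p.factorial / l ^ p * r ^ (μ + p - 1)) (𝓝[>] 0) (𝓝 0) := by
      have := ((continuousAt_rpow_const 0 (μ + p - 1) (Or.inr hq.le)).tendsto.mono_left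
        (nhdsWithin_le_nhds (s := Ioi 0))).const_mul (p.factorial / l ^ p)
      rwa [zero_rpow hq.ne', mul_zero] at this
    refine squeeze_zero' ?_ ?_ h2
    · filter_upwards [self_mem_nhdsWithin] with r hr using psiKer_nonneg hr
    · filter_upwards [self_mem_nhdsWithin] with r hr; have hr' : (0 : ℝ) < r := hr; refine (psiKer_le hl hr p).trans ?_
      have : exp (-r) ≤ 1 := exp_le_one_iff.2 (by linarith)
      gcongr; exact mul_le_of_le_one_left pos! this
  have t1 : Tendsto (psiKer μ l) atTop (𝓝 0) := by
    refine squeeze_zero' ?_ ?_ (tendsto_rpow_mul_exp_neg_mul_atTop_nhds_zero (μ - 1) 1 one_pos)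
    · filter_upwards [eventually_gt_atTop 0] with r hr using psiKer_nonneg hr
    · filter_upwards [eventually_gt_atTop 0] with r hr; refine (psiKer_le_gamma hl.le hr).trans_eq ?_; ring_nf
  have key := integral_Ioi_of_hasDerivAt_of_tendsto (continuousWithinAt_update_same.2 (t0.mono_left (nhdsWithin_mono _
      fun x hx => lt_of_le_of_ne hx.1 (Ne.symm hx.2)))) (fun r hr => (hd r hr).congr_of_eventuallyEq ?_) ((((I _).const_mul l).add ((I _).const_mul _)).sub (I _))
    (t1.congr' ?_)
  · rw [Function.update_self, sub_zero, integral_sub, integral_add, integral_const_mul, integral_const_mul] at key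
    · simp only [psi]; linarith
    exacts [(I _).const_mul l, (I _).const_mul _, ((I _).const_mul l).add ((I _).const_mul _), I _]
  · filter_upwards [Ioi_mem_nhds hr] with x hx; rw [Function.update_of_ne (ne_of_gt hx)]
  · filter_upwards [eventually_gt_atTop 0] with r hr; rw [Function.update_of_ne hr.ne']

lemma exists_psi_le (hμ : 0 < μ) : ∃ C, 0 ≤ C ∧ ∀ l, 0 ≤ l → psi μ l ≤ C * exp (-√l) := by
  have hI : IntegrableOn (fun r => r ^ (μ - 1) * exp (-(1 / 2) * r)) (Ioi 0) := by
    simpa using integrableOn_rpow_mul_exp_neg_mul_rpow (by linarith) one_pos (by norm_num)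
  refine ⟨∫ r in Ioi 0, r ^ (μ - 1) * exp (-(1 / 2) * r),
    setIntegral_nonneg measurableSet_Ioi fun r hr => ?_, fun l hl => ?_⟩
  · have : (0 : ℝ) < r := hr; positivity
  rw [psi, ← integral_mul_const]
  refine setIntegral_mono_on (integrableOn_psiKer hμ hl) (hI.mul_const _) measurableSet_Ioi fun r hr => ?_
  have hr' : (0 : ℝ) < r := hr
  rw [psiKer, mul_comm, mul_assoc, ← exp_add]
  have h1 : √l ≤ r / 2 + l / r := by
    have h2 : (r / 2 + l / r) ^ 2 ≥ l := by
      have e : (r / 2 + l / r) ^ 2 = l + ((r / 2) ^ 2 + (l / r) ^ 2) := by field_simp; ring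
      rw [e]; have := sq_nonneg (r / 2); have := sq_nonneg (l / r); linarith
    exact (sqrt_le_sqrt h2).trans_eq (sqrt_sq pos!)
  gcongr
  linarith

lemma continuousOn_psi (hμ : 0 < μ) : ContinuousOn (psi μ) (Ici 0) := by
  refine continuousOn_of_dominated (fun l _ => (measurable_psiKer μ l).aestronglyMeasurable) (fun l hl => ?_)
    (GammaIntegral_convergent hμ) (ae_of_all _ fun r => ?_)
  · filter_upwards [ae_restrict_mem measurableSet_Ioi] with r hr
    rw [norm_of_nonneg (psiKer_nonneg hr)]; exact psiKer_le_gamma hl hr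
  · unfold psiKer; fun_prop

lemma deriv_psi (hl : 0 < l) (μ : ℝ) : deriv (psi μ) l = -psi (μ - 1) l := (hasDerivAt_psi hl μ).deriv

lemma contDiffOn_psi (μ : ℝ) : ContDiffOn ℝ ∞ (psi μ) (Ioi 0) := by
  rw [contDiffOn_infty]
  intro j
  induction j generalizing μ with
  | zero => exact contDiffOn_zero.2 fun l hl => (hasDerivAt_psi hl μ).continuousAt.continuousWithinAt
  | succ j ih =>
    push_cast; rw [contDiffOn_succ_iff_deriv_of_isOpen isOpen_Ioi]
    exact ⟨fun l hl => (hasDerivAt_psi hl μ).differentiableAt.differentiableWithinAt, by simp,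
      (ih (μ - 1)).neg.congr fun l hl => deriv_psi hl μ⟩

lemma iteratedDeriv_psi (j : ℕ) (μ : ℝ) (hl : 0 < l) :
    iteratedDeriv j (psi μ) l = (-1) ^ j * psi (μ - j) l := by
  induction j generalizing μ l with
  | zero => simp
  | succ j ih =>
    rw [iteratedDeriv_succ, (show iteratedDeriv j (psi μ) =ᶠ[𝓝 l] fun l => (-1) ^ j * psi (μ - j) l from
      Filter.eventuallyEq_of_mem (Ioi_mem_nhds hl) fun l hl => ih μ hl).deriv_eq,
      deriv_const_mul _ (hasDerivAt_psi hl _).differentiableAt, deriv_psi hl]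
    push_cast; rw [show μ - j - 1 = μ - (j + 1) by ring]; ring

lemma exists_pow_mul_psi_le (hγ : 0 < γ) (hγN : ∀ N : ℕ, γ ≠ N) (j p : ℕ) :
    ∃ C, 0 ≤ C ∧ ∀ l, 0 < l → l ^ j * (1 + l) ^ p * psi (γ - j) l ≤ C := by
  obtain ⟨a, μ, ha, hμ, e⟩ : ∃ a μ : ℝ, 0 ≤ a ∧ 0 < μ ∧ ∀ l : ℝ, 0 < l → l ^ j * psi (γ - j) l = l ^ a * psi μ l := by
    rcases lt_or_ge (j : ℝ) γ with h | h
    · exact ⟨j, γ - j, pos!, by linarith, fun l _ => by rw [rpow_natCast]⟩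
    · have h' : γ < j := lt_of_le_of_ne h (hγN j); refine ⟨γ, j - γ, hγ.le, by linarith, fun l hl => ?_⟩
      rw [show γ - (j : ℝ) = -(j - γ) by ring, psi_neg hl, ← mul_assoc, ← rpow_natCast, ← rpow_add hl]
      ring_nf
  obtain ⟨C, hC0, hC⟩ := exists_psi_le hμ
  obtain ⟨q, hq⟩ := exists_nat_ge a
  refine ⟨(2 * (q + p)).factorial * exp 1 * C, pos!, fun l hl => ?_⟩
  have h1 : l ^ a ≤ (1 + l) ^ q := by
    rw [← rpow_natCast]
    exact (rpow_le_rpow hl.le (by linarith) ha).trans (rpow_le_rpow_of_exponent_le (by linarith) hq)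
  have h2 : (1 + l) ^ (q + p) ≤ (2 * (q + p)).factorial * exp 1 * exp (√l) := by
    have h3 := pow_div_factorial_le_exp (1 + √l) pos! (2 * (q + p))
    rw [div_le_iff₀ pos!, exp_add] at h3
    have h4 : 1 + l ≤ (1 + √l) ^ 2 := by nlinarith [sq_sqrt hl.le, sqrt_nonneg l]
    calc (1 + l) ^ (q + p) ≤ ((1 + √l) ^ 2) ^ (q + p) := by gcongr
      _ = (1 + √l) ^ (2 * (q + p)) := by rw [pow_mul]
      _ ≤ _ := by linarith
  calc l ^ j * (1 + l) ^ p * psi (γ - j) l = l ^ a * (1 + l) ^ p * psi μ l := by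
        rw [mul_right_comm, e l hl]; ring
    _ ≤ (1 + l) ^ q * (1 + l) ^ p * (C * exp (-√l)) := by have := psi_nonneg μ l; gcongr; exact hC l hl.le
    _ = (1 + l) ^ (q + p) * (C * exp (-√l)) := by rw [pow_add]
    _ ≤ (2 * (q + p)).factorial * exp 1 * exp (√l) * (C * exp (-√l)) := by gcongr
    _ = (2 * (q + p)).factorial * exp 1 * C * (exp (√l) * exp (-√l)) := by ring
    _ = _ := by rw [← exp_add]; simp

/-! ### Splitting of the profile at the origin -/

/-- The coefficients of the confluent hypergeometric limit function. -/
def hCoef (c : ℝ) (j : ℕ) : ℝ := (j.factorial * ∏ i ∈ ℛ j, (c + i))⁻¹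

/-- The confluent hypergeometric limit function `₀F₁(c; ·)`. -/
def hypF (c l : ℝ) : ℝ := ∑' j, hCoef c j * l ^ j

lemma hCoef_succ (c : ℝ) (j : ℕ) : hCoef c (j + 1) = hCoef c j * ((j + 1) * (c + j))⁻¹ := by
  simp only [hCoef, prod_range_succ, Nat.factorial_succ]
  push_cast
  rw [← mul_inv]
  ring_nf

lemma hCoef_succ' (c : ℝ) (j : ℕ) : (j + 1) * hCoef c (j + 1) = c⁻¹ * hCoef (c + 1) j := by
  simp only [hCoef, prod_range_succ', Nat.factorial_succ]
  push_cast
  have : (∏ i ∈ ℛ j, (c + 1 + i) : ℝ) = ∏ i ∈ ℛ j, (c + (i + 1)) :=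
    prod_congr rfl fun i _ => by ring
  rw [this]
  have : j + 1 ≠ 0 := pos!
  simp
  field_simp

lemma summable_hCoef (hc : ∀ i : ℕ, c + i ≠ 0) (R : ℝ) (hR : 0 < R) :
    Summable fun j => |hCoef c j| * R ^ j := by
  have h0 (j : ℕ) : hCoef c j ≠ 0 := by
    unfold hCoef; exact inv_ne_zero (mul_ne_zero pos! (Finset.prod_ne_zero_iff.2 fun i _ => hc i))
  refine summable_of_ratio_test_tendsto_lt_one (l := 0) one_pos (Eventually.of_forall fun j =>
    mul_ne_zero (abs_ne_zero.2 (h0 j)) (pow_ne_zero _ hR.ne')) ?_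
  have t1 : Tendsto (fun j : ℕ => (j : ℝ) + 1) atTop atTop :=
    tendsto_atTop_add_const_right _ _ tendsto_natCast_atTop_atTop
  have t2 : Tendsto (fun j : ℕ => |c + j|) atTop atTop :=
    tendsto_abs_atTop_atTop.comp (tendsto_atTop_add_const_left _ _ tendsto_natCast_atTop_atTop)
  have := (t1.atTop_mul_atTop₀ t2).inv_tendsto_atTop.mul_const R
  rw [zero_mul] at this
  refine this.congr fun j => ?_
  have a := abs_ne_zero.2 (h0 j)
  have b := pow_ne_zero j hR.ne'
  have d : (0 : ℝ) < j + 1 := pos!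
  simp only [norm_mul, hCoef_succ, norm_eq_abs, abs_mul, abs_abs, abs_inv, abs_pow,
    abs_of_pos hR, abs_of_pos d, pow_succ, Pi.inv_apply]
  field_simp

lemma hasDerivAt_hypF (hc : ∀ i : ℕ, c + i ≠ 0) (l : ℝ) : HasDerivAt (hypF c) (c⁻¹ * hypF (c + 1) l) l := by
  set R := |l| + 1
  have hs := (summable_hCoef hc (2 * R) pos!)
  have hb (j : ℕ) (y : ℝ) (hy : y ∈ Metric.ball (0 : ℝ) R) :
      ‖hCoef c j * (j * y ^ (j - 1))‖ ≤ |hCoef c j| * (2 * R) ^ j := by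
    rw [norm_mul, norm_eq_abs, norm_mul, norm_pow, norm_eq_abs, norm_eq_abs, Nat.abs_cast, mul_pow]
    gcongr
    · exact_mod_cast Nat.lt_two_pow_self.le
    · exact (pow_le_pow_left₀ (abs_nonneg _) (by simpa using (mem_ball_zero_iff.1 hy).le) _).trans (pow_le_pow_right₀ (by simp [R]) (Nat.sub_le j 1))
  have hl : l ∈ Metric.ball 0 R := by simp [R]
  refine (hasDerivAt_tsum_of_isPreconnected hs Metric.isOpen_ball (convex_ball 0 R).isPreconnected (g' := fun j y => hCoef c j * (j * y ^ (j - 1))) (fun j y _ => (hasDerivAt_pow j y).const_mul _) hb (Metric.mem_ball_self pos!) (summable_of_ne_finset_zero (s := {0}) fun j hj => by simp at hj; simp [hj]) hl).congr_deriv ?_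
  rw [(hs.of_norm_bounded fun j => hb j l hl).tsum_eq_zero_add]
  simp only [Nat.cast_zero, zero_mul, mul_zero, zero_add, Nat.add_sub_cancel]
  rw [hypF, ← tsum_mul_left]
  refine tsum_congr fun j => ?_
  push_cast
  rw [← mul_assoc, mul_comm _ ((j : ℝ) + 1), hCoef_succ', mul_assoc]

lemma hypF_rec (hc : ∀ i : ℕ, c + i ≠ 0) (l : ℝ) :
    hypF c l = hypF (c + 1) l + l / (c * (c + 1)) * hypF (c + 2) l := by
  have sm {c : ℝ} (hc : ∀ i : ℕ, c + i ≠ 0) : Summable fun j => hCoef c j * l ^ j := by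
    refine (summable_hCoef hc (|l| + 1) pos!).of_norm_bounded fun j => ?_
    rw [norm_mul, norm_pow, norm_eq_abs, norm_eq_abs]; gcongr; linarith
  have hc1 : ∀ i : ℕ, c + 1 + i ≠ 0 := fun i => by have := hc (i + 1); push_cast at this; rwa [add_assoc, add_comm 1]
  have hc2 : ∀ i : ℕ, c + 2 + i ≠ 0 := fun i => by have := hc (i + 2); push_cast at this; rwa [add_assoc, add_comm 2]
  have sm1 : Summable fun j => hCoef (c + 1) (j + 1) * l ^ (j + 1) := (sm hc1).comp_injective (add_left_injective 1)
  simp only [hypF]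
  rw [(sm hc).tsum_eq_zero_add, (sm hc1).tsum_eq_zero_add, ← tsum_mul_left, add_assoc,
    ← sm1.tsum_add ((sm hc2).mul_left _)]
  refine congrArg₂ _ (by simp [hCoef]) (tsum_congr fun j => ?_)
  have n0 := hc 0
  have n1 := hc 1
  have n2 : c + (j + 1) ≠ 0 := by simpa using hc (j + 1)
  simp at n0 n1
  have nj : j + 1 ≠ 0 := pos!
  have n3 := hc1 j
  simp only [show hCoef (c + 2) j = (c + 1) * ((j + 1) * hCoef (c + 1) (j + 1)) by rw [hCoef_succ', show c + 1 + 1 = c + 2 by ring]; field_simp, show hCoef (c + 1) (j + 1) = c * hCoef c (j + 1) / (c + 1 + j) by rw [hCoef_succ, show hCoef (c + 1) j = c * ((j + 1) * hCoef c (j + 1)) by rw [hCoef_succ']; field_simp]; have := hc1 j; field_simp]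
  field_simp
  ring

lemma contDiff_hypF (hc : ∀ i : ℕ, c + i ≠ 0) : C∞ (hypF c) := by
  rw [contDiff_infty]
  intro j
  induction j generalizing c with
  | zero => exact contDiff_zero.2 (continuous_iff_continuousAt.2 fun l => (hasDerivAt_hypF hc l).continuousAt)
  | succ j ih =>
    push_cast; rw [contDiff_succ_iff_deriv]
    refine ⟨fun l => (hasDerivAt_hypF hc l).differentiableAt, by simp, ?_⟩
    rw [show deriv (hypF c) = fun l => c⁻¹ * hypF (c + 1) l from funext fun l => (hasDerivAt_hypF hc l).deriv]
    exact contDiff_const.mul (ih (fun i => by have := hc (i + 1); push_cast at this; rwa [add_assoc, add_comm 1]))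

lemma exists_wronskian_eq {f f' f'' g g' g'' : ℝ → ℝ}
    (hf : ∀ l, 0 < l → HasDerivAt f (f' l) l) (hf' : ∀ l, 0 < l → HasDerivAt f' (f'' l) l)
    (hg : ∀ l, 0 < l → HasDerivAt g (g' l) l) (hg' : ∀ l, 0 < l → HasDerivAt g' (g'' l) l)
    (ef : ∀ l, 0 < l → l * f'' l + (1 - γ) * f' l = f l)
    (eg : ∀ l, 0 < l → l * g'' l + (1 - γ) * g' l = g l) :
    ∃ C, ∀ l, 0 < l → l ^ (1 - γ) * (f l * g' l - f' l * g l) = C := by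
  have hd : ∀ l ∈ Ioi 0, HasDerivAt (fun l => l ^ (1 - γ) * (f l * g' l - f' l * g l)) 0 l := by
    intro l hl; have hl' : (0 : ℝ) < l := hl
    refine ((hasDerivAt_rpow_const (p := 1 - γ) (Or.inl hl'.ne')).mul
      (((hf l hl).mul (hg' l hl)).sub ((hf' l hl).mul (hg l hl)))).congr_deriv ?_
    rw [show l ^ (1 - γ) = l * l ^ (1 - γ - 1) by rw [rpow_sub_one hl'.ne']; field_simp]; simp only [Pi.mul_apply, Pi.sub_apply]
    linear_combination l ^ (1 - γ - 1) * (f l * eg l hl' - g l * ef l hl')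
  refine ⟨1 ^ (1 - γ) * (f 1 * g' 1 - f' 1 * g 1), fun l hl => ?_⟩
  exact (convex_Ioi 0).is_const_of_fderivWithin_eq_zero
    (fun l hl => (hd l hl).differentiableAt.differentiableWithinAt)
    (fun l hl => by
      rw [fderivWithin_of_isOpen isOpen_Ioi hl]; ext; simpa using (hd l hl).deriv) hl (mem_Ioi.2 one_pos)

lemma exists_psi_eq (hγ : 0 < γ) (hγN : ∀ N : ℕ, γ ≠ N) : ∃ a b : ℝ → ℝ,
    C∞ a ∧ C∞ b ∧ ∀ l, 0 < l → psi γ l = a l + l ^ γ * b l := by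
  have hF : ∀ i : ℕ, 1 - γ + i ≠ 0 := fun i h => hγN (i + 1) (by push_cast; linarith)
  have hF1 : ∀ i : ℕ, 1 - γ + 1 + i ≠ 0 := fun i h => hγN (i + 2) (by push_cast; linarith)
  have hG : ∀ i : ℕ, 1 + γ + i ≠ 0 := fun i => by positivity
  have hG1 : ∀ i : ℕ, 1 + γ + 1 + i ≠ 0 := fun i => by positivity
  have n0 : 1 - γ ≠ 0 := by simpa using hF 0
  have n1 : 1 - γ + 1 ≠ 0 := by simpa using hF1 0
  have n2 : 1 + γ ≠ 0 := pos!
  have n3 : 1 + γ + 1 ≠ 0 := pos!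
  have a1 (l : ℝ) := hasDerivAt_hypF hF l
  have a2 (l : ℝ) := (hasDerivAt_hypF hF1 l).const_mul (1 - γ)⁻¹
  have b0 (l : ℝ) := hasDerivAt_hypF hG l
  have b0' (l : ℝ) := (hasDerivAt_hypF hG1 l).const_mul (1 + γ)⁻¹
  have rp (p : ℝ) {l : ℝ} (hl : 0 < l) := hasDerivAt_rpow_const (p := p) (Or.inl hl.ne')
  have b1 (l : ℝ) hl := (rp γ hl).mul (b0 l)
  have b2 l hl := (((rp (γ - 1) hl).const_mul γ).mul (b0 l)).add ((rp γ hl).mul (b0' l))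
  have ea (l : ℝ) (_ : 0 < l) : l * ((1 - γ)⁻¹ * ((1 - γ + 1)⁻¹ * hypF (1 - γ + 1 + 1) l))
      + (1 - γ) * ((1 - γ)⁻¹ * hypF (1 - γ + 1) l) = hypF (1 - γ) l := by
    rw [hypF_rec hF l, show 1 - γ + 1 + 1 = 1 - γ + 2 by ring]; field_simp; ring
  have eb (l : ℝ) (hl : 0 < l) : l * ((γ * ((γ - 1) * l ^ (γ - 1 - 1))) * hypF (1 + γ) l +
      γ * l ^ (γ - 1) * ((1 + γ)⁻¹ * hypF (1 + γ + 1) l) +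
      (γ * l ^ (γ - 1) * ((1 + γ)⁻¹ * hypF (1 + γ + 1) l) +
        l ^ γ * ((1 + γ)⁻¹ * ((1 + γ + 1)⁻¹ * hypF (1 + γ + 1 + 1) l)))) +
      (1 - γ) * (γ * l ^ (γ - 1) * hypF (1 + γ) l + l ^ γ * ((1 + γ)⁻¹ * hypF (1 + γ + 1) l)) =
      l ^ γ * hypF (1 + γ) l := by
    have e1 : l ^ (γ - 1) = l * l ^ (γ - 1 - 1) := by rw [rpow_sub_one hl.ne' (γ - 1)]; field_simp
    have e3 := hypF_rec hG l; rw [show 1 + γ + 2 = 1 + γ + 1 + 1 by ring] at e3; rw [show l ^ γ = l * (l * l ^ (γ - 1 - 1)) by rw [← e1, rpow_sub_one hl.ne']; field_simp, e1, e3]; field_simp; ring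
  have u2 l hl : HasDerivAt (fun l => -psi (γ - 1) l) (psi (γ - 2) l) l :=
    (hasDerivAt_psi hl (γ - 1)).neg.congr_deriv (by rw [neg_neg]; ring_nf)
  have eu (l : ℝ) (hl : 0 < l) : l * psi (γ - 2) l + (1 - γ) * -psi (γ - 1) l = psi γ l := by
    rw [← psi_rec hl γ]; ring
  obtain ⟨c0, h0⟩ := exists_wronskian_eq (fun l _ => a1 l) (fun l _ => a2 l) b1 b2 ea eb
  obtain ⟨c1, h1⟩ := exists_wronskian_eq (fun l hl => hasDerivAt_psi hl γ) u2 b1 b2 eu eb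
  obtain ⟨c2, h2⟩ := exists_wronskian_eq (fun l _ => a1 l) (fun l _ => a2 l)
    (fun l hl => hasDerivAt_psi hl γ) u2 ea eu
  simp at h0 h1
  have hc0 : c0 = γ := by
    have hA : C∞ (fun l => hypF (1 - γ) l * (γ * hypF (1 + γ) l +
        l * ((1 + γ)⁻¹ * hypF (1 + γ + 1) l)) - (1 - γ)⁻¹ * hypF (1 - γ + 1) l *
        (l * hypF (1 + γ) l)) := by
      have := contDiff_hypF hF; have := contDiff_hypF hF1; have := contDiff_hypF hG; have := contDiff_hypF hG1; fun_prop
    have t := (hA.continuous.tendsto 0).mono_left (nhdsWithin_le_nhds (s := Ioi 0))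
    have v c : hypF c 0 = 1 := by rw [hypF, tsum_eq_single 0 fun j hj => by simp [hj]]; simp [hCoef]
    simp only [v, zero_mul, mul_zero, add_zero, sub_zero, mul_one, one_mul] at t
    refine tendsto_nhds_unique (tendsto_const_nhds.congr' ?_) t; filter_upwards [self_mem_nhdsWithin] with l hl; have hl' : (0 : ℝ) < l := hl; rw [← h0 l hl]; have := (rpow_pos_of_pos hl' γ).ne'
    rw [rpow_sub_one hl'.ne' γ, show l ^ (1 - γ) = l / l ^ γ by rw [rpow_sub hl', rpow_one]]
    field_simp
  refine ⟨fun l => c1 / γ * hypF (1 - γ) l, fun l => c2 / γ * hypF (1 + γ) l,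
    contDiff_const.mul (contDiff_hypF hF), contDiff_const.mul (contDiff_hypF hG), fun l hl => ?_⟩
  have w0 := h0 l hl
  rw [hc0] at w0
  simp only
  field_simp
  rw [← (h1 l hl), ← (h2 l hl)]
  linear_combination -(psi γ l) * w0

lemma exists_psi_split (hγ : 0 < γ) (hγN : ∀ N : ℕ, γ ≠ N) : ∃ κ β : ℝ → ℝ,
    C∞ κ ∧ C∞ β ∧ (∀ j, ∃ C, ∀ l, 0 ≤ l → |iteratedDeriv j κ l| ≤ C) ∧
    (∀ j, ∃ C, ∀ l, 0 ≤ l → |iteratedDeriv j β l| ≤ C) ∧ κ 0 = Gamma γ ∧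
    ∀ l, 0 < l → psi γ l = κ l + l ^ γ * β l := by
  obtain ⟨a, b, ha, hb, hab⟩ := exists_psi_eq hγ hγN
  obtain ⟨χ, hχ, χ1, χ0⟩ : ∃ χ : ℝ → ℝ, C∞ χ ∧ (∀ l, l ≤ 1 → χ l = 1) ∧
      ∀ l, 2 < l → χ l = 0 :=
    ⟨fun l => 1 - smoothTransition (l - 1),
      contDiff_const.sub (smoothTransition.contDiff.comp (contDiff_id.sub contDiff_const)),
      fun l hl => by simp [smoothTransition.zero_of_nonpos (sub_nonpos.2 hl)],
      fun l hl => by simp [smoothTransition.one_of_one_le (show 1 ≤ l - 1 by linarith)]⟩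
  have bdd {f g : ℝ → ℝ} (hf : C∞ f) (j : ℕ) (hg : ∀ l, 2 < l → f l = g l) {C : ℝ}
      (hC : ∀ l, 2 < l → |iteratedDeriv j g l| ≤ C) : ∃ C, ∀ l, 0 ≤ l → |iteratedDeriv j f l| ≤ C := by
    obtain ⟨C', hC'⟩ := isCompact_Icc.exists_bound_of_continuousOn (s := Icc (0 : ℝ) 2)
      (hf.continuous_iteratedDeriv j (by exact_mod_cast le_top)).continuousOn
    refine ⟨max C' C, fun l hl => ?_⟩; rcases le_or_gt l 2 with h | h
    · exact (hC' l ⟨hl, h⟩).trans (le_max_left _ _)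
    · rw [(Filter.eventuallyEq_of_mem (Ioi_mem_nhds h) fun l hl => hg l hl : f =ᶠ[𝓝 l] g).iteratedDeriv_eq j]
      exact (hC l h).trans (le_max_right _ _)
  have hκ : C∞ fun l => χ l * a l := hχ.mul ha
  have hβ : C∞ fun l => χ l * b l + (1 - χ l) * psi (-γ) l := by
    refine (hχ.mul hb).add (contDiff_iff_contDiffAt.2 fun l => ?_); rcases lt_or_ge l 1 with h | h
    · refine (contDiffAt_const (c := 0)).congr_of_eventuallyEq ?_
      filter_upwards [Iio_mem_nhds h] with x hx; rw [χ1 x (le_of_lt hx)]; simp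
    · exact (contDiffAt_const.sub hχ.contDiffAt).mul
        ((contDiffOn_psi _).contDiffAt (Ioi_mem_nhds (by linarith)))
  refine ⟨_, _, hκ, hβ, fun j => bdd hκ j (g := 0) (C := 0) (fun l hl => ?_) (fun l hl => ?_),
    fun j => ?_, ?_, fun l hl => ?_⟩
  · rw [χ0 l hl]; simp
  · simp
  · obtain ⟨C, hC0, hC⟩ := exists_psi_le (μ := γ + j) pos!
    refine bdd hβ j (g := psi (-γ)) (C := C) (fun l hl => ?_) fun l hl => ?_
    · rw [χ0 l hl]; simp
    · have hl' : 0 < l := by linarith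
      rw [iteratedDeriv_psi j _ hl', abs_mul, abs_pow, abs_neg, abs_one, one_pow, one_mul,
        abs_of_nonneg (psi_nonneg _ _), show -γ - (j : ℝ) = -(γ + j) by ring, psi_neg hl']
      have h1 : l ^ (-(γ + j)) ≤ 1 := rpow_le_one_of_one_le_of_nonpos (by linarith)
        (by have : (0 : ℝ) ≤ j := pos!
            linarith)
      have h2 : exp (-√l) ≤ 1 := exp_le_one_iff.2 (by simp)
      calc l ^ (-(γ + j)) * psi (γ + j) l ≤ 1 * (C * exp (-√l)) :=
            mul_le_mul h1 (hC l hl'.le) (psi_nonneg _ _) zero_le_one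
        _ ≤ C := by nlinarith
  · have t1 := ((continuousOn_psi hγ 0 self_mem_Ici).mono Ioi_subset_Ici_self).tendsto
    have t2 : Tendsto (fun l => a l + l ^ γ * b l) (𝓝[>] 0) (𝓝 (a 0)) := by
      have := (ha.continuous.continuousAt.add ((continuousAt_rpow_const 0 γ (Or.inr hγ.le)).mul
        hb.continuous.continuousAt)).tendsto.mono_left (nhdsWithin_le_nhds (s := Ioi 0))
      simp only [Pi.add_apply, Pi.mul_apply, zero_rpow hγ.ne', zero_mul, add_zero] at this; exact this
    simp only [χ1 0 zero_le_one, one_mul]; rw [← (tendsto_nhds_unique (t1.congr' (by filter_upwards [self_mem_nhdsWithin] with l hl using hab l hl)) t2), psi_zero γ hγ]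
  · have e := hab l hl; rw [psi_neg hl, rpow_neg hl.le]; have := (rpow_pos_of_pos hl γ).ne'; field_simp; rw [e]; ring

end

section

variable {f : Bdry n → ℝ} {G : Bdry n → ℂ}

/-! ### The Fourier transform of square-integrable functions -/

lemma integral_fourierInv_mul {f g : Ξ → ℂ} (hf : Integrable f) (hg : Integrable g) :
    ∫ ξ, 𝓕⁻ f ξ * g ξ = ∫ x, f x * 𝓕⁻ g x := by
  have e1 (f : Ξ → ℂ) (ξ : Ξ) : VectorFourier.fourierIntegral fourierChar volume
      (-innerₗ Ξ) f ξ = 𝓕⁻ f ξ := by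
    rw [fourierInv_eq]; simp [VectorFourier.fourierIntegral]
  have e2 (f : Ξ → ℂ) (ξ : Ξ) : VectorFourier.fourierIntegral fourierChar volume
      (-innerₗ Ξ).flip f ξ = 𝓕⁻ f ξ := by
    rw [fourierInv_eq]; simp [VectorFourier.fourierIntegral, real_inner_comm]
  simpa only [e1, e2, smul_eq_mul] using (VectorFourier.integral_fourierIntegral_smul_eq_flip (μ := (volume : Measure Ξ)) (ν := (volume : Measure Ξ)) (L := -innerₗ Ξ) (e := fourierChar) continuous_fourierChar (continuous_inner (𝕜 := ℝ) (E := Ξ)).neg hf hg)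

lemma coeFn_fourierInv_toLp (h1 : Integrable G) (h2 : MemLp G 2) :
    ((𝓕⁻ (h2.toLp G) : Lp ℂ 2 (volume : Measure Ξ)) : Ξ → ℂ) =ᵐ[volume] 𝓕⁻ G := by
  have hc : Continuous (𝓕⁻ G) := by
    rw [fourierInv_eq_fourier_comp_neg]
    exact VectorFourier.fourierIntegral_continuous continuous_fourierChar
      (by simpa using! (continuous_inner (𝕜 := ℝ))) h1.comp_neg
  refine ae_eq_of_integral_contDiff_smul_eq ((Lp.memLp _).locallyIntegrable one_le_two)
    hc.locallyIntegrable fun g hg hgc => ?_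
  set s := (hgc.comp_left Complex.ofReal_zero).toSchwartzMap (ofRealCLM.contDiff.comp hg)
  have es (x : Ξ) : s x = g x := rfl
  have key := congrArg (fun T => T s) (Lp.fourierInv_toTemperedDistribution_eq (h2.toLp G))
  simp at key
  have e3 : ∫ x, (𝓕⁻ s) x * (h2.toLp G) x = ∫ x, (𝓕⁻ s) x * G x := by
    refine integral_congr_ae ?_; filter_upwards [h2.coeFn_toLp] with x hx; rw [hx]
  have e4 := integral_fourierInv_mul s.integrable h1
  rw [e3, SchwartzMap.fourierInv_coe, e4] at key
  simp only [es] at key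
  simpa using key.symm

lemma fourierL2_of_memLp (h : MemLp f 2) :
    fourierL2 f = ((𝓕 (h.ofReal (K := ℂ)).toLp : Lp ℂ 2 (volume : Measure Ξ)) : Ξ → ℂ) :=
  dif_pos (h.ofReal)

lemma memLp_fourierL2 (h : MemLp f 2) : MemLp (fourierL2 f) 2 := by
  rw [fourierL2_of_memLp h]
  exact Lp.memLp _

lemma fourierL2_comb {g : Ξ → ℝ} (hf : MemLp f 2) (hg : MemLp g 2) (c : ℝ) :
    fourierL2 (fun x => c * f x + g x) =ᵐ[volume] fun ξ => c * fourierL2 f ξ + fourierL2 g ξ := by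
  have hs : MemLp (fun x => c * f x + g x) 2 := (hf.const_mul c).add hg
  rw [fourierL2_of_memLp hf, fourierL2_of_memLp hg, fourierL2_of_memLp hs]
  rw [show (hs.ofReal (K := ℂ)).toLp = (c : ℂ) • (hf.ofReal (K := ℂ)).toLp + (hg.ofReal (K := ℂ)).toLp by rw [← MemLp.toLp_const_smul, ← MemLp.toLp_add]; congr 1; ext x; simp, FourierTransform.fourier_add, FourierTransform.fourier_smul]
  filter_upwards [Lp.coeFn_add ((c : ℂ) • 𝓕 (hf.ofReal (K := ℂ)).toLp) (𝓕 (hg.ofReal (K := ℂ)).toLp),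
    Lp.coeFn_smul (c : ℂ) (𝓕 (hf.ofReal (K := ℂ)).toLp)] with ξ h1 h2
  rw [h1, Pi.add_apply, h2, Pi.smul_apply, smul_eq_mul]

lemma integral_norm_fourierL2_sq (h : MemLp f 2) : ∫ ξ, ‖fourierL2 f ξ‖ ^ 2 = ∫ x, f x ^ 2 := by
  have e (g : Lp ℂ 2 (volume : Measure Ξ)) : ∫ x, ‖g x‖ ^ 2 = ‖g‖ ^ 2 := by
    have := L2.inner_def (𝕜 := ℂ) g g; rw [inner_self_eq_norm_sq_to_K] at this; simp at this; have h2 : (‖g‖ ^ 2 : ℝ) = ((∫ x, ‖g x‖ ^ 2 : ℝ) : ℂ) := by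
      rw [← integral_complex_ofReal]; push_cast; exact this
    exact (Complex.ofReal_injective h2).symm
  rw [fourierL2_of_memLp h, e, Lp.norm_fourier_eq, ← e]
  refine integral_congr_ae ?_
  filter_upwards [(h.ofReal (K := ℂ)).coeFn_toLp] with x hx
  rw [hx]
  simp

lemma conj_fourierInv (G : Ξ → ℂ) (x : Ξ) :
    (starRingEnd ℂ) (𝓕⁻ (fun ξ => (starRingEnd ℂ) (G ξ)) x) = 𝓕 G x := by
  rw [fourierInv_eq', fourier_eq', ← integral_conj]
  congr 1
  ext ξ
  simp [← Complex.exp_conj, Complex.conj_ofNat]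

lemma integral_fourierL2_mul (hf : MemLp f 2) (h1 : Integrable G)
    (h2 : MemLp G 2) : ∫ ξ, fourierL2 f ξ * G ξ = ∫ x, f x * 𝓕 G x := by
  have c1 : Integrable fun ξ => (starRingEnd ℂ) (G ξ) := by
    simpa using Complex.conjCLE.toContinuousLinearMap.integrable_comp h1
  have c2 := h2.of_le c1.aestronglyMeasurable (ae_of_all _ fun ξ => by simp)
  have hf' := hf.ofReal (K := ℂ)
  have key := Lp.inner_fourier_eq (𝓕⁻ (c2.toLp _)) hf'.toLp
  rw [FourierTransform.fourier_fourierInv_eq, L2.inner_def, L2.inner_def] at key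
  rw [fourierL2_of_memLp hf]
  rw [show ∫ ξ, 𝓕 hf'.toLp ξ * G ξ = ∫ ξ, inner ℂ ((c2.toLp _) ξ) (𝓕 hf'.toLp ξ) by refine integral_congr_ae ?_; filter_upwards [c2.coeFn_toLp] with ξ h; rw [h]; simp, key]
  refine integral_congr_ae ?_
  filter_upwards [coeFn_fourierInv_toLp c1 c2, hf'.coeFn_toLp] with x h h'
  rw [h, h', ← conj_fourierInv]
  simp

lemma lintegral_enorm_fourierInv_sq (h1 : Integrable G) (h2 : MemLp G 2) :
    ∫⁻ x, ‖𝓕⁻ G x‖ₑ ^ 2 = ∫⁻ ξ, ‖G ξ‖ₑ ^ 2 := by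
  have e0 : ‖(𝓕⁻ (h2.toLp G))‖ = ‖h2.toLp G‖ := by
    rw [← Lp.norm_fourier_eq (𝓕⁻ (h2.toLp G)), FourierTransform.fourier_fourierInv_eq]
  have e (g : Ξ → ℂ) : ∫⁻ x, ‖g x‖ₑ ^ 2 = eLpNorm g 2 volume ^ 2 := by
    rw [eLpNorm_eq_lintegral_rpow_enorm_toReal two_ne_zero ENNReal.ofNat_ne_top, ← ENNReal.rpow_natCast,
      ← ENNReal.rpow_mul]
    simp
  rw [Lp.norm_def, Lp.norm_def, ENNReal.toReal_eq_toReal_iff' (Lp.eLpNorm_ne_top _)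
    (Lp.eLpNorm_ne_top _), eLpNorm_congr_ae (coeFn_fourierInv_toLp h1 h2),
    eLpNorm_congr_ae h2.coeFn_toLp] at e0
  rw [e, e, e0]

lemma fourierL2_of_hasCompactSupport (hf : C∞ f) (hc : HasCompactSupport f) :
    ∃ s : SchwartzMap Ξ ℂ, fourierL2 f =ᵐ[volume] s ∧ (∀ x, 𝓕⁻ (s : Ξ → ℂ) x = f x) ∧
      ∃ t : SchwartzMap Ξ ℂ, (∀ x, t x = f x) ∧ s = 𝓕 t := by
  set t := (hc.comp_left Complex.ofReal_zero).toSchwartzMap (ofRealCLM.contDiff.comp hf)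
  have et (x : Ξ) : t x = f x := rfl
  have h2 : MemLp f 2 := hf.continuous.memLp_of_hasCompactSupport hc
  refine ⟨𝓕 t, ?_, fun x => ?_, t, et, rfl⟩
  · have e0 : (h2.ofReal).toLp = t.toLp 2 := by
      apply Lp.ext; filter_upwards [(h2.ofReal (K := ℂ)).coeFn_toLp, t.coeFn_toLp 2 volume] with x h1 h3; rw [h1, h3]; rfl
    rw [fourierL2_of_memLp h2, e0, SchwartzMap.toLp_fourier_eq]; exact (𝓕 t).coeFn_toLp 2 volume
  · rw [← SchwartzMap.fourierInv_coe, FourierTransform.fourierInv_fourier_eq, et]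

end

section

variable {O : Set ℝ} {h : Bdry n → ℂ} {κ κ' : ℝ → ℝ} {p : Amb n} {s μ : ℝ}

local notation "ϖ" => 1 - 2 * s

/-! ### Functions given by a Fourier integral with a radial profile -/

/-- The plane wave `e^{2πi⟨ξ,x⟩}`. -/
def pw (ξ x : Ξ) : ℂ := Complex.exp (↑(2 * π * inner ℝ ξ x) * Complex.I)

/-- The argument of the profiles. -/
def lam (ξ : Ξ) (y : ℝ) : ℝ := π ^ 2 * ‖ξ‖ ^ 2 * y ^ 2

/-- The function with Fourier transform `h(ξ) κ(π²|ξ|²y²)` on the slices. -/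
def Ext (h : Ξ → ℂ) (κ : ℝ → ℝ) : Ψ := fun p =>
  ∫ ξ, (h ξ * pw ξ p.1).re * κ (lam ξ p.2)

lemma norm_pw (ξ x : Ξ) : ‖pw ξ x‖ = 1 := Complex.norm_exp_ofReal_mul_I _

lemma continuous_pw (x : Ξ) : Continuous fun ξ : Ξ => pw ξ x := by unfold pw; fun_prop

lemma continuous_lam (y : ℝ) : Continuous fun ξ : Ξ => lam ξ y := by unfold lam; fun_prop

lemma lam_nonneg (ξ : Ξ) (y : ℝ) : 0 ≤ lam ξ y := by unfold lam; positivity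

/-- Conditions which allow differentiation under the integral at heights `y ∈ O`. -/
structure Adm (O : Set ℝ) (h : Ξ → ℂ) (κ : ℝ → ℝ) : Prop where
  meas : AEStronglyMeasurable h
  smooth : ∀ᵐ ξ, ∀ y ∈ O, ContDiffAt ℝ ∞ κ (lam (ξ : Ξ) y)
  meas' : ∀ j : ℕ, ∀ y ∈ O, AEStronglyMeasurable fun ξ : Ξ => iteratedDeriv j κ (lam ξ y)
  bound : ∀ j p : ℕ, ∀ y₀ ∈ O, ∃ ε > 0, ∃ g : Ξ → ℝ, Integrable g ∧ ∀ᵐ ξ, ∀ y ∈ O,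
    |y - y₀| < ε → ‖h ξ‖ * ‖ξ‖ ^ (2 * j) * (1 + ‖ξ‖) ^ p * |iteratedDeriv j κ (lam ξ y)| ≤ g ξ

lemma Adm.mul (H : Adm O h κ) {c : Ξ → ℂ}
    (hc : Continuous c) {r : ℕ} {C : ℝ} (hC : ∀ ξ, ‖c ξ‖ ≤ C * (1 + ‖ξ‖) ^ r) :
    Adm O (fun ξ => c ξ * h ξ) κ := by
  refine ⟨hc.aestronglyMeasurable.mul H.meas, H.smooth, H.meas', fun j p y₀ hy₀ => ?_⟩
  obtain ⟨ε, hε, g, hg, hb⟩ := H.bound j (p + r) y₀ hy₀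
  refine ⟨ε, hε, fun ξ => C * g ξ, hg.const_mul C, ?_⟩
  have hC0 : 0 ≤ C := by simpa using (norm_nonneg _).trans (hC 0)
  filter_upwards [hb] with ξ hξ y hy hyy
  calc ‖c ξ * h ξ‖ * ‖ξ‖ ^ (2 * j) * (1 + ‖ξ‖) ^ p * |iteratedDeriv j κ (lam ξ y)|
      = ‖c ξ‖ * (‖h ξ‖ * ‖ξ‖ ^ (2 * j) * (1 + ‖ξ‖) ^ p * |iteratedDeriv j κ (lam ξ y)|) := by rw [norm_mul]; ring
    _ ≤ C * (1 + ‖ξ‖) ^ r * (‖h ξ‖ * ‖ξ‖ ^ (2 * j) * (1 + ‖ξ‖) ^ p *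
        |iteratedDeriv j κ (lam ξ y)|) := by gcongr; exact hC ξ
    _ = C * (‖h ξ‖ * ‖ξ‖ ^ (2 * j) * (1 + ‖ξ‖) ^ (p + r) * |iteratedDeriv j κ (lam ξ y)|) := by rw [pow_add]; ring
    _ ≤ C * g ξ := by gcongr; exact hξ y hy hyy

protected lemma Adm.deriv (H : Adm O h κ) :
    Adm O (fun ξ => (‖ξ‖ ^ 2 : ℝ) * h ξ) (deriv κ) := by
  have e j : iteratedDeriv j (deriv κ) = iteratedDeriv (j + 1) κ := iteratedDeriv_succ'.symm
  refine ⟨(Continuous.aestronglyMeasurable (by fun_prop)).mul H.meas, ?_, fun j => ?_, fun j p y₀ hy₀ => ?_⟩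
  · filter_upwards [H.smooth] with ξ hξ y hy; have := (hξ y hy).fderiv_right (m := ∞) (by simp); exact this.clm_apply contDiffAt_const
  · simpa only [e] using H.meas' (j + 1)
  · obtain ⟨ε, hε, g, hg, hb⟩ := H.bound (j + 1) p y₀ hy₀; refine ⟨ε, hε, g, hg, ?_⟩; filter_upwards [hb] with ξ hξ y hy hyy; refine le_trans (le_of_eq ?_) (hξ y hy hyy)
    rw [e, norm_mul, norm_real, norm_pow, norm_norm]; ring

/-- The frequency side of a tangential derivative. -/
def mX (v : Ξ) (h : Ξ → ℂ) : Ξ → ℂ := fun ξ =>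
  (2 * π * inner ℝ ξ v : ℝ) * Complex.I * h ξ

protected lemma Adm.mX (H : Adm O h κ) (v : Ξ) : Adm O (mX v h) κ := by
  refine H.mul (r := 1) (C := 2 * π * ‖v‖) (by fun_prop) fun ξ => ?_
  rw [norm_mul, norm_I, mul_one, norm_real, norm_mul, norm_mul,
    norm_of_nonneg zero_le_two, norm_of_nonneg pi_pos.le]
  calc 2 * π * ‖inner ℝ ξ v‖ ≤ 2 * π * (‖v‖ * (1 + ‖ξ‖)) := by
        gcongr; exact (norm_inner_le_norm ξ v).trans (by nlinarith [norm_nonneg v])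
    _ = _ := by ring

lemma Adm.const_mul (H : Adm O h κ) (c : ℂ) :
    Adm O (fun ξ => c * h ξ) κ := H.mul (r := 0) (C := ‖c‖) continuous_const fun ξ => by simp

lemma Adm.aesm (H : Adm O h κ) (hp : p.2 ∈ O) :
    AEStronglyMeasurable fun ξ => (h ξ * pw ξ p.1).re * κ (lam ξ p.2) := by
  have h2 := H.meas' 0 p.2 hp
  simp at h2
  exact (continuous_re.comp_aestronglyMeasurable (H.meas.mul (continuous_pw p.1).aestronglyMeasurable)).mul h2

lemma abs_re_mul_pw_le (h : Ξ → ℂ) (ξ x : Ξ) : |(h ξ * pw ξ x).re| ≤ ‖h ξ‖ :=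
  (abs_re_le_norm _).trans_eq (by rw [norm_mul, norm_pw, mul_one])

lemma Adm.integrable (H : Adm O h κ)
    (hp : p.2 ∈ O) : Integrable fun ξ => (h ξ * pw ξ p.1).re * κ (lam ξ p.2) := by
  obtain ⟨ε, hε, g, hg, hb⟩ := H.bound 0 0 p.2 hp
  refine hg.mono' (H.aesm hp) ?_
  filter_upwards [hb] with ξ hξ
  have := hξ p.2 hp (by simpa using hε)
  simp at this
  rw [norm_mul]
  exact (mul_le_mul_of_nonneg_right (abs_re_mul_pw_le h ξ p.1) (abs_nonneg _)).trans this

lemma Adm.fderiv_apply (hO : IsOpen O) (H : Adm O h κ)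
    (hp : p.2 ∈ O) : DifferentiableAt ℝ (Ext h κ) p ∧ ∀ v : Υ,
      fderiv ℝ (Ext h κ) p v = Ext (mX v.1 h) κ p +
        v.2 * (2 * π ^ 2 * p.2) * Ext (fun ξ => (‖ξ‖ ^ 2 : ℝ) * h ξ) (deriv κ) p := by
  set D : Υ → Ξ → (Υ →L[ℝ] ℝ) := fun q ξ =>
    ((2 * π) * ((Complex.I * (h ξ * pw ξ q.1)).re * κ (lam ξ q.2))) •
      (innerSL ℝ ξ ∘L ContinuousLinearMap.fst ℝ Ξ ℝ) +
    ((h ξ * pw ξ q.1).re * (2 * π ^ 2 * q.2 * (‖ξ‖ ^ 2 * deriv κ (lam ξ q.2)))) •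
      ContinuousLinearMap.snd ℝ Ξ ℝ with hD
  obtain ⟨ε₀, hε₀, hball⟩ := Metric.isOpen_iff.1 hO p.2 hp
  obtain ⟨ε₁, hε₁, g₁, hg₁, hb₁⟩ := H.bound 0 1 p.2 hp
  obtain ⟨ε₂, hε₂, g₂, hg₂, hb₂⟩ := H.bound 1 0 p.2 hp
  set ε := min ε₀ (min ε₁ ε₂)
  have hε : 0 < ε := lt_min hε₀ (lt_min hε₁ hε₂)
  have hq {q : Υ} (hq : q ∈ Metric.ball p ε) : q.2 ∈ O ∧ |q.2 - p.2| < ε := by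
    have : dist q.2 p.2 < ε := lt_of_le_of_lt (le_max_right _ _) hq
    exact ⟨hball (lt_of_lt_of_le this (min_le_left _ _)), this⟩
  have hbD : ∀ᵐ ξ, ∀ q ∈ Metric.ball p ε, ‖D q ξ‖ ≤ 2 * π * g₁ ξ + 2 * π ^ 2 * (|p.2| + ε) * g₂ ξ := by
    filter_upwards [hb₁, hb₂] with ξ h1 h2 q hqq; obtain ⟨o, ho⟩ := hq hqq
    have h1' := h1 q.2 o (lt_of_lt_of_le ho ((min_le_right _ _).trans (min_le_left _ _)))
    have h2' := h2 q.2 o (lt_of_lt_of_le ho ((min_le_right _ _).trans (min_le_right _ _)))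
    simp at h1' h2'
    have n1 : ‖(innerSL ℝ ξ ∘L ContinuousLinearMap.fst ℝ Ξ ℝ)‖ ≤ 1 + ‖ξ‖ := by
      refine (opNorm_comp_le _ _).trans ?_; rw [innerSL_apply_norm]; have := norm_fst_le ℝ Ξ ℝ; nlinarith [norm_nonneg ξ]
    have n2 := norm_snd_le ℝ Ξ ℝ
    have n3 : |(Complex.I * (h ξ * pw ξ q.1)).re| ≤ ‖h ξ‖ :=
      (abs_re_le_norm _).trans_eq (by rw [norm_mul, norm_mul, norm_pw, norm_I]; ring)
    have n4 : |q.2| ≤ |p.2| + ε := by have := abs_sub_abs_le_abs_sub q.2 p.2; linarith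
    refine (norm_add_le _ _).trans (add_le_add ?_ ?_)
    · rw [norm_smul, norm_mul, norm_of_nonneg (by positivity : (0 : ℝ) ≤ 2 * π), norm_mul,
        norm_eq_abs, norm_eq_abs, mul_assoc]
      gcongr
      calc |(Complex.I * (h ξ * pw ξ q.1)).re| * |κ (lam ξ q.2)| * _
          ≤ ‖h ξ‖ * |κ (lam ξ q.2)| * (1 + ‖ξ‖) := by gcongr
        _ ≤ g₁ ξ := by linarith
    · have e5 : |2 * π ^ 2 * q.2 * (‖ξ‖ ^ 2 * deriv κ (lam ξ q.2))| =
          2 * π ^ 2 * |q.2| * (‖ξ‖ ^ 2 * |deriv κ (lam ξ q.2)|) := by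
        simp [abs_mul]
      rw [norm_smul, norm_mul, norm_eq_abs, norm_eq_abs, e5]
      calc |(h ξ * pw ξ q.1).re| * (2 * π ^ 2 * |q.2| * (‖ξ‖ ^ 2 * |deriv κ (lam ξ q.2)|)) * _
          ≤ ‖h ξ‖ * (2 * π ^ 2 * (|p.2| + ε) * (‖ξ‖ ^ 2 * |deriv κ (lam ξ q.2)|)) * 1 := by
            gcongr; exact abs_re_mul_pw_le h ξ q.1
        _ = 2 * π ^ 2 * (|p.2| + ε) * (‖h ξ‖ * ‖ξ‖ ^ 2 * |deriv κ (lam ξ q.2)|) := by ring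
        _ ≤ _ := by gcongr
  have hDm : AEStronglyMeasurable (D p) := by
    have a1 := H.meas.mul (continuous_pw p.1).aestronglyMeasurable
    have a2 := H.meas' 0 p.2 hp; have a3 := H.meas' 1 p.2 hp; simp at a2 a3
    refine (AEStronglyMeasurable.smul (((continuous_re.comp_aestronglyMeasurable
      (aestronglyMeasurable_const.mul a1)).mul a2).const_mul _)
      (Continuous.aestronglyMeasurable (by fun_prop))).add
      (AEStronglyMeasurable.smul ((continuous_re.comp_aestronglyMeasurable a1).mul
      (((Continuous.aestronglyMeasurable (by fun_prop)).mul a3).const_mul _))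
      aestronglyMeasurable_const)
  have hDb := (hg₁.const_mul (2 * π)).add (hg₂.const_mul (2 * π ^ 2 * (|p.2| + ε)))
  have key := hasFDerivAt_integral_of_dominated_of_fderiv_le
    (F := fun q ξ => (h ξ * pw ξ q.1).re * κ (lam ξ q.2)) (F' := D) (x₀ := p)
    (bound := fun ξ => 2 * π * g₁ ξ + 2 * π ^ 2 * (|p.2| + ε) * g₂ ξ)
    (Metric.ball_mem_nhds p hε) ?_ (H.integrable hp) ?_ ?_ ?_ ?_
  · refine ⟨key.differentiableAt, fun v => ?_⟩; have i1 := (H.mX v.1).integrable hp; have i2 := H.deriv.integrable hp; have hDi :=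
      hDb.mono' hDm (hbD.mono fun ξ hξ => hξ p (Metric.mem_ball_self hε))
    rw [show fderiv ℝ (Ext h κ) p v = ∫ ξ, D p ξ v by rw [show fderiv ℝ (Ext h κ) p = _ from key.fderiv, ContinuousLinearMap.integral_apply hDi], Ext, Ext, ← integral_const_mul, ← integral_add i1 (i2.const_mul _)]
    congr 1; ext ξ; simp only [hD, add_apply, FunLike.coe_smul, Pi.smul_apply,
      ContinuousLinearMap.comp_apply, coe_fst', coe_snd',
      innerSL_apply_apply, mX]
    rw [mul_assoc ((2 * π * inner ℝ ξ v.1 : ℝ) : ℂ), mul_assoc ((2 * π * inner ℝ ξ v.1 : ℝ) : ℂ),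
      re_ofReal_mul, mul_assoc Complex.I, mul_assoc ((‖ξ‖ ^ 2 : ℝ) : ℂ), re_ofReal_mul]
    ring
  · filter_upwards [Metric.ball_mem_nhds p hε] with q h using H.aesm (hq h).1
  · exact hDm
  · exact hbD
  · exact hDb
  · filter_upwards [H.smooth] with ξ hs q hqq
    have d1 : HasFDerivAt (fun q : Υ => 2 * π * inner ℝ ξ q.1)
        ((2 * π) • (innerSL ℝ ξ ∘L ContinuousLinearMap.fst ℝ Ξ ℝ)) q :=
      (innerSL ℝ ξ ∘L ContinuousLinearMap.fst ℝ Ξ ℝ).hasFDerivAt.const_mul (2 * π)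
    have d2 (u : ℝ) : HasDerivAt (fun u : ℝ => (h ξ * Complex.exp (u * Complex.I)).re)
        (Complex.I * (h ξ * Complex.exp (u * Complex.I))).re u := by
      have a : HasDerivAt (fun u : ℝ => h ξ * Complex.exp (u * Complex.I))
          (Complex.I * (h ξ * Complex.exp (u * Complex.I))) u := by
        refine (((ofRealCLM.hasDerivAt (x := u)).mul_const Complex.I).cexp.const_mul (h ξ)).congr_deriv ?_
        simp; ring
      exact Complex.reCLM.hasFDerivAt.comp_hasDerivAt u a
    have d4 : HasFDerivAt (fun q => lam ξ q.2)
        ((π ^ 2 * ‖ξ‖ ^ 2 * (2 * q.2)) • ContinuousLinearMap.snd ℝ Ξ ℝ) q := by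
      exact (show HasDerivAt (fun y => lam ξ y) (π ^ 2 * ‖ξ‖ ^ 2 * (2 * q.2)) q.2 by simpa [lam] using (hasDerivAt_pow 2 q.2).const_mul (π ^ 2 * ‖ξ‖ ^ 2)).comp_hasFDerivAt q hasFDerivAt_snd
    have d5 := ((hs q.2 (hq hqq).1).differentiableAt (by simp)).hasDerivAt.comp_hasFDerivAt q d4
    refine (((d2 (2 * π * inner ℝ ξ q.1)).comp_hasFDerivAt q d1).mul d5).congr_fderiv ?_; simp only [hD, smul_smul, pw]; rw [add_comm]; congr 1
    · congr 1; simp; ring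
    · congr 1; simp only [Function.comp]; ring

lemma Adm.contDiffOn (hO : IsOpen O) (H : Adm O h κ) :
    ContDiffOn ℝ ∞ (Ext h κ) {p | p.2 ∈ O} := by
  have hO' : IsOpen {p : Υ | p.2 ∈ O} := hO.preimage continuous_snd
  rw [contDiffOn_infty]
  intro j
  induction j generalizing h κ with
  | zero => exact contDiffOn_zero.2 fun p hp =>
      (H.fderiv_apply hO hp).1.continuousAt.continuousWithinAt
  | succ j ih =>
    push_cast; refine contDiffOn_succ_of_fderiv_apply
      (fun p hp => (H.fderiv_apply hO hp).1.differentiableWithinAt) (by simp) fun v => ?_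
    refine ContDiffOn.congr ?_ fun p hp => by rw [fderivWithin_of_isOpen hO' hp, (H.fderiv_apply hO hp).2 v]
    exact (ih (H.mX v.1)).add ((ContDiff.contDiffOn (by fun_prop)).mul (ih H.deriv))

lemma Adm.smU (H : Adm (Ioi 0) h κ) : SmU (Ext h κ) := H.contDiffOn isOpen_Ioi

lemma Adm.Dv_eX (H : Adm (Ioi 0) h κ) (i : Fin n) :
    EqOn (Dv (eX i) (Ext h κ)) (Ext (mX (single i 1) h) κ) ℍ :=
  fun p hp => by rw [Dv, (H.fderiv_apply isOpen_Ioi hp).2]; simp [eX]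

protected lemma Adm.dy (H : Adm (Ioi 0) h κ) :
    EqOn (dy (Ext h κ)) (fun p => 2 * π ^ 2 * p.2 *
      Ext (fun ξ => (‖ξ‖ ^ 2 : ℝ) * h ξ) (deriv κ) p) ℍ := fun p hp => by
  rw [dy_eq_Dv H.smU hp, Dv, (H.fderiv_apply isOpen_Ioi hp).2]
  have : Ext (mX 0 h) κ p = 0 := by simp [Ext, mX]
  simp [eY, this]

protected lemma Adm.wLap (H : Adm (Ioi 0) h κ) :
    EqOn (wLap ϖ (Ext h κ)) (Ext (fun ξ => (4 * π ^ 2 * ‖ξ‖ ^ 2 : ℝ) * h ξ)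
      fun l => l * deriv (deriv κ) l + (1 - s) * deriv κ l - κ l) ℍ := by
  intro p hp
  have hp' : (0 : ℝ) < p.2 := hp
  have e1 : LX (Ext h κ) p = ∑ i, Ext (mX (single i 1)
        (mX (single i 1) h)) κ p := by
    rw [H.smU.LX_eq hp]; refine sum_congr rfl fun i _ => ?_; rw [Dv_congr (H.Dv_eX i) _ hp, (H.mX _).Dv_eX i hp]
  have e2 : dy (dy (Ext h κ)) p = 2 * π ^ 2 * (Ext (fun ξ => (‖ξ‖ ^ 2 : ℝ) * h ξ) (deriv κ) p +
      p.2 * (2 * π ^ 2 * p.2 * Ext (fun ξ => (‖ξ‖ ^ 2 : ℝ) * ((‖ξ‖ ^ 2 : ℝ) * h ξ))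
        (deriv (deriv κ)) p)) := by
    rw [dy_congr H.dy hp]; have d := H.deriv.smU.hasDerivAt_slice p.1 hp'
    rw [H.deriv.dy (show (p.1, p.2) ∈ ℍ from hp)] at d
    have := (((hasDerivAt_id p.2).const_mul (2 * π ^ 2)).mul d).deriv
    simp only [dy]; refine this.trans ?_; simp; ring
  have e3 : wLap ϖ (Ext h κ) p = LX (Ext h κ) p +
    dy (dy (Ext h κ)) p +
    ϖ / p.2 * dy (Ext h κ) p := rfl
  rw [e3, e1, e2, H.dy hp]
  have i0 (i : Fin n) := ((H.mX (single i 1)).mX (single i 1)).integrable hp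
  have i1 := (H.deriv.integrable hp).const_mul (2 * π ^ 2 * (2 - 2 * s))
  have i2 := (H.deriv.deriv.integrable hp).const_mul (4 * π ^ 4 * p.2 ^ 2)
  have e4 : ϖ / p.2 * (2 * π ^ 2 * p.2 * Ext (fun ξ => (‖ξ‖ ^ 2 : ℝ) * h ξ) (deriv κ) p) =
      ϖ * (2 * π ^ 2) * Ext (fun ξ => (‖ξ‖ ^ 2 : ℝ) * h ξ) (deriv κ) p := by
    field_simp
  rw [e4]
  trans (∑ i : Fin n, ∫ ξ, (mX (single i 1)
      (mX (single i 1) h) ξ * pw ξ p.1).re * κ (lam ξ p.2)) +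
    (∫ ξ, 2 * π ^ 2 * (2 - 2 * s) * (((‖ξ‖ ^ 2 : ℝ) * h ξ * pw ξ p.1).re * deriv κ (lam ξ p.2))) +
    ∫ ξ, 4 * π ^ 4 * p.2 ^ 2 * (((‖ξ‖ ^ 2 : ℝ) * ((‖ξ‖ ^ 2 : ℝ) * h ξ) * pw ξ p.1).re *
      deriv (deriv κ) (lam ξ p.2))
  · rw [integral_const_mul, integral_const_mul]
    change _ = (∑ i, Ext _ κ p) + 2 * π ^ 2 * (2 - 2 * s) * Ext _ (deriv κ) p +
      4 * π ^ 4 * p.2 ^ 2 * Ext _ (deriv (deriv κ)) p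
    ring
  have i3 := (integrable_finsetSum Finset.univ fun i _ => i0 i).add i1
  simp only [Pi.add_def] at i3
  rw [← integral_finsetSum _ fun i _ => i0 i, ← integral_add (integrable_finsetSum _ fun i _ => i0 i) i1,
    ← integral_add i3 i2, Ext]
  congr 1
  ext ξ
  have f1 (i : Fin n) : (mX (single i 1)
      (mX (single i 1) h) ξ * pw ξ p.1).re =
      -(4 * π ^ 2) * ξ i ^ 2 * (h ξ * pw ξ p.1).re := by
    have : mX (single i 1)
      (mX (single i 1) h) ξ * pw ξ p.1 =
      ((-(4 * π ^ 2) * ξ i ^ 2 : ℝ) : ℂ) * (h ξ * pw ξ p.1) := by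
      simp only [mX, EuclideanSpace.inner_single_right]
      push_cast; simp only [map_one, one_mul, conj_trivial]
      linear_combination (4 * (π : ℂ) ^ 2 * (ξ i : ℂ) ^ 2 * h ξ * pw ξ p.1) * Complex.I_sq
    rw [this, re_ofReal_mul]
  have f2 (c : ℝ) (z : ℂ) : ((c : ℂ) * z * pw ξ p.1).re = c * (z * pw ξ p.1).re := by
    rw [mul_assoc, re_ofReal_mul]
  simp only [f1, f2]
  rw [← sum_mul, ← sum_mul, ← mul_sum]
  rw [(EuclideanSpace.real_norm_sq_eq ξ).symm]
  simp only [lam]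
  ring

lemma Ext_congr_ae {h' : Ξ → ℂ} (e : h =ᵐ[volume] h') (κ : ℝ → ℝ) : Ext h κ = Ext h' κ := by
  ext p
  refine integral_congr_ae ?_
  filter_upwards [e] with ξ hξ
  rw [hξ]

lemma ae_ne_zero (hn : 1 ≤ n) : ∀ᵐ ξ : Ξ, ξ ≠ 0 := by
  have : Nonempty (Fin n) := ⟨⟨0, hn⟩⟩
  exact Measure.ae_ne volume 0

lemma lam_pos {ξ : Ξ} (hξ : ξ ≠ 0) {y : ℝ} (hy : 0 < y) : 0 < lam ξ y := by
  have := norm_pos_iff.2 hξ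
  unfold lam
  positivity

lemma Ext_congr_profile (hn : 1 ≤ n) (h : Ξ → ℂ) (e : EqOn κ κ' (Ioi 0)) :
    EqOn (Ext h κ) (Ext h κ') ℍ := fun p hp => by
  refine integral_congr_ae ?_
  filter_upwards [ae_ne_zero hn] with ξ hξ
  rw [e (lam_pos hξ hp)]

lemma iteratedDeriv_congr_Ioi (e : EqOn κ κ' (Ioi 0)) (j : ℕ) :
    EqOn (iteratedDeriv j κ) (iteratedDeriv j κ') (Ioi 0) := fun l hl =>
  (Filter.eventuallyEq_of_mem (Ioi_mem_nhds hl) fun l hl => e hl : κ =ᶠ[𝓝 l] κ').iteratedDeriv_eq j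

lemma Adm.congr_profile (hn : 1 ≤ n) (H : Adm (Ioi 0) h κ)
    (e : EqOn κ κ' (Ioi 0)) : Adm (Ioi 0) h κ' := by
  refine ⟨H.meas, ?_, fun j y hy => (H.meas' j y hy).congr ?_, fun j p y₀ hy₀ => ?_⟩
  · filter_upwards [H.smooth, ae_ne_zero hn] with ξ hs hξ y hy; exact (hs y hy).congr_of_eventuallyEq
      (Filter.eventuallyEq_of_mem (Ioi_mem_nhds (lam_pos hξ hy)) fun l hl => (e hl).symm)
  · filter_upwards [ae_ne_zero hn] with ξ hξ; exact iteratedDeriv_congr_Ioi e j (lam_pos hξ hy)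
  · obtain ⟨ε, hε, g, hg, hb⟩ := H.bound j p y₀ hy₀; refine ⟨ε, hε, g, hg, ?_⟩; filter_upwards [hb, ae_ne_zero hn] with ξ hb hξ y hy hyy
    rw [← iteratedDeriv_congr_Ioi e j (lam_pos hξ hy)]; exact hb y hy hyy

lemma Adm.profile_const_mul (H : Adm O h κ) (c : ℝ) :
    Adm O h fun l => c * κ l := by
  have e j l : iteratedDeriv j (fun l => c * κ l) l = c * iteratedDeriv j κ l := by
    exact iteratedDeriv_const_mul_field c κ
  refine ⟨H.meas, ?_, fun j y hy => ?_, fun j p y₀ hy₀ => ?_⟩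
  · filter_upwards [H.smooth] with ξ hs y hy using contDiffAt_const.mul (hs y hy)
  · simp; exact (H.meas' j y hy).const_mul c
  · obtain ⟨ε, hε, g, hg, hb⟩ := H.bound j p y₀ hy₀
    refine ⟨ε, hε, fun ξ => |c| * g ξ, hg.const_mul _, ?_⟩; filter_upwards [hb] with ξ hb y hy hyy; rw [e, abs_mul, mul_left_comm]; gcongr; exact hb y hy hyy

lemma Adm.psi_pred (hn : 1 ≤ n) (H : Adm (Ioi 0) h (psi μ)) :
    Adm (Ioi 0) (fun ξ => (‖ξ‖ ^ 2 : ℝ) * h ξ) (psi (μ - 1)) :=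
  (H.deriv.profile_const_mul (-1)).congr_profile hn fun l hl => by simp [deriv_psi hl]

lemma Adm.wLap_psi (hn : 1 ≤ n) (H : Adm (Ioi 0) h (psi μ)) :
    EqOn (wLap (1 - 2 * s) (Ext h (psi μ)))
      (Ext (fun ξ => ((s - μ) * (4 * π ^ 2 * ‖ξ‖ ^ 2) : ℝ) * h ξ) (psi (μ - 1))) ℍ := by
  intro p hp
  rw [H.wLap hp, Ext_congr_profile hn _ (κ' := fun l => (s - μ) * psi (μ - 1) l) (fun l (hl : 0 < l) => ?_) hp]
  · simp only [Ext]; congr 1; ext ξ; push_cast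
    rw [show ((s : ℂ) - μ) * (4 * (π : ℂ) ^ 2 * (‖ξ‖ : ℂ) ^ 2) * h ξ * pw ξ p.1 =
      ((s - μ : ℝ) : ℂ) * (4 * (π : ℂ) ^ 2 * (‖ξ‖ : ℂ) ^ 2 * h ξ * pw ξ p.1) by push_cast; ring,
      re_ofReal_mul]
    ring
  · have hl' := hl; have e : deriv (deriv (psi μ)) l = psi (μ - 2) l := by
      have : deriv (psi μ) =ᶠ[𝓝 l] fun l => -psi (μ - 1) l :=
        Filter.eventuallyEq_of_mem (Ioi_mem_nhds hl') fun l hl => deriv_psi hl μ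
      rw [this.deriv_eq, deriv.fun_neg, deriv_psi hl', neg_neg]; ring_nf
    simp only [e, deriv_psi hl']; rw [← psi_rec hl' μ]; ring

lemma Adm.wLap_iterate_psi (hn : 1 ≤ n) (H : Adm (Ioi 0) h (psi μ)) (j : ℕ) :
    Adm (Ioi 0) (fun ξ => ((∏ i ∈ ℛ j, (s + i - μ)) * (4 * π ^ 2 * ‖ξ‖ ^ 2) ^ j : ℝ) * h ξ)
      (psi (μ - j)) ∧
    EqOn ((wLap ϖ)^[j] (Ext h (psi μ)))
      (Ext (fun ξ => ((∏ i ∈ ℛ j, (s + i - μ)) * (4 * π ^ 2 * ‖ξ‖ ^ 2) ^ j : ℝ) * h ξ)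
        (psi (μ - j))) ℍ := by
  induction j generalizing h μ with
  | zero => simpa using ⟨H, fun _ _ => rfl⟩
  | succ j ih =>
    have H' : Adm (Ioi 0) (fun ξ => ((s - μ) * (4 * π ^ 2 * ‖ξ‖ ^ 2) : ℝ) * h ξ) (psi (μ - 1)) := by
      convert (H.psi_pred hn).const_mul ((s - μ) * (4 * π ^ 2)) using 2; push_cast; ring
    obtain ⟨i1, i2⟩ := ih H'; have e : (fun ξ : Ξ => (((∏ i ∈ ℛ j, (s + i - (μ - 1))) *
        (4 * π ^ 2 * ‖ξ‖ ^ 2) ^ j : ℝ) : ℂ) * (((s - μ) * (4 * π ^ 2 * ‖ξ‖ ^ 2) : ℝ) * h ξ)) =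
        fun ξ => ((∏ i ∈ ℛ (j + 1), (s + i - μ)) * (4 * π ^ 2 * ‖ξ‖ ^ 2) ^ (j + 1) : ℝ) * h ξ := by
      ext ξ; rw [prod_range_succ', ← mul_assoc]; congr 2
      rw [prod_congr rfl fun (i : ℕ) _ => show s + (i : ℝ) - (μ - 1) = s + ((i + 1 : ℕ) : ℝ) - μ by
        push_cast; ring]
      push_cast; ring
    rw [e, show μ - 1 - (j : ℝ) = μ - ((j + 1 : ℕ) : ℝ) by push_cast; ring] at i1 i2
    exact ⟨i1, fun p hp => (wLap_iterate_congr (H.wLap_psi hn) j hp).trans (i2 hp)⟩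

end

section

variable {γ y : ℝ} {h : Bdry n → ℂ} {κ : ℝ → ℝ} {O : Set ℝ} {j : ℕ} {U : Amb n → ℝ}

/-! ### The extension has finite energy -/

lemma stronglyMeasurable_psi (μ : ℝ) : StronglyMeasurable (psi μ) := by
  have : Measurable fun q : ℝ × ℝ => psiKer μ q.1 q.2 := by unfold psiKer; fun_prop
  exact this.stronglyMeasurable.integral_prod_right

lemma memLp_one_add_norm (n : ℕ) : MemLp (fun ξ : Bdry n => ((1 + ‖ξ‖) ^ (n + 1))⁻¹) 2 := by
  refine (memLp_two_iff_integrable_sq (Continuous.inv₀ (by fun_prop) fun ξ => by positivity).aestronglyMeasurable).2 ?_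
  refine (integrable_one_add_norm (E := Bdry n) (μ := volume) (r := (2 * (n + 1) : ℕ)) (by simp only [finrank_euclideanSpace, Fintype.card_fin]; norm_cast; omega)).congr (ae_of_all _ fun ξ => ?_)
  change (1 + ‖ξ‖) ^ (-((2 * (n + 1) : ℕ) : ℝ)) = (((1 + ‖ξ‖) ^ (n + 1))⁻¹) ^ 2
  rw [rpow_neg pos!, rpow_natCast, inv_pow, ← pow_mul, mul_comm]

lemma adm_psi (hn : 1 ≤ n) (hγ : 0 < γ) (hγN : ∀ N : ℕ, γ ≠ N)
    (hh : MemLp h 2) : Adm (Ioi 0) h (psi γ) := by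
  refine ⟨hh.1, ?_, fun j y hy => ?_, fun j p y₀ hy₀ => ?_⟩
  · filter_upwards [ae_ne_zero hn] with ξ hξ y hy
    exact (contDiffOn_psi γ).contDiffAt (Ioi_mem_nhds (lam_pos hξ hy))
  · have : AEStronglyMeasurable fun ξ : Ξ => (-1) ^ j * psi (γ - j) (lam ξ y) :=
      (((stronglyMeasurable_psi (γ - j)).comp_measurable
        (continuous_lam y).measurable).const_mul _).aestronglyMeasurable
    refine this.congr ?_; filter_upwards [ae_ne_zero hn] with ξ hξ; rw [iteratedDeriv_psi j γ (lam_pos hξ hy)]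
  · have hy₀ : (0 : ℝ) < y₀ := hy₀; obtain ⟨C, hC, hb⟩ := exists_pow_mul_psi_le hγ hγN j (p + (n + 1))
    set c : ℝ := π ^ 2 * (y₀ / 2) ^ 2 with hc; have hc0 : 0 < c := pos!
    refine ⟨y₀ / 2, pos!, fun ξ => c⁻¹ ^ j * (2 * (1 + c⁻¹)) ^ (p + (n + 1)) * C *
      (‖h ξ‖ * ((1 + ‖ξ‖) ^ (n + 1))⁻¹), ((hh.norm).integrable_mul (memLp_one_add_norm n)).const_mul _, ?_⟩
    filter_upwards [ae_ne_zero hn] with ξ hξ y hy hyy; have hy2 : y₀ / 2 ≤ y := by rw [abs_lt] at hyy; linarith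
    have hl := lam_pos hξ hy; set l := lam ξ y with hl'; have h1 : ‖ξ‖ ^ 2 ≤ c⁻¹ * l := by
      rw [le_inv_mul_iff₀ hc0, hc, hl', lam, mul_right_comm]; gcongr
    have h2 : 1 + ‖ξ‖ ≤ 2 * (1 + c⁻¹) * (1 + l) := by have := inv_pos.2 hc0; nlinarith
    rw [iteratedDeriv_psi j γ hl, abs_mul, abs_pow, abs_neg, abs_one, one_pow, one_mul,
      abs_of_nonneg (psi_nonneg _ _)]
    have h3 : ‖ξ‖ ^ (2 * j) * (1 + ‖ξ‖) ^ (p + (n + 1)) * psi (γ - j) l ≤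
        c⁻¹ ^ j * (2 * (1 + c⁻¹)) ^ (p + (n + 1)) * C := by
      calc _ ≤ (c⁻¹ * l) ^ j * (2 * (1 + c⁻¹) * (1 + l)) ^ (p + (n + 1)) * psi (γ - j) l := by
            rw [pow_mul]; gcongr; exact psi_nonneg _ _
        _ = c⁻¹ ^ j * (2 * (1 + c⁻¹)) ^ (p + (n + 1)) *
            (l ^ j * (1 + l) ^ (p + (n + 1)) * psi (γ - j) l) := by rw [mul_pow, mul_pow]; ring
        _ ≤ _ := by gcongr; exact hb l hl
    calc _ = (‖ξ‖ ^ (2 * j) * (1 + ‖ξ‖) ^ (p + (n + 1)) * psi (γ - j) l) *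
          (‖h ξ‖ * ((1 + ‖ξ‖) ^ (n + 1))⁻¹) := by
          rw [pow_add (1 + ‖ξ‖)]; field_simp
      _ ≤ _ := by gcongr

lemma Ext_eq_re (p : Υ) (hi : Integrable fun ξ => h ξ * κ (lam ξ p.2)) :
    Ext h κ p = (𝓕⁻ (fun ξ => h ξ * κ (lam ξ p.2)) p.1).re := by
  rw [fourierInv_eq', Ext]
  change _ = RCLike.re (∫ ξ, pw ξ p.1 • (h ξ * (κ (lam ξ p.2))))
  rw [← integral_re (by refine (integrable_norm_iff ((continuous_pw p.1).aestronglyMeasurable.smul hi.1)).1 ?_; refine hi.norm.congr (ae_of_all _ fun ξ => ?_); change _ = ‖pw ξ p.1 • (h ξ * (κ (lam ξ p.2)))‖; rw [norm_smul, norm_pw, one_mul])]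
  congr 1; ext ξ
  change _ = (pw ξ p.1 * (h ξ * (κ (lam ξ p.2)))).re
  rw [← mul_assoc, mul_comm (pw ξ p.1), re_mul_ofReal]

lemma Adm.integrable_mul_profile (H : Adm O h κ)
    (hy : y ∈ O) : Integrable fun ξ => h ξ * (κ (lam ξ y) : ℂ) := by
  obtain ⟨ε, hε, g, hg, hb⟩ := H.bound 0 0 y hy
  refine hg.mono' (H.meas.mul (continuous_ofReal.comp_aestronglyMeasurable (H.meas' 0 y hy))) ?_
  filter_upwards [hb] with ξ hξ
  simpa using hξ y hy (by simpa using hε)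

lemma Adm.lintegral_sq_le (H : Adm O h κ)
    (hy : y ∈ O) : ∫⁻ x, ofReal (Ext h κ (x, y) ^ 2) ≤
      ∫⁻ ξ, ofReal (‖h ξ‖ ^ 2 * κ (lam ξ y) ^ 2) := by
  have hi := H.integrable_mul_profile hy
  set G := fun ξ => h ξ * (κ (lam ξ y))
  have e : (∫⁻ ξ, ofReal (‖h ξ‖ ^ 2 * κ (lam ξ y) ^ 2)) = ∫⁻ ξ, ‖G ξ‖ₑ ^ 2 := by
    congr 1; ext ξ
    rw [← ofReal_norm, ← ofReal_pow (norm_nonneg _), norm_mul, norm_real, mul_pow,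
      norm_eq_abs, sq_abs]
  rw [e]
  by_cases hf : ∫⁻ ξ, ‖G ξ‖ₑ ^ 2 < ⊤
  · have h2 : MemLp G 2 := by
      refine ⟨hi.1, (eLpNorm_lt_top_iff_lintegral_rpow_enorm_lt_top two_ne_zero ENNReal.ofNat_ne_top).2 ?_⟩
      simpa using! hf
    rw [← lintegral_enorm_fourierInv_sq hi h2]; refine lintegral_mono fun x => ?_
    rw [← ofReal_norm, ← ofReal_pow (norm_nonneg _), Ext_eq_re (x, y) hi]
    refine ofReal_le_ofReal ?_; rw [← sq_abs]; gcongr; exact abs_re_le_norm _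
  · rw [not_lt_top_iff.1 hf]; exact le_top

/-- Terms which occur in derivatives of order `j` of `Ext h (psi γ)`. -/
def ExtTerm (γ : ℝ) (h : Ξ → ℂ) (j : ℕ) (U : Ψ) : Prop :=
  ∃ (e i : ℕ) (C : ℝ) (h' : Ξ → ℂ), 2 * i ≤ e + j ∧ i ≤ j ∧
    (∀ ξ, ‖h' ξ‖ ≤ C * ‖ξ‖ ^ (e + j) * ‖h ξ‖) ∧ Adm (Ioi 0) h' (psi (γ - i)) ∧
    EqOn U (fun p => p.2 ^ e * Ext h' (psi (γ - i)) p) ℍ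

lemma ExtTerm.smU (H : ExtTerm γ h j U) : SmU U := by
  obtain ⟨e, i, C, h', -, -, -, A, E⟩ := H
  exact SmU.congr ((contDiff_snd.pow e).contDiffOn.mul A.smU) E

lemma ExtTerm.Dv_eX (H : ExtTerm γ h j U)
    (a : Fin n) : ExtTerm γ h (j + 1) (Dv (eX a) U) := by
  obtain ⟨e, i, C, h', h1, h2, hb, A, E⟩ := H
  refine ⟨e, i, 2 * π * C, mX (single a 1) h', by omega, by omega,
    fun ξ => ?_, A.mX _, fun p hp => ?_⟩
  · rw [mX, norm_mul, norm_mul, norm_I, mul_one, norm_real, norm_mul,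
      norm_mul, norm_of_nonneg zero_le_two, norm_of_nonneg pi_pos.le]
    have h3 := norm_inner_le_norm (𝕜 := ℝ) ξ (single a 1)
    rw [PiLp.norm_single, norm_one, mul_one] at h3
    calc _ ≤ 2 * π * ‖ξ‖ * (C * ‖ξ‖ ^ (e + j) * ‖h ξ‖) := by
          have := pi_pos; gcongr; exact hb ξ
      _ = _ := by rw [← add_assoc, pow_succ]; ring
  · beta_reduce; rw [Dv_congr E _ hp, ← A.Dv_eX a hp]; have d1 : DifferentiableAt ℝ (fun q => q.2 ^ e) p := by fun_prop
    have : fderiv ℝ (fun q => q.2 ^ e) p (eX a) = 0 := by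
      rw [show (fun q : Υ => q.2 ^ e) = fun q => (q.2 : ℝ) ^ e from rfl, fderiv_fun_pow e (by fun_prop)]
      simp [eX, fderiv_snd]
    simp only [Dv]; rw [fderiv_fun_mul d1 (A.smU.differentiableAt hp)]; simp [this]

protected lemma ExtTerm.dy (hn : 1 ≤ n) (H : ExtTerm γ h j U) :
    ∃ U₁ U₂, ExtTerm γ h (j + 1) U₁ ∧ ExtTerm γ h (j + 1) U₂ ∧ EqOn (dy U) (fun p => U₁ p + U₂ p) ℍ := by
  obtain ⟨e, i, C, h', h1, h2, hb, A, E⟩ := H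
  have A2 := A.psi_pred hn
  rw [sub_sub, ← cast_succ] at A2
  refine ⟨_, _, ⟨e - 1, i, e * C, fun ξ => e * h' ξ, by omega, by omega, fun ξ => ?_,
    A.const_mul e, fun p _ => rfl⟩, ⟨e + 1, i + 1, 2 * π ^ 2 * C,
      fun ξ => (-(2 * π ^ 2)) * ((‖ξ‖ ^ 2 : ℝ) * h' ξ),
      by omega, by omega, fun ξ => ?_, A2.const_mul _, fun p _ => rfl⟩, fun p hp => ?_⟩
  · rcases Nat.eq_zero_or_pos e with rfl | he
    · simp
    · rw [norm_mul, Complex.norm_natCast, show e - 1 + (j + 1) = e + j by omega]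
      calc _ ≤ e * (C * ‖ξ‖ ^ (e + j) * ‖h ξ‖) := by gcongr; exact hb ξ
        _ = _ := by ring
  · rw [norm_mul, norm_mul, norm_real, norm_neg, norm_pow, norm_norm]
    have : ‖(2 * π ^ 2 : ℂ)‖ = 2 * π ^ 2 := by simp [abs_of_pos pi_pos]
    rw [this]
    calc _ ≤ 2 * π ^ 2 * (‖ξ‖ ^ 2 * (C * ‖ξ‖ ^ (e + j) * ‖h ξ‖)) := by gcongr; exact hb ξ
      _ = _ := by rw [show e + 1 + (j + 1) = (e + j) + 2 by ring, pow_add]; ring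
  · have hp' := hp; rw [dy_congr E hp]; have d := ((hasDerivAt_id p.2).pow e).mul (A.smU.hasDerivAt_slice p.1 hp)
    have d' : dy (fun p => p.2 ^ e * Ext h' (psi (γ - i)) p) p = _ := d.deriv; rw [d', A.dy hp]; beta_reduce
    rw [Ext_congr_profile hn _ (κ := deriv (psi (γ - i))) (κ' := fun l => -psi (γ - (i + 1 : ℕ)) l) (fun l hl => by
      rw [deriv_psi hl, sub_sub, cast_succ]) hp]
    have e2 : Ext (fun ξ => (-(2 * π ^ 2)) * ((‖ξ‖ ^ 2 : ℝ) * h' ξ))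
        (psi (γ - (i + 1 : ℕ))) p = 2 * π ^ 2 * Ext (fun ξ => (‖ξ‖ ^ 2 : ℝ) * h' ξ)
          (fun l => -psi (γ - (i + 1 : ℕ)) l) p := by
      simp only [Ext]; rw [← integral_const_mul]; congr 1; ext ξ
      rw [mul_assoc _ _ (pw _ _), show (-(2 * π ^ 2) : ℂ) = ((-(2 * π ^ 2) : ℝ) : ℂ) by
        push_cast; ring, re_ofReal_mul]
      ring
    rw [show Ext (fun ξ => e * h' ξ) (psi (γ - i)) p = e * Ext h' (psi (γ - i)) p by simp only [Ext]; rw [← integral_const_mul]; congr 1; ext ξ; rw [mul_assoc, ← Complex.ofReal_natCast, re_ofReal_mul, mul_assoc], e2]; simp; ring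

end

section

variable {m s : ℝ} {h : Bdry n → ℂ} {e N : ℕ}

local notation "ϖ" => 1 - 2 * s

lemma norm_iteratedFDeriv_succ_le {U : Ψ} (h : SmU U) (r : ℕ) {p : Υ}
    (hp : p ∈ ℍ) : ‖𝒟 (r + 1) U p‖ ≤ ∑ o, ‖𝒟 r (gr o U) p‖ := by
  set ℓ : Option (Fin n) → (Υ →L[ℝ] ℝ) := fun o => o.elim (ContinuousLinearMap.snd ℝ _ _)
    fun i => (EuclideanSpace.proj i).comp (ContinuousLinearMap.fst ℝ _ _) with hℓ
  have hℓ1 (o : Option (Fin n)) : ‖ℓ o‖ ≤ 1 := by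
    refine opNorm_le_bound _ zero_le_one fun v => ?_; rw [one_mul]; rcases o with _ | i
    · exact norm_snd_le v
    · exact (PiLp.norm_apply_le v.1 i).trans (norm_fst_le v)
  have hg (o : Option (Fin n)) {q : Υ} (hq : q ∈ ℍ) : ContDiffAt ℝ ∞ (gr o U) q := (h.gr o).contDiffAt hq
  have e : fderiv ℝ U =ᶠ[𝓝 p] fun q => ∑ o, toSpanSingleton ℝ (ℓ o) (gr o U q) := by
    filter_upwards [isOpen_upper.mem_nhds hp] with q hq; refine ContinuousLinearMap.ext fun v => ?_
    conv_lhs => rw [show v = (∑ i, v.1 i • (eX i : Υ)) + v.2 • eY by refine Prod.ext ?_ (by simp [eX, eY, Prod.snd_sum]); simpa [eX, eY, Prod.fst_sum] using ((EuclideanSpace.basisFun (Fin n) ℝ).sum_repr v.1).symm]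
    simp only [map_add, map_sum, map_smul, ContinuousLinearMap.toSpanSingleton_apply,
      Fintype.sum_option, _root_.add_apply, sum_apply,
      _root_.smul_apply, smul_eq_mul, gr, dy_eq_Dv h hq, Dv, hℓ]
    rw [add_comm]; simp [mul_comm]
  rw [← norm_iteratedFDeriv_fderiv, e.iteratedFDeriv ℝ r |>.eq_of_nhds, iteratedFDeriv_fun_sum_apply
    (f := fun o q => toSpanSingleton ℝ (ℓ o) (gr o U q))
    fun o _ => (ContinuousLinearMap.contDiff _).contDiffAt.comp p ((hg o hp).of_le (by exact_mod_cast le_top))]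
  refine (norm_sum_le _ _).trans (sum_le_sum fun o _ => ?_)
  refine (ContinuousLinearMap.norm_iteratedFDeriv_comp_left _ (hg o hp) (by exact_mod_cast le_top)).trans ?_
  rw [ContinuousLinearMap.norm_toSpanSingleton]
  exact mul_le_of_le_one_left (norm_nonneg _) (hℓ1 o)

lemma ExtTerm.memLp (hn : 1 ≤ n) {γ : ℝ} {S : Set Υ} {K : ℕ}
    (base : ∀ U, ExtTerm γ h K U → MemLp U 2 ((mu m).restrict S)) (r : ℕ) : ∀ (j : ℕ) (U : Ψ),
    j + r = K → ExtTerm γ h j U → MemLp (fun p => ‖𝒟 r U p‖) 2 ((mu m).restrict S) := by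
  induction r with
  | zero =>
    rintro j U rfl H; simpa using (base U H).norm
  | succ r ih =>
    intro j U hj H; have hm : ∀ᵐ p ∂(mu m).restrict S, p ∈ ℍ := ae_restrict_of_ae (ae_mu m)
    have hme V (hV : SmU V) (r : ℕ) : AEStronglyMeasurable (fun p => ‖𝒟 r V p‖) ((mu m).restrict S) :=
      (aestronglyMeasurable_mu (hV.continuousOn_iteratedFDeriv r).norm).restrict
    have key o : MemLp (fun p => ‖𝒟 r (gr o U) p‖) 2 ((mu m).restrict S) := by
      rcases o with _ | i
      · obtain ⟨U₁, U₂, H₁, H₂, E⟩ := H.dy hn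
        refine ((ih (j + 1) U₁ (by omega) H₁).add (ih (j + 1) U₂ (by omega) H₂)).mono (hme _ H.smU.dy r) ?_
        filter_upwards [hm] with p hp; change ‖‖𝒟 r (dy U) p‖‖ ≤ _
        rw [iteratedFDeriv_congr_upper E r hp, norm_norm,
          show (fun p => U₁ p + U₂ p) = U₁ + U₂ from rfl, iteratedFDeriv_add_apply
          ((H₁.smU.contDiffAt hp).of_le (by exact_mod_cast le_top))
          ((H₂.smU.contDiffAt hp).of_le (by exact_mod_cast le_top)), Pi.add_apply,
          norm_of_nonneg pos!]
        exact norm_add_le _ _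
      · exact ih (j + 1) _ (by omega) (H.Dv_eX i)
    refine (memLp_finsetSum Finset.univ fun o _ => key o).mono (hme _ H.smU _) ?_; filter_upwards [hm] with p hp
    rw [norm_norm, norm_of_nonneg (sum_nonneg fun _ _ => norm_nonneg _)]
    exact norm_iteratedFDeriv_succ_le H.smU r hp

lemma lintegral_ext_sq_le (hh : AEStronglyMeasurable h) {S : Set ℝ}
    {j : ℕ} {C : ℝ} {h' : Ξ → ℂ} {κ : ℝ → ℝ}
    (hb : ∀ ξ, ‖h' ξ‖ ≤ C * ‖ξ‖ ^ (e + j) * ‖h ξ‖) (A : Adm (Ioi 0) h' κ) (hn : 1 ≤ n)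
    {Φ : ℝ → ℝ} (hΦ : Measurable Φ) (hle : ∀ t, 0 < t → (t ^ e * κ (π ^ 2 * t ^ 2)) ^ 2 ≤ Φ t) :
    ∫⁻ p in {p : Υ | p.2 ∈ S}, ofReal ((p.2 ^ e * Ext h' κ p) ^ 2) ∂mu m ≤
      ∫⁻ ξ, ofReal (C ^ 2 * ‖ξ‖ ^ (2 * j) * ‖h ξ‖ ^ 2) * ∫⁻ y in S, ofReal (Φ (‖ξ‖ * y)) ∂nu m := by
  set F : Υ → ENNReal := fun p =>
    ofReal ((ℍ).indicator (fun p => (p.2 ^ e * Ext h' κ p) ^ 2) p) with hF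
  have mF : Measurable F := ENNReal.measurable_ofReal.comp (measurable_indicator_upper
    (((continuous_snd.pow e).continuousOn.mul A.smU.continuousOn).pow 2))
  have e1 : (mu m : Measure Υ).restrict {p : Υ | p.2 ∈ S} =
      (volume : Measure Ξ).prod ((nu m).restrict S) := by
    rw [show {p : Υ | p.2 ∈ S} = univ ×ˢ S by ext; simp, mu, ← Measure.prod_restrict, Measure.restrict_univ]
  have m2 : AEMeasurable (Function.uncurry fun (ξ : Ξ) (y : ℝ) =>
      ofReal (C ^ 2 * ‖ξ‖ ^ (2 * j) * ‖h ξ‖ ^ 2) * ofReal (Φ (‖ξ‖ * y)))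
      ((volume : Measure Ξ).prod ((nu m).restrict S)) := by
    refine AEMeasurable.mul (f := fun q : Ξ × ℝ =>
      ofReal (C ^ 2 * ‖q.1‖ ^ (2 * j) * ‖h q.1‖ ^ 2)) (show AEMeasurable (fun ξ => ofReal (C ^ 2 * ‖ξ‖ ^ (2 * j) * ‖h ξ‖ ^ 2)) (volume : Measure Ξ) by have := hh.norm.aemeasurable; fun_prop).comp_fst ?_
    exact (ENNReal.measurable_ofReal.comp (hΦ.comp (by fun_prop :
      Measurable fun q : Ξ × ℝ => ‖q.1‖ * q.2))).aemeasurable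
  calc _ = ∫⁻ p in {p : Υ | p.2 ∈ S}, F p ∂mu m := by
        refine lintegral_congr_ae ?_; filter_upwards [ae_restrict_of_ae (ae_mu m)] with p hp; rw [hF]; simp only [indicator_of_mem hp]
    _ = ∫⁻ y in S, (∫⁻ x, F (x, y)) ∂nu m := by rw [e1, lintegral_prod_symm _ mF.aemeasurable]
    _ ≤ ∫⁻ y in S, (∫⁻ ξ : Ξ, ofReal (C ^ 2 * ‖ξ‖ ^ (2 * j) * ‖h ξ‖ ^ 2) *
          ofReal (Φ (‖ξ‖ * y))) ∂nu m := by
        refine lintegral_mono_ae ?_; filter_upwards [ae_restrict_of_ae (ae_nu m)] with y hy; have hup (x : Ξ) : (x, y) ∈ ℍ := hy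
        simp only [show ∀ x, F (x, y) = ofReal (y ^ (2 * e)) * ofReal (Ext h' κ (x, y) ^ 2) by intro x; rw [hF, ← ofReal_mul pos!]; simp only [indicator_of_mem (hup x)]; ring_nf]; rw [lintegral_const_mul' _ _ ofReal_ne_top]
        refine (mul_le_mul_right (A.lintegral_sq_le hy) _).trans ?_
        rw [← lintegral_const_mul' _ _ ofReal_ne_top]; refine lintegral_mono_ae ?_; filter_upwards [ae_ne_zero hn] with ξ hξ
        rw [← ofReal_mul pos!, ← ofReal_mul pos!]
        refine ofReal_le_ofReal ?_; have h1 := hle _ (mul_pos (norm_pos_iff.2 hξ) hy); rw [mul_pow ‖ξ‖ y 2, ← mul_assoc] at h1; change ((‖ξ‖ * y) ^ e * κ (lam ξ y)) ^ 2 ≤ _ at h1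
        have h2 : ‖h' ξ‖ ^ 2 ≤ (C * ‖ξ‖ ^ (e + j) * ‖h ξ‖) ^ 2 := by gcongr; exact hb ξ
        calc _ ≤ y ^ (2 * e) * ((C * ‖ξ‖ ^ (e + j) * ‖h ξ‖) ^ 2 * κ (lam ξ y) ^ 2) := by gcongr
          _ = C ^ 2 * ‖ξ‖ ^ (2 * j) * ‖h ξ‖ ^ 2 * ((‖ξ‖ * y) ^ e * κ (lam ξ y)) ^ 2 := by rw [pow_add]; ring
          _ ≤ _ := by gcongr
    _ = ∫⁻ ξ, ∫⁻ y in S, ofReal (C ^ 2 * ‖ξ‖ ^ (2 * j) * ‖h ξ‖ ^ 2) *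
          ofReal (Φ (‖ξ‖ * y)) ∂nu m := (lintegral_lintegral_swap m2).symm
    _ = _ := lintegral_congr fun ξ => lintegral_const_mul' _ _ ofReal_ne_top

lemma exists_pow_mul_psi_sq_le (hs1 : s < 1) {i : ℕ} (h : i ≤ N ∧ 0 < s ∨ i = N + 1 ∧ 1 ≤ e) :
    ∃ C, 0 ≤ C ∧ ∀ t, 0 < t → (t ^ e * psi (N + s - i) (π ^ 2 * t ^ 2)) ^ 2 ≤
      C * ((if i ≤ N then 1 else t ^ (4 * s - 2)) * exp (-t)) := by
  have hexp (t : ℝ) (ht : 0 < t) (a : ℕ) :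
      t ^ a * exp (-√(π ^ 2 * t ^ 2)) ≤ a.factorial * exp (-t) := by
    rw [← mul_pow, sqrt_sq pos!]; have h1 := pow_div_factorial_le_exp t ht.le a; rw [div_le_iff₀ pos!] at h1
    have h2 : exp (-(π * t)) ≤ exp (-t - t) :=
      exp_le_exp.2 (by nlinarith [pi_gt_three])
    calc _ ≤ (exp t * a.factorial) * exp (-t - t) := by gcongr
      _ = _ := by rw [mul_right_comm, ← exp_add]; ring_nf
  have hsq (t : ℝ) (ht : 0 < t) : exp (-t) ^ 2 ≤ exp (-t) := by
    rw [sq]; exact mul_le_of_le_one_left (exp_pos _).le (exp_le_one_iff.2 (by linarith))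
  rcases h with ⟨hi, hs0⟩ | ⟨rfl, he⟩
  · have hiN : (i : ℝ) ≤ N := by exact_mod_cast hi
    obtain ⟨C, hC, hb⟩ := exists_psi_le (μ := N + s - i) (by linarith)
    refine ⟨(C * e.factorial) ^ 2, pos!, fun t ht => ?_⟩; rw [if_pos hi, one_mul]
    calc _ ≤ (t ^ e * (C * exp (-√(π ^ 2 * t ^ 2)))) ^ 2 := by
          gcongr
          · exact mul_nonneg pos! (psi_nonneg _ _)
          · exact hb _ pos!
      _ = (C * (t ^ e * exp (-√(π ^ 2 * t ^ 2)))) ^ 2 := by ring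
      _ ≤ (C * (e.factorial * exp (-t))) ^ 2 :=
          pow_le_pow_left₀ pos! (mul_le_mul_of_nonneg_left (hexp t ht e) hC) 2
      _ = (C * e.factorial) ^ 2 * exp (-t) ^ 2 := by ring
      _ ≤ _ := by gcongr; exact hsq t ht
  · obtain ⟨C, hC, hb⟩ := exists_psi_le (μ := 1 - s) (by linarith)
    refine ⟨((π ^ 2) ^ (s - 1) * C * (e - 1).factorial) ^ 2, pos!, fun t ht => ?_⟩
    rw [if_neg (by omega)]
    rw [show (N + s - (N + 1 : ℕ)) = -(1 - s) by push_cast; ring, psi_neg pos!, show (π ^ 2 * t ^ 2) ^ (-(1 - s)) = (π ^ 2) ^ (s - 1) * t ^ (2 * s - 2) by rw [mul_rpow pos! pos!, ← rpow_natCast t 2, ← rpow_mul ht.le]; push_cast; ring_nf]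
    calc _ = ((π ^ 2) ^ (s - 1) * (t * t ^ (2 * s - 2)) * (t ^ (e - 1) * psi (1 - s) (π ^ 2 * t ^ 2))) ^ 2 := by
          rw [show t ^ e = t ^ (e - 1) * t by rw [← pow_succ]; congr 1; omega]; ring
      _ ≤ ((π ^ 2) ^ (s - 1) * t ^ (2 * s - 1) *
            (t ^ (e - 1) * (C * exp (-√(π ^ 2 * t ^ 2))))) ^ 2 := by
          rw [show t * t ^ (2 * s - 2) = t ^ (2 * s - 1) by rw [mul_comm, ← rpow_add_one ht.ne']; ring_nf]; gcongr
          · exact mul_nonneg pos! (mul_nonneg pos! (psi_nonneg _ _))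
          · exact hb _ pos!
      _ = ((π ^ 2) ^ (s - 1) * t ^ (2 * s - 1) *
            (C * (t ^ (e - 1) * exp (-√(π ^ 2 * t ^ 2))))) ^ 2 := by ring
      _ ≤ ((π ^ 2) ^ (s - 1) * t ^ (2 * s - 1) * (C * ((e - 1).factorial * exp (-t)))) ^ 2 :=
          pow_le_pow_left₀ pos! (mul_le_mul_of_nonneg_left
            (mul_le_mul_of_nonneg_left (hexp t ht _) hC) pos!) 2
      _ = ((π ^ 2) ^ (s - 1) * C * (e - 1).factorial) ^ 2 *
            ((t ^ (2 * s - 1)) ^ 2 * exp (-t) ^ 2) := by ring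
      _ ≤ _ := by rw [show (t ^ (2 * s - 1)) ^ 2 = t ^ (4 * s - 2) by rw [← rpow_natCast, ← rpow_mul ht.le]; push_cast; ring_nf]; gcongr; exact hsq t ht

lemma nu_Iio_lt_top (hs1 : s < 1) (Y : ℝ) : nu ϖ (Iio Y) < ⊤ := by
  rw [nu, withDensity_apply _ measurableSet_Iio, Measure.restrict_restrict measurableSet_Iio]
  have hsub : Iio Y ∩ Ioi 0 ⊆ Ioc 0 (max Y 0) := fun y hy => ⟨hy.2, hy.1.le.trans (le_max_left _ _)⟩
  exact (lintegral_mono_set hsub).trans_lt <| (lintegral_ofReal_le_lintegral_enorm _).trans_lt ((intervalIntegrable_iff_integrableOn_Ioc_of_le (le_max_right _ _)).1 (intervalIntegral.intervalIntegrable_rpow' (by linarith))).2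

lemma lintegral_profile_le (hs0 : 0 < s) (hs1 : s < 1) {ρ : ℝ} (hρ : 0 < ρ) :
    ∫⁻ y, ofReal ((1 + (ρ * y) ^ (4 * s - 2)) * exp (-(ρ * y))) ∂nu ϖ ≤
      ofReal (ρ ^ (2 * s - 2) * (Gamma (2 - 2 * s) + Gamma (2 * s))) := by
  have i1 (a : ℝ) (ha : 0 < a) : IntegrableOn (fun y : ℝ => y ^ (a - 1) * exp (-(ρ * y))) (Ioi 0) := by
    simpa using integrableOn_rpow_mul_exp_neg_mul_rpow (by linarith) one_pos hρ
  have E : EqOn (fun y : ℝ => (1 + (ρ * y) ^ (4 * s - 2)) * exp (-(ρ * y)) * y ^ ϖ)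
      (fun y => y ^ (2 - 2 * s - 1) * exp (-(ρ * y)) +
        ρ ^ (4 * s - 2) * (y ^ (2 * s - 1) * exp (-(ρ * y)))) (Ioi 0) := fun y hy => by
    have hy : 0 < y := hy
    beta_reduce; rw [mul_rpow hρ.le hy.le, show y ^ (2 * s - 1) = y ^ (4 * s - 2) * y ^ ϖ by rw [← rpow_add hy]; ring_nf]; ring_nf
  rw [← ofReal_integral_eq_lintegral_ofReal (integrable_nu_iff.2 (((i1 (2 - 2 * s) (by linarith)).add ((i1 (2 * s) (by linarith)).const_mul (ρ ^ (4 * s - 2)))).congr_fun E.symm measurableSet_Ioi)) (by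
    filter_upwards [ae_nu _] with y hy; positivity), integral_nu,
    setIntegral_congr_fun measurableSet_Ioi E,
    integral_add (i1 (2 - 2 * s) (by linarith)) ((i1 (2 * s) (by linarith)).const_mul _),
    integral_const_mul, integral_rpow_mul_exp_neg_mul_Ioi (by linarith) hρ,
    integral_rpow_mul_exp_neg_mul_Ioi (by linarith) hρ]
  refine ofReal_le_ofReal (le_of_eq ?_)
  have e2 (a : ℝ) : (1 / ρ) ^ a = ρ ^ (-a) := by rw [one_div, inv_rpow hρ.le, rpow_neg hρ.le]
  rw [e2, e2, ← mul_assoc, ← rpow_add hρ]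
  ring_nf

lemma fe_ext (hn : 1 ≤ n) (hs0 : 0 < s) (hs1 : s < 1)     (hh : MemLp h 2) (A : Adm (Ioi 0) h (psi (N + s)))
    (hint : Integrable fun ξ : Ξ => (1 + ‖ξ‖ ^ 2) ^ (N + s : ℝ) * ‖h ξ‖ ^ 2) :
    FE (1 - 2 * s) (N + 1) (Ext h (psi (N + s))) := by
  have T0 : ExtTerm (N + s) h 0 (Ext h (psi (N + s))) :=
    ⟨0, 0, 1, h, by simp, le_rfl, fun ξ => by simp, by simpa using A, fun p _ => by simp⟩
  have dom {a : ℝ} (ha0 : 0 ≤ a) (ha : a ≤ N + s) (ξ : Ξ) :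
      (‖ξ‖ ^ 2) ^ a ≤ (1 + ‖ξ‖ ^ 2) ^ (N + s : ℝ) :=
    (rpow_le_rpow pos! (by linarith) ha0).trans (rpow_le_rpow_of_exponent_le (by nlinarith) ha)
  have fin (C : ℝ) (hC : 0 ≤ C) : ∫⁻ ξ : Ξ, ofReal (C * ((1 + ‖ξ‖ ^ 2) ^ (N + s : ℝ) * ‖h ξ‖ ^ 2)) < ⊤ :=
    (hasFiniteIntegral_iff_ofReal (ae_of_all _ fun ξ => by positivity)).1 (hint.const_mul C).2
  have toL2 {U : Ψ} (hU : SmU U) {S : Set ℝ}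
      (hf : ∫⁻ p in {p : Υ | p.2 ∈ S}, ofReal (U p ^ 2) ∂mu (1 - 2 * s) < ⊤) :
      MemLp U 2 ((mu (1 - 2 * s)).restrict {p | p.2 ∈ S}) := by
    have hm := (aestronglyMeasurable_mu (m := 1 - 2 * s) hU.continuousOn).restrict (s := {p | p.2 ∈ S})
    exact (memLp_two_iff_integrable_sq hm).2 ⟨hm.pow 2, (hasFiniteIntegral_iff_ofReal
      (ae_of_all _ fun p => sq_nonneg _)).2 hf⟩
  have cong {U V : Ψ} (E : EqOn U V ℍ) {S : Set Υ} :
      ∫⁻ p in S, ofReal (U p ^ 2) ∂mu (1 - 2 * s) = ∫⁻ p in S, ofReal (V p ^ 2) ∂mu (1 - 2 * s) := by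
    refine lintegral_congr_ae ?_; filter_upwards [ae_restrict_of_ae (ae_mu _)] with p hp; rw [E hp]
  have top : MemLp (fun p => ‖𝒟 (N + 1) (Ext h (psi (N + s))) p‖) 2
      ((mu (1 - 2 * s)).restrict {p | p.2 ∈ univ}) := by
    refine ExtTerm.memLp hn (K := N + 1) (fun U H => toL2 H.smU ?_) (N + 1) 0 _ (by omega) T0
    obtain ⟨e, i, C, h', h1, h2, hb, A', E⟩ := H
    obtain ⟨D, hD, hD'⟩ := exists_pow_mul_psi_sq_le (s := s) hs1 (N := N) (i := i) (e := e)
      (by rcases Nat.lt_or_ge i (N + 1) with h | h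
          · exact Or.inl ⟨by omega, hs0⟩
          · exact Or.inr ⟨by omega, by omega⟩)
    rw [cong E]; refine (lintegral_ext_sq_le (m := 1 - 2 * s) (S := univ) hh.1 hb A' hn (Φ := fun t => D * ((1 + t ^ (4 * s - 2)) * exp (-t))) (by fun_prop) fun t ht => by refine (hD' t ht).trans ?_; have := rpow_nonneg ht.le (4 * s - 2); gcongr; split_ifs <;> linarith).trans_lt (lt_of_le_of_lt (lintegral_mono_ae ?_)
      (fin (C ^ 2 * (D * (Gamma (2 - 2 * s) + Gamma (2 * s)))) (by
        have := Gamma_pos_of_pos (s := 2 - 2 * s) (by linarith)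
        have := Gamma_pos_of_pos (s := 2 * s) (by linarith); positivity)))
    filter_upwards [ae_ne_zero hn] with ξ hξ; have hρ : 0 < ‖ξ‖ := norm_pos_iff.2 hξ; have l1 := lintegral_profile_le hs0 hs1 hρ; rw [Measure.restrict_univ]; simp only [ofReal_mul hD]; rw [lintegral_const_mul' _ _ ofReal_ne_top]
    refine (mul_le_mul_right (mul_le_mul_right l1 _) _).trans ?_
    rw [← ofReal_mul hD, ← ofReal_mul pos!]; refine ofReal_le_ofReal ?_; have := Gamma_pos_of_pos (s := 2 - 2 * s) (by linarith); have := Gamma_pos_of_pos (by linarith)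
    calc _ = C ^ 2 * (D * (Gamma (2 - 2 * s) + Gamma (2 * s))) *
          ((‖ξ‖ ^ (2 * (N + 1)) * ‖ξ‖ ^ (2 * s - 2)) * ‖h ξ‖ ^ 2) := by ring
      _ ≤ _ := by
        rw [show ‖ξ‖ ^ (2 * (N + 1)) * ‖ξ‖ ^ (2 * s - 2) = (‖ξ‖ ^ 2) ^ (N + s) by rw [← rpow_natCast, ← rpow_natCast, ← rpow_add hρ, ← rpow_mul hρ.le]; push_cast; ring_nf]
        exact mul_le_mul_of_nonneg_left (mul_le_mul_of_nonneg_right (dom pos! le_rfl ξ)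
          pos!) pos!
  have slab (Y : ℝ) (j : ℕ) (hj : j ≤ N) : MemLp (fun p => ‖𝒟 j (Ext h (psi (N + s))) p‖) 2
      ((mu (1 - 2 * s)).restrict {p | p.2 ∈ Iio Y}) := by
    refine ExtTerm.memLp hn (K := j) (fun U H => toL2 H.smU ?_) j 0 _ (by omega) T0
    obtain ⟨e, i, C, h', h1, h2, hb, A', E⟩ := H
    obtain ⟨D, hD, hD'⟩ := exists_pow_mul_psi_sq_le hs1 (N := N) (i := i) (e := e) (Or.inl ⟨by omega, hs0⟩)
    have key := lintegral_ext_sq_le (m := 1 - 2 * s) (S := Iio Y) hh.1 hb A' hn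
      (Φ := fun t => D) measurable_const fun t ht => by
        refine (hD' t ht).trans ?_; rw [if_pos (by omega), one_mul]
        exact mul_le_of_le_one_right hD (exp_le_one_iff.2 (by linarith))
    rw [cong E]; have hnu := nu_Iio_lt_top hs1 Y; rw [lintegral_mul_const' _ _ (by
      rw [setLIntegral_const]; exact ENNReal.mul_ne_top ofReal_ne_top hnu.ne)] at key
    refine key.trans_lt (mul_lt_top (lt_of_le_of_lt (lintegral_mono fun ξ => ?_)
      (fin (C ^ 2) pos!)) ?_)
    · refine ofReal_le_ofReal ?_
      have := dom (a := j) pos! (by linarith [show (j : ℝ) ≤ N by exact_mod_cast hj]) ξ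
      rw [rpow_natCast, ← pow_mul] at this; rw [mul_assoc]; gcongr
    · rw [setLIntegral_const]; exact mul_lt_top ofReal_lt_top hnu
  refine ⟨A.smU, fun Y _ j hj => ?_, ?_⟩
  · rcases Nat.lt_or_ge j (N + 1) with h | h
    · exact (slab Y j (by omega)).integrable_sq
    · obtain rfl : j = N + 1 := by omega
      have := top.integrable_sq
      rw [show {p : Υ | p.2 ∈ univ} = univ by ext; simp, Measure.restrict_univ] at this
      exact this.integrableOn
  · have := top.integrable_sq
    rwa [show {p : Υ | p.2 ∈ univ} = univ by ext; simp, Measure.restrict_univ] at this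

end

section

variable {h : Bdry n → ℂ} {κ : ℝ → ℝ} {γ : ℝ}

/-! ### Regularity of the extension up to the boundary -/

lemma adm_of_decay (hm : AEStronglyMeasurable h)
    (hd : ∀ p : ℕ, Integrable fun ξ => ‖h ξ‖ * (1 + ‖ξ‖) ^ p) (hκ : C∞ κ)
    (hb : ∀ j, ∃ C, ∀ l, 0 ≤ l → |iteratedDeriv j κ l| ≤ C) : Adm univ h κ := by
  refine ⟨hm, ae_of_all _ fun ξ y _ => hκ.contDiffAt, fun j y _ =>
    ((hκ.continuous_iteratedDeriv j (by exact_mod_cast le_top)).comp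
      (continuous_lam y)).aestronglyMeasurable, fun j p y₀ _ => ?_⟩
  obtain ⟨C, hC⟩ := hb j
  refine ⟨1, one_pos, _, (hd (2 * j + p)).mul_const C, ae_of_all _ fun ξ y _ _ => ?_⟩
  rw [pow_add, ← mul_assoc]
  gcongr
  · linarith
  · exact hC _ (lam_nonneg _ _)

lemma integrable_norm_mul_one_add_pow (s : SchwartzMap Ξ ℂ) (p : ℕ) :
    Integrable fun ξ => ‖s ξ‖ * (1 + ‖ξ‖) ^ p := by
  refine (((s.integrable_pow_mul volume 0).add (s.integrable_pow_mul volume p)).const_mul (2 ^ (p - 1))).mono' (by have := s.continuous; fun_prop) (ae_of_all _ fun ξ => ?_)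
  rw [norm_of_nonneg pos!]
  have := add_pow_le zero_le_one (norm_nonneg ξ) p
  rw [one_pow] at this
  calc _ ≤ ‖s ξ‖ * (2 ^ (p - 1) * (1 + ‖ξ‖ ^ p)) := by gcongr
    _ = _ := by simp; ring

lemma Ext_even (A : Adm univ h κ) : IsEvenSmooth (Ext h κ) := by
  refine ⟨contDiffOn_univ.1 ((A.contDiffOn isOpen_univ).mono fun _ _ => trivial), fun x y => ?_⟩
  simp [Ext, lam]

lemma exists_rep_of_hasCompactSupport (hn : 1 ≤ n) (hγ : 0 < γ) (hγN : ∀ N : ℕ, γ ≠ N)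
    {f : Ξ → ℝ} (hf : C∞ f) (hc : HasCompactSupport f) :
    ∃ A B : Ψ, IsEvenSmooth A ∧ IsEvenSmooth B ∧
      RepOn (2 * γ) A B (Ext (fourierL2 f) (psi γ)) ∧ ∀ x, A (x, 0) = Gamma γ * f x := by
  obtain ⟨s, hs, hinv, -⟩ := fourierL2_of_hasCompactSupport hf hc
  obtain ⟨κ, β, hκ, hβ, bκ, bβ, κ0, e⟩ := exists_psi_split hγ hγN
  have hpw : Continuous fun ξ : Ξ => (π ^ 2 * ‖ξ‖ ^ 2) ^ γ :=
    Continuous.rpow_const (by fun_prop) fun _ => Or.inr hγ.le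
  have A1 : Adm univ s κ := adm_of_decay s.continuous.aestronglyMeasurable (integrable_norm_mul_one_add_pow s) hκ bκ
  have A2 : Adm univ (fun ξ => (((π ^ 2 * ‖ξ‖ ^ 2) ^ γ : ℝ) : ℂ) * s ξ) β := by
    refine adm_of_decay ((continuous_ofReal.comp hpw).mul s.continuous).aestronglyMeasurable
      (fun p => ?_) hβ bβ
    refine ((integrable_norm_mul_one_add_pow s (2 * ⌈γ⌉₊ + p)).const_mul
      ((π ^ 2) ^ ⌈γ⌉₊)).mono' ?_ (ae_of_all _ fun ξ => ?_)
    · have := s.continuous; have h1 := continuous_ofReal.comp hpw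
      exact ((h1.mul this).norm.mul (by fun_prop)).aestronglyMeasurable
    · have h1 : (π ^ 2 * ‖ξ‖ ^ 2) ^ γ ≤ (π ^ 2 * (1 + ‖ξ‖) ^ 2) ^ ⌈γ⌉₊ := by
        rw [← rpow_natCast _ ⌈γ⌉₊]
        refine (rpow_le_rpow pos! (?_ : _ ≤ π ^ 2 * (1 + ‖ξ‖) ^ 2) hγ.le).trans
          (rpow_le_rpow_of_exponent_le ?_ (Nat.le_ceil γ))
        · gcongr; linarith
        · have : 1 ≤ (1 + ‖ξ‖) ^ 2 := one_le_pow₀ (by linarith [norm_nonneg ξ]); nlinarith [pi_gt_three]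
      rw [norm_of_nonneg pos!, norm_mul, norm_real, norm_of_nonneg pos!]
      calc _ ≤ (π ^ 2 * (1 + ‖ξ‖) ^ 2) ^ ⌈γ⌉₊ * ‖s ξ‖ * (1 + ‖ξ‖) ^ p := by gcongr
        _ = _ := by rw [mul_pow, pow_add, pow_mul (1 + ‖ξ‖)]; ring
  refine ⟨_, _, Ext_even A1, Ext_even A2, fun p hp => ?_, fun x => ?_⟩
  · have hp' : (0 : ℝ) < p.2 := hp; rw [Ext_congr_ae hs]; simp only [Ext]
    rw [← integral_const_mul, ← integral_add (A1.integrable (mem_univ _)) ((A2.integrable (mem_univ _)).const_mul _)]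
    refine integral_congr_ae ?_; filter_upwards [ae_ne_zero hn] with ξ hξ
    rw [e _ (lam_pos hξ hp), mul_assoc _ _ (pw _ _), re_ofReal_mul, lam,
      mul_rpow pos! pos!, ← rpow_natCast p.2 2, ← rpow_mul hp'.le]
    push_cast; ring
  · rw [← hinv x |> congrArg Complex.re |>.trans (ofReal_re _), Ext_eq_re (x, 0)
      (A1.integrable_mul_profile (mem_univ _))]
    simp only [lam, ne_eq, OfNat.ofNat_ne_zero, not_false_eq_true, zero_pow, mul_zero, κ0]
    rw [fourierInv_eq', fourierInv_eq', ← re_ofReal_mul, ← integral_const_mul]; congr 2; ext ξ; simp; ring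

lemma fourier_pw_mul_psi (hn : 1 ≤ n) (hγ : 0 < γ) (x : Ξ) {y : ℝ} (hy : 0 < y)
    (hi : Integrable fun ξ : Ξ => psi γ (lam ξ y)) (z : Ξ) :
    𝓕 (fun ξ => pw ξ x * (psi γ (lam ξ y) : ℂ)) z =
      ((π ^ (-(n / 2 : ℝ)) * Gamma (n / 2 + γ) * (y ^ (2 * γ) *
        (‖x - z‖ ^ 2 + y ^ 2) ^ (-(n / 2 + γ))) : ℝ) : ℂ) := by
  set w := x - z with hw
  set Φ : Ξ → ℝ → ℂ := fun ξ r => pw ξ w * (psiKer γ (lam ξ y) r) with hΦ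
  have hpw ξ : Complex.exp (↑(-2 * π * inner ℝ ξ z) * Complex.I) * pw ξ x = pw ξ w := by
    rw [pw, pw, hw, ← Complex.exp_add, inner_sub_right]; push_cast; ring_nf
  have nΦ ξ : ∀ᵐ r ∂volume.restrict (Ioi 0), ‖Φ ξ r‖ = psiKer γ (lam ξ y) r := by
    filter_upwards [ae_restrict_mem measurableSet_Ioi] with r hr; rw [hΦ]; simp only
    rw [norm_mul, norm_pw, one_mul, norm_real, norm_of_nonneg (psiKer_nonneg hr)]
  have iΦ : Integrable (Function.uncurry Φ) (volume.prod (volume.restrict (Ioi 0))) := by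
    refine (integrable_prod_iff (by refine Measurable.aestronglyMeasurable ?_; simp only [Function.uncurry_def, hΦ, pw, psiKer, lam]; fun_prop)).2 ⟨ae_of_all _ fun ξ => ?_, hi.congr (ae_of_all _ fun ξ => ?_)⟩
    · refine (integrableOn_psiKer hγ (lam_nonneg ξ y)).mono' ?_ ((nΦ ξ).mono fun r hr => hr.le)
      change AEStronglyMeasurable (fun r => pw ξ w * (Complex.ofReal ∘ psiKer γ (lam ξ y)) r) _
      exact (Complex.measurable_ofReal.comp (measurable_psiKer _ _)).aestronglyMeasurable.const_mul _
    · exact (integral_congr_ae (nΦ ξ)).symm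
  set a := n / 2 + γ with ha
  have e2 : ∀ r ∈ Ioi 0, ∫ ξ, Φ ξ r = (((π * y ^ 2) ^ (-(n / 2 : ℝ)) *
      (r ^ (a - 1) * exp (-((1 + ‖w‖ ^ 2 / y ^ 2) * r))) : ℝ) : ℂ) := by
    intro r (hr : 0 < r); set b := π ^ 2 * y ^ 2 / r with hb
    have e3 : ∀ ξ, Φ ξ r = (exp (-r) * r ^ (γ - 1) : ℝ) *
        Complex.exp (-b * ‖ξ‖ ^ 2 + 2 * π * Complex.I * inner ℝ w ξ) := by
      intro ξ
      rw [hΦ]; simp only [pw, psiKer, lam]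
      rw [Complex.exp_add, real_inner_comm, show (-r - π ^ 2 * ‖ξ‖ ^ 2 * y ^ 2 / r) =
        -r + (-b * ‖ξ‖ ^ 2) by rw [hb]; ring, exp_add]
      push_cast; ring_nf
    simp_rw [e3]
    rw [integral_const_mul, GaussianFourier.integral_cexp_neg_mul_sq_norm_add (V := Ξ) (by simpa using pos!) (2 * π * Complex.I) w, finrank_euclideanSpace, Fintype.card_fin]
    have e5 : (2 * π * Complex.I) ^ 2 * (‖w‖) ^ 2 / (4 * b) = (-(‖w‖ ^ 2 / y ^ 2 * r) : ℝ) := by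
      rw [hb]; push_cast; have : π ≠ 0 := by exact_mod_cast pi_ne_zero
      have : (y : ℂ) ≠ 0 := by exact_mod_cast hy.ne'
      field_simp; rw [Complex.I_sq]; ring
    rw [show (π / b) ^ ((n : ℂ) / 2) = (((π / b) ^ (n / 2 : ℝ) : ℝ) : ℂ) by rw [Complex.ofReal_cpow pos!]; push_cast; rfl, e5, ← Complex.ofReal_exp, ← Complex.ofReal_mul, ← Complex.ofReal_mul]; congr 1; have e6 : π / b = (π * y ^ 2)⁻¹ * r := by rw [hb]; field_simp
    rw [e6, mul_rpow pos! hr.le, inv_rpow pos!,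
      ← rpow_neg pos!, show a - 1 = n / 2 + (γ - 1) by rw [ha]; ring, rpow_add hr,
      show -((1 + ‖w‖ ^ 2 / y ^ 2) * r) = -r + -(‖w‖ ^ 2 / y ^ 2 * r) by ring, exp_add]
    ring
  rw [show 𝓕 (fun ξ => pw ξ x * (psi γ (lam ξ y))) z = ∫ ξ, ∫ r in Ioi 0, Φ ξ r by rw [fourier_eq']; congr 1; ext ξ; rw [smul_eq_mul, ← mul_assoc, hpw, psi, ← integral_complex_ofReal, ← integral_const_mul], integral_integral_swap iΦ, setIntegral_congr_fun measurableSet_Ioi e2, integral_complex_ofReal,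
    integral_const_mul, integral_rpow_mul_exp_neg_mul_Ioi pos! pos!]
  congr 1
  rw [show 1 / (1 + ‖w‖ ^ 2 / y ^ 2) = y ^ 2 * (‖w‖ ^ 2 + y ^ 2)⁻¹ by field_simp; ring, mul_rpow pos! pos!, mul_rpow pos! pos!,
    inv_rpow pos!, ← rpow_neg pos!, ← show (y ^ 2) ^ (-(n / 2 : ℝ)) * (y ^ 2) ^ a = y ^ (2 * γ) by rw [← rpow_add pos!, ← rpow_natCast, ← rpow_mul hy.le, ha]; push_cast; ring_nf]
  ring

end

section

variable {γ : ℝ} {f : Bdry n → ℝ}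

lemma integrable_psi_lam (hn : 1 ≤ n) (hγ : 0 < γ) (hγN : ∀ N : ℕ, γ ≠ N) {y : ℝ} (hy : 0 < y) :
    Integrable (fun ξ : Ξ => psi γ (lam ξ y)) ∧ MemLp (fun ξ : Ξ => psi γ (lam ξ y)) 2 := by
  have hm : AEStronglyMeasurable fun ξ : Ξ => psi γ (lam ξ y) :=
    ((stronglyMeasurable_psi γ).comp_measurable (continuous_lam y).measurable).aestronglyMeasurable
  have h1 : Integrable fun ξ : Ξ => psi γ (lam ξ y) := by
    obtain ⟨ε, hε, g, hg, hb⟩ := (adm_psi hn hγ hγN ((memLp_one_add_norm n).ofReal)).bound 0 (n + 1) y hy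
    refine hg.mono' hm ?_; filter_upwards [hb] with ξ hξ; have := hξ y hy (by simpa using hε)
    rw [RCLike.norm_ofReal, abs_of_nonneg pos!, mul_zero, pow_zero, mul_one, inv_mul_cancel₀
      pos!, one_mul, iteratedDeriv_zero] at this
    exact this
  refine ⟨h1, (memLp_two_iff_integrable_sq hm).2 ?_⟩
  obtain ⟨C, hC, hb⟩ := exists_psi_le hγ
  refine (h1.const_mul C).mono' (hm.pow 2) (ae_of_all _ fun ξ => ?_)
  rw [norm_of_nonneg pos!, sq]
  exact mul_le_mul_of_nonneg_right ((hb _ (lam_nonneg ξ y)).trans (mul_le_of_le_one_right hC (exp_le_one_iff.2 (by simp)))) (psi_nonneg γ (lam ξ y))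

lemma Ext_eq_poisson (hn : 1 ≤ n) (hγ : 0 < γ) (hγN : ∀ N : ℕ, γ ≠ N)
    (hf : MemLp f 2) {p : Υ} (hp : p ∈ ℍ) : Ext (fourierL2 f) (psi γ) p =
      p.2 ^ (2 * γ) * (π ^ (-(n / 2 : ℝ)) * Gamma (n / 2 + γ) *
        ∫ z, f z * (‖p.1 - z‖ ^ 2 + p.2 ^ 2) ^ (-(n / 2 + γ))) := by
  obtain ⟨h1, h2⟩ := integrable_psi_lam hn hγ hγN hp
  set G := fun ξ => pw ξ p.1 * (psi γ (lam ξ p.2)) with hG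
  have mG := (continuous_pw p.1).aestronglyMeasurable.mul (continuous_ofReal.comp_aestronglyMeasurable h1.1)
  have nG ξ : ‖G ξ‖ = ‖psi γ (lam ξ p.2)‖ := by rw [hG]; simp only; rw [norm_mul, norm_pw, one_mul, norm_real]
  have G1 : Integrable G := h1.mono mG (ae_of_all _ fun ξ => (nG ξ).le)
  have G2 : MemLp G 2 := h2.of_le mG (ae_of_all _ fun ξ => (nG ξ).le)
  have key := integral_fourierL2_mul hf G1 G2
  have e1 : Ext (fourierL2 f) (psi γ) p = (∫ ξ, fourierL2 f ξ * G ξ).re := by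
    change _ = RCLike.re (∫ ξ, fourierL2 f ξ * G ξ)
    have i1 : Integrable fun ξ => fourierL2 f ξ * G ξ := (memLp_fourierL2 hf).integrable_mul G2
    rw [← integral_re i1]; refine integral_congr_ae (ae_of_all _ fun ξ => ?_)
    change _ = (fourierL2 f ξ * (pw ξ p.1 * (psi γ (lam ξ p.2) : ℂ))).re
    rw [← mul_assoc, re_mul_ofReal]
  rw [e1, key]
  simp_rw [hG, fourier_pw_mul_psi hn hγ p.1 hp h1, ← Complex.ofReal_mul]
  rw [integral_complex_ofReal, ofReal_re, ← integral_const_mul, ← integral_const_mul]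
  congr 1; ext z; ring

lemma exists_contDiff_rpow {c : ℝ} (hc : 0 < c) (a : ℝ) :
    ∃ g : ℝ → ℝ, C∞ g ∧ ∀ t, c ≤ t → g t = t ^ a := by
  refine ⟨fun t => smoothTransition (2 * t / c - 1) * t ^ a, contDiff_iff_contDiffAt.2 fun t => ?_,
    fun t ht => ?_⟩
  · rcases lt_or_ge 0 t with ht | ht
    · exact (smoothTransition.contDiffAt.comp t (by fun_prop)).mul (contDiffAt_id.rpow_const_of_ne ht.ne')
    · refine (contDiffAt_const (c := (0 : ℝ))).congr_of_eventuallyEq ?_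
      filter_upwards [gt_mem_nhds (show t < c / 2 by linarith)] with u hu
      rw [smoothTransition.zero_of_nonpos, zero_mul]; rw [sub_nonpos, div_le_one hc]; linarith
  · beta_reduce; rw [smoothTransition.one_of_one_le, one_mul]; rw [le_sub_iff_add_le, le_div_iff₀ hc]; linarith

lemma exists_even_kernel {a : ℝ} (ha : (n : ℝ) < 4 * a) (hf : MemLp f 2) {x₀ : Ξ}
    {R : ℝ} (hR : 0 < R) (h0 : ∀ z, ‖z - x₀‖ < R → f z = 0) : ∃ K : Ψ, IsEvenSmooth K ∧
      ∀ p : Υ, ‖p.1 - x₀‖ ≤ R / 2 → K p = ∫ z, f z * (‖p.1 - z‖ ^ 2 + p.2 ^ 2) ^ (-a) := by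
  set c : ℝ := (4 * (2 + (1 + 2 * ‖x₀‖ ^ 2) / R ^ 2))⁻¹ with hc
  have hc0 : 0 < c := pos!
  obtain ⟨g, hg, hgc⟩ := exists_contDiff_rpow hc0 (-a)
  set Q : Υ × (ℝ × Ξ) → ℝ := fun q =>
    (‖q.1.1‖ ^ 2 + q.1.2 ^ 2) * q.2.1 - 2 * inner ℝ q.1.1 q.2.2 + 1 - q.2.1 with hQ
  have cQ : C∞ Q := by
    rw [hQ]; have h1 : C∞ fun q : Υ × (ℝ × Ξ) => ‖q.1.1‖ ^ 2 :=
      (contDiff_norm_sq ℝ).comp (contDiff_fst.comp contDiff_fst)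
    have h2 : C∞ fun q : Υ × (ℝ × Ξ) => (inner ℝ q.1.1 q.2.2 : ℝ) :=
      ContDiff.inner ℝ (by fun_prop) (by fun_prop)
    fun_prop
  set θ : Ξ → ℝ × Ξ := fun z => ((1 + ‖z‖ ^ 2)⁻¹, (1 + ‖z‖ ^ 2)⁻¹ • z) with hθ
  have cθ : Continuous θ := by
    have : Continuous fun z : Ξ => (1 + ‖z‖ ^ 2)⁻¹ := Continuous.inv₀ (by fun_prop) fun z => by positivity
    exact this.prodMk (this.smul continuous_id)
  have bθ (z : Ξ) : θ z ∈ Metric.closedBall (0 : ℝ × Ξ) 1 := by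
    rw [mem_closedBall_zero_iff, Prod.norm_def, hθ]; refine max_le ?_ ?_
    · rw [norm_of_nonneg pos!]; exact inv_le_one_of_one_le₀ (by nlinarith [sq_nonneg ‖z‖])
    · rw [norm_smul, norm_of_nonneg pos!, inv_mul_le_iff₀ pos!]
      nlinarith [sq_nonneg (‖z‖ - 1)]
  have eQ (p : Υ) (z : Ξ) : Q (p, θ z) = (1 + ‖z‖ ^ 2)⁻¹ * (‖p.1 - z‖ ^ 2 + p.2 ^ 2) := by
    rw [hQ, hθ]; simp only [inner_smul_right, norm_sub_sq_real]; field_simp; ring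
  set k : Ξ → ℝ := fun z => f z * (1 + ‖z‖ ^ 2) ^ (-a) with hk
  have ik : Integrable k := by
    refine hf.integrable_mul (q := 2) ?_; have cm : Continuous fun z : Ξ => (1 + ‖z‖ ^ 2) ^ (-a) :=
      Continuous.rpow_const (by fun_prop) fun z => Or.inl pos!
    refine (memLp_two_iff_integrable_sq cm.aestronglyMeasurable).2 ?_
    refine (integrable_rpow_neg_one_add_norm_sq (by simpa using ha)).congr (ae_of_all _ fun z => ?_)
    beta_reduce; rw [← rpow_natCast ((1 + ‖z‖ ^ 2) ^ (-a)) 2, ← rpow_mul pos!]; push_cast; ring_nf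
  set F := fun q => g (Q q) with hF
  have cF := hg.comp cQ
  have cj := continuous_iteratedFDeriv_left cF
  have sm (z : Ξ) : C∞ fun p => F (p, θ z) := cF.comp (contDiff_id.prodMk contDiff_const)
  have ej (j : ℕ) (p : Υ) (z : Ξ) : 𝒟 j (fun p => k z * F (p, θ z)) p =
      k z • 𝒟 j (fun p => F (p, θ z)) p :=
    iteratedFDeriv_const_smul_apply' (a := k z) (f := fun p => F (p, θ z)) (((sm z).of_le (by exact_mod_cast le_top)).contDiffAt)
  refine ⟨fun p => ∫ z, k z * F (p, θ z), ⟨contDiffOn_univ.1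
    (contDiffOn_integral_of_dominated isOpen_univ (ae_of_all _ fun z =>
      (contDiff_const.mul (sm z)).contDiffOn) (fun j p _ => ?_) (fun j p₀ _ => ?_)).1, fun x y => ?_⟩,
    fun p hp => ?_⟩
  · simp_rw [ej]; exact ik.1.smul ((cj j).comp (continuous_const.prodMk cθ)).aestronglyMeasurable
  · obtain ⟨C, hC⟩ := ((isCompact_closedBall p₀ 1).prod (isCompact_closedBall 0 1)).exists_bound_of_continuousOn
      (cj j).continuousOn
    refine ⟨_, Metric.closedBall_mem_nhds _ one_pos, _, ik.norm.mul_const C, ae_of_all _ fun z p hp => ?_⟩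
    rw [ej, norm_smul]; gcongr; exact hC (p, θ z) ⟨hp, bθ z⟩
  · simp [hF, hQ]
  · refine integral_congr_ae (ae_of_all _ fun z => ?_); beta_reduce; rcases lt_or_ge ‖z - x₀‖ R with hz | hz
    · simp [hk, h0 z hz]
    · have h1 : ‖z - x₀‖ / 2 ≤ ‖p.1 - z‖ := by
        have := norm_sub_le_norm_sub_add_norm_sub z p.1 x₀; rw [norm_sub_rev z p.1] at this
        linarith
      have h2 : 1 + ‖z‖ ^ 2 ≤ ‖z - x₀‖ ^ 2 * (2 + (1 + 2 * ‖x₀‖ ^ 2) / R ^ 2) := by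
        have h3 : ‖z‖ ≤ ‖z - x₀‖ + ‖x₀‖ := by simpa using norm_add_le (z - x₀) x₀
        have h4 : 1 + 2 * ‖x₀‖ ^ 2 ≤ ‖z - x₀‖ ^ 2 * ((1 + 2 * ‖x₀‖ ^ 2) / R ^ 2) := by
          rw [mul_div_assoc', le_div_iff₀ pos!, mul_comm]; gcongr
        have h5 : ‖z‖ ^ 2 ≤ (‖z - x₀‖ + ‖x₀‖) ^ 2 := by gcongr
        nlinarith [sq_nonneg (‖z - x₀‖ - ‖x₀‖)]
      have h6 : c ≤ Q (p, θ z) := by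
        rw [eQ, hc, inv_mul_eq_div, le_div_iff₀ pos!, inv_mul_le_iff₀ pos!]
        have h7 : ‖z - x₀‖ ^ 2 ≤ 4 * (‖p.1 - z‖ ^ 2 + p.2 ^ 2) := by nlinarith [norm_nonneg (z - x₀), sq_nonneg p.2]
        have h8 : 0 ≤ 2 + (1 + 2 * ‖x₀‖ ^ 2) / R ^ 2 := pos!
        nlinarith
      rw [hF, hk]; simp only
      rw [hgc _ h6, eQ, mul_rpow pos! pos!, inv_rpow pos!,
        ← rpow_neg pos!, neg_neg, mul_assoc, ← mul_assoc ((1 + ‖z‖ ^ 2) ^ (-a)),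
        ← rpow_add pos!, neg_add_cancel, rpow_zero, one_mul]

lemma Ext_add (hn : 1 ≤ n) (hγ : 0 < γ) (hγN : ∀ N : ℕ, γ ≠ N) {g : Ξ → ℝ}
    (hf : MemLp f 2) (hg : MemLp g 2) (c : ℝ) :
    EqOn (Ext (fourierL2 fun x => c * f x + g x) (psi γ))
      (fun p => c * Ext (fourierL2 f) (psi γ) p + Ext (fourierL2 g) (psi γ) p) ℍ := fun p hp => by
  rw [Ext_congr_ae (fourierL2_comb hf hg c)]
  simp only [Ext]
  rw [← integral_const_mul, ← integral_add (((adm_psi hn hγ hγN (memLp_fourierL2 hf)).integrable hp).const_mul c) ((adm_psi hn hγ hγN (memLp_fourierL2 hg)).integrable hp)]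
  congr 1; ext ξ
  rw [add_mul, add_re, mul_assoc _ _ (pw _ _), re_ofReal_mul]
  ring

lemma exists_rep_ext (hn : 1 ≤ n) (hγ : 0 < γ) (hγN : ∀ N : ℕ, γ ≠ N)
    (hf : C∞ f) (hf2 : MemLp f 2) : ∃ A B : Ψ, IsEvenSmooth A ∧ IsEvenSmooth B ∧
      RepOn (2 * γ) A B (Ext (fourierL2 f) (psi γ)) ∧ ∀ x, A (x, 0) = Gamma γ * f x := by
  set V := Ext (fourierL2 f) (psi γ) with hV
  set W : Ψ := fun p => if p.2 = 0 then Gamma γ * f p.1 else V (p.1, |p.2|) with hW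
  set t : Υ → Set (ℝ × ℝ) := fun p => {q | q.1 + |p.2| ^ (2 * γ) * q.2 = W p} with ht
  have conv (p : Υ) : Convex ℝ (t p) := by
    intro q hq r hr a b _ _ hab
    simp only [ht, mem_ofPred_eq, Prod.fst_add, Prod.snd_add, Prod.smul_fst, Prod.smul_snd, smul_eq_mul] at hq hr ⊢
    calc _ = a * (q.1 + |p.2| ^ (2 * γ) * q.2) + b * (r.1 + |p.2| ^ (2 * γ) * r.2) := by ring
      _ = _ := by rw [hq, hr, ← add_mul, hab, one_mul]
  obtain ⟨g, hg⟩ := exists_contMDiffMap_forall_mem_convex_of_local (n := ⊤) (modelWithCornersSelf ℝ Υ)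
    (F := ℝ × ℝ) conv (fun p₀ => by
      by_cases hp : p₀.2 = 0
      · set x₀ := p₀.1 with hx₀; let χ : ContDiffBump x₀ := ⟨1, 2, one_pos, one_lt_two⟩
        have c1 : HasCompactSupport fun x => χ x * f x := χ.hasCompactSupport.mul_right
        have s1 : C∞ fun x => χ x * f x := χ.contDiff.mul hf
        have l1 : MemLp (fun x => χ x * f x) 2 := s1.continuous.memLp_of_hasCompactSupport c1
        have l2 : MemLp (fun x => f x - χ x * f x) 2 := hf2.sub l1
        have z2 (z : Ξ) (hz : ‖z - x₀‖ < 1) : f z - χ z * f z = 0 := by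
          rw [χ.one_of_mem_closedBall (by simpa [dist_eq_norm] using hz.le), one_mul, sub_self]
        obtain ⟨A, B, hA, hB, hr, hA0⟩ := exists_rep_of_hasCompactSupport hn hγ hγN s1 c1
        obtain ⟨K, hK, hKe⟩ := exists_even_kernel (a := n / 2 + γ) (by linarith [(Nat.cast_nonneg n : (0 : ℝ) ≤ n)])
          l2 one_pos z2
        set C := π ^ (-(n / 2 : ℝ)) * Gamma (n / 2 + γ)
        refine ⟨{q : Υ | ‖q.1 - x₀‖ < 1 / 2}, (isOpen_lt (by fun_prop) continuous_const).mem_nhds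
          (by simp [hx₀]), fun q => (A q, B q + C * K q), ?_, fun q hq => ?_⟩
        · exact (hA.1.prodMk (hB.1.add (contDiff_const.mul hK.1))).contDiffOn.contMDiffOn
        · have hq : ‖q.1 - x₀‖ < 1 / 2 := hq; rw [ht]; simp only [mem_ofPred_eq, hW]; by_cases hq2 : q.2 = 0
          · rw [if_pos hq2, hq2, abs_zero, zero_rpow pos!, zero_mul, add_zero,
              show q = (q.1, 0) from Prod.ext rfl hq2, hA0,
              χ.one_of_mem_closedBall (by simp [dist_eq_norm]; linarith), one_mul]
          · have hup : (q.1, |q.2|) ∈ ℍ := abs_pos.2 hq2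
            have ev {E : Ψ} (hE : IsEvenSmooth E) : E (q.1, |q.2|) = E q := by
              rcases abs_choice q.2 with h | h <;> rw [h]; exact hE.2 q.1 q.2
            rw [if_neg hq2, hV]; conv_rhs => rw [show f = fun x => 1 * (χ x * f x) + (f x - χ x * f x) by ext x; ring]; rw [Ext_add hn hγ hγN l1 l2 1 hup]; beta_reduce; rw [one_mul, hr _ hup, Ext_eq_poisson hn hγ hγN l2 hup,
              ← hKe (q.1, |q.2|) hq.le, ev hA, ev hB, ev hK]
            ring
      · refine ⟨{q : Υ | q.2 ≠ 0}, (isOpen_ne_fun continuous_snd continuous_const).mem_nhds hp,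
          fun q => (V (q.1, |q.2|), 0), ContDiffOn.contMDiffOn fun q hq => ?_, fun q hq => ?_⟩
        · refine ContDiffAt.contDiffWithinAt (ContDiffAt.prodMk ?_ contDiffAt_const)
          exact (((adm_psi hn hγ hγN (memLp_fourierL2 hf2)).smU).contDiffAt (abs_pos.2 hq)).comp (g := V) (f := fun q : Υ => ((q.1, |q.2|) : Υ)) q
            (contDiffAt_fst.prodMk ((contDiffAt_abs hq).comp q contDiffAt_snd))
        · simp only [ht, hW, mem_ofPred_eq, mul_zero, add_zero]; rw [if_neg hq])
  have sg : C∞ (g : Υ → ℝ × ℝ) := g.contMDiff.contDiff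
  have hg' (x : Ξ) (y : ℝ) : (g (x, y)).1 + |y| ^ (2 * γ) * (g (x, y)).2 = W (x, y) := hg (x, y)
  have sr : C∞ fun p : Υ => g (p.1, -p.2) := sg.comp (by fun_prop)
  refine ⟨fun p => ((g p).1 + (g (p.1, -p.2)).1) / 2, fun p => ((g p).2 + (g (p.1, -p.2)).2) / 2,
    ⟨by fun_prop, fun x y => ?_⟩, ⟨by fun_prop, fun x y => ?_⟩, fun p hp => ?_, fun x => ?_⟩
  · simp only [neg_neg]; ring
  · simp only [neg_neg]; ring
  · have hp' : (0 : ℝ) < p.2 := hp; have h1 := hg' p.1 p.2; have h2 := hg' p.1 (-p.2); simp only [hW, neg_eq_zero, hp'.ne', if_false, abs_neg, abs_of_pos hp'] at h1 h2; change V (p.1, p.2) = _; linear_combination (-1 / 2 : ℝ) * (h1 + h2)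
  · have h1 := hg' x 0
    simp only [hW, if_true, abs_zero, zero_rpow (show 2 * γ ≠ 0 by positivity), zero_mul, add_zero] at h1
    simp only [neg_zero, h1]; ring

end

section

variable {u v φ : Bdry n → ℝ}

/-! ### Boundary data of the extension -/

lemma hasCompactSupport_bLap (hu : C∞ u) (hc : HasCompactSupport u) :
    HasCompactSupport (bLap u) := by
  have : bLap u = fun x => ∑ i, fderiv ℝ (fun z => fderiv ℝ u z (single i 1)) x
      (single i 1) := funext fun x => bLap_eq_sum (hu.of_le (by norm_cast)).contDiffAt
  refine HasCompactSupport.of_support_subset_isCompact hc fun x hx => ?_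
  by_contra h
  refine hx ?_
  rw [this]
  refine sum_eq_zero fun i _ => ?_
  have h1 : (fun z => fderiv ℝ u z (single i 1)) =ᶠ[𝓝 x] fun _ => 0 := by
    filter_upwards [(isClosed_tsupport u).isOpen_compl.mem_nhds h] with z hz
    rw [fderiv_of_notMem_tsupport ℝ hz]; rfl
  rw [h1.fderiv_eq]; simp

lemma integral_bLap_mul (hu : C∞ u) (hv : C∞ v)
    (hc : HasCompactSupport v) : ∫ x, bLap u x * v x = ∫ x, u x * bLap v x := by
  have step {f g : Ξ → ℝ} (hf : C∞ f) (hg : C∞ g) (hg' : HasCompactSupport g)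
      (w : Ξ) : ∫ x, f x * fderiv ℝ g x w = - ∫ x, fderiv ℝ f x w * g x := by
    have d (k : Ξ → ℝ) (hk : C∞ k) : Continuous fun x => fderiv ℝ k x w :=
      (hk.continuous_fderiv (by simp)).clm_apply continuous_const
    exact integral_mul_fderiv_eq_neg_fderiv_mul_of_integrable
      (((d f hf).mul hg.continuous).integrable_of_hasCompactSupport hg'.mul_left)
      ((hf.continuous.mul (d g hg)).integrable_of_hasCompactSupport
        (HasCompactSupport.mul_left (hg'.fderiv_apply ℝ w)))
      ((hf.continuous.mul hg.continuous).integrable_of_hasCompactSupport hg'.mul_left)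
      (fun x _ => hf.differentiable (by simp) x) (fun x _ => hg.differentiable (by simp) x)
  have sm {k : Ξ → ℝ} (hk : C∞ k) (w : Ξ) : C∞ fun x => fderiv ℝ k x w :=
    (hk.fderiv_right (m := ∞) (by simp)).clm_apply contDiff_const
  have e {k : Ξ → ℝ} (hk : C∞ k) : bLap k = fun x => ∑ i, fderiv ℝ (fun z =>
      fderiv ℝ k z (single i 1)) x (single i 1) :=
    funext fun x => bLap_eq_sum (hk.of_le (by norm_cast)).contDiffAt
  rw [e hu, e hv]
  simp only [sum_mul, mul_sum]
  rw [integral_finsetSum, integral_finsetSum]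
  · refine sum_congr rfl fun i _ => ?_; rw [step hu (sm hv _) (hc.fderiv_apply ℝ _)]
    have := step (sm hu (single i 1)) hv hc (single i 1); linarith
  · exact fun i _ => (hu.continuous.mul (sm (sm hv _) _).continuous).integrable_of_hasCompactSupport
      (HasCompactSupport.mul_left ((hc.fderiv_apply ℝ _).fderiv_apply ℝ _))
  · exact fun i _ => ((sm (sm hu _) _).continuous.mul hv.continuous).integrable_of_hasCompactSupport hc.mul_left

lemma bLap_iterate (hv : C∞ v) (j : ℕ) :
    C∞ (bLap^[j] v) ∧ (HasCompactSupport v → HasCompactSupport (bLap^[j] v)) := by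
  induction j generalizing v with
  | zero => exact ⟨hv, id⟩
  | succ j ih => exact ⟨(ih (contDiff_bLap hv)).1, fun hc =>
      (ih (contDiff_bLap hv)).2 (hasCompactSupport_bLap hv hc)⟩

lemma integral_bLap_iterate_mul (hu : C∞ u) (hv : C∞ v)
    (hc : HasCompactSupport v) (j : ℕ) : ∫ x, bLap^[j] u x * v x = ∫ x, u x * bLap^[j] v x := by
  induction j generalizing v with
  | zero => rfl
  | succ j ih =>
    rw [iterate_succ_apply', integral_bLap_mul (bLap_iterate hu j).1 hv hc,
      ih (contDiff_bLap hv) (hasCompactSupport_bLap hv hc)]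
    rfl

lemma exists_schwartz (hφ : C∞ φ) (hc : HasCompactSupport φ) :
    ∃ t : SchwartzMap Ξ ℂ, (t : Ξ → ℂ) = (fun x => (φ x : ℂ)) ∧
      ((𝓕⁻ t : SchwartzMap Ξ ℂ) : Ξ → ℂ) = 𝓕⁻ fun x => (φ x : ℂ) := by
  exact ⟨(hc.comp_left Complex.ofReal_zero).toSchwartzMap (ofRealCLM.contDiff.comp hφ), rfl, SchwartzMap.fourierInv_coe _⟩

lemma fourierInv_bLap (hφ : C∞ φ) (hc : HasCompactSupport φ) (ξ : Ξ) :
    𝓕⁻ (fun x => (bLap φ x : ℂ)) ξ = ((-(4 * π ^ 2 * ‖ξ‖ ^ 2) : ℝ) : ℂ) * 𝓕⁻ (fun x => (φ x : ℂ)) ξ := by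
  obtain ⟨t, ht, -⟩ := exists_schwartz hφ hc
  have e2 : 𝓕 (Laplacian.laplacian t) = -(2 * π) ^ 2 •
      SchwartzMap.smulLeftCLM ℂ (fun ξ : Ξ => ‖ξ‖ ^ 2) (𝓕 t) := by
    have h1 := SchwartzMap.laplacian_eq_fourierMultiplierCLM t; rw [h1, FourierTransform.fourier_smul]; congr 1; rw [SchwartzMap.fourierMultiplierCLM_apply, FourierTransform.fourier_fourierInv_eq]
  have e3 := DFunLike.congr_fun e2 (-ξ)
  rw [SchwartzMap.fourier_coe, show Laplacian.laplacian t = fun x => (bLap φ x : ℂ) by ext x; rw [SchwartzMap.laplacian_apply, ht]; exact (hφ.of_le (by norm_cast) : ContDiff ℝ 2 φ).contDiffAt.laplacian_CLM_comp_left (l := ofRealCLM), smul_apply, SchwartzMap.smulLeftCLM_apply_apply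
    (by fun_prop), SchwartzMap.fourier_coe, ht, norm_neg] at e3
  rw [fourierInv_eq_fourier_neg, fourierInv_eq_fourier_neg, e3, Complex.real_smul, Complex.real_smul]
  push_cast; ring

lemma fourierInv_bLap_iterate (hφ : C∞ φ) (hc : HasCompactSupport φ) (j : ℕ)
    (ξ : Ξ) : 𝓕⁻ (fun x => (bLap^[j] φ x : ℂ)) ξ =
      (((-(4 * π ^ 2 * ‖ξ‖ ^ 2)) ^ j : ℝ) : ℂ) * 𝓕⁻ (fun x => (φ x : ℂ)) ξ := by
  induction j with
  | zero => simp
  | succ j ih =>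
    have := fourierInv_bLap (bLap_iterate hφ j).1 ((bLap_iterate hφ j).2 hc) ξ
    simp only [iterate_succ_apply']
    rw [this, ih, ← mul_assoc, ← Complex.ofReal_mul, pow_succ' (-(4 * π ^ 2 * ‖ξ‖ ^ 2)) j]

lemma fourierInv_mul_integrable (hφ : C∞ φ) (hc : HasCompactSupport φ)
    {θ : Ξ → ℝ} (hθ : Continuous θ) {C : ℝ} {p : ℕ} (hb : ∀ ξ, |θ ξ| ≤ C * (1 + ‖ξ‖) ^ p) :
    Integrable (fun ξ => (θ ξ : ℂ) * 𝓕⁻ (fun x => (φ x : ℂ)) ξ) ∧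
      MemLp (fun ξ => (θ ξ : ℂ) * 𝓕⁻ (fun x => (φ x : ℂ)) ξ) 2 := by
  obtain ⟨t, -, ht⟩ := exists_schwartz hφ hc
  simp_rw [← ht]
  set u : SchwartzMap Ξ ℂ := 𝓕⁻ t
  have hm : AEStronglyMeasurable fun ξ => (θ ξ : ℂ) * u ξ :=
    ((continuous_ofReal.comp hθ).mul u.continuous).aestronglyMeasurable
  have hle ξ : ‖θ ξ * u ξ‖ ≤ C * (‖u ξ‖ * (1 + ‖ξ‖) ^ p) := by
    rw [norm_mul, norm_real, norm_eq_abs]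
    calc _ ≤ C * (1 + ‖ξ‖) ^ p * ‖u ξ‖ := by gcongr; exact hb ξ
      _ = _ := by ring
  obtain ⟨D, -, hD⟩ := u.decay 0 0
  simp at hD
  refine ⟨((integrable_norm_mul_one_add_pow u p).const_mul C).mono' hm (ae_of_all _ hle),
    (memLp_two_iff_integrable_sq_norm hm).2 ?_⟩
  refine ((integrable_norm_mul_one_add_pow u (2 * p)).const_mul (C ^ 2 * D)).mono' (hm.norm.pow 2)
    (ae_of_all _ fun ξ => ?_)
  rw [norm_of_nonneg pos!]
  calc _ ≤ (C * (‖u ξ‖ * (1 + ‖ξ‖) ^ p)) ^ 2 := by gcongr; exact hle ξ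
    _ = C ^ 2 * ‖u ξ‖ * (‖u ξ‖ * (1 + ‖ξ‖) ^ (2 * p)) := by ring
    _ ≤ _ := by gcongr; exact hD ξ

lemma integral_trace_mul {h : Ξ → ℂ} {μ : ℝ} (hμ : 0 < μ) (A : Adm (Ioi 0) h (psi μ))
    (hφ : C∞ φ) (hc : HasCompactSupport φ)
    (hi : Integrable fun ξ => h ξ * 𝓕⁻ (fun x => (φ x : ℂ)) ξ) {G : Ψ} (hG : Continuous G)
    {c : ℝ} (hE : EqOn G (fun p => c * Ext h (psi μ) p) ℍ) :
    ∫ x, G (x, 0) * φ x = c * Gamma μ * (∫ ξ, h ξ * 𝓕⁻ (fun x => (φ x : ℂ)) ξ).re := by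
  have l1 : Tendsto (fun y => ∫ x, G (x, y) * φ x) (𝓝[>] 0) (𝓝 (∫ x, G (x, 0) * φ x)) := by
    have hcont : Continuous fun y => ∫ x in tsupport φ, G (x, y) * φ x :=
      continuous_parametric_integral_of_continuous (by have := hφ.continuous; fun_prop) hc
    have e (y : ℝ) : ∫ x in tsupport φ, G (x, y) * φ x = ∫ x, G (x, y) * φ x :=
      setIntegral_eq_integral_of_forall_compl_eq_zero fun x hx => by
        rw [image_eq_zero_of_notMem_tsupport hx, mul_zero]
    simp_rw [e] at hcont; exact (hcont.tendsto 0).mono_left nhdsWithin_le_nhds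
  have iφ : Integrable fun x => (φ x : ℂ) := (hφ.continuous.integrable_of_hasCompactSupport hc).ofReal
  have e2 : ∀ y ∈ Ioi (0 : ℝ), ∫ x, G (x, y) * φ x =
      c * (∫ ξ, h ξ * (psi μ (lam ξ y) : ℂ) * 𝓕⁻ (fun x => (φ x : ℂ)) ξ).re := by
    intro y hy; have hF := A.integrable_mul_profile hy; rw [← integral_fourierInv_mul hF iφ]
    have hb : Integrable fun x => 𝓕⁻ (fun ξ => h ξ * (psi μ (lam ξ y))) x * φ x := by
      refine iφ.bdd_mul (c := ∫ ξ, ‖h ξ * (psi μ (lam ξ y) : ℂ)‖) ?_ (ae_of_all _ fun x => ?_)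
      · refine Continuous.aestronglyMeasurable ?_; rw [fourierInv_eq_fourier_comp_neg]
        exact VectorFourier.fourierIntegral_continuous continuous_fourierChar
          (by simpa using! (continuous_inner)) hF.comp_neg
      · rw [fourierInv_eq']; refine (norm_integral_le_integral_norm _).trans_eq ?_; congr 1; ext ξ; rw [norm_smul, Complex.norm_exp_ofReal_mul_I, one_mul]
    change _ = c * RCLike.re (∫ x, 𝓕⁻ (fun ξ => h ξ * (psi μ (lam ξ y))) x * φ x)
    rw [← integral_re hb, ← integral_const_mul]; congr 1; ext x; rw [hE (show (x, y) ∈ ℍ from hy)]; beta_reduce; rw [Ext_eq_re (x, y) hF]; change _ = c * (𝓕⁻ (fun ξ => h ξ * (psi μ (lam ξ y))) x * φ x).re; rw [re_mul_ofReal]; ring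
  obtain ⟨C, hC, hb⟩ := exists_psi_le hμ
  have l2 : Tendsto (fun y => ∫ ξ, h ξ * (psi μ (lam ξ y) : ℂ) * 𝓕⁻ (fun x => (φ x : ℂ)) ξ) (𝓝[>] 0)
      (𝓝 (∫ ξ, Gamma μ * (h ξ * 𝓕⁻ (fun x => (φ x : ℂ)) ξ))) := by
    have mψ (y : ℝ) : AEStronglyMeasurable fun ξ : Ξ => (psi μ (lam ξ y) : ℂ) :=
      continuous_ofReal.comp_aestronglyMeasurable ((stronglyMeasurable_psi μ).comp_measurable
        (continuous_lam y).measurable).aestronglyMeasurable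
    refine tendsto_integral_filter_of_dominated_convergence
      (fun ξ => C * ‖h ξ * 𝓕⁻ (fun x => (φ x : ℂ)) ξ‖) (Eventually.of_forall fun y =>
        (hi.1.mul (mψ y)).congr (ae_of_all _ fun ξ => ?_)) (Eventually.of_forall fun y => ae_of_all _ fun ξ => ?_)
      (hi.norm.const_mul C) (ae_of_all _ fun ξ => ?_)
    · simp; ring
    · rw [mul_right_comm, norm_mul, norm_real, norm_of_nonneg (psi_nonneg _ _), mul_comm C]
      have h3 : exp (-√(lam ξ y)) ≤ 1 := exp_le_one_iff.2 (by simp); gcongr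
      exact (hb _ (lam_nonneg ξ y)).trans (mul_le_of_le_one_right hC h3)
    · have h1 : Tendsto (fun y => psi μ (lam ξ y)) (𝓝[>] 0) (𝓝 (Gamma μ)) := by
        have h2 := continuousOn_psi hμ 0 self_mem_Ici; rw [ContinuousWithinAt, psi_zero μ hμ] at h2
        refine h2.comp (tendsto_nhdsWithin_iff.2 ⟨?_, Eventually.of_forall fun y => lam_nonneg ξ y⟩)
        have h3 : Continuous fun y => lam ξ y := by unfold lam; fun_prop
        have := (h3.tendsto 0).mono_left (nhdsWithin_le_nhds (s := Ioi 0))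
        have e : lam ξ 0 = 0 := by simp [lam]
        rwa [e] at this
      have h2 := ((continuous_ofReal.tendsto _).comp h1).mul_const (h ξ * 𝓕⁻ (fun x => (φ x : ℂ)) ξ)
      refine h2.congr fun y => ?_; simp; ring
  have := tendsto_nhds_unique l1 ((((continuous_re.tendsto _).comp l2).const_mul c).congr' (by
    filter_upwards [self_mem_nhdsWithin] with y hy; exact (e2 y hy).symm))
  rw [this, integral_const_mul, re_ofReal_mul, mul_assoc]

end

section

variable {φ f : Bdry n → ℝ} {γ s : ℝ} {N : ℕ}

lemma eq_of_integral_mul_eq {u v : Ξ → ℝ} (hu : Continuous u) (hv : Continuous v)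
    (h : ∀ φ : Ξ → ℝ, C∞ φ → HasCompactSupport φ → ∫ x, u x * φ x = ∫ x, v x * φ x) : u = v := by
  refine (hu.ae_eq_iff_eq volume hv).1 (ae_eq_of_integral_contDiff_smul_eq hu.locallyIntegrable
    hv.locallyIntegrable fun g hg hc => ?_)
  simp only [smul_eq_mul, mul_comm (g _)]
  exact h g hg hc

lemma fourierInv_conj (ξ : Ξ) :
    (starRingEnd ℂ) (𝓕⁻ (fun x => (φ x : ℂ)) ξ) = 𝓕 (fun x => (φ x : ℂ)) ξ := by
  rw [← conj_fourierInv]; simp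

lemma symb_le (hγ : 0 < γ) : ∃ (C : ℝ) (p : ℕ), ∀ ξ : Ξ, |symb γ ξ| ≤ C * (1 + ‖ξ‖) ^ p := by
  obtain ⟨p, hp⟩ := exists_nat_ge (2 * γ)
  refine ⟨(2 * π) ^ (2 * γ), p, fun ξ => ?_⟩
  rw [symb, abs_of_nonneg pos!, mul_rpow pos! (norm_nonneg _)]
  gcongr
  calc ‖ξ‖ ^ (2 * γ) ≤ (1 + ‖ξ‖) ^ (2 * γ) := by gcongr; linarith
    _ ≤ (1 + ‖ξ‖) ^ (p : ℝ) := rpow_le_rpow_of_exponent_le (by linarith [norm_nonneg ξ]) hp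
    _ = _ := rpow_natCast _ p

lemma continuous_symb (hγ : 0 < γ) : Continuous fun ξ : Ξ => symb γ ξ := by
  unfold symb
  exact (continuous_rpow_const (by linarith)).comp (by fun_prop)

lemma integrable_fourierL2_mul (hf : MemLp f 2) {G : Ξ → ℂ} (hG : MemLp G 2) :
    Integrable fun ξ => fourierL2 f ξ * G ξ :=
  (memLp_fourierL2 hf).integrable_mul hG

lemma im_integral_symb_mul (hγ : 0 < γ) (hf : MemLp f 2)
    (hφ : C∞ φ) (hc : HasCompactSupport φ) :
    (∫ ξ, (symb γ ξ : ℂ) * fourierL2 f ξ * 𝓕⁻ (fun x => (φ x : ℂ)) ξ).im = 0 := by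
  obtain ⟨C, p, hb⟩ := symb_le (n := n) hγ
  obtain ⟨g1, g2⟩ := fourierInv_mul_integrable hφ hc (continuous_symb hγ) hb
  set G := fun ξ => symb γ ξ * 𝓕⁻ (fun x => (φ x : ℂ)) ξ with hG
  have e2 : (fun ξ => (starRingEnd ℂ) (G ξ)) = fun ξ => G (-ξ) := by
    ext ξ
    simp only [hG, map_mul, conj_ofReal, fourierInv_conj]
    rw [fourierInv_eq_fourier_neg, neg_neg]
    simp [symb]
  have e3 x : (starRingEnd ℂ) (𝓕 G x) = 𝓕 G x := by
    conv_rhs => rw [← conj_fourierInv, e2]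
    congr 1
    rw [fourierInv_eq_fourier_comp_neg]; simp
  rw [show ∫ ξ, symb γ ξ * fourierL2 f ξ * 𝓕⁻ (fun x => (φ x : ℂ)) ξ = ∫ ξ, fourierL2 f ξ * G ξ by congr 1; ext ξ; simp only [hG]; ring, integral_fourierL2_mul hf g1 g2, ← Complex.conj_eq_iff_im, ← integral_conj]
  congr 1; ext x
  rw [map_mul, e3, conj_ofReal]

/-- The positive constant `|K_γ|`, for `γ = N + s`. -/
def cK (N : ℕ) (s : ℝ) : ℝ :=
  (2 : ℝ) ^ (1 - 2 * s) * (N.factorial : ℝ) * (Gamma (1 - s) / Gamma (N + s))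

lemma cK_pos (N : ℕ) (hs0 : 0 < s) (hs1 : s < 1) : 0 < cK N s := by
  have h1 := Gamma_pos_of_pos (show 0 < 1 - s by linarith)
  have h2 := Gamma_pos_of_pos (show 0 < N + s by positivity)
  unfold cK; positivity

lemma yangConst_eq (hγ : 0 < γ) (hγN : ∀ N : ℕ, γ ≠ N) :
    yangConst γ = (-1) ^ (1 + ⌊γ⌋₊) * cK ⌊γ⌋₊ (fract γ) := by
  have hs0 := fract_pos_of hγ hγN
  have hs1 := fract_lt_one γ
  have hγ' := eq_floor_add_fract hγ
  set N := ⌊γ⌋₊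
  set s := fract γ
  have hG := Gamma_pos_of_pos hs0
  have hG1 := Gamma_pos_of_pos hγ
  have e1 : -γ * Gamma (-γ) = Gamma (1 - γ) := by rw [← Gamma_add_one (by linarith)]; ring_nf
  have r1 := Gamma_mul_Gamma_one_sub γ
  have r2 := Gamma_mul_Gamma_one_sub s
  have e2 : sin (π * γ) = (-1) ^ N * sin (π * s) := by
    rw [hγ', mul_add, add_comm, mul_comm π N, sin_add_nat_mul_pi]
  have hsin : sin (π * s) ≠ 0 := by
    refine (sin_pos_of_pos_of_lt_pi pos! ?_).ne'; nlinarith [pi_pos]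
  have h1 : ((-1 : ℝ) ^ N) * (-1) ^ N = 1 := by rw [← mul_pow]; simp
  have key : Gamma γ * Gamma (1 - γ) = (-1) ^ N * (Gamma s * Gamma (1 - s)) := by
    rw [r1, r2, e2, div_eq_iff (by simp [hsin])]; field_simp; linear_combination (-1) * h1
  have e4 : γ * Gamma (-γ) / Gamma s = (-1) ^ (1 + N) * (Gamma (1 - s) / Gamma γ) := by
    rw [div_eq_iff hG.ne', show γ * Gamma (-γ) = -Gamma (1 - γ) by rw [← e1]; ring, pow_add]
    field_simp; linear_combination -key
  rw [yangConst, cK, e4, ← hγ']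
  ring

lemma not_nat (hs0 : 0 < s) (hs1 : s < 1) (M : ℕ) : (N + s : ℝ) ≠ M := fun h => by
  have h1 : (N : ℝ) < M := by linarith
  have h2 : (M : ℝ) < N + 1 := by linarith
  norm_cast at h1 h2
  omega

lemma FE.congr {m : ℝ} {k : ℕ} {U V : Ψ} (h : FE m k U) (e : EqOn V U ℍ) : FE m k V := by
  have h1 j : (fun p => ‖𝒟 j U p‖ ^ 2) =ᵐ[mu m] fun p => ‖𝒟 j V p‖ ^ 2 := by
    filter_upwards [ae_mu m] with p hp; rw [iteratedFDeriv_congr_upper e j hp]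
  exact ⟨h.smooth.congr e, fun Y hY j hj => (h.slab Y hY j hj).congr (ae_restrict_of_ae (h1 j)), h.top.congr (h1 k)⟩

/-- The frequency form `∫ |2πξ|^{2γ} f̂ φ̂⁻` of a function and a test function. -/
def cross (γ : ℝ) (f φ : Ξ → ℝ) : ℝ :=
  (∫ ξ, (symb γ ξ : ℂ) * fourierL2 f ξ * 𝓕⁻ (fun x => (φ x : ℂ)) ξ).re

/-- `V = A + y^{2s} B` is an extension of `f`, with its boundary data, for `γ = N + s`. -/
structure ExtData (N : ℕ) (s : ℝ) (f : Ξ → ℝ) (V : Ψ) (A B : ES n) : Prop where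
  eq : ∀ x y, 0 ≤ y → V (x, y) = A.1 (x, y) + y ^ (2 * s) * B.1 (x, y)
  rep : RepOn (2 * s) A B V
  cl : Cl s N V
  fe : FE (1 - 2 * s) (N + 1) V
  pde : ∀ p ∈ ℍ, (wLap (1 - 2 * s))^[N + 1] V p = 0
  value : ∀ x, V (x, 0) = f x
  even_trace : ∀ (hf : C∞ f), ∀ j ≤ N,
    tr ((Le (1 - 2 * s) ^ j) A) = cw (-s) N j 0 • (Lb ^ j) (⟨f, hf⟩ : SB n)
  flux : ∀ φ : Ξ → ℝ, C∞ φ → HasCompactSupport φ →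
    ∫ x, 2 * s * (tr ((Le (1 + 2 * s) ^ N) B)).1 x * φ x = (-1) ^ (1 + N) * cK N s * cross (N + s) f φ

lemma exists_extension (hn : 1 ≤ n) (hs0 : 0 < s) (hs1 : s < 1)
    (hf : C∞ f) (hH : MemH (N + s) f) : ∃ V A B, ExtData N s f V A B := by
  have hγ : (0 : ℝ) < N + s := pos!
  have hγN := fun M : ℕ => not_nat (N := N) hs0 hs1 M
  have hG := Gamma_pos_of_pos hγ
  have hf2 := hH.1
  have hF := memLp_fourierL2 hf2
  obtain ⟨A', B', hA', hB', hR, hA0⟩ := exists_rep_ext hn hγ hγN hf hf2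
  set c : ℝ := (Gamma (N + s))⁻¹ with hc
  set h : Ξ → ℂ := fun ξ => (c : ℂ) * fourierL2 f ξ with hh
  have h2 : MemLp h 2 := hF.const_mul _
  have ad : Adm (Ioi 0) h (psi (N + s)) := adm_psi hn hγ hγN h2
  set E := Ext h (psi (N + s)) with hE
  have eE (p : Υ) : E p = c * Ext (fourierL2 f) (psi (N + s)) p := by
    simp only [hE, Ext, ← integral_const_mul]; congr 1; ext ξ; simp only [hh]; rw [mul_assoc, re_ofReal_mul, mul_assoc]
  set A : ES n := ⟨fun p => c * A' p, (isEvenSmooth_const c).mul hA'⟩ with hA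
  set B : ES n := ⟨fun p => c * (p.2 ^ 2) ^ N * B' p, (by refine IsEvenSmooth.mul ⟨by fun_prop, fun x y => by simp⟩ hB')⟩ with hB
  set V : Ψ := fun p => if p.2 ≤ 0 then f p.1 else E p with hV
  have hVE : EqOn V E ℍ := fun p hp => if_neg (not_le.2 hp)
  have hV0 (x : Ξ) : V (x, 0) = f x := if_pos le_rfl
  have rep : RepOn (2 * s) A B V := by
    intro p hp; have hp' : 0 < p.2 := hp
    rw [hVE hp, eE, hR p hp, mul_add (2 : ℝ), rpow_add hp', show (2 * (N : ℝ)) = ((2 * N : ℕ) : ℝ) by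
      push_cast; ring, rpow_natCast p.2 (2 * N)]
    simp only [hA, hB]; ring
  have it := fun j : ℕ => ad.wLap_iterate_psi hn (s := s) j
  have wV (j : ℕ) : EqOn ((wLap (1 - 2 * s))^[j] V) _ ℍ := fun p hp =>
    (wLap_iterate_congr hVE j hp).trans ((it j).2 hp)
  have prodN (j : ℕ) : ∏ i ∈ ℛ j, (s + i - (N + s)) = ph (-(N : ℝ)) j :=
    prod_congr rfl fun i _ => by ring
  refine ⟨V, A, B, fun x y hy => ?_, rep, (by refine ⟨A, fun p => c * B' p, A.2, (isEvenSmooth_const c).mul hB', fun p hp => ?_⟩; rw [hVE hp, eE, hR p hp, show 2 * s + 2 * (N : ℝ) = 2 * (N + s) by ring]; simp only [hA]; ring), ?_, fun p hp => ?_, hV0, fun _ j hj => ?_, fun φ hφ hcφ => ?_⟩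
  · rcases hy.eq_or_lt with rfl | hy
    · rw [hV0, zero_rpow pos!, zero_mul, add_zero]; simp only [hA, hA0, hc]; field_simp
    · exact rep (x, y) hy
  · have hint : Integrable fun ξ : Ξ => (1 + ‖ξ‖ ^ 2) ^ (N + s : ℝ) * ‖h ξ‖ ^ 2 := by
      refine (hH.2.const_mul (c ^ 2)).congr (ae_of_all _ fun ξ => ?_)
      simp only [hh, norm_mul, norm_real, norm_eq_abs, mul_pow, sq_abs]; ring
    exact (fe_ext hn hs0 hs1 h2 ad hint).congr hVE
  · rw [wV (N + 1) hp, prod_range_succ, show s + N - (N + s) = 0 by ring]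
    simp [Ext]
  · have repj := rep.wLap_iterate j
    obtain ⟨G, cG, eG, G0⟩ := repj.exists_continuous pos! (ES_continuous _) (ES_continuous _)
    have hμ : 0 < (N : ℝ) + s - j := by
      have : (j : ℝ) ≤ N := by exact_mod_cast hj
      linarith
    ext1; refine eq_of_integral_mul_eq (SB.contDiff _).continuous (SB.contDiff _).continuous fun φ hφ hcφ => ?_
    obtain ⟨b1, b2⟩ := bLap_iterate hφ j
    have hG1 := fourierInv_mul_integrable b1 (b2 hcφ) (θ := fun _ => 1) continuous_const (C := 1) (p := 0) (by simp)
    simp only [Complex.ofReal_one, one_mul] at hG1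
    have eh (ξ : Ξ) : (((∏ i ∈ ℛ j, (s + i - (N + s))) * (4 * π ^ 2 * ‖ξ‖ ^ 2) ^ j : ℝ) : ℂ) *
        h ξ * 𝓕⁻ (fun x => (φ x : ℂ)) ξ = ((ph (-N) j * (-1) ^ j * c : ℝ) : ℂ) *
          (fourierL2 f ξ * 𝓕⁻ (fun x => (bLap^[j] φ x : ℂ)) ξ) := by
      rw [fourierInv_bLap_iterate hφ hcφ, prodN, neg_pow]; simp only [hh]; push_cast
      have hsq : ((-1 : ℂ) ^ j) * (-1) ^ j = 1 := by rw [← mul_pow]; simp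
      generalize (4 * (π : ℂ) ^ 2 * (‖ξ‖ : ℂ) ^ 2) = X
      linear_combination (-(ph (-N) j : ℂ) * X ^ j * (c * fourierL2 f ξ) * 𝓕⁻ (fun x => (φ x : ℂ)) ξ) * hsq
    have key := integral_trace_mul hμ (it j).1 hφ hcφ
      (((integrable_fourierL2_mul hf2 hG1.2).const_mul _).congr (ae_of_all _ fun ξ => (eh ξ).symm)) cG (c := 1)
      fun p hp => by rw [← eG hp, wV j hp]; exact (one_mul _).symm
    have e5 : ∫ ξ, fourierL2 f ξ * 𝓕⁻ (fun x => (bLap^[j] φ x : ℂ)) ξ = ((∫ x, bLap^[j] f x * φ x : ℝ) : ℂ) := by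
      rw [integral_fourierL2_mul hf2 hG1.1 hG1.2, integral_bLap_iterate_mul hf hφ hcφ, ← integral_complex_ofReal]
      obtain ⟨t, ht, ht'⟩ := exists_schwartz b1 (b2 hcφ)
      rw [← ht', ← SchwartzMap.fourier_coe, FourierTransform.fourier_fourierInv_eq, ht]; push_cast; rfl
    simp_rw [eh] at key; rw [integral_const_mul, e5, ← Complex.ofReal_mul, ofReal_re] at key; simp_rw [G0] at key; change ∫ x, ((Le (1 - 2 * s) ^ j) A : ES n).1 (x, 0) * φ x = _
    rw [key, SetLike.val_smul, coe_Lb_pow, cw_zero_eq N j hj _ s rfl hs0 hs1]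
    simp only [Pi.smul_apply, smul_eq_mul, mul_assoc, integral_const_mul]
    have hph := ph_neg_nat N j hj; have hfac : ((N - j).factorial : ℝ) ≠ 0 := pos!
    have hph' : ph (-(N : ℝ)) j = (-1) ^ j * (N.factorial : ℝ) / ((N - j).factorial : ℝ) := by rw [← hph]; field_simp
    have hsq : ((-1 : ℝ) ^ j) * (-1) ^ j = 1 := by rw [← mul_pow]; simp
    rw [hph', hc]; field_simp; linear_combination (∫ x, bLap^[j] f x * φ x) * hsq
  · have repN := rep.wLap_iterate N; obtain ⟨G, cG, eG, G0⟩ := repN.exists_continuous_wNormal hs1; have hμ : 0 < 1 - s := by linarith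
    set C : ℝ := (-1) ^ N * N.factorial * c * (2 : ℝ) ^ (-(2 * s)) with hC
    have ad' : Adm (Ioi 0) (fun ξ => ((C * symb (N + s) ξ : ℝ) : ℂ) * fourierL2 f ξ) (psi (1 - s)) := by
      obtain ⟨D, p, hb⟩ := symb_le (n := n) hγ
      refine (adm_psi hn hμ (fun M h => ?_) hF).mul (c := fun ξ => ((C * symb (N + s) ξ : ℝ) : ℂ))
        (continuous_ofReal.comp ((continuous_symb hγ).const_mul C)) (C := |C| * D) (r := p) fun ξ => ?_
      · rcases M with _ | M
        · simp at h; linarith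
        · push_cast at h; linarith [show (0 : ℝ) ≤ M by positivity]
      · rw [norm_real, norm_eq_abs, abs_mul, mul_assoc]; gcongr; exact hb ξ
    have eN : EqOn G (fun p => (-2) * Ext (fun ξ => ((C * symb (N + s) ξ : ℝ) : ℂ) * fourierL2 f ξ) (psi (1 - s)) p)
        ℍ := by
      intro p hp; have hp' : 0 < p.2 := hp; rw [← eG hp, wNormal, dy_congr (wV N) hp, ((it N).1).dy hp]; simp only [Ext, ← integral_const_mul]; refine integral_congr_ae ?_; filter_upwards [ae_ne_zero hn] with ξ hξ; have hξ' : 0 < ‖ξ‖ := norm_pos_iff.2 hξ; have hl := lam_pos hξ hp'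
      rw [show (N : ℝ) + s - N = s by ring, deriv_psi hl, show s - 1 = -(1 - s) by ring, psi_neg hl, prodN]
      have hph := ph_neg_nat N N le_rfl
      simp only [Nat.sub_self, Nat.factorial_zero, Nat.cast_one, mul_one] at hph
      rw [show (((‖ξ‖ ^ 2 : ℝ) : ℂ) * (((ph (-N) N * (4 * π ^ 2 * ‖ξ‖ ^ 2) ^ N : ℝ) : ℂ) * h ξ) * pw ξ p.1).re = ‖ξ‖ ^ 2 * (ph (-N) N * (4 * π ^ 2 * ‖ξ‖ ^ 2) ^ N) * c * (fourierL2 f ξ * pw ξ p.1).re by rw [← re_ofReal_mul]; congr 1; simp only [hh]; push_cast; ring, show (((C * symb (N + s) ξ : ℝ) : ℂ) * fourierL2 f ξ * pw ξ p.1).re = C * symb (N + s) ξ * (fourierL2 f ξ * pw ξ p.1).re by rw [mul_assoc, re_ofReal_mul], hph]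
      have e3 : lam ξ p.2 ^ (-(1 - s)) = (π * ‖ξ‖) ^ (2 * s) * (π * ‖ξ‖) ^ (-2 : ℝ) *
          (p.2 ^ (2 * s) * p.2 ^ (-2 : ℝ)) := by
        rw [← rpow_add pos!, ← rpow_add hp', lam, show π ^ 2 * ‖ξ‖ ^ 2 * p.2 ^ 2 =
          (π * ‖ξ‖ * p.2) ^ (2 : ℝ) by rw [rpow_two]; ring, ← rpow_mul pos!,
          mul_rpow pos! hp'.le]
        ring_nf
      have e4 : symb (N + s) ξ = (2 : ℝ) ^ (2 * s) * (π * ‖ξ‖) ^ (2 * s) * (4 * π ^ 2 * ‖ξ‖ ^ 2) ^ N := by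
        rw [symb, mul_add (2 : ℝ), rpow_add pos!, mul_assoc 2 π,
          mul_rpow (y := π * ‖ξ‖) zero_le_two pos! (z := 2 * s),
          rpow_mul pos! 2 N, rpow_two, rpow_natCast _ N]
        ring
      have e5 : p.2 ^ (1 - 2 * s) * p.2 * (p.2 ^ (2 * s) * p.2 ^ (-2 : ℝ)) = 1 := by
        have : p.2 ^ (1 - 2 * s) * p.2 = p.2 ^ (1 - 2 * s) * p.2 ^ (1 : ℝ) := by rw [rpow_one]
        rw [this, ← rpow_add hp', ← rpow_add hp', ← rpow_add hp']; ring_nf; simp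
      have e6 : (2 : ℝ) ^ (-(2 * s)) * (2 : ℝ) ^ (2 * s) = 1 := by rw [← rpow_add two_pos]; simp
      have e7 : (π * ‖ξ‖) ^ (-2 : ℝ) * (π ^ 2 * ‖ξ‖ ^ 2) = 1 := by
        rw [rpow_neg pos!, rpow_two]; field_simp
      rw [e3, e4, hC]; generalize (2 : ℝ) ^ (-(2 * s)) = a1 at *
      generalize (2 : ℝ) ^ (2 * s) = a2 at *
      generalize (π * ‖ξ‖) ^ (-2 : ℝ) = a3 at *
      generalize (π * ‖ξ‖) ^ (2 * s) = a4 at *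
      generalize p.2 ^ (1 - 2 * s) = a5 at *
      generalize p.2 ^ (2 * s) = a6 at *
      generalize p.2 ^ (-2 : ℝ) = a7 at *
      generalize (fourierL2 f ξ * pw ξ p.1).re = a8; generalize (4 * π ^ 2 * ‖ξ‖ ^ 2) ^ N = a9; generalize psi (1 - s) (lam ξ p.2) = a10
      linear_combination (-2 * (-1) ^ N * N.factorial * c * a8 * a9 * a10 * a4) *
        ((a3 * (π ^ 2 * ‖ξ‖ ^ 2)) * e5 + e7 - e6)
    obtain ⟨D, p, hb⟩ := symb_le hγ; obtain ⟨g1, g2⟩ := fourierInv_mul_integrable hφ hcφ (continuous_symb hγ) hb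
    have eh (ξ : Ξ) : ((C * symb (N + s) ξ : ℝ) : ℂ) * fourierL2 f ξ * 𝓕⁻ (fun x => (φ x : ℂ)) ξ =
        (C : ℂ) * ((symb (N + s) ξ : ℂ) * fourierL2 f ξ * 𝓕⁻ (fun x => (φ x : ℂ)) ξ) := by
      push_cast; ring
    have key := integral_trace_mul hμ ad' hφ hcφ
      (((integrable_fourierL2_mul hf2 g2).const_mul (C : ℂ)).congr (ae_of_all _ fun ξ => by beta_reduce; rw [eh]; ring)) cG eN
    simp_rw [eh, G0] at key; rw [integral_const_mul, re_ofReal_mul] at key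
    rw [key, hC, cK, hc, cross, show 1 - 2 * s = 1 + -(2 * s) by ring, rpow_add two_pos]; ring

end

section

variable {e s : ℝ} {A B Z : Amb n → ℝ}

local notation "ϖ" => 1 - 2 * s

/-! ### The trace inequality -/

lemma RepOn.dxs {U : Ψ} (hA : C∞ A) (hB : C∞ B) (h : RepOn e A B U)
    (α : List (Fin n)) : C∞ (dxs α A) ∧ C∞ (dxs α B) ∧ RepOn e (dxs α A) (dxs α B) (dxs α U) := by
  induction α with
  | nil => exact ⟨hA, hB, h⟩
  | cons i α ih => exact ⟨csm_Dv ih.1 _, csm_Dv ih.2.1 _, ih.2.2.Dv_eX ih.1 ih.2.1 i⟩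

lemma lintegral_rpow_Ioo (he : -1 < e) :
    ∫⁻ y in Ioo (0 : ℝ) 1, ofReal (y ^ e) = ofReal (1 / (e + 1)) := by
  have hi :=
    (intervalIntegrable_iff_integrableOn_Ioo_of_le zero_le_one).1 (intervalIntegral.intervalIntegrable_rpow' he)
  rw [← ofReal_integral_eq_lintegral_ofReal hi
    ((ae_restrict_mem measurableSet_Ioo).mono fun y hy => rpow_nonneg hy.1.le _),
    ← integral_Ioc_eq_integral_Ioo, ← intervalIntegral.integral_of_le zero_le_one, integral_rpow (Or.inl he),
    one_rpow, zero_rpow (by linarith), sub_zero]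

lemma memLp_trace (hs0 : 0 < s) (hs1 : s < 1) (hA : C∞ A)
    (hB : C∞ B) (h : RepOn (2 * s) A B Z)
    (h0 : IntegrableOn (fun p => Z p ^ 2) {p | p.2 < 1} (mu ϖ))
    (h1 : IntegrableOn (fun p => dy Z p ^ 2) {p | p.2 < 1} (mu ϖ)) :
    MemLp (fun x : Ξ => A (x, 0)) 2 := by
  have sZ := h.smU hA hB
  have strip {F : Ψ} (hF : ContinuousOn F ℍ) (hi : IntegrableOn (fun p => F p ^ 2) {p | p.2 < 1} (mu ϖ)) :
      Measurable (fun x : Ξ => ∫⁻ y in Ioo 0 1, ofReal (y ^ ϖ * F (x, y) ^ 2)) ∧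
      ∫⁻ x, ∫⁻ y in Ioo 0 1, ofReal (y ^ ϖ * F (x, y) ^ 2) < ⊤ := by
    obtain ⟨m1, m2⟩ := lintegral_mu_strip ϖ (hF.pow 2) measurableSet_Ioo fun y hy => hy.1
    refine ⟨m1, m2 ▸ (lintegral_mono_set (fun p hp => hp.2)).trans_lt ?_⟩
    exact (hasFiniteIntegral_iff_ofReal (ae_of_all _ fun p => sq_nonneg _)).1 hi.2
  obtain ⟨-, z2⟩ := strip sZ.continuousOn h0
  obtain ⟨d1, d2⟩ := strip sZ.dy.continuousOn h1
  set D := fun x => ∫⁻ y in Ioo 0 1, ofReal (y ^ ϖ * dy Z (x, y) ^ 2)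
  have key x : ∀ y ∈ Ioo 0 1, ofReal (A (x, 0) ^ 2) ≤
      ofReal (2 * Z (x, y) ^ 2) + ofReal (2 / s) * D x := by
    intro y hy; refine le_of_tendsto ((ENNReal.continuous_ofReal.tendsto _).comp
      ((h.tendsto pos! hA.continuous hB.continuous x).pow 2)) ?_
    filter_upwards [Ioo_mem_nhdsGT hy.1] with ε hε
    have c : IntegrableOn (fun t => t ^ ϖ * dy Z (x, t) ^ 2) (Icc ε y) := by
      refine ContinuousOn.integrableOn_Icc fun t ht => ContinuousAt.continuousWithinAt ?_
      have ht0 := hε.1.trans_le ht.1; exact (continuousAt_rpow_const _ _ (Or.inl ht0.ne')).mul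
        ((sZ.dy.hasDerivAt_slice x ht0).continuousAt.pow 2)
    have der {t : ℝ} (ht : ε ≤ t) := ((hasDerivAt_rpow_const (p := 2 * s)
      (Or.inl (hε.1.trans_le ht).ne')).const_add 1).mul ((sZ.hasDerivAt_slice x (hε.1.trans_le ht)).pow 2)
    have mono := intervalIntegral.sub_le_integral_of_hasDeriv_right_of_le hε.2.le (fun t ht =>
      (der ht.1).neg.continuousAt.continuousWithinAt) (fun t ht => (der ht.1.le).neg.hasDerivWithinAt)
      (c.const_mul (2 / s)) fun t ht => by
        have ht0 := hε.1.trans ht.1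
        have w1 : t ^ (2 * s) ≤ 1 := rpow_le_one ht0.le (ht.2.trans hy.2).le pos!
        have w0 := rpow_nonneg ht0.le (2 * s)
        have e : t ^ (2 * s - 1) * t ^ ϖ = 1 := by rw [← rpow_add ht0]; simp
        have a0 := rpow_nonneg ht0.le (2 * s - 1); have b0 := rpow_nonneg ht0.le ϖ; simp only [Nat.cast_ofNat, Nat.add_one_sub_one, pow_one]; generalize t ^ (2 * s - 1) = a at *
        generalize t ^ ϖ = b at *
        generalize t ^ (2 * s) = w at *
        have h3 : 0 ≤ b / 2 * (2 * s * a * Z (x, t) + (1 + w) * dy Z (x, t)) ^ 2 +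
            b / 2 * ((1 - w) * (3 + w)) * dy Z (x, t) ^ 2 := by
          have := sub_nonneg.2 w1; positivity
        rw [div_mul_eq_mul_div, le_div_iff₀ hs0]; simp
        linear_combination h3 + (2 * s ^ 2 * a * Z (x, t) ^ 2 + 2 * s * (1 + w) * Z (x, t) * dy Z (x, t)) * e
    rw [intervalIntegral.integral_const_mul] at mono; simp at mono; have w1 : y ^ (2 * s) ≤ 1 := rpow_le_one hy.1.le hy.2.le pos!
    have w0 := mul_nonneg (rpow_nonneg hε.1.le (2 * s)) (sq_nonneg (Z (x, ε)))
    have w2 := mul_nonneg (sub_nonneg.2 w1) (sq_nonneg (Z (x, y)))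
    have nn (t : ℝ) (ht : ε ≤ t) : 0 ≤ t ^ ϖ * dy Z (x, t) ^ 2 :=
      mul_nonneg (rpow_nonneg (hε.1.le.trans ht) _) (sq_nonneg _)
    refine (ofReal_le_ofReal (show _ ≤ 2 * Z (x, y) ^ 2 + 2 / s * _ by linarith)).trans ?_
    rw [ofReal_add pos! (mul_nonneg pos!
      (intervalIntegral.integral_nonneg hε.2.le fun t ht => nn t ht.1)), ofReal_mul (p := 2 / s) pos!,
      intervalIntegral.integral_of_le hε.2.le, ofReal_integral_eq_lintegral_ofReal (c.mono_set Ioc_subset_Icc_self)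
        ((ae_restrict_mem measurableSet_Ioc).mono fun t ht => nn t ht.1.le)]
    refine add_le_add le_rfl (mul_le_mul_right ?_ _)
    exact lintegral_mono_set fun t ht => ⟨hε.1.trans ht.1, ht.2.trans_lt hy.2⟩
  have fin : ∫⁻ x, ofReal (A (x, 0) ^ 2) < ⊤ := by
    set c := ofReal (1 / (1 - 2 * s + 1)) with hc
    have hc0 : c ≠ 0 := by rw [hc, Ne, ENNReal.ofReal_eq_zero, not_le]; exact one_div_pos.2 (by linarith)
    have le x : c * ofReal (A (x, 0) ^ 2) ≤
        2 * (∫⁻ y in Ioo 0 1, ofReal (y ^ ϖ * Z (x, y) ^ 2)) + c * (ofReal (2 / s) * D x) := by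
      rw [hc, ← lintegral_rpow_Ioo (by linarith), ← lintegral_mul_const _ (by fun_prop),
        ← lintegral_mul_const _ (by fun_prop), ← lintegral_const_mul' _ _ ENNReal.ofNat_ne_top,
        ← lintegral_add_right _ (by fun_prop)]
      refine setLIntegral_mono' measurableSet_Ioo fun y hy => ?_
      refine (mul_le_mul_right (key x y hy) _).trans_eq ?_
      rw [mul_add, ← ofReal_mul (rpow_nonneg hy.1.le _), mul_left_comm (y ^ _),
        ofReal_mul zero_le_two, ENNReal.ofReal_ofNat]
    have fin' : ∫⁻ x, c * ofReal (A (x, 0) ^ 2) < ⊤ := by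
      refine (lintegral_mono le).trans_lt ?_
      rw [lintegral_add_right _ ((d1.const_mul _).const_mul _), lintegral_const_mul' _ _ ENNReal.ofNat_ne_top,
        lintegral_const_mul _ (d1.const_mul _), lintegral_const_mul _ d1]
      exact ENNReal.add_lt_top.2 ⟨mul_lt_top ENNReal.ofNat_lt_top z2, mul_lt_top ofReal_lt_top
        (mul_lt_top ofReal_lt_top d2)⟩
    rw [lintegral_const_mul' _ _ ofReal_ne_top] at fin'
    exact (ENNReal.mul_lt_top_iff.1 fin').elim And.right (by rintro (h | h) <;> simp_all)
  have hcont : Continuous fun x : Ξ => A (x, 0) := hA.continuous.comp (by fun_prop)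
  rw [memLp_two_iff_integrable_sq hcont.aestronglyMeasurable]
  exact ⟨(hcont.pow 2).aestronglyMeasurable, (hasFiniteIntegral_iff_ofReal (ae_of_all _ fun x => sq_nonneg _)).2 fin⟩

lemma memLp_trace_dxs (hs0 : 0 < s) (hs1 : s < 1) {A B : ES n} {k : ℕ}
    (h : RepOn (2 * s) A B Z) (hE : FE ϖ k Z) {α : List (Fin n)} (hα : α.length + 1 ≤ k) :
    MemLp (fun x : Ξ => dxs α (A : Ψ) (x, 0)) 2 := by
  obtain ⟨hA, hB, hR⟩ := h.dxs (ES_contDiff A) (ES_contDiff B) α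
  have bd (j : ℕ) (hj : j ≤ 1) : IntegrableOn (fun p => dy^[j] (dxs α Z) p ^ 2) {p | p.2 < 1} (mu ϖ) := by
    refine (hE.slab 1 one_pos (α.length + j) (by omega)).mono'
      ((aestronglyMeasurable_mu ((((hE.smooth.dxs α)).dy_iterate j).continuousOn.pow 2)).restrict) (ae_restrict_of_ae ?_)
    filter_upwards [ae_mu _] with p hp; rw [norm_of_nonneg (sq_nonneg _), ← sq_abs]; gcongr; exact abs_dy_iterate_dxs_le hE.smooth j α hp
  exact memLp_trace hs0 hs1 hA hB hR (bd 0 zero_le_one) (bd 1 le_rfl)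

end

section

variable {φ f : Bdry n → ℝ} {γ s : ℝ} {P V Z : Amb n → ℝ} {A B : ES n} {N : ℕ} {g : ℕ → Bdry n → ℝ}

local notation "ϖ" => 1 - 2 * s

lemma fourierInv_ae_eq_conj (hφ : C∞ φ) (hc : HasCompactSupport φ) :
    𝓕⁻ (fun x => (φ x : ℂ)) =ᵐ[volume] fun ξ => (starRingEnd ℂ) (fourierL2 φ ξ) := by
  obtain ⟨s, h1, -, t, ht, rfl⟩ := fourierL2_of_hasCompactSupport hφ hc
  filter_upwards [h1] with ξ hξ
  rw [hξ, SchwartzMap.fourier_coe, funext ht, ← fourierInv_conj, Complex.conj_conj]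

lemma memH_of_hasCompactSupport (hγ : 0 < γ) (hφ : C∞ φ)
    (hc : HasCompactSupport φ) : MemH γ φ := by
  refine ⟨hφ.continuous.memLp_of_hasCompactSupport hc, ?_⟩
  obtain ⟨p, hp⟩ := exists_nat_ge (γ / 2)
  have hb (ξ : Ξ) : |(1 + ‖ξ‖ ^ 2) ^ (γ / 2)| ≤ 1 * (1 + ‖ξ‖) ^ (2 * p) := by
    rw [abs_of_nonneg pos!, one_mul, pow_mul]
    refine (rpow_le_rpow_of_exponent_le (by nlinarith [norm_nonneg ξ]) hp).trans ?_; rw [rpow_natCast _ p]; gcongr; nlinarith [norm_nonneg ξ]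
  have h2 := (fourierInv_mul_integrable hφ hc ((by fun_prop : Continuous fun ξ => 1 + ‖ξ‖ ^ 2).rpow_const fun ξ => Or.inr pos!) hb).2
  refine ((memLp_two_iff_integrable_sq_norm h2.1).1 h2).congr ?_
  filter_upwards [fourierInv_ae_eq_conj hφ hc] with ξ hξ
  rw [hξ, norm_mul, RCLike.norm_conj, norm_real, norm_of_nonneg pos!, mul_pow,
    ← rpow_two ((1 + ‖ξ‖ ^ 2) ^ (γ / 2)), ← rpow_mul pos!]
  ring_nf

lemma integrable_symb (hγ : 0 < γ) (h : MemH γ f) :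
    Integrable fun ξ => symb γ ξ * ‖fourierL2 f ξ‖ ^ 2 := by
  refine (h.2.const_mul ((2 * π) ^ (2 * γ))).mono' ((continuous_symb hγ).aestronglyMeasurable.mul
    ((memLp_fourierL2 h.1).1.norm.pow 2)) (ae_of_all _ fun ξ => ?_)
  have h0 : 0 ≤ symb γ ξ := by unfold symb; positivity
  rw [norm_of_nonneg pos!, ← mul_assoc]
  gcongr
  rw [symb, mul_rpow pos! (norm_nonneg _)]
  gcongr
  rw [rpow_mul (norm_nonneg _), rpow_two]
  gcongr; linarith

lemma fracForm_nonneg (γ : ℝ) (f : Ξ → ℝ) : 0 ≤ fracForm γ f :=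
  integral_nonneg fun ξ => by unfold symb; positivity

lemma cross_eq (f : Ξ → ℝ) (hφ : C∞ φ) (hc : HasCompactSupport φ) :
    cross γ f φ = (∫ ξ, (symb γ ξ : ℂ) * fourierL2 f ξ * (starRingEnd ℂ) (fourierL2 φ ξ)).re := by
  rw [cross]
  congr 1
  refine integral_congr_ae ?_
  filter_upwards [fourierInv_ae_eq_conj hφ hc] with ξ hξ
  rw [hξ]

lemma cross_self (hφ : C∞ φ) (hc : HasCompactSupport φ) :
    cross γ φ φ = fracForm γ φ := by
  rw [cross_eq φ hφ hc, fracForm, ← ofReal_re (∫ ξ, symb γ ξ * ‖fourierL2 φ ξ‖ ^ 2), ← integral_complex_ofReal]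
  congr 2; ext ξ
  rw [mul_assoc, Complex.mul_conj, Complex.normSq_eq_norm_sq]
  push_cast; ring

lemma cross_le (hγ : 0 < γ) (hf : MemH γ f) (hφ : C∞ φ)
    (hc : HasCompactSupport φ) : cross γ f φ ≤ (fracForm γ f + fracForm γ φ) / 2 := by
  have i1 := integrable_symb hγ hf
  have i2 := integrable_symb hγ (memH_of_hasCompactSupport hγ hφ hc)
  rw [cross_eq f hφ hc, fracForm, fracForm, ← integral_add i1 i2, ← integral_div]
  have b ξ : ‖symb γ ξ * fourierL2 f ξ * (starRingEnd ℂ) (fourierL2 φ ξ)‖ ≤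
      (symb γ ξ * ‖fourierL2 f ξ‖ ^ 2 + symb γ ξ * ‖fourierL2 φ ξ‖ ^ 2) / 2 := by
    have h0 : 0 ≤ symb γ ξ := by unfold symb; positivity
    rw [norm_mul, norm_mul, RCLike.norm_conj, norm_real, norm_of_nonneg h0]
    nlinarith [mul_nonneg h0 (sq_nonneg (‖fourierL2 f ξ‖ - ‖fourierL2 φ ξ‖))]
  exact (Complex.re_le_norm _).trans ((norm_integral_le_integral_norm _).trans
    (integral_mono_of_nonneg (ae_of_all _ fun _ => norm_nonneg _) ((i1.add i2).div_const 2) (ae_of_all _ b)))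

lemma CS.hasCompactSupport_tr (hs0 : 0 < s) (hc : CS P)
    (h : RepOn (2 * s) A B P) : HasCompactSupport (tr A).1 := by
  obtain ⟨R, hR⟩ := hc
  refine HasCompactSupport.intro (isCompact_closedBall 0 R) fun x hx => ?_
  refine tendsto_nhds_unique (h.tendsto pos! (ES_continuous A) (ES_continuous B) x)
    (tendsto_const_nhds.congr' ?_)
  filter_upwards [self_mem_nhdsWithin] with y hy
  exact (hR (x, y) hy ((show R < ‖x‖ by simpa using hx).trans_le (norm_fst_le (x, y)))).symm

lemma tr_Le_eq_zero (hs0 : 0 < s) (hs1 : s < 1) {q : ℕ} {U : Ψ}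
    (h : RepOn (2 * s) A B U) (hU : Cl s q U) {j : ℕ} (hj : j < q) : tr ((Le (1 + 2 * s) ^ j) B) = 0 :=
  (odd_trace_iff hs0 hs1 h).1 hU j hj

lemma ExtData.aF_eq (hs0 : 0 < s) (hs1 : s < 1)     (E : ExtData N s f V A B) {A' B' : ES n} (hP : RepOn (2 * s) A' B' P) (hc : CS P)
    (h1 : Cl s ((N + 1) / 2) P) : aF ϖ (N + 1) P V = cK N s * cross (N + s) f (tr A').1 := by
  have key := integral_mul_wLap_pow hs0 hs1 (N + 1) hP E.rep (Or.inl hc) h1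
  rw [show ∫ p, P p * (wLap ϖ)^[N + 1] V p ∂mu ϖ = 0 by refine integral_eq_zero_of_ae ?_; filter_upwards [ae_mu _] with p hp; rw [E.pde p hp, mul_zero]; rfl, sum_eq_single_of_mem 0 (Finset.mem_range.2 (by omega)) fun r hr hr0 => ?_] at key
  · have fl := E.flux _ (SB.contDiff _) (hc.hasCompactSupport_tr hs0 hP); simp at key
    simp_rw [mul_comm ((tr A').1 _)] at key; rw [fl, add_comm 1 N] at key; have : ((-1 : ℝ)) ^ (N + 1) ≠ 0 := by simp
    refine mul_left_cancel₀ this ?_; linarith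
  · have := Finset.mem_range.1 hr; rw [tr_Le_eq_zero hs0 hs1 E.rep E.cl (by omega : N + 1 - 1 - r < N)]; simp

lemma RepOn.chi_mul {e : ℝ} (h : RepOn e A B Z) (M : ℕ) :
    RepOn e (⟨fun p => chi M p * A.1 p, (isEvenSmooth_chi M).mul A.2⟩ : ES n)
      (⟨fun p => chi M p * B.1 p, (isEvenSmooth_chi M).mul B.2⟩ : ES n) fun p => chi M p * Z p := fun p hp => by
  simp only [h p hp]; ring

lemma cs_chi_mul (M : ℕ) (Z : Ψ) : CS fun p => chi M p * Z p := (cs_chi M).mul_right Z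

lemma ExtData.aF_self_of_hasCompactSupport (hs0 : 0 < s) (hs1 : s < 1)
    (hf : C∞ f) (hc : HasCompactSupport f) (E : ExtData N s f V A B) :
    aF ϖ (N + 1) V V = cK N s * fracForm (N + s) f := by
  have hq : Cl s ((N + 1) / 2) V := E.cl.of_le (by omega)
  refine tendsto_nhds_unique (tendsto_aF_chi_left hs0 hs1 hq E.fe (kl2_and_tendsto hs0 hs1 hq E.fe).2.1) ?_
  refine tendsto_const_nhds.congr' ?_
  obtain ⟨R, hR⟩ := hc.isCompact.isBounded.exists_norm_le
  filter_upwards [eventually_ge_atTop ⌈R⌉₊] with M hM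
  rw [E.aF_eq hs0 hs1 (E.rep.chi_mul M) (cs_chi_mul M V) (hq.chi_mul M), ← cross_self hf hc]
  congr 2; ext x
  change f x = chi M (x, 0) * A.1 (x, 0)
  rw [show A.1 (x, 0) = f x by have := E.eq x 0 le_rfl; rw [zero_rpow pos!, zero_mul, add_zero, E.value] at this; exact this.symm]
  by_cases hx : f x = 0
  · rw [hx, mul_zero]
  · rw [chi_eq_one, one_mul]; have h1 := hR x (subset_tsupport f hx); have h2 := Nat.ceil_le.1 hM; rw [Prod.norm_mk, norm_zero, max_eq_left (norm_nonneg _)]; linarith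

lemma cK_mul_fracForm_le_of_cs (hn : 1 ≤ n) (hs0 : 0 < s) (hs1 : s < 1)
    (hP : RepOn (2 * s) A B P) (hc : CS P) (h1 : Cl s ((N + 1) / 2) P) :
    cK N s * fracForm (N + s) (tr A).1 ≤ aF ϖ (N + 1) P P := by
  have hγ : 0 < N + s := pos!
  have hf := SB.contDiff (tr A)
  have hcf := hc.hasCompactSupport_tr hs0 hP
  obtain ⟨V, A', B', E⟩ := exists_extension hn hs0 hs1 hf (memH_of_hasCompactSupport hγ hf hcf)
  have e1 := aF_comb_self ((kl2_and_tendsto hs0 hs1 (E.cl.of_le (by omega)) E.fe).2.1) (h1.kl2_of_cs hs0 hs1 hc) (-1)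
  rw [E.aF_self_of_hasCompactSupport hs0 hs1 hf hcf, aF_comm _ _ V P, E.aF_eq hs0 hs1 hP hc h1, cross_self hf hcf] at e1
  have := aF_self_nonneg ϖ (N + 1) fun p => -1 * V p + P p
  linarith

lemma exists_subseq_fourierL2 (g2 : ∀ M, MemLp (g M) 2) (f2 : MemLp f 2)
    (h : Tendsto (fun M => ∫ x, (-1 * g M x + f x) ^ 2) atTop (𝓝 0)) : ∃ ns : ℕ → ℕ, StrictMono ns ∧
      ∀ᵐ ξ, Tendsto (fun i => fourierL2 (g (ns i)) ξ) atTop (𝓝 (fourierL2 f ξ)) := by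
  have conv : Tendsto (fun M => ∫ ξ, ‖-1 * fourierL2 (g M) ξ + fourierL2 f ξ‖ ^ 2) atTop (𝓝 0) := by
    have e M : ∫ ξ, ‖-1 * fourierL2 (g M) ξ + fourierL2 f ξ‖ ^ 2 = ∫ x, (-1 * g M x + f x) ^ 2 := by
      rw [show ∫ x, (-1 * g M x + f x) ^ 2 = ∫ x, ((fun x => -1 * g M x) + f) x ^ 2 from rfl,
        ← integral_norm_fourierL2_sq (((g2 M).const_mul (-1)).add f2)]
      refine integral_congr_ae ?_; filter_upwards [fourierL2_comb (g2 M) f2 (-1)] with ξ hξ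
      have : fourierL2 ((fun x => -1 * g M x) + f) ξ = _ := hξ; rw [this]; simp
    simpa only [e] using h
  have im : TendstoInMeasure volume (fun M ξ => ‖-1 * fourierL2 (g M) ξ + fourierL2 f ξ‖ ^ 2) atTop fun _ => 0 := by
    refine tendstoInMeasure_of_tendsto_eLpNorm one_ne_zero (fun M => ?_) aestronglyMeasurable_const ?_
    · exact (((memLp_fourierL2 (g2 M)).1.const_mul _).add (memLp_fourierL2 f2).1).norm.pow 2
    · have i M : Integrable fun ξ => ‖-1 * fourierL2 (g M) ξ + fourierL2 f ξ‖ ^ 2 := by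
        have := ((memLp_fourierL2 (g2 M)).const_mul (-1)).add (memLp_fourierL2 f2)
        exact (memLp_two_iff_integrable_sq_norm this.1).1 this
      have := (ENNReal.continuous_ofReal.tendsto 0).comp conv; rw [ENNReal.ofReal_zero] at this; refine this.congr fun M => ?_
      rw [eLpNorm_one_eq_lintegral_enorm, Function.comp, ofReal_integral_eq_lintegral_ofReal (i M)
        (ae_of_all _ fun _ => by positivity)]
      refine lintegral_congr fun ξ => ?_; simp only [Pi.sub_apply, sub_zero]; rw [enorm_eq_ofReal pos!]
  obtain ⟨ns, hns, hae⟩ := im.exists_seq_tendsto_ae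
  refine ⟨ns, hns, ?_⟩
  filter_upwards [hae] with ξ hξ
  exact by have := (show Tendsto (fun i => -1 * fourierL2 (g (ns i)) ξ + fourierL2 f ξ) atTop (𝓝 0) by rw [tendsto_zero_iff_norm_tendsto_zero]; have := (continuous_sqrt.tendsto 0).comp hξ; simpa [Function.comp_def] using this).const_sub (fourierL2 f ξ); simpa using this

lemma memH_of_integrable_symb (hγ : 0 < γ) (f2 : MemLp f 2)
    (int : Integrable fun ξ => symb γ ξ * ‖fourierL2 f ξ‖ ^ 2) : MemH γ f := by
  refine ⟨f2, ?_⟩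
  have s0 (ξ : Ξ) : 0 ≤ symb γ ξ := by unfold symb; positivity
  refine ((((memLp_two_iff_integrable_sq_norm (memLp_fourierL2 f2).1).1 (memLp_fourierL2 f2)).add int).const_mul (2 ^ γ)).mono' (((by fun_prop : Continuous fun ξ => 1 + ‖ξ‖ ^ 2).rpow_const fun ξ => Or.inr hγ.le).aestronglyMeasurable.mul
    ((memLp_fourierL2 f2).1.norm.pow 2)) (ae_of_all _ fun ξ => ?_)
  have h2 : (1 + ‖ξ‖ ^ 2) ^ γ ≤ 2 ^ γ * (1 + symb γ ξ) := by
    have h3 : (‖ξ‖ ^ 2) ^ γ ≤ symb γ ξ := by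
      rw [symb, rpow_mul pos!, rpow_two]; gcongr; nlinarith [pi_gt_three, norm_nonneg ξ]
    rcases le_total (‖ξ‖ ^ 2) 1 with h | h
    · calc _ ≤ (2 : ℝ) ^ γ := by gcongr; linarith
        _ ≤ _ := le_mul_of_one_le_right pos! (by linarith [s0 ξ])
    · calc _ ≤ (2 * ‖ξ‖ ^ 2) ^ γ := by gcongr; linarith
        _ = 2 ^ γ * (‖ξ‖ ^ 2) ^ γ := mul_rpow zero_le_two pos!
        _ ≤ _ := by gcongr; linarith
  rw [norm_of_nonneg pos!]
  refine (mul_le_mul_of_nonneg_right h2 (sq_nonneg _)).trans_eq ?_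
  simp; ring

lemma memH_and_fracForm_le (hγ : 0 < γ) (mg : ∀ M, MemH γ (g M))
    (f2 : MemLp f 2) (conv : Tendsto (fun M => ∫ x, (-1 * g M x + f x) ^ 2) atTop (𝓝 0)) {a : ℕ → ℝ} {L : ℝ}
    (ta : Tendsto a atTop (𝓝 L)) (hb : ∀ M, fracForm γ (g M) ≤ a M) : MemH γ f ∧ fracForm γ f ≤ L := by
  obtain ⟨ns, hns, hae⟩ := exists_subseq_fourierL2 (fun M => (mg M).1) f2 conv
  have s0 (ξ : Ξ) : 0 ≤ symb γ ξ := by unfold symb; positivity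
  have meas {u : Ξ → ℝ} (hu : MemLp u 2) : AEStronglyMeasurable fun ξ => symb γ ξ * ‖fourierL2 u ξ‖ ^ 2 :=
    (continuous_symb hγ).aestronglyMeasurable.mul ((memLp_fourierL2 hu).1.norm.pow 2)
  have fatou : ∫⁻ ξ, ofReal (symb γ ξ * ‖fourierL2 f ξ‖ ^ 2) ≤ ofReal (L) := by
    calc _ ≤ ∫⁻ ξ, liminf (fun i => ofReal (symb γ ξ * ‖fourierL2 (g (ns i)) ξ‖ ^ 2)) atTop := by
          refine lintegral_mono_ae ?_; filter_upwards [hae] with ξ hξ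
          exact (((ENNReal.continuous_ofReal.tendsto _).comp ((hξ.norm.pow 2).const_mul _)).liminf_eq).ge
      _ ≤ liminf (fun i => ∫⁻ ξ, ofReal (symb γ ξ * ‖fourierL2 (g (ns i)) ξ‖ ^ 2)) atTop :=
          lintegral_liminf_le' fun i => (meas (mg _).1).aemeasurable.ennreal_ofReal
      _ ≤ liminf (fun i => ofReal (a (ns i))) atTop := by
          refine liminf_le_liminf (Eventually.of_forall fun i => ?_)
          rw [← ofReal_integral_eq_lintegral_ofReal (integrable_symb hγ (mg _))
            (ae_of_all _ fun ξ => mul_nonneg (s0 ξ) (sq_nonneg _))]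
          exact ofReal_le_ofReal (hb _)
      _ = _ := ((ENNReal.continuous_ofReal.tendsto _).comp (ta.comp hns.tendsto_atTop)).liminf_eq
  have nn : 0 ≤ᵐ[volume] fun ξ => symb γ ξ * ‖fourierL2 f ξ‖ ^ 2 :=
    ae_of_all _ fun ξ => mul_nonneg (s0 ξ) (sq_nonneg _)
  have int : Integrable fun ξ => symb γ ξ * ‖fourierL2 f ξ‖ ^ 2 :=
    ⟨meas f2, (hasFiniteIntegral_iff_ofReal nn).2 (fatou.trans_lt ofReal_lt_top)⟩
  refine ⟨?_, ?_⟩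
  · exact memH_of_integrable_symb hγ f2 int
  · rw [← ofReal_integral_eq_lintegral_ofReal int nn, ENNReal.ofReal_le_ofReal_iff
      (ge_of_tendsto' ta fun M => (fracForm_nonneg γ (g M)).trans (hb M))] at fatou
    exact fatou

lemma memH_and_cK_mul_fracForm_le (hn : 1 ≤ n) (hs0 : 0 < s) (hs1 : s < 1)
    (hZ : RepOn (2 * s) A B Z) (h1 : Cl s ((N + 1) / 2) Z) (hE : FE ϖ (N + 1) Z) :
    MemH (N + s) (tr A).1 ∧ cK N s * fracForm (N + s) (tr A).1 ≤ aF ϖ (N + 1) Z Z := by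
  have hγ : (0 : ℝ) < N + s := pos!
  have hcK := cK_pos N hs0 hs1
  set f := (tr A).1 with hf
  have cf : Continuous f := (SB.contDiff (tr A)).continuous
  have f2 : MemLp f 2 := memLp_trace_dxs hs0 hs1 hZ hE (α := []) (by simp)
  set g := fun M x => chi M (x, 0) * f x with hg
  obtain ⟨C, hC0, hC⟩ := exists_norm_iteratedFDeriv_chi_le 0
  have hC' M (p : Υ) : |chi M p| ≤ C := by simpa using hC M p
  have cg M := ((contDiff_chi M).continuous.comp (by fun_prop : Continuous fun x : Ξ => (x, (0 : ℝ)))).mul cf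
  have g2 M := f2.of_le_mul (cg M).aestronglyMeasurable (ae_of_all _ fun x => by
    simp; exact mul_le_mul_of_nonneg_right (hC' M _) (abs_nonneg _))
  have ev x : ∀ᶠ M : ℕ in atTop, g M x = f x := by
    filter_upwards [eventually_ge_atTop ⌈‖x‖⌉₊] with M hM; have h2 := Nat.ceil_le.1 hM; simp only [hg]
    rw [chi_eq_one (by rw [Prod.norm_mk, norm_zero, max_eq_left (norm_nonneg _)]; linarith), one_mul]
  set a := fun M => aF ϖ (N + 1) (fun q => chi M q * Z q) fun q => chi M q * Z q
  have eg (M : ℕ) : (tr (⟨fun p => chi M p * A.1 p, (isEvenSmooth_chi M).mul A.2⟩ : ES n)).1 = g M := rfl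
  have trg M : cK N s * fracForm (N + s) (g M) ≤ a M := by
    rw [← eg]; exact cK_mul_fracForm_le_of_cs hn hs0 hs1 (hZ.chi_mul M) (cs_chi_mul M Z) (h1.chi_mul M)
  have mg M : MemH (N + s) (g M) := by
    rw [← eg]
    exact memH_of_hasCompactSupport hγ (SB.contDiff _) ((cs_chi_mul M Z).hasCompactSupport_tr hs0 (hZ.chi_mul M))
  have conv : Tendsto (fun M => ∫ x, (-1 * g M x + f x) ^ 2) atTop (𝓝 0) := by
    rw [← integral_zero Ξ ℝ]
    refine tendsto_integral_of_dominated_convergence (fun x => (C + 1) ^ 2 * f x ^ 2)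
      (fun M => ((continuous_const.mul (cg M)).add cf).pow 2 |>.aestronglyMeasurable)
      (((memLp_two_iff_integrable_sq f2.1).1 f2).const_mul _) (fun M => ae_of_all _ fun x => ?_) (ae_of_all _ fun x => ?_)
    · rw [norm_of_nonneg (sq_nonneg _), ← mul_pow, sq_le_sq]
      rw [show -1 * g M x + f x = (1 - chi M (x, 0)) * f x by simp; ring, abs_mul, abs_mul, abs_of_nonneg (by positivity : 0 ≤ C + 1)]; gcongr; have := abs_sub 1 (chi M (x, 0)); rw [abs_one] at this; linarith [hC' M (x, 0)]
    · refine tendsto_const_nhds.congr' ?_; filter_upwards [ev x] with M hM; rw [hM]; ring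
  obtain ⟨r1, r2⟩ := memH_and_fracForm_le hγ mg f2 conv ((tendsto_aF_chi_self hs0 hs1 h1 hE).div_const (cK N s)) fun M =>
    (le_div_iff₀ hcK).2 (by rw [mul_comm]; exact trg M)
  exact ⟨r1, by rwa [le_div_iff₀ hcK, mul_comm] at r2⟩

lemma ExtData.aF_self (hn : 1 ≤ n) (hs0 : 0 < s) (hs1 : s < 1)
    (hH : MemH (N + s) f) (E : ExtData N s f V A B) :
    aF ϖ (N + 1) V V = cK N s * fracForm (N + s) f := by
  have hcK := cK_pos N hs0 hs1
  have hq : Cl s ((N + 1) / 2) V := E.cl.of_le (by omega)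
  have hA : (tr A).1 = f := by
    ext x; have := E.eq x 0 le_rfl; rw [zero_rpow pos!, zero_mul, add_zero, E.value] at this; exact this.symm
  refine le_antisymm ?_ (hA ▸ (memH_and_cK_mul_fracForm_le hn hs0 hs1 E.rep hq E.fe).2)
  have l1 := tendsto_aF_chi_left hs0 hs1 hq E.fe (kl2_and_tendsto hs0 hs1 hq E.fe).2.1
  have l2 := ((tendsto_aF_chi_self hs0 hs1 hq E.fe).add_const (cK N s * fracForm (N + s) f)).div_const 2
  have := le_of_tendsto_of_tendsto' l1 l2 fun M => ?_
  · linarith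
  · have hr := E.rep.chi_mul M; have hc := cs_chi_mul M V; have b1 := cK_mul_fracForm_le_of_cs hn hs0 hs1 hr hc (hq.chi_mul M)
    have b2 := cross_le pos! hH (SB.contDiff _) (hc.hasCompactSupport_tr hs0 hr)
    rw [E.aF_eq hs0 hs1 hr hc (hq.chi_mul M)]; nlinarith

end

section

variable {κ : ℝ} {c : ℕ → ES n} {E : ES n} {b : Bdry n → ℝ} {p : ℕ}

/-! ### Cutoffs on the boundary -/

lemma csm_Dv_mul {f g : Ψ} (hf : C∞ f) (hg : C∞ g) (v : Υ) :
    Dv v (fun p => f p * g p) = fun p => f p * Dv v g p + Dv v f p * g p := by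
  ext p
  simp only [Dv]
  rw [fderiv_fun_mul (hf.differentiable (by simp) p) (hg.differentiable (by simp) p)]
  simp [mul_comm]

/-- The product of even smooth functions. -/
def mulE (A B : ES n) : ES n := ⟨fun p => A.1 p * B.1 p, A.2.mul B.2⟩

/-- A tangential derivative of an even smooth function. -/
def dE (i : Fin n) (A : ES n) : ES n := ⟨Dv (eX i) A.1, A.2.dX i⟩

/-- The cutoff functions as elements of `ES n`. -/
def chiE (M : ℕ) : ES n := ⟨chi M, isEvenSmooth_chi M⟩

lemma LXe_mulE (A B : ES n) : LXe (mulE A B) =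
    ∑ i, (mulE A (dE i (dE i B)) + (2 : ℝ) • mulE (dE i A) (dE i B) + mulE (dE i (dE i A)) B) := by
  have hA := ES_contDiff A
  have hB := ES_contDiff B
  refine Subtype.ext ?_
  rw [AddSubmonoidClass.coe_finsetSum]
  change LX (fun p => A.1 p * B.1 p) = _
  rw [csm_LX_eq (hA.mul hB)]
  ext p
  rw [Finset.sum_apply]
  refine sum_congr rfl fun i _ => ?_
  have a1 := csm_Dv hA (eX i)
  have b1 := csm_Dv hB (eX i)
  rw [csm_Dv_mul hA hB, csm_Dv_add (hA.mul b1) (a1.mul hB), csm_Dv_mul hA b1, csm_Dv_mul a1 hB]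
  change _ = A.1 p * Dv (eX i) (Dv (eX i) B.1) p + 2 * (Dv (eX i) A.1 p * Dv (eX i) B.1 p) +
    Dv (eX i) (Dv (eX i) A.1) p * B.1 p
  ring

lemma LXe_eq_sum (A : ES n) : LXe A = ∑ i, dE i (dE i A) := by
  refine Subtype.ext ?_
  rw [AddSubmonoidClass.coe_finsetSum]
  ext p
  rw [Finset.sum_apply]
  exact congrFun (csm_LX_eq (ES_contDiff A)) p

/-- A sequence of functions with uniformly bounded derivatives which is eventually equal to the
constant `κ` near each point. -/
structure Cut (κ : ℝ) (c : ℕ → ES n) : Prop where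
  bound : ∀ j : ℕ, ∃ C, ∀ M p, ‖𝒟 j (c M).1 p‖ ≤ C
  loc : ∀ p, ∀ᶠ M in atTop, (c M).1 =ᶠ[𝓝 p] fun _ => κ

protected lemma Cut.dE (h : Cut κ c) (i : Fin n) : Cut 0 fun M => dE i (c M) := by
  refine ⟨fun j => ?_, fun p => ?_⟩
  · obtain ⟨C, hC⟩ := h.bound (j + 1); refine ⟨C, fun M p => le_trans ?_ (hC M p)⟩
    have hs : C∞ (fderiv ℝ (c M).1) := (ES_contDiff (c M)).fderiv_right (by simp)
    refine (norm_iteratedFDeriv_clm_apply_const hs.contDiffAt (by exact_mod_cast le_top)).trans ?_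
    rw [norm_iteratedFDeriv_fderiv]; exact mul_le_of_le_one_left (norm_nonneg _) (norm_eX_le i)
  · filter_upwards [h.loc p] with M hM; filter_upwards [hM.eventuallyEq_nhds] with z hz; change fderiv ℝ (c M).1 z (eX i) = 0; rw [hz.fderiv_eq]; simp

lemma cut_chiE : Cut 1 (chiE : ℕ → ES n) := by
  refine ⟨fun j => ?_, fun p => ?_⟩
  · obtain ⟨C, hC0, hC⟩ := exists_norm_iteratedFDeriv_chi_le j
    exact ⟨C, fun M p => (hC M p).trans (mul_le_of_le_one_right hC0 (pow_le_one₀ pos!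
      (inv_le_one_of_one_le₀ (by linarith))))⟩
  · filter_upwards [eventually_ge_atTop ⌈‖p‖⌉₊] with M hM
    have h2 : ‖p‖ < M + 1 := by linarith [Nat.ceil_le.1 hM]
    filter_upwards [(isOpen_lt continuous_norm continuous_const).mem_nhds h2] with z hz
    exact chi_eq_one (le_of_lt hz)

lemma Cut.tendsto_integral (h : Cut κ c)     (hb : Integrable fun x => E.1 (x, 0) * b x) (hbm : AEStronglyMeasurable b) :
    (∀ M, Integrable fun x => (mulE (c M) E).1 (x, 0) * b x) ∧
      Tendsto (fun M => ∫ x, (mulE (c M) E).1 (x, 0) * b x) atTop (𝓝 (κ * ∫ x, E.1 (x, 0) * b x)) := by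
  obtain ⟨C, hC⟩ := h.bound 0
  simp only [norm_iteratedFDeriv_zero, norm_eq_abs] at hC
  have hm (M : ℕ) : AEStronglyMeasurable fun x => (mulE (c M) E).1 (x, 0) * b x :=
    ((ES_continuous (mulE (c M) E)).comp (by fun_prop : Continuous fun x : Ξ => (x, (0 : ℝ)))).aestronglyMeasurable.mul hbm
  have hle (M : ℕ) (x : Ξ) : ‖(mulE (c M) E).1 (x, 0) * b x‖ ≤ C * ‖E.1 (x, 0) * b x‖ := by
    change ‖(c M).1 (x, 0) * E.1 (x, 0) * b x‖ ≤ _; rw [mul_assoc, norm_mul, norm_eq_abs]; exact mul_le_mul_of_nonneg_right (hC M _) (norm_nonneg _)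
  refine ⟨fun M => (hb.norm.const_mul C).mono' (hm M) (ae_of_all _ (hle M)), ?_⟩
  rw [← integral_const_mul]
  refine tendsto_integral_of_dominated_convergence _ hm (hb.norm.const_mul C) (fun M => ae_of_all _ (hle M))
    (ae_of_all _ fun x => tendsto_const_nhds.congr' ?_)
  filter_upwards [h.loc (x, 0)] with M hM
  change _ = (c M).1 (x, 0) * E.1 (x, 0) * b x
  rw [hM.eq_of_nhds, mul_assoc]

/-- Tangential derivatives of order at most `p` have square-integrable boundary values. -/
def HK (p : ℕ) (E : ES n) : Prop :=
  ∀ α : List (Fin n), α.length ≤ p → MemLp (fun x : Ξ => dxs α E.1 (x, 0)) 2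

protected lemma HK.dE (h : HK (p + 1) E) (i : Fin n) : HK p (dE i E) := fun α hα => by
  have := h (α ++ [i]) (by simpa using hα)
  rwa [dxs_append] at this

lemma HK.of_le {q : ℕ} (h : HK p E) (hq : q ≤ p) : HK q E := fun α hα => h α (hα.trans hq)

lemma Cut.tendsto_integral_LXe (hb : MemLp b 2) (a : ℕ) (h : Cut κ c)
    (hE : HK (2 * a) E) : (Integrable fun x => ((LXe ^ a) E : ES n).1 (x, 0) * b x) ∧
    (∀ M, Integrable fun x => ((LXe ^ a) (mulE (c M) E) : ES n).1 (x, 0) * b x) ∧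
      Tendsto (fun M => ∫ x, ((LXe ^ a) (mulE (c M) E) : ES n).1 (x, 0) * b x) atTop
        (𝓝 (κ * ∫ x, ((LXe ^ a) E : ES n).1 (x, 0) * b x)) := by
  induction a generalizing κ c E with
  | zero =>
    have hi := (hE [] (by simp)).integrable_mul hb; exact ⟨hi, h.tendsto_integral hi hb.1⟩
  | succ a ih =>
    have h3 : HK (2 * a + 1 + 1) E := hE
    have h2 (i : Fin n) : HK (2 * a) (dE i (dE i E)) := (h3.dE i).dE i
    have h1 (i : Fin n) : HK (2 * a) (dE i E) := (h3.dE i).of_le (by omega)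
    have h0 : HK (2 * a) E := hE.of_le (by omega); have e1 x : ((LXe ^ (a + 1)) E).1 (x, 0) * b x =
        ∑ i, ((LXe ^ a) (dE i (dE i E))).1 (x, 0) * b x := by
      rw [pow_succ, Module.End.mul_apply, LXe_eq_sum, map_sum, AddSubmonoidClass.coe_finsetSum, Finset.sum_apply,
        sum_mul]
    have e2 M x : ((LXe ^ (a + 1)) (mulE (c M) E)).1 (x, 0) * b x =
        ∑ i, (((LXe ^ a) (mulE (c M) (dE i (dE i E)))).1 (x, 0) * b x +
          2 * (((LXe ^ a) (mulE (dE i (c M)) (dE i E))).1 (x, 0) * b x) +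
          ((LXe ^ a) (mulE (dE i (dE i (c M))) E)).1 (x, 0) * b x) := by
      rw [pow_succ, Module.End.mul_apply, LXe_mulE, map_sum, AddSubmonoidClass.coe_finsetSum, Finset.sum_apply,
        sum_mul]
      refine sum_congr rfl fun i _ => ?_; rw [map_add, map_add, map_smul]; change (_ + 2 * _ + _) * b x = _; ring
    have i2 := fun i => ih h (h2 i); have i1 := fun i => ih (h.dE i) (h1 i); have i0 := fun i => ih ((h.dE i).dE i) h0; simp_rw [e1, e2]
    have iM M i := (((i2 i).2.1 M).add (((i1 i).2.1 M).const_mul 2)).add ((i0 i).2.1 M)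
    refine ⟨integrable_finsetSum _ fun i _ => (i2 i).1, fun M => integrable_finsetSum _ fun i _ => iM M i, ?_⟩
    rw [integral_finsetSum _ fun i _ => (i2 i).1, mul_sum]
    refine (tendsto_finsetSum _ fun i _ => ?_ : Tendsto (fun M => ∑ i, ∫ x, _) atTop _).congr fun M =>
      (integral_finsetSum _ fun i _ => iM M i).symm
    have := ((i2 i).2.2.add ((i1 i).2.2.const_mul 2)).add (i0 i).2.2
    simp at this; refine this.congr fun M => ?_; have a1 := ((i2 i).2.1 M).add (((i1 i).2.1 M).const_mul 2); have a2 := integral_add a1 ((i0 i).2.1 M)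
    have a3 := integral_add ((i2 i).2.1 M) (((i1 i).2.1 M).const_mul 2); rw [integral_const_mul] at a3; simp at a2 a3 ⊢; rw [a2, a3]

/-! ### Traces of a cut-off function -/

lemma Te_pow_slice_mul {c r : ℝ} {E' : ES n} {κ : Ξ → ℝ} (h : ∀ p : Υ, |p.2| < r → E.1 p = κ p.1 * E'.1 p)
    (i : ℕ) : ∀ p : Υ, |p.2| < r → ((Te c ^ i) E).1 p = κ p.1 * ((Te c ^ i) E').1 p := by
  have D {F F' : Ψ} (h : ∀ p : Υ, |p.2| < r → F p = κ p.1 * F' p) p (hp : |p.2| < r) :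
      dy F p = κ p.1 * dy F' p := by
    have : (fun t => F (p.1, t)) =ᶠ[𝓝 p.2] fun t => κ p.1 * F' (p.1, t) := by
      filter_upwards [(isOpen_lt continuous_abs continuous_const).mem_nhds hp] with t ht; exact h (p.1, t) ht
    rw [dy, this.deriv_eq, deriv_const_mul_field]; rfl
  induction i generalizing E E' with
  | zero => exact h
  | succ i ih =>
    refine ih fun p hp => ?_; change Tc c E.1 p = κ p.1 * Tc c E'.1 p; have e : hd E.1 p = κ p.1 * hd E'.1 p := by
      rw [hd, hd, ← intervalIntegral.integral_const_mul]; refine intervalIntegral.integral_congr fun t ht => ?_; rw [uIcc_of_le zero_le_one] at ht; refine D (D h) (p.1, t * p.2) (lt_of_le_of_lt ?_ hp); rw [abs_mul, abs_of_nonneg ht.1]; exact mul_le_of_le_one_left (abs_nonneg _) ht.2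
    rw [Tc, Tc, D (D h) p hp, e]; ring

lemma chi_slice (M : ℕ) {p : Υ} (hp : |p.2| < M + 1) : chi M p = chi M (p.1, 0) := by
  have hM : (0 : ℝ) < M + 1 := pos!
  simp only [chi, bump, Prod.smul_fst, Prod.smul_snd, smul_eq_mul, mul_zero]
  rw [ContDiffBump.one_of_mem_closedBall _ (x := ((M : ℝ) + 1)⁻¹ * p.2), ContDiffBump.one_of_mem_closedBall _ (x := (0 : ℝ))]
  · simp
  · rw [mem_closedBall_zero_iff, norm_eq_abs, abs_mul, abs_of_pos (inv_pos.2 hM)]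
    exact (inv_mul_le_iff₀ hM).2 (by linarith)

lemma tr_Te_chi_mul (c : ℝ) (M i : ℕ) (A : ES n) :
    tr ((Te c ^ i) (mulE (chiE M) A)) = tr (mulE (chiE M) ((Te c ^ i) A)) := by
  ext x
  exact Te_pow_slice_mul (κ := fun x => chi M (x, 0)) (r := M + 1) (fun p hp => by
    change chi M p * A.1 p = _; rw [chi_slice M hp]) i (x, 0) (by rw [abs_zero]; positivity)

end

section

variable {γ : ℝ} {U : Amb n → ℝ} {A E : ES n} {J p : ℕ}

/-! ### The energy is the energy form -/

lemma InC.exists_rep (h : InC γ U) : ∃ A B : ES n,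
    (∀ x y, 0 ≤ y → U (x, y) = A.1 (x, y) + y ^ (2 * fract γ) * B.1 (x, y)) ∧ RepOn (2 * fract γ) A B U := by
  obtain ⟨A, B, hA, hB, h⟩ := h
  exact ⟨⟨A, hA⟩, ⟨B, hB⟩, h, fun p hp => h p.1 p.2 (le_of_lt hp)⟩

lemma finiteEnergy_iff (hU : SmU U) :
    FiniteEnergy γ U ↔ FE (1 - 2 * fract γ) (⌊γ⌋₊ + 1) U := by
  have e j Y : IntegrableOn (fun p => ‖𝒟 j U p‖ ^ 2) {p | p.2 < Y} (mu (wt γ)) ↔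
      IntegrableOn (fun p => ‖𝒟 j U p‖ ^ 2 * p.2 ^ wt γ) {p | 0 < p.2 ∧ p.2 < Y} := by
    have hS : MeasurableSet {p : Υ | p.2 < Y} := measurableSet_lt measurable_snd measurable_const
    rw [← integrable_indicator_iff hS, integrable_mu_iff]
    simp_rw [← Set.indicator_mul_left _ _ fun p : Υ => p.2 ^ wt γ]
    rw [integrableOn_indicator_iff hS, inter_comm]; rfl
  exact ⟨fun h => ⟨hU, fun Y hY j hj => (e j Y).2 (h.slab Y hY j hj), integrable_mu_iff.2 h.top⟩,
    fun h => ⟨fun Y hY j hj => (e j Y).1 (h.slab Y hY j hj), integrable_mu_iff.1 h.top⟩⟩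

lemma sum_choose_cf {N : ℕ} {s : ℝ} (hs0 : 0 < s) (hs1 : s < 1) (r : ℕ) :
    ∑ i ∈ ℛ (r + 1), (r.choose i : ℝ) * ((-1) ^ i * cf (-s) N i 0) = cw (-s) N r 0 := by
  have := sum_choose_ph (1 - s) (1 - N - s) (fun i hi => neg_add_int_ne_zero hs0 hs1 (1 - N + i) (by
    push_cast; linarith)) r
  simp only [cf, cw, Nat.cast_zero, mul_zero, add_zero, Nat.sub_zero, pow_zero, Nat.choose_zero_right, Nat.cast_one,
    one_mul, zero_sub]
  rwa [show (1 - N - s) - (1 - s) = -N by ring] at this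

lemma tr_Te_eq (hγ : 0 < γ) (hγN : ∀ N : ℕ, γ ≠ N) {B : ES n}
    (h : RepOn (2 * fract γ) A B U) (h0 : ∀ j, 1 ≤ j → j ≤ J → ∀ x, bEven γ j U x = 0) {j : ℕ} (hj : j ≤ J) :
    tr ((Te (1 - 2 * fract γ) ^ j) A) = ((-1) ^ j * cf (-fract γ) ⌊γ⌋₊ j 0) • (Lb ^ j) (tr A) := by
  obtain ⟨b, hb, hr⟩ := exists_bEven hγ hγN h
  have hz i h1 h2 : b i = 0 := Subtype.ext ((hb i).trans (funext (h0 i h1 h2)))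
  have e := hr j
  rw [sum_eq_single_of_mem 0 (by simp) fun i hi hi0 => by
    rw [hz i (by omega) (by have := Finset.mem_range.1 hi; omega), map_zero, smul_zero], Subtype.ext ((hb 0).trans (bEven_zero_eq hγ hγN h))] at e
  have e' := congrArg (((-1 : ℝ) ^ j) • ·) e
  beta_reduce at e'
  rw [smul_smul, show ((-1 : ℝ) ^ j) * (-1) ^ j = 1 by rw [← mul_pow]; simp, one_smul] at e'
  simpa [mul_smul] using e'

lemma tr_Le_chi_mul {c : ℝ} {e : ℕ → ℝ} (h : ∀ j ≤ J, tr ((Te c ^ j) A) = e j • (Lb ^ j) (tr A))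
    (M : ℕ) {r : ℕ} (hr : r ≤ J) : tr ((Le c ^ r) (mulE (chiE M) A)) =
      ∑ i ∈ ℛ (r + 1), ((r.choose i : ℝ) * e i) • tr ((LXe ^ (r - i)) (mulE (chiE M) ((LXe ^ i) A))) := by
  rw [tr_Le_pow]
  refine sum_congr rfl fun i hi => ?_
  have : tr (mulE (chiE M) ((Te c ^ i) A)) = e i • tr (mulE (chiE M) ((LXe ^ i) A)) := by
    have h1 := h i ((lt_succ_iff.1 (Finset.mem_range.1 hi)).trans hr); rw [← tr_LXe_pow] at h1; ext x
    have h2 : ((Te c ^ i) A).1 (x, 0) = e i * ((LXe ^ i) A).1 (x, 0) := congrFun (congrArg Subtype.val h1) x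
    change chi M (x, 0) * ((Te c ^ i) A).1 (x, 0) = e i * (chi M (x, 0) * ((LXe ^ i) A).1 (x, 0)); rw [h2]; ring
  rw [tr_Te_chi_mul, this, map_smul, smul_smul, tr_LXe_pow]

lemma HK.add {F : ES n} (hE : HK p E) (hF : HK p F) : HK p (E + F) := fun α hα => by
  have e α : C∞ (dxs α E.1) ∧ C∞ (dxs α F.1) ∧
      dxs α (E + F).1 = fun p => dxs α E.1 p + dxs α F.1 p := by
    induction α with
    | nil => exact ⟨ES_contDiff E, ES_contDiff F, rfl⟩
    | cons i α ih =>
      refine ⟨csm_Dv ih.1 _, csm_Dv ih.2.1 _, ?_⟩; change Dv (eX i) (dxs α (E + F).1) = _; rw [ih.2.2, csm_Dv_add ih.1 ih.2.1]; rfl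
  rw [(e α).2.2]
  exact (hE α hα).add (hF α hα)

protected lemma HK.LXe (h : HK (p + 2) E) : HK p (LXe E) := by
  rw [LXe_eq_sum]
  refine Finset.sum_induction _ (HK p) (fun _ _ h h' => h.add h') (fun α _ => ?_) fun i _ => (HK.dE (p := p + 1) h i).dE i
  have e α : dxs α (0 : ES n).1 = fun _ => 0 := by
    induction α with
    | nil => rfl
    | cons i α ih =>
      change Dv (eX i) (dxs α (0 : ES n).1) = _; rw [ih]; ext p; simp [Dv]
  rw [e]; exact MemLp.zero'

lemma HK.LXe_pow (i : ℕ) (h : HK (p + 2 * i) E) : HK p ((LXe ^ i) E) := by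
  induction i generalizing E with
  | zero => exact h
  | succ i ih => exact ih (HK.LXe h)

lemma floor_half (γ : ℝ) : ⌊γ / 2⌋₊ = ⌊γ⌋₊ / 2 := by simpa using Nat.floor_div_natCast γ 2

lemma interior_eq_aF (hγ : 0 < γ) (hγN : ∀ N : ℕ, γ ≠ N) (hU : InCPlus γ U)
    (hE : EnergyConverges γ U) : ∫ p in ℍ, U p * opL γ U p * p.2 ^ wt γ =
      aF (1 - 2 * fract γ) (⌊γ⌋₊ + 1) U U - ∫ x, bEven γ 0 U x * bOdd γ ⌊γ⌋₊ U x := by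
  have hs0 := fract_pos_of hγ hγN
  have hs1 := fract_lt_one γ
  obtain ⟨A, B, -, rep⟩ := hU.smooth.exists_rep
  have fe := (finiteEnergy_iff (rep.smU (ES_contDiff A) (ES_contDiff B))).1 hU.sobolev
  obtain ⟨b, hb, hbr⟩ := exists_bOdd_trace hγ hγN rep
  have hcl := (odd_data_iff hγ hγN rep _).1 hU.odd_zero
  have hbz (p : ℕ) (hp : p < ⌊γ⌋₊ - ⌊γ⌋₊ / 2) : b p = 0 :=
    Subtype.ext ((hb p).trans (funext (hU.odd_zero p (by rwa [floor_half]))))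
  have hTe := fun j (hj : j ≤ ⌊γ / 2⌋₊) => tr_Te_eq hγ hγN rep hU.even_zero hj
  have hint := hE.interior
  have hne := hE.neumann
  have he0 := hE.even_odd 0 (Nat.zero_le _)
  rw [Nat.sub_zero] at he0
  rw [bEven_zero_eq hγ hγN rep, ← hb] at he0 ⊢
  simp only [← hb] at hne
  rw [wt_eq] at hint ⊢
  simp only [floor_half] at hcl hTe hne
  have hopL : opL γ U = fun p => (-1) ^ (⌊γ⌋₊ + 1) * (wLap (1 - 2 * fract γ))^[⌊γ⌋₊ + 1] U p := by
    ext p; rw [opL, wt_eq]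
  rw [hopL] at hint ⊢
  clear hopL hU hE hb
  generalize fract γ = s at *
  generalize ⌊γ⌋₊ = N at *
  set J := N / 2 with hJ
  have hcl' : Cl s ((N + 1) / 2) U := hcl.of_le (by omega)
  set e : ℕ → ℝ := fun i => (-1) ^ i * cf (-s) N i 0 with he
  set I : ℕ → ℝ := fun l => ∫ x, ((LXe ^ l) A).1 (x, 0) * (b (N - l)).1 x with hI
  set Y : ℕ → ℕ → ℕ → Ξ → ℝ := fun M l i x =>
    ((LXe ^ (l - i)) (mulE (chiE M) ((LXe ^ i) A))).1 (x, 0) * (b (N - l)).1 x with hY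
  have hlim (l i : ℕ) (hi : i ≤ l) (hl : l ≤ J) :
      (∀ M, Integrable (Y M l i)) ∧ Tendsto (fun M => ∫ x, Y M l i x) atTop (𝓝 (I l)) := by
    rcases Nat.eq_zero_or_pos l with rfl | hl0
    · obtain rfl : i = 0 := by omega
      have := cut_chiE.tendsto_integral he0 (SB.contDiff (b N)).continuous.aestronglyMeasurable
      rwa [one_mul] at this
    · have hk : HK (2 * (l - i)) ((LXe ^ i) A) := HK.LXe_pow i fun α hα => memLp_trace_dxs hs0 hs1 rep fe (by omega)
      have := (cut_chiE.tendsto_integral_LXe (hne l hl0 hl) (l - i) hk).2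
      rwa [one_mul, ← Module.End.mul_apply, ← pow_add, Nat.sub_add_cancel hi] at this
  set X : ℕ → ℕ → ℕ → ℝ := fun M r l => ∑ i ∈ ℛ (r + 1), (r.choose i * e i) * ∫ x, Y M l i x
  have term (M r : ℕ) (hr : r ≤ J) : ∫ x, (tr ((Le (1 - 2 * s) ^ r) (mulE (chiE M) A))).1 x *
      (2 * s * (tr ((Le (1 + 2 * s) ^ (N - r)) B)).1 x) =
      -∑ l ∈ Finset.Ico r (J + 1), cw s N (N - r) (N - l) * X M r l := by
    set R := tr ((Le (1 - 2 * s) ^ r) (mulE (chiE M) A)) with hR; have cR : HasCompactSupport R.1 := by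
      exact ((cs_chi_mul M U).wLap_iterate _ r).hasCompactSupport_tr hs0 ((rep.chi_mul M).wLap_iterate r)
    have sR := SB.contDiff R; have sb a p := (bLap_iterate (SB.contDiff (b p)) a).1.continuous
    have e1 x : R.1 x * (2 * s * (tr ((Le (1 + 2 * s) ^ (N - r)) B)).1 x) =
        -∑ p ∈ ℛ (N - r + 1), cw s N (N - r) p * (bLap^[N - r - p] (b p).1 x * R.1 x) := by
      have h1 := congrFun (congrArg Subtype.val (hbr (N - r))) x
      rw [NegMemClass.coe_neg, AddSubmonoidClass.coe_finsetSum, Pi.neg_apply, Finset.sum_apply] at h1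
      change 2 * s * (tr ((Le (1 + 2 * s) ^ (N - r)) B)).1 x = _ at h1
      rw [h1, mul_neg, mul_sum]; congr 1; refine sum_congr rfl fun p _ => ?_
      rw [SetLike.val_smul, coe_Lb_pow, Pi.smul_apply, smul_eq_mul]; ring
    simp_rw [e1]; have iR a p : Integrable fun x => bLap^[a] (b p).1 x * R.1 x :=
      ((sb a p).mul sR.continuous).integrable_of_hasCompactSupport cR.mul_left
    rw [integral_neg, integral_finsetSum _ fun p _ => (iR _ p).const_mul _]; congr 1; simp_rw [integral_const_mul]
    have e2 : ∑ l ∈ Finset.Ico r (J + 1), cw s N (N - r) (N - l) * X M r l = ∑ l ∈ Finset.Ico r (J + 1),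
        (fun p => cw s N (N - r) p * ∫ x, bLap^[N - r - p] (b p).1 x * R.1 x) (N - l) := by
      refine sum_congr rfl fun l hl => ?_; obtain ⟨hl1, hl2⟩ := Finset.mem_Ico.1 hl; have e3 : N - r - (N - l) = l - r := by omega
      beta_reduce; rw [e3, integral_bLap_iterate_mul (SB.contDiff _) sR cR]; congr 1
      have e4 x : (b (N - l)).1 x * bLap^[l - r] R.1 x =
          ∑ i ∈ ℛ (r + 1), (r.choose i * e i) * Y M l i x := by
        rw [← coe_Lb_pow, hR, tr_Le_chi_mul hTe M hr, map_sum, AddSubmonoidClass.coe_finsetSum, Finset.sum_apply,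
          mul_sum]
        refine sum_congr rfl fun i hi => ?_; have hi' := Finset.mem_range.1 hi
        rw [map_smul, ← tr_LXe_pow, ← Module.End.mul_apply, ← pow_add, show l - r + (r - i) = l - i by omega,
          SetLike.val_smul, Pi.smul_apply, smul_eq_mul]
        change _ * (_ * ((LXe ^ (l - i)) (mulE (chiE M) ((LXe ^ i) A))).1 (x, 0)) = _; ring
      simp_rw [e4]; rw [integral_finsetSum _ fun i hi => ((hlim l i (by have := Finset.mem_range.1 hi; omega)
        (by omega)).1 M).const_mul _]
      simp_rw [integral_const_mul]; rfl
    rw [e2, Finset.sum_Ico_reflect (fun p => cw s N (N - r) p * ∫ x, bLap^[N - r - p] (b p).1 x * R.1 x) r (by omega : J + 1 ≤ N + 1), show N + 1 - r = N - r + 1 by omega]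
    refine (Finset.sum_subset (fun p hp => Finset.mem_range.2 (Finset.mem_Ico.1 hp).2) fun p hp hp' => ?_).symm
    rw [hbz p (by have := Finset.mem_range.1 hp; simp at hp'; omega)]
    have : bLap^[N - r - p] (0 : Ξ → ℝ) = 0 := (coe_Lb_pow 0 _).symm.trans (by rw [map_zero]; rfl)
    simp [this]
  have limX (r l : ℕ) (hr : r ≤ l) (hl : l ≤ J) : Tendsto (fun M => X M r l) atTop (𝓝 (cw (-s) N r 0 * I l)) := by
    rw [← sum_choose_cf hs0 hs1, sum_mul]
    exact tendsto_finsetSum _ fun i hi => (hlim l i (by have := Finset.mem_range.1 hi; omega) hl).2.const_mul _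
  have limS : Tendsto (fun M => ∑ r ∈ ℛ (J + 1), -∑ l ∈ Finset.Ico r (J + 1),
      cw s N (N - r) (N - l) * X M r l) atTop (𝓝 (-((-1) ^ N * I 0))) := by
    have h1 : ∑ r ∈ ℛ (J + 1), -∑ l ∈ Finset.Ico r (J + 1),
        cw s N (N - r) (N - l) * (cw (-s) N r 0 * I l) = -((-1) ^ N * I 0) := by
      rw [sum_neg_distrib, sum_comm' (t' := ℛ (J + 1)) (s' := fun l => ℛ (l + 1))
        fun r l => by simp only [Finset.mem_range, Finset.mem_Ico]; omega]
      congr 1; have h2 l : ∑ r ∈ ℛ (l + 1), cw s N (N - r) (N - l) * (cw (-s) N r 0 * I l) =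
          (∑ r ∈ ℛ (l + 1), cw (-s) N r 0 * cw s N (N - r) (N - l)) * I l := by
        rw [sum_mul]; exact sum_congr rfl fun r _ => by ring
      rw [sum_eq_single_of_mem 0 (by simp) fun l hl hl0 => by
        rw [h2, sum_cw_mul_eq_zero N l (by omega) (by have := Finset.mem_range.1 hl; omega) s hs0 hs1, zero_mul], h2]
      simp [cw_self]
    rw [← h1]; refine tendsto_finsetSum _ fun r hr => (tendsto_finsetSum _ fun l hl => ?_).neg
    obtain ⟨hl1, hl2⟩ := Finset.mem_Ico.1 hl; exact (limX r l hl1 (by omega)).const_mul _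
  have green M := integral_mul_wLap_pow hs0 hs1 (N + 1) (rep.chi_mul M) rep (Or.inl (cs_chi_mul M U)) (hcl'.chi_mul M)
  have sq : ((-1 : ℝ) ^ (N + 1)) * (-1) ^ (N + 1) = 1 := by rw [← mul_pow]; simp
  have hint2 : Integrable (fun p => U p * (wLap (1 - 2 * s))^[N + 1] U p) (mu (1 - 2 * s)) := by
    refine (integrable_mu_iff.2 ((hint.const_mul ((-1) ^ (N + 1))).congr (ae_of_all _ fun p => ?_)))
    linear_combination (U p * (wLap (1 - 2 * s))^[N + 1] U p * p.2 ^ (1 - 2 * s)) * sq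
  have lim2 : Tendsto (fun M => ∫ p, chi M p * U p * (wLap (1 - 2 * s))^[N + 1] U p ∂mu (1 - 2 * s)) atTop
      (𝓝 (∫ p, U p * (wLap (1 - 2 * s))^[N + 1] U p ∂mu (1 - 2 * s))) := by
    obtain ⟨C, -, hC⟩ := exists_norm_iteratedFDeriv_chi_le 0
    refine tendsto_integral_of_dominated_convergence (fun p => C * ‖U p * (wLap (1 - 2 * s))^[N + 1] U p‖) (fun M => ?_)
      (hint2.norm.const_mul C) (fun M => ae_of_all _ fun p => ?_) (ae_of_all _ fun p => tendsto_const_nhds.congr' ?_)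
    · simp_rw [mul_assoc]; exact (contDiff_chi M).continuous.aestronglyMeasurable.mul hint2.1
    · rw [mul_assoc, norm_mul]; have := hC M p; rw [norm_iteratedFDeriv_zero, pow_zero, mul_one] at this
      exact mul_le_mul_of_nonneg_right this (norm_nonneg _)
    · filter_upwards [cut_chiE.loc p] with M hM; have : chi M p = 1 := hM.eq_of_nhds; rw [this, one_mul]
  have fin : ∫ p in ℍ, U p * ((-1) ^ (N + 1) * (wLap (1 - 2 * s))^[N + 1] U p) * p.2 ^ (1 - 2 * s) =
      (-1) ^ (N + 1) * ∫ p, U p * (wLap (1 - 2 * s))^[N + 1] U p ∂mu (1 - 2 * s) := by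
    rw [integral_mu, ← integral_const_mul]; congr 1; ext p; ring
  have hI0 : I 0 = ∫ x, (tr A).1 x * (b N).1 x := rfl
  rw [fin, tendsto_nhds_unique lim2 ((((tendsto_aF_chi_left hs0 hs1 hcl' fe ((kl2_and_tendsto hs0 hs1 hcl' fe).2.1)).const_mul ((-1) ^ (N + 1))).sub limS).congr fun M => by rw [green M, show N + 1 - (N + 1) / 2 = J + 1 by omega]; congr 1; exact sum_congr rfl fun r hr => (by rw [← term M r (lt_succ_iff.1 (Finset.mem_range.1 hr)), show N + 1 - 1 - r = N - r by omega]; rfl)), ← hI0, pow_succ]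
  rw [pow_succ] at sq
  linear_combination (aF (1 - 2 * s) (N + 1) U U - I 0) * sq

lemma energy_eq_aF (hγ : 0 < γ) (hγN : ∀ N : ℕ, γ ≠ N) (hU : InCPlus γ U)
    (hE : EnergyConverges γ U) : energy γ U = aF (1 - 2 * fract γ) (⌊γ⌋₊ + 1) U U := by
  rw [energy, formQ, interior_eq_aF hγ hγN hU hE, sum_eq_single_of_mem 0 (by simp) fun j hj hj0 => ?_,
    sum_eq_zero fun j hj => ?_]
  · rw [Nat.sub_zero]; ring
  · simp [hU.odd_zero j (Finset.mem_range.1 hj)]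
  · simp [hU.even_zero j (by omega) (lt_succ_iff.1 (Finset.mem_range.1 hj))]

end

section

variable {N : ℕ} {s : ℝ} {A B : ES n} {f : Bdry n → ℝ} {V U : Amb n → ℝ}

local notation "ϖ" => 1 - 2 * s

/-! ### Uniqueness and the extension problem -/

lemma eqOn_zero_of_data (hn : 1 ≤ n) (hs0 : 0 < s) (hs1 : s < 1) {W : Ψ}
    (rep : RepOn (2 * s) A B W) (hcl : Cl s ((N + 1) / 2) W) (fe : FE ϖ (N + 1) W)
    (pde : ∀ p ∈ ℍ, (wLap ϖ)^[N + 1] W p = 0)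
    (h0 : ∀ j ≤ N / 2, tr ((Le ϖ ^ j) A) = 0) : EqOn W 0 ℍ := by
  refine eqOn_zero_of_aF_eq_zero hn hs0 hs1 hcl fe (tendsto_nhds_unique
    (tendsto_aF_chi_left hs0 hs1 hcl fe (kl2_and_tendsto hs0 hs1 hcl fe).2.1) (tendsto_const_nhds.congr fun M => ?_))
  have hT := (triangular_zero_iff (b := fun j => tr ((Te ϖ ^ j) A))
    (fun r p => (r.choose p : ℝ) • (Lb : Module.End ℝ (SB n)) ^ (r - p))
    (fun r => ⟨1, one_ne_zero, by simp⟩) (fun r => tr_Le_pow _ A r) (N / 2 + 1)).2 fun j hj => h0 j (by omega)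
  have green := integral_mul_wLap_pow hs0 hs1 (N + 1) (rep.chi_mul M) rep (Or.inl (cs_chi_mul M W)) (hcl.chi_mul M)
  rw [integral_eq_zero_of_ae, sum_eq_zero, sub_zero] at green
  · have : ((-1 : ℝ)) ^ (N + 1) ≠ 0 := by simp
    exact ((mul_eq_zero.1 green.symm).resolve_left this).symm
  · intro r hr; have h1 := tr_Le_chi_mul (c := 1 - 2 * s) (J := N / 2) (A := A) (e := fun _ => 0)
      (fun j hj => by rw [zero_smul]; exact hT j (by omega)) M (r := r) (by have := Finset.mem_range.1 hr; omega)
    simp only [mul_zero, zero_smul, Finset.sum_const_zero] at h1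
    have h2 : tr ((Le ϖ ^ r) (⟨fun p => chi M p * A.1 p, (isEvenSmooth_chi M).mul A.2⟩ : ES n)) = 0 := h1
    simp [h2]
  · filter_upwards [ae_mu _] with p hp; rw [pde p hp, mul_zero]; rfl

lemma ExtData.tr_eq (hs0 : 0 < s)     (E : ExtData N s f V A B) : (tr A).1 = f := by
  ext x
  have := E.eq x 0 le_rfl
  rw [zero_rpow pos!, zero_mul, add_zero, E.value] at this
  exact this.symm

lemma ExtData.congr (hs0 : 0 < s)     (E : ExtData N s f V A B) (h : EqOn U V ℍ) (hU : ∀ x, U (x, 0) = f x) : ExtData N s f U A B where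
  eq x y hy := by
    rcases hy.eq_or_lt with rfl | hy
    · rw [hU, zero_rpow pos!, zero_mul, add_zero, ← E.tr_eq hs0]; rfl
    · rw [h (show (x, y) ∈ ℍ from hy), E.eq x y hy.le]
  rep := E.rep.congr h
  cl := E.cl.congr h
  fe := E.fe.congr h
  pde p hp := by rw [wLap_iterate_congr h _ hp, E.pde p hp]
  value := hU
  even_trace := E.even_trace
  flux := E.flux

variable {γ : ℝ}

lemma ExtData.isYangExtension (hγ : 0 < γ) (hγN : ∀ N : ℕ, γ ≠ N) (hf : C∞ f)
    (E : ExtData ⌊γ⌋₊ (fract γ) f V A B) : IsYangExtension γ f V := by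
  have hs0 := fract_pos_of hγ hγN
  have hs1 := fract_lt_one γ
  refine ⟨⟨A, B, A.2, B.2, E.eq⟩, (finiteEnergy_iff E.cl.smU).2 E.fe, ?_, E.value, fun j _ hj x => ?_, fun j hj x => ?_⟩
  · rw [wt_eq]; exact E.pde
  · rw [floor_half] at hj; have hj' := hj.trans (Nat.div_le_self _ _)
    have := (E.rep.wLap_iterate j).tendsto pos! (ES_continuous _) (ES_continuous _) x
    have e := congrFun (congrArg Subtype.val (E.even_trace hf j hj')) x
    rw [SetLike.val_smul, coe_Lb_pow, cw_zero_eq _ j hj' γ _ (eq_floor_add_fract hγ) hs0 hs1] at e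
    change ((Le (1 - 2 * fract γ) ^ j) A).1 (x, 0) = _ at e; rw [e] at this; rw [wt_eq]; exact this
  · rw [floor_half] at hj; rw [wt_eq]; exact Cl.tendsto_wNormal hs1 (Cl.wLap_iterate (E.cl.of_le (by omega : 1 + j ≤ ⌊γ⌋₊))) x

lemma ExtData.inCPlus (hγ : 0 < γ) (hγN : ∀ N : ℕ, γ ≠ N) (hf : C∞ f)
    (E : ExtData ⌊γ⌋₊ (fract γ) f V A B) : InCPlus γ V := by
  have hs0 := fract_pos_of hγ hγN
  have e : tr A = ⟨f, hf⟩ := Subtype.ext (E.tr_eq hs0)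
  refine ⟨⟨A, B, A.2, B.2, E.eq⟩, (finiteEnergy_iff E.cl.smU).2 E.fe, (even_data_iff hγ hγN E.rep _).2 fun j _ hj => ?_,
    (odd_data_iff hγ hγN E.rep _).2 (E.cl.of_le (Nat.sub_le _ _))⟩
  rw [floor_half] at hj
  rw [e]
  exact E.even_trace hf j (hj.trans (Nat.div_le_self _ _))

lemma RepOn.sub {e : ℝ} {A' B' : ES n} (hU : RepOn e A B U) (hV : RepOn e A' B' V) :
    RepOn e (A - A' : ES n) (B - B' : ES n) fun p => U p - V p := fun p hp => by
  change U p - V p = (A.1 p - A'.1 p) + p.2 ^ e * (B.1 p - B'.1 p)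
  rw [hU p hp, hV p hp]; ring

lemma IsYangExtension.eq_extData (hn : 1 ≤ n) (hγ : 0 < γ) (hγN : ∀ N : ℕ, γ ≠ N)
    (hf : C∞ f) (hU : IsYangExtension γ f U)     (E : ExtData ⌊γ⌋₊ (fract γ) f V A B) (x : Ξ) (y : ℝ) (hy : 0 ≤ y) : U (x, y) = V (x, y) := by
  have hs0 := fract_pos_of hγ hγN
  have hs1 := fract_lt_one γ
  obtain ⟨A', B', hU', rep⟩ := hU.smooth.exists_rep
  have hsm := rep.smU (ES_contDiff A') (ES_contDiff B')
  rcases hy.eq_or_lt with rfl | hy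
  · rw [hU.value, E.value]
  have hpde := hU.pde
  rw [wt_eq] at hpde
  have hW := eqOn_zero_of_data hn hs0 hs1 (rep.sub E.rep) (((show Cl (fract γ) (⌊γ⌋₊ - ⌊γ⌋₊ / 2) U by refine (odd_trace_iff hs0 hs1 rep).2 fun j hj => ?_; ext x; have h1 := (rep.wLap_iterate j).tendsto_wNormal hs1 x; have h2 := hU.odd_data j (by rwa [floor_half]) x; rw [wt_eq] at h2; exact (mul_eq_zero.1 (tendsto_nhds_unique h1 h2)).resolve_left pos!).sub (E.cl.of_le (Nat.sub_le _ _))).of_le (by omega))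
    (((finiteEnergy_iff hsm).1 hU.sobolev).sub E.fe) (fun p hp => ?_) fun j hj => ?_
  · exact sub_eq_zero.1 (hW (show (x, y) ∈ ℍ from hy))
  · have h1 : EqOn (fun p => U p - V p) (fun p => -1 * V p + U p) ℍ := fun p _ => by ring
    rw [wLap_iterate_congr h1 _ hp, wLap_iterate_comb E.cl.smU hsm _ _ _ hp]; beta_reduce; rw [E.pde p hp, hpde p hp]; simp
  · have hj' := hj.trans (Nat.div_le_self _ _); rw [map_sub, map_sub, sub_eq_zero, E.even_trace hf j hj']; rcases Nat.eq_zero_or_pos j with rfl | hj0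
    · simp [show tr A' = ⟨f, hf⟩ by ext x; have := hU' x 0 le_rfl; rw [zero_rpow pos!, zero_mul, add_zero, hU.value] at this; exact this.symm, cw]
    ext x; have h1 := (rep.wLap_iterate j).tendsto pos! (ES_continuous _) (ES_continuous _) x
    have h2 := hU.even_data j hj0 (by rwa [floor_half]) x; rw [wt_eq] at h2
    rw [SetLike.val_smul, coe_Lb_pow, cw_zero_eq _ j hj' γ _ (eq_floor_add_fract hγ) hs0 hs1]
    exact tendsto_nhds_unique h1 h2

lemma cross_zero (γ : ℝ) (f : Ξ → ℝ) : cross γ f 0 = 0 := by simp [cross, fourierInv_eq']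

lemma neg_one_pow_mul_yangConst (hγ : 0 < γ) (hγN : ∀ N : ℕ, γ ≠ N) :
    (-1 : ℝ) ^ (1 + ⌊γ⌋₊) * yangConst γ = cK ⌊γ⌋₊ (fract γ) := by
  rw [yangConst_eq hγ hγN, ← mul_assoc, ← mul_pow]; simp

lemma energy_inequality (hn : 1 ≤ n) (hγ : 0 < γ) (hγN : ∀ N : ℕ, γ ≠ N) (hU : InCPlus γ U)
    (hE : EnergyConverges γ U) : MemH γ (restr U) ∧ cK ⌊γ⌋₊ (fract γ) * fracForm γ (restr U) ≤ energy γ U ∧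
      (energy γ U = cK ⌊γ⌋₊ (fract γ) * fracForm γ (restr U) ↔ IsYangExtension γ (restr U) U) := by
  have hs0 := fract_pos_of hγ hγN
  have hs1 := fract_lt_one γ
  have hγ' := eq_floor_add_fract hγ
  obtain ⟨A, B, hU', rep⟩ := hU.smooth.exists_rep
  have fe := (finiteEnergy_iff (rep.smU (ES_contDiff A) (ES_contDiff B))).1 hU.sobolev
  have hcl : Cl (fract γ) ((⌊γ⌋₊ + 1) / 2) U := by
    have := (odd_data_iff hγ hγN rep _).1 hU.odd_zero; rw [floor_half] at this; exact this.of_le (by omega)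
  have hf : restr U = (tr A).1 := by
    ext x; have := hU' x 0 le_rfl; rw [zero_rpow pos!, zero_mul, add_zero] at this; exact this
  have sf := hf ▸ SB.contDiff (tr A)
  obtain ⟨mH, le⟩ := memH_and_cK_mul_fracForm_le hn hs0 hs1 rep hcl fe
  rw [← hf, ← hγ'] at mH le
  rw [energy_eq_aF hγ hγN hU hE]
  refine ⟨mH, le, ?_⟩
  obtain ⟨V, A', B', E⟩ := exists_extension hn hs0 hs1 sf (by rwa [← hγ'])
  have hV := E.aF_self hn hs0 hs1 (by rwa [← hγ'])
  rw [← hγ'] at hV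
  constructor
  · intro h; have hq : Cl (fract γ) ((⌊γ⌋₊ + 1) / 2) V := E.cl.of_le (by omega); have hqW := hcl.sub hq; have feW := fe.sub E.fe; have kV := (kl2_and_tendsto hs0 hs1 hq E.fe).2.1; have kW := (kl2_and_tendsto hs0 hs1 hqW feW).2.1
    have orth : aF (1 - 2 * fract γ) (⌊γ⌋₊ + 1) (fun p => U p - V p) V = 0 := by
      refine tendsto_nhds_unique (tendsto_aF_chi_left hs0 hs1 hqW feW kV) (tendsto_const_nhds.congr fun M => ?_)
      rw [E.aF_eq hs0 hs1 ((rep.sub E.rep).chi_mul M) (cs_chi_mul M _) (hqW.chi_mul M)]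
      rw [show (tr (⟨fun p => chi M p * (A - A').1 p, (isEvenSmooth_chi M).mul (A - A').2⟩ : ES n)).1 = 0 by ext x; change chi M (x, 0) * ((tr A).1 x - (tr A').1 x) = 0; rw [← hf, E.tr_eq hs0, sub_self, mul_zero], cross_zero, mul_zero]
    have comb := aF_comb_self kV kW 1
    have eU : EqOn (fun p => 1 * V p + (U p - V p)) U ℍ := fun p _ => by ring
    rw [aF_congr eU, aF_comm, aF_congr eU, h, hV, aF_comm _ _ V, orth] at comb
    exact (E.congr hs0 (fun p hp => sub_eq_zero.1 ((eqOn_zero_of_aF_eq_zero hn hs0 hs1 hqW feW (by linarith)) hp)) fun x => rfl).isYangExtension hγ hγN sf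
  · intro h; have eq : EqOn U V ℍ := fun p hp => h.eq_extData hn hγ hγN sf E p.1 p.2 (le_of_lt hp)
    rw [aF_congr eq, aF_comm, aF_congr eq, hV]

lemma ExtData.isFracLaplacian (hγ : 0 < γ) (hγN : ∀ N : ℕ, γ ≠ N) (hf : MemLp f 2)
    (E : ExtData ⌊γ⌋₊ (fract γ) f V A B) : IsFracLaplacian γ f fun x =>
      (yangConst γ)⁻¹ * (2 * fract γ * (tr ((Le (1 + 2 * fract γ) ^ ⌊γ⌋₊) B)).1 x) := by
  refine ⟨((SB.contDiff _).continuous.const_mul _).const_mul _, fun φ hφ hc => ?_⟩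
  have fl := E.flux φ hφ hc
  rw [← (eq_floor_add_fract hγ), ← yangConst_eq hγ hγN] at fl
  simp_rw [mul_assoc (yangConst γ)⁻¹]
  rw [integral_const_mul, fl, ← mul_assoc, inv_mul_cancel₀ (by rw [yangConst_eq hγ hγN]; exact mul_ne_zero (by simp) (cK_pos ⌊γ⌋₊ (fract_pos_of hγ hγN) (fract_lt_one γ)).ne'), one_mul]
  exact Complex.ext (by rw [ofReal_re]; rfl) (by rw [Complex.ofReal_im, im_integral_symb_mul hγ hf hφ hc])

end

end

end WeightedTrace

theorem mainTheorem9 (n : ℕ) (hn : 1 ≤ n) (γ : ℝ) (hγ : 0 < γ) (hγN : ∀ N : ℕ, γ ≠ (N : ℝ)) :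
    (∀ U : Amb n → ℝ, InCPlus γ U → EnergyConverges γ U →
      MemH γ (restr U) ∧
      energy γ U ≥ (-1 : ℝ) ^ (1 + ⌊γ⌋₊) * yangConst γ * fracForm γ (restr U) ∧
      (energy γ U = (-1 : ℝ) ^ (1 + ⌊γ⌋₊) * yangConst γ * fracForm γ (restr U) ↔
        IsYangExtension γ (restr U) U)) ∧
    (∀ f : Bdry n → ℝ, ContDiff ℝ ∞ f → MemH γ f →
      (∃ U : Amb n → ℝ, IsYangExtension γ f U ∧ InCPlus γ U ∧
        ∀ V : Amb n → ℝ, IsYangExtension γ f V →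
          ∀ (x : Bdry n) (y : ℝ), 0 ≤ y → V (x, y) = U (x, y)) ∧
      ∀ U : Amb n → ℝ, IsYangExtension γ f U →
        ∃ g : Bdry n → ℝ, IsFracLaplacian γ f g ∧
          ∀ x, Tendsto
            (fun y : ℝ => (yangConst γ)⁻¹ * wNormal (wt γ) ((wLap (wt γ))^[⌊γ⌋₊] U) (x, y))
            (𝓝[>] 0) (𝓝 (g x))) := by
  have hs0 := fract_pos_of hγ hγN
  have hs1 := Int.fract_lt_one γ
  refine ⟨fun U hU hE => ?_, fun f hf hH => ?_⟩
  · rw [neg_one_pow_mul_yangConst hγ hγN]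
    exact energy_inequality hn hγ hγN hU hE
  obtain ⟨V, A, B, E⟩ :=
    exists_extension (N := ⌊γ⌋₊) hn hs0 hs1 hf (by rwa [← eq_floor_add_fract hγ])
  refine ⟨⟨V, E.isYangExtension hγ hγN hf, E.inCPlus hγ hγN hf,
    fun W hW x y hy => hW.eq_extData hn hγ hγN hf E x y hy⟩, fun U hU => ?_⟩
  refine ⟨_, E.isFracLaplacian hγ hγN hH.1, fun x => ?_⟩
  have heq : EqOn U V (upper n) := fun p hp => hU.eq_extData hn hγ hγN hf E p.1 p.2 (le_of_lt hp)
  rw [wt_eq]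
  exact (((E.rep.congr heq).wLap_iterate ⌊γ⌋₊).tendsto_wNormal hs1 x).const_mul _
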